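/- **Setting.** Let $(\Omega,\mathcal A,\mathbb P)$ be a probability space with a filtration $\mathbb F=(\mathcal F_t)_{t\ge 0}$ satisfying the usual conditions, $X$ an $\mathbb F$-adapted càdlàg process, $X^*_t=\inf_{s\le t}X_s$, $L$ a real random variable with law $P^L$, and $\tau=\inf\{t: X^*_t\le L\}$ (with $\inf\emptyset=\infty$), so that $\{\tau>t\}=\{X_t^*>L\}$. Assume Jacod's density hypothesis: for every $t\ge 0$, $\mathbb P(L\in\cdot\,|\,\mathcal F_t)(\omega)\sim P^L$ for $\mathbb P$-almost every $\omega$. Let $p_t(x)(\omega)=\frac{d\mathbb P(L\in\cdot|\mathcal F_t)(\omega)}{dP^L}(x)\ge 0$ be the version of the conditional density that is $\mathcal F_t\otimes\mathcal B(\mathbb R)$-measurable in $(\omega,x)$ for each $t$ and such that $(p_t(x))_{t\ge0}$ is a càdlàg $(\mathbb F,\mathbb P)$-martingale for each $x$. Put $F^M_t(x)=p_t(x)1_{\{X_t^*>x\}}$. Let $\epsilon$ be a continuous process independent of $\mathcal F_\infty\vee\sigma(L)$ with backwardly independent increments: for all $t\le\theta$ the family $(\epsilon_s-\epsilon_t)_{s\le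 t}$ is independent of $\epsilon_\theta$. Put $L_t=L+\epsilon_t$, $\mathcal F^I_t=\mathcal F_t\vee\sigma(L_s,s\le t)$, $\mathcal D_t=\bigcap_{u>t}\sigma(\tau\wedge u)$ and $\mathcal G^I_t=\mathcal F^I_t\vee\mathcal D_t$. Let $R>0$ be an $\mathbb F$-predictable discount factor process and $(C,G,Z)$ a claim of maturity $T$: $C$ is $\mathcal F_T$-measurable, $G$ is an $\mathbb F$-adapted continuous process of finite variation with $G_0=0$, and $Z$ is $\mathbb F$-predictable. Fix $t\in[0,T]$ such that $\epsilon_t$ has a density $q_t$ with respect to Lebesgue measure. The insider's (pre-default) value process under $\mathbb P$ is $$V^I_t=1_{\{\tau>t\}}R_t\,E_{\mathbb P}\Big[CR_T^{-1}1_{\{\tau>T\}}+\int_t^T1_{\{\tau>u\}}R_u^{-1}dG_u+Z_\tau R_\tau^{-1}1_{\{\tau\le T\}}\,\Big|\,\mathcal G^I_t\Big].$$ Assume that $CR_T^{-1}1_{\{\tau>T\}}$, $\int_t^T1_{\{\tau>u\}}R_u^{-1}|dG_u|$ and $Z_\tau R_\tau^{-1}1_{\{\tau\le T\}}$ are integrable,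 and that for $P^L$-almost every $x$ the stochastic integral $\int_0^{\cdot}1_{(t,T]}(s)Z_sR_s^{-1}dF^M_s(x)$ exists and is of class (D) on $[0,T]$ (its values at stopping times bounded by $T$ are uniformly integrable). **Theorem.** There is an $\mathcal F_t\otimes\mathcal B(\mathbb R)$-measurable function $(\omega,x)\mapsto\widetilde V^M_t(x)(\omega)$ such that, for $P^L$-almost every $x$, the random variable in the following bracket is integrable and almost surely $$\widetilde V^M_t(x)=R_t\,E_{\mathbb P}\Big[CR_T^{-1}F^M_T(x)+\int_t^TF^M_s(x)R_s^{-1}dG_s-\int_t^TZ_sR_s^{-1}dF^M_s(x)\,\Big|\,\mathcal F_t\Big].$$ For every such function, almost surely on $\{\tau>t\}$ the functions $l\mapsto\widetilde V^M_t(l)q_t(L_t-l)$ and $l\mapsto F^M_t(l)q_t(L_t-l)$ are $P^L$-integrable, the integral of the latter is strictly positive, and almost surely $$V^I_t=1_{\{\tau>t\}}\,\frac{\int\widetilde V^M_t(l)\,q_t(L_t-l)\,P^L(dl)}{\int F^M_t(l)\,q_t(L_t-l)\,P^L(dl)}.$$ -/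

import Mathlib

open MeasureTheory ProbabilityTheory Filter Set
open scoped NNReal ENNReal Topology

noncomputable section

namespace CreditInfo

variable {Ω : Type*} {mΩ : MeasurableSpace Ω}

/-- Right-continuous paths with left limits. -/
def IsCadlag (f : ℝ≥0 → ℝ) : Prop :=
  (∀ t, ContinuousWithinAt f (Ici t) t) ∧ ∀ t, ∃ y, Tendsto f (𝓝[<] t) (𝓝 y)

/-- Completeness of a filtration: all `P`-null sets belong to the initial σ-algebra. -/
def IsCompleteFiltration (𝓕 : Filtration ℝ≥0 mΩ) (P : Measure Ω) : Prop :=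
  ∀ A : Set Ω, P A = 0 → MeasurableSet[𝓕 0] A

/-! ### Pathwise Lebesgue–Stieltjes integrals -/

open Classical in
/-- `∫_(t,T] f dg` for a path `g` of finite variation on `[0,T]`: the integral of `f` against the
signed Stieltjes measure of `g` stopped at `T` (and `0` if `g` has infinite variation). -/
def lsIntegral (g : ℝ≥0 → ℝ) (t T : ℝ≥0) (f : ℝ≥0 → ℝ) : ℝ :=
  if h : BoundedVariationOn (fun u => g (min u T)) univ then
    ∫ᵛ u in Ioc t T, f u ∂•h.vectorMeasure
  else 0

open Classical in
/-- `∫_(t,T] f |dg|` for a nonnegative `f`: the integral against the total variation measure. -/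
def lsVariationIntegral (g : ℝ≥0 → ℝ) (t T : ℝ≥0) (f : ℝ≥0 → ℝ≥0∞) : ℝ≥0∞ :=
  if h : BoundedVariationOn (fun u => g (min u T)) univ then
    ∫⁻ u in Ioc t T, f u ∂h.vectorMeasure.variation
  else ∞

/-! ### Stochastic integration -/

/-- Convergence of processes uniformly on compact time intervals in probability. -/
def TendstoUCP (P : Measure Ω) (J : ℕ → ℝ≥0 → Ω → ℝ) (J' : ℝ≥0 → Ω → ℝ) : Prop :=
  ∀ S : ℝ≥0, ∀ δ > (0 : ℝ),
    Tendsto (fun n => P {ω | ∃ u ≤ S, δ < |J n u ω - J' u ω|}) atTop (𝓝 0)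

/-- `IsBddStochIntegral 𝓕 P Y H J`: the process `J` is the stochastic integral `∫_(0,·] H dY` of the
bounded predictable process `H` against the semimartingale `Y`. The integral is the extension of
the elementary integral, `1_{(s,v] × A} ↦ 1_A (Y_{v ∧ ·} - Y_{s ∧ ·})` for `A ∈ 𝓕 s`, by linearity
and by the bounded convergence theorem (pointwise uniformly bounded convergence of the integrands,
ucp convergence of the integrals). -/
inductive IsBddStochIntegral (𝓕 : Filtration ℝ≥0 mΩ) (P : Measure Ω) (Y : ℝ≥0 → Ω → ℝ) :
    (ℝ≥0 → Ω → ℝ) → (ℝ≥0 → Ω → ℝ) → Prop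
  | step (s v : ℝ≥0) (A : Set Ω) (hsv : s ≤ v) (hA : MeasurableSet[𝓕 s] A) :
      IsBddStochIntegral 𝓕 P Y
        (fun r ω => (Ioc s v ×ˢ A).indicator (fun _ => (1 : ℝ)) (r, ω))
        (fun u ω => A.indicator (fun ω' => Y (min u v) ω' - Y (min u s) ω') ω)
  | add {H H' J J' : ℝ≥0 → Ω → ℝ} :
      IsBddStochIntegral 𝓕 P Y H J → IsBddStochIntegral 𝓕 P Y H' J' →
        IsBddStochIntegral 𝓕 P Y (fun r ω => H r ω + H' r ω) (fun u ω => J u ω + J' u ω)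
  | smul (c : ℝ) {H J : ℝ≥0 → Ω → ℝ} :
      IsBddStochIntegral 𝓕 P Y H J →
        IsBddStochIntegral 𝓕 P Y (fun r ω => c * H r ω) (fun u ω => c * J u ω)
  | limit (H J : ℕ → ℝ≥0 → Ω → ℝ) (H' J' : ℝ≥0 → Ω → ℝ) (K : ℝ)
      (hH : ∀ n r ω, |H n r ω| ≤ K)
      (hlim : ∀ r ω, Tendsto (fun n => H n r ω) atTop (𝓝 (H' r ω)))
      (hJ : ∀ n, IsBddStochIntegral 𝓕 P Y (H n) (J n))
      (hJlim : TendstoUCP P J J') :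
      IsBddStochIntegral 𝓕 P Y H' J'

/-- Truncation `H 1_{|H| ≤ n}`. -/
def truncProc (n : ℕ) (H : ℝ≥0 → Ω → ℝ) : ℝ≥0 → Ω → ℝ :=
  fun r ω => {x : ℝ | |x| ≤ n}.indicator id (H r ω)

/-- `J` is the stochastic integral `∫_(0,·] H dY` of the predictable process `H`: the ucp limit of
the stochastic integrals of the truncations of `H`. -/
def IsStochIntegral (𝓕 : Filtration ℝ≥0 mΩ) (P : Measure Ω) (Y H J : ℝ≥0 → Ω → ℝ) : Prop :=
  ∃ Jn : ℕ → ℝ≥0 → Ω → ℝ,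
    (∀ n, IsBddStochIntegral 𝓕 P Y (truncProc n H) (Jn n)) ∧ TendstoUCP P Jn J

/-- The process `J` is of class (D) on `[0,T]`: its values at stopping times bounded by `T` are
uniformly integrable. -/
def IsClassD (𝓕 : Filtration ℝ≥0 mΩ) (P : Measure Ω) (T : ℝ≥0) (J : ℝ≥0 → Ω → ℝ) : Prop :=
  UniformIntegrable
    (fun (ρ : {ρ : Ω → WithTop ℝ≥0 // IsStoppingTime 𝓕 ρ ∧ ∀ ω, ρ ω ≤ (T : WithTop ℝ≥0)}) =>
      stoppedValue J ρ.1) 1 P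

/-! ### The default model -/

/-- The running infimum `X*_t = inf_{s ≤ t} X_s`. -/
def runInf (X : ℝ≥0 → Ω → ℝ) (t : ℝ≥0) (ω : Ω) : ℝ := ⨅ s : Iic t, X s ω

/-- The default time `τ = inf {t : X*_t ≤ L}`, with `inf ∅ = ∞`. -/
def defaultTime (X : ℝ≥0 → Ω → ℝ) (L : Ω → ℝ) (ω : Ω) : ℝ≥0∞ :=
  ⨅ (t : ℝ≥0) (_ : runInf X t ω ≤ L ω), (t : ℝ≥0∞)

/-- `D_t = ⋂_{u > t} σ(τ ∧ u)`. -/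
@[reducible] def sigmaD (τ : Ω → ℝ≥0∞) (t : ℝ≥0) : MeasurableSpace Ω :=
  ⨅ (u : ℝ≥0) (_ : t < u), MeasurableSpace.comap (fun ω => min (τ ω) (u : ℝ≥0∞)) inferInstance

/-- `F^I_t = F_t ∨ σ(L_s, s ≤ t)` for the noisy barrier `L_s = L + ε_s`. -/
@[reducible] def sigmaFI (𝓕 : Filtration ℝ≥0 mΩ) (L : Ω → ℝ) (ε : ℝ≥0 → Ω → ℝ) (t : ℝ≥0) :
    MeasurableSpace Ω :=
  𝓕 t ⊔ ⨆ (s : ℝ≥0) (_ : s ≤ t), MeasurableSpace.comap (fun ω => L ω + ε s ω) inferInstance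

/-- The insider's information `G^I_t = F^I_t ∨ D_t`. -/
@[reducible] def sigmaGI (𝓕 : Filtration ℝ≥0 mΩ) (X : ℝ≥0 → Ω → ℝ) (L : Ω → ℝ) (ε : ℝ≥0 → Ω → ℝ)
    (t : ℝ≥0) : MeasurableSpace Ω :=
  sigmaFI 𝓕 L ε t ⊔ sigmaD (defaultTime X L) t

/-- Backwardly independent increments: for all `t ≤ θ`, the family of increments
`(ε_s - ε_t)_{s ≤ t}` is independent of `ε_θ`. -/
def HasBackwardIndepIncrements (P : Measure Ω) (ε : ℝ≥0 → Ω → ℝ) : Prop :=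
  ∀ t θ : ℝ≥0, t ≤ θ →
    Indep (⨆ (s : ℝ≥0) (_ : s ≤ t),
        MeasurableSpace.comap (fun ω => ε s ω - ε t ω) inferInstance)
      (MeasurableSpace.comap (ε θ) inferInstance) P

/-! ### Jacod's hypothesis and the conditional density -/

/-- A regular version of the conditional law of `L` given the sub-σ-algebra `m`. -/
def condLaw (P : Measure Ω) [IsFiniteMeasure P] (m : MeasurableSpace Ω) (L : Ω → ℝ) (ω : Ω) :
    Measure ℝ :=
  (@condDistrib Ω Ω ℝ _ _ _ mΩ m L id P _) ω

/-- Jacod's density hypothesis: `P(L ∈ · | F_t)(ω) ∼ P(L ∈ ·)` for all `t`, almost surely. -/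
def JacodHypothesis (𝓕 : Filtration ℝ≥0 mΩ) (P : Measure Ω) [IsFiniteMeasure P]
    (L : Ω → ℝ) : Prop :=
  ∀ t, ∀ᵐ ω ∂P, condLaw P (𝓕 t) L ω ≪ P.map L ∧ P.map L ≪ condLaw P (𝓕 t) L ω

/-- `p t x ω` is the version of the conditional density `dP^L_t / dP^L (ω, x)` which is measurable
in `(ω, x)` and, for every `x`, a càdlàg martingale in `t`. -/
structure IsCondDensity (𝓕 : Filtration ℝ≥0 mΩ) (P : Measure Ω) [IsFiniteMeasure P]
    (L : Ω → ℝ) (p : ℝ≥0 → ℝ → Ω → ℝ) : Prop where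
  measurable : ∀ t,
    @Measurable (Ω × ℝ) ℝ ((𝓕 t).prod inferInstance) _ (fun z => p t z.2 z.1)
  nonneg : ∀ t x ω, 0 ≤ p t x ω
  density : ∀ t, ∀ᵐ ω ∂P,
    condLaw P (𝓕 t) L ω = (P.map L).withDensity (fun x => ENNReal.ofReal (p t x ω))
  martingale : ∀ x, Martingale (fun t => p t x) 𝓕 P
  cadlag : ∀ x ω, IsCadlag (fun t => p t x ω)

/-- `F^M_t(x) = p_t(x) 1_{X*_t > x}`. -/
def FM (X : ℝ≥0 → Ω → ℝ) (p : ℝ≥0 → ℝ → Ω → ℝ) (x : ℝ) (t : ℝ≥0) (ω : Ω) : ℝ :=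
  {ω' | x < runInf X t ω'}.indicator (p t x) ω

/-! ### Claims and their value -/

/-- The payment `C R_T⁻¹ 1_{τ > T}`. -/
def terminalPart (τ : Ω → ℝ≥0∞) (R : ℝ≥0 → Ω → ℝ) (C : Ω → ℝ) (T : ℝ≥0) (ω : Ω) : ℝ :=
  {ω' | (T : ℝ≥0∞) < τ ω'}.indicator (fun ω' => C ω' * (R T ω')⁻¹) ω

/-- The dividends `∫_t^T 1_{τ > u} R_u⁻¹ dG_u`. -/
def dividendPart (τ : Ω → ℝ≥0∞) (R G : ℝ≥0 → Ω → ℝ) (t T : ℝ≥0) (ω : Ω) : ℝ :=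
  lsIntegral (fun u => G u ω) t T
    (fun u => {u' : ℝ≥0 | (u' : ℝ≥0∞) < τ ω}.indicator (fun u' => (R u' ω)⁻¹) u)

/-- `∫_t^T 1_{τ > u} R_u⁻¹ |dG_u|`. -/
def dividendVariation (τ : Ω → ℝ≥0∞) (R G : ℝ≥0 → Ω → ℝ) (t T : ℝ≥0) (ω : Ω) : ℝ≥0∞ :=
  lsVariationIntegral (fun u => G u ω) t T
    (fun u => {u' : ℝ≥0 | (u' : ℝ≥0∞) < τ ω}.indicator
      (fun u' => ENNReal.ofReal (R u' ω)⁻¹) u)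

/-- The recovery payment `Z_τ R_τ⁻¹ 1_{τ ≤ T}`. -/
def recoveryPart (τ : Ω → ℝ≥0∞) (R Z : ℝ≥0 → Ω → ℝ) (T : ℝ≥0) (ω : Ω) : ℝ :=
  {ω' | τ ω' ≤ (T : ℝ≥0∞)}.indicator
    (fun ω' => Z (τ ω').toNNReal ω' * (R (τ ω').toNNReal ω')⁻¹) ω

/-- The pre-default value at time `t` of the claim `(C, G, Z)`, under the probability `P` and the
information `H`:
`1_{τ > t} R_t E[C R_T⁻¹ 1_{τ > T} + ∫_t^T 1_{τ > u} R_u⁻¹ dG_u + Z_τ R_τ⁻¹ 1_{τ ≤ T} | H]`. -/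
def valueProcess (P : Measure Ω) (H : MeasurableSpace Ω) (τ : Ω → ℝ≥0∞)
    (R : ℝ≥0 → Ω → ℝ) (C : Ω → ℝ) (G Z : ℝ≥0 → Ω → ℝ) (t T : ℝ≥0) (ω : Ω) : ℝ :=
  {ω' | (t : ℝ≥0∞) < τ ω'}.indicator (fun ω' => R t ω' *
    (P[fun ω'' => terminalPart τ R C T ω'' + dividendPart τ R G t T ω'' + recoveryPart τ R Z T ω''
      | H]) ω') ω

/-- The integrand `1_{(t,T]} Z R⁻¹`. -/
def recoveryIntegrand (R Z : ℝ≥0 → Ω → ℝ) (t T : ℝ≥0) : ℝ≥0 → Ω → ℝ :=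
  fun s ω => (Ioc t T).indicator (fun s' => Z s' ω * (R s' ω)⁻¹) s

/-- `C R_T⁻¹ F^M_T(x) + ∫_t^T F^M_s(x) R_s⁻¹ dG_s - ∫_t^T Z_s R_s⁻¹ dF^M_s(x)`, where `I` stands for
the stochastic integral process `∫_(0,·] 1_{(t,T]} Z R⁻¹ dF^M(x)`. -/
def managerPayoff (F R : ℝ≥0 → Ω → ℝ) (C : Ω → ℝ) (G I : ℝ≥0 → Ω → ℝ) (t T : ℝ≥0) (ω : Ω) : ℝ :=
  C ω * (R T ω)⁻¹ * F T ω
    + lsIntegral (fun u => G u ω) t T (fun u => F u ω * (R u ω)⁻¹)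
    - I T ω

/-- `V x ω` is a version, measurable in `(ω, x)` with respect to `F_t ⊗ B(ℝ)`, of
`Ṽ^M_t(x) = R_t E[C R_T⁻¹ F^M_T(x) + ∫_t^T F^M_s(x) R_s⁻¹ dG_s - ∫_t^T Z_s R_s⁻¹ dF^M_s(x) | F_t]`,
for almost every `x` with respect to the law of `L`. -/
structure IsManagerValue (𝓕 : Filtration ℝ≥0 mΩ) (P : Measure Ω) (X : ℝ≥0 → Ω → ℝ) (L : Ω → ℝ)
    (p : ℝ≥0 → ℝ → Ω → ℝ) (R : ℝ≥0 → Ω → ℝ) (C : Ω → ℝ) (G : ℝ≥0 → Ω → ℝ)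
    (I : ℝ → ℝ≥0 → Ω → ℝ) (t T : ℝ≥0) (V : ℝ → Ω → ℝ) : Prop where
  measurable : @Measurable (Ω × ℝ) ℝ ((𝓕 t).prod inferInstance) _ (fun z => V z.2 z.1)
  integrable : ∀ᵐ x ∂(P.map L), Integrable (managerPayoff (FM X p x) R C G (I x) t T) P
  eq_condExp : ∀ᵐ x ∂(P.map L), ∀ᵐ ω ∂P,
    V x ω = R t ω * (P[managerPayoff (FM X p x) R C G (I x) t T | 𝓕 t]) ω

end CreditInfo

end

/-! The proof separates a filtering argument over the unknown barrier from a valuation for each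
fixed barrier `x`.

For the filtering, the claim enters through a function `g (ω, x)`, measurable for `F_T ⊗ B(ℝ)`: the
discounted cash flows after `t` if the barrier were `x`, vanishing when default has occurred by `t`.
On `{τ > t}` the σ-algebra `D_t` is trivial (`sigmaD_trivial`, `exists_trace_eq`), so there `G^I_t`
reduces to `F^I_t`. Since `L_s = L_t + (ε_s - ε_t)`, and the increments before `t` are independent
of `F_∞ ∨ σ(L) ∨ σ(ε_t)` (`indep_sigmaInc`), only events `F ∩ {L_t ∈ B}` with `F ∈ F_t` have to be
tested. For these, the joint law of scenario, barrier and observation has density `p_T(x) q(z - x)`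
with respect to `P ⊗ P^L ⊗ dz`, so `g (·, L)` integrates to the integral over `F × B` of `N (ω, z) =
∫ v (ω, l) q (z - l) P^L(dl)`, where `v (·, x) = E[p_T(x) g (·, x) | F_t]`. The same computation at
time `t` shows that on survival the pair `(ω, L_t)` has density `D (ω, z) = ∫ F^M_t(l) q (z - l)
P^L(dl)`. Hence `1_{τ>t} N / D` has the required integrals. A nonnegative martingale stays at zero
once it gets there, so `N` vanishes almost everywhere where `D` does, and `D > 0` almost surely on
survival (`condExp_sigmaGI`).

It remains to identify `R_t v (·, x)` with the manager's value (`setIntegral_managerPayoff`). For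
fixed `x` the default time is a stopping time `τ`, and `F^M(x)` is the martingale `p(x)` killed at
`τ`. The terminal payment needs no argument. For dividends, a time change turns `∫ p_u h_u dA_u`
into an ordinary integral over levels, and optional stopping at each level replaces `p_u` by `p_T`.
For recovery, the killed process is the stopped martingale minus the jump `p_τ` at `τ`, so an
integral of `H` against it should have mean `-E[H_τ p_τ]`; optional stopping then replaces `p_τ` by
`p_T`.

The last mean formula has to be proved for an integral known only as an extension of the elementary
one. Up to a bounded time before which `p ≤ k`, the killed process is a bounded supermartingale. A
Doob decomposition bounds elementary integrals in `L¹` by an `L²(ν)` norm of the integrand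
(`integral_abs_transform_le`, `exists_control`), with `ν` built from the measure of the squared
submartingale (`exists_dyMeasure`). Induction on the definition of the integral gives approximation
by dyadic step processes in `L²(ν)` and in probability, which the bound upgrades to `L¹`
(`IsStepApprox.mean`). Unbounded integrands are handled by truncation and localization: the jump
relation `ΔJ = H ΔF` and class (D) supply the domination (`IsStochIntegral.setIntegral_eq`). -/

noncomputable section

set_option linter.unusedSectionVars false

namespace CreditInfo

/-! ### Dyadic approximation of times, and optional stopping in continuous time. -/

section

variable {Ω : Type*} {mΩ : MeasurableSpace Ω}

/-! ### Dyadic rounding -/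

/-- The smallest point of `2⁻ⁿ ℕ` above `u`. -/
def dyCeil (n : ℕ) (u : ℝ≥0) : ℝ≥0 := (⌈u * 2 ^ n⌉₊ : ℝ≥0) / 2 ^ n

/-- The largest point of `2⁻ⁿ ℕ` below `u`. -/
def dyFloor (n : ℕ) (u : ℝ≥0) : ℝ≥0 := (⌊u * 2 ^ n⌋₊ : ℝ≥0) / 2 ^ n

lemma le_dyCeil (n : ℕ) (u : ℝ≥0) : u ≤ dyCeil n u := by
  rw [dyCeil, le_div_iff₀ (by positivity)]
  exact Nat.le_ceil _

lemma dyFloor_le (n : ℕ) (u : ℝ≥0) : dyFloor n u ≤ u := by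
  rw [dyFloor, div_le_iff₀ (by positivity)]
  exact Nat.floor_le (by positivity)

lemma dyCeil_le_add (n : ℕ) (u : ℝ≥0) : dyCeil n u ≤ u + (1 / 2) ^ n := by
  rw [dyCeil, div_le_iff₀ (by positivity), add_mul, ← mul_pow]
  have := (Nat.ceil_lt_add_one (show 0 ≤ u * 2 ^ n by positivity)).le
  simpa using this

/-- Galois adjunction between the two roundings. It rewrites the event that a rounded-up time has
occurred by `v` as an event known at `dyFloor n v ≤ v`, so rounding up preserves stopping times. -/
lemma dyCeil_le_iff (n : ℕ) (u v : ℝ≥0) : dyCeil n u ≤ v ↔ u ≤ dyFloor n v := by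
  rw [dyCeil, dyFloor, div_le_iff₀ (by positivity), le_div_iff₀ (by positivity),
    ← Nat.le_floor_iff (by positivity), ← Nat.ceil_le]

/-- The limit is stated in `𝓝[≥] u` because it is composed with right-continuous paths, which can
only be followed from above. -/
lemma tendsto_dyCeil (u : ℝ≥0) : Tendsto (fun n => dyCeil n u) atTop (𝓝[≥] u) := by
  refine tendsto_nhdsWithin_iff.2 ⟨?_, Eventually.of_forall fun n => le_dyCeil n u⟩
  refine tendsto_of_tendsto_of_tendsto_of_le_of_le tendsto_const_nhds (h := fun n =>
    u + (1 / 2) ^ n) ?_ (fun n => le_dyCeil n u) fun n => dyCeil_le_add n u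
  have : Tendsto (fun n : ℕ => (1 / 2 : ℝ≥0) ^ n) atTop (𝓝 0) :=
    NNReal.tendsto_pow_atTop_nhds_zero_of_lt_one (by
      rw [← NNReal.coe_lt_coe]; norm_num)
  simpa using this.const_add u

lemma dyCeil_mono (n : ℕ) : Monotone (dyCeil n) := fun u v huv => by
  have : ⌈u * 2 ^ n⌉₊ ≤ ⌈v * 2 ^ n⌉₊ := Nat.ceil_mono (by gcongr)
  unfold dyCeil; gcongr

lemma countable_range_dyCeil (n : ℕ) : (range (dyCeil n)).Countable :=
  (countable_range fun k : ℕ => (k : ℝ≥0) / 2 ^ n).mono (by rintro _ ⟨u, rfl⟩; exact ⟨_, rfl⟩)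

/-- A right-continuous process is jointly measurable. -/
lemma measurable_uncurry_of_rightCont {Y : Type*} [MeasurableSpace Y] {f : ℝ≥0 → Y → ℝ}
    (hf : ∀ u, Measurable (f u)) (hrc : ∀ y u, ContinuousWithinAt (fun u => f u y) (Ici u) u) :
    Measurable (Function.uncurry f) := by
  refine measurable_of_tendsto_metrizable (f := fun n (z : ℝ≥0 × Y) => f (dyCeil n z.1) z.2)
    (fun n => ?_) (tendsto_pi_nhds.2 fun z => (hrc z.2 z.1).tendsto.comp (tendsto_dyCeil z.1))
  have : (fun z : ℝ≥0 × Y => f (dyCeil n z.1) z.2)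
      = (fun z : ℕ × Y => f ((z.1 : ℝ≥0) / 2 ^ n) z.2) ∘
        fun z : ℝ≥0 × Y => (⌈z.1 * 2 ^ n⌉₊, z.2) := rfl
  rw [this]
  have hm : Measurable fun z : ℕ × Y => f ((z.1 : ℝ≥0) / 2 ^ n) z.2 :=
    measurable_from_prod_countable_right fun k => hf ((k : ℝ≥0) / 2 ^ n)
  refine hm.comp ?_
  exact (Nat.measurable_ceil.comp (by fun_prop)).prodMk measurable_snd

/-! ### Optional stopping for right-continuous martingales -/

lemma isStoppingTime_dyCeil {𝓕 : Filtration ℝ≥0 mΩ} {ρ : Ω → ℝ≥0}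
    (hρ : IsStoppingTime 𝓕 (fun ω => (ρ ω : WithTop ℝ≥0))) (n : ℕ) :
    IsStoppingTime 𝓕 (fun ω => (dyCeil n (ρ ω) : WithTop ℝ≥0)) := by
  intro v
  have h := hρ (dyFloor n v)
  simp only [WithTop.coe_le_coe, dyCeil_le_iff] at h ⊢
  exact 𝓕.mono (dyFloor_le n v) _ h

lemma measurable_of_isStoppingTime {𝓕 : Filtration ℝ≥0 mΩ} {ρ : Ω → ℝ≥0}
    (hρ : IsStoppingTime 𝓕 (fun ω => (ρ ω : WithTop ℝ≥0))) : Measurable ρ :=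
  measurable_of_Iic fun v => by
    have := 𝓕.le v _ (hρ v)
    simp only [WithTop.coe_le_coe] at this
    exact this

/-- **Optional stopping** for a right-continuous martingale and a bounded stopping time. -/
theorem optional_stopping {P : Measure Ω} [IsFiniteMeasure P] {𝓕 : Filtration ℝ≥0 mΩ}
    {p : ℝ≥0 → Ω → ℝ} (hp : Martingale p 𝓕 P)
    (hrc : ∀ ω u, ContinuousWithinAt (fun u => p u ω) (Ici u) u)
    {ρ : Ω → ℝ≥0} (hρ : IsStoppingTime 𝓕 (fun ω => (ρ ω : WithTop ℝ≥0)))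
    {T : ℝ≥0} (hT : ∀ ω, ρ ω ≤ T) :
    Integrable (fun ω => p (ρ ω) ω) P ∧
      ∀ A, MeasurableSet[hρ.measurableSpace] A → ∫ ω in A, p (ρ ω) ω ∂P = ∫ ω in A, p T ω ∂P := by
  have hbd (n : ℕ) (ω : Ω) : (dyCeil n (ρ ω) : WithTop ℝ≥0) ≤ ((T + 1 : ℝ≥0) : WithTop ℝ≥0) := by
    rw [WithTop.coe_le_coe]
    refine (dyCeil_le_add n _).trans (add_le_add (hT ω) ?_)
    exact pow_le_one₀ (by positivity) (by norm_num)
  have hst (n : ℕ) := isStoppingTime_dyCeil hρ n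
  -- The rounded time has countable range, so optional stopping is available for it. All the stopped
  -- values are conditional expectations of the single variable `p (T + 1)`, hence uniformly
  -- integrable; the extra unit of time leaves room for rounding up by `2⁻ⁿ ≤ 1`.
  have heq (n : ℕ) : (fun ω => p (dyCeil n (ρ ω)) ω) =ᵐ[P] P[p (T + 1) | (hst n).measurableSpace] := by
    refine hp.stoppedValue_ae_eq_condExp_of_le_const_of_countable_range (hst n) (hbd n) ?_
    refine ((countable_range_dyCeil n).image ((↑) : ℝ≥0 → WithTop ℝ≥0)).mono ?_
    rintro _ ⟨ω, rfl⟩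
    exact ⟨_, ⟨_, rfl⟩, rfl⟩
  have hui : UniformIntegrable (fun n ω => p (dyCeil n (ρ ω)) ω) 1 P :=
    ((hp.integrable (T + 1)).uniformIntegrable_condExp
      fun n => (hst n).measurableSpace_le).ae_eq fun n => (heq n).symm
  have hlim (ω : Ω) : Tendsto (fun n => p (dyCeil n (ρ ω)) ω) atTop (𝓝 (p (ρ ω) ω)) :=
    (hrc ω (ρ ω)).tendsto.comp (tendsto_dyCeil (ρ ω))
  have hmem : MemLp (fun ω => p (ρ ω) ω) 1 P :=
    hui.memLp_of_ae_tendsto (Eventually.of_forall hlim)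
  have hL1 := tendsto_Lp_finite_of_tendsto_ae le_rfl ENNReal.one_ne_top hui.1 hmem hui.2.1
    (Eventually.of_forall hlim)
  refine ⟨memLp_one_iff_integrable.1 hmem, fun A hA => ?_⟩
  have hAm : MeasurableSet A := hρ.measurableSpace_le _ hA
  have h1 : Tendsto (fun n => ∫ ω in A, p (dyCeil n (ρ ω)) ω ∂P) atTop
      (𝓝 (∫ ω in A, p (ρ ω) ω ∂P)) :=
    tendsto_setIntegral_of_L1' _ hmem.1
      (Eventually.of_forall fun n => memLp_one_iff_integrable.1 (hui.memLp n)) hL1 A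
  have h2 (n : ℕ) : ∫ ω in A, p (dyCeil n (ρ ω)) ω ∂P = ∫ ω in A, p T ω ∂P := by
    rw [setIntegral_congr_ae hAm ((heq n).mono fun ω h _ => h)]
    have hle : hρ.measurableSpace ≤ (hst n).measurableSpace :=
      hρ.measurableSpace_mono (hst n) fun ω => WithTop.coe_le_coe.2 (le_dyCeil n _)
    rw [setIntegral_condExp (hst n).measurableSpace_le (hp.integrable _) (hle _ hA)]
    have hAT : MeasurableSet[𝓕 T] A := by
      refine hρ.measurableSpace_le_of_le_const (fun ω => ?_) _ hA
      exact WithTop.coe_le_coe.2 (hT ω)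
    exact (hp.setIntegral_eq (le_add_of_nonneg_right zero_le_one) hAT).symm
  simp only [h2] at h1
  exact (tendsto_nhds_unique h1 tendsto_const_nhds)

end

/-! ### Elementary integrals against a killed martingale: the `L¹` bound and its control measure. -/

section

variable {Ω : Type*} {mΩ : MeasurableSpace Ω}

/-! ### An `L¹` estimate for transforms of bounded submartingales -/

lemma integrable_of_abs_le {P : Measure Ω} [IsFiniteMeasure P] {f : Ω → ℝ} (hf : AEStronglyMeasurable f P)
    {K : ℝ} (hK : ∀ᵐ ω ∂P, |f ω| ≤ K) : Integrable f P :=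
  Integrable.of_bound hf K hK

lemma integral_mul_sub_condExp {P : Measure Ω} [IsFiniteMeasure P] {m : MeasurableSpace Ω}
    (hm : m ≤ mΩ) {f g : Ω → ℝ} (hf : Integrable f P) (hg : StronglyMeasurable[m] g) {K : ℝ}
    (hK : ∀ᵐ ω ∂P, |g ω| ≤ K) : ∫ ω, g ω * (f ω - (P[f | m]) ω) ∂P = 0 := by
  have hgf : Integrable (fun ω => g ω * f ω) P :=
    hf.bdd_mul (hg.mono hm).aestronglyMeasurable hK
  have hgc : Integrable (fun ω => g ω * (P[f | m]) ω) P :=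
    integrable_condExp.bdd_mul (hg.mono hm).aestronglyMeasurable hK
  simp_rw [mul_sub]
  rw [integral_sub hgf hgc, ← integral_condExp hm (f := fun ω => g ω * f ω), sub_eq_zero]
  exact integral_congr_ae (condExp_mul_of_stronglyMeasurable_left hg hgf hf)

lemma integral_abs_le_sqrt {P : Measure Ω} [IsProbabilityMeasure P] {f : Ω → ℝ} (hf : MemLp f 2 P) :
    ∫ ω, |f ω| ∂P ≤ √(∫ ω, f ω ^ 2 ∂P) := by
  have h := variance_nonneg |f| P
  rw [variance_eq_sub hf.abs] at h
  simp only [Pi.pow_apply, Pi.abs_apply, sq_abs] at h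
  exact Real.le_sqrt_of_sq_le (by linarith)

lemma integral_add_two_mul_add {P : Measure Ω} {f g h : Ω → ℝ} (hf : Integrable f P)
    (hg : Integrable g P) (hh : Integrable h P) :
    ∫ ω, f ω + 2 * g ω + h ω ∂P = ∫ ω, f ω ∂P + 2 * ∫ ω, g ω ∂P + ∫ ω, h ω ∂P := by
  have h1 : Integrable (fun ω => f ω + 2 * g ω) P := hf.add (hg.const_mul 2)
  rw [integral_add h1 hh, integral_add hf (hg.const_mul 2), integral_const_mul]

/-- Doob decomposition: each increment of `U` splits into a martingale difference `d i` and a drift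
`a i ≥ 0`. The transforms of the `d i` are orthogonal, so their `L¹` norm is at most the root of a
sum of second moments, each dominated by an increment of the submartingale `U²`. The drift part is
bounded termwise, and since `|e i|` is known at step `i` the drift can be replaced by the full
increment. -/
theorem integral_abs_transform_le {P : Measure Ω} [IsProbabilityMeasure P] {𝓖 : Filtration ℕ mΩ}
    {U e : ℕ → Ω → ℝ} {k K : ℝ} (hU : Submartingale U 𝓖 P) (hU0 : ∀ i ω, 0 ≤ U i ω)
    (hUk : ∀ i ω, U i ω ≤ k) (he : ∀ i, StronglyMeasurable[𝓖 i] (e i)) (heK : ∀ i ω, |e i ω| ≤ K)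
    (n : ℕ) :
    ∫ ω, |∑ i ∈ Finset.range n, e i ω * (U (i + 1) ω - U i ω)| ∂P
      ≤ √(∑ i ∈ Finset.range n, ∫ ω, e i ω ^ 2 * (U (i + 1) ω ^ 2 - U i ω ^ 2) ∂P)
        + ∑ i ∈ Finset.range n, ∫ ω, |e i ω| * (U (i + 1) ω - U i ω) ∂P := by
  classical
  set f : ℕ → Ω → ℝ := fun i ω => U (i + 1) ω - U i ω with hf_def
  set a : ℕ → Ω → ℝ := fun i => P[f i | 𝓖 i] with ha_def
  set d : ℕ → Ω → ℝ := fun i ω => f i ω - a i ω with hd_def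
  have hUm (i) : StronglyMeasurable (U i) := (hU.1 i).mono (𝓖.le i)
  have hem (i) : StronglyMeasurable (e i) := (he i).mono (𝓖.le i)
  have ham (i) : StronglyMeasurable[𝓖 i] (a i) := stronglyMeasurable_condExp
  have ham' (i) : StronglyMeasurable (a i) := (ham i).mono (𝓖.le i)
  have hfm (i) : StronglyMeasurable (f i) := (hUm (i + 1)).sub (hUm i)
  have hdm (i) : StronglyMeasurable (d i) := (hfm i).sub (ham' i)
  have hfk (i ω) : |f i ω| ≤ k := by
    rw [abs_le]; constructor <;> simp only [hf_def] <;>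
      linarith [hU0 i ω, hUk i ω, hU0 (i + 1) ω, hUk (i + 1) ω]
  have hfi (i) : Integrable (f i) P :=
    integrable_of_abs_le (hfm i).aestronglyMeasurable (Eventually.of_forall (hfk i))
  have hak (i) : ∀ᵐ ω ∂P, |a i ω| ≤ k := by
    rcases isEmpty_or_nonempty Ω with hΩ | ⟨⟨ω₀⟩⟩
    · exact Eventually.of_forall fun ω => (hΩ.false ω).elim
    · exact ae_bdd_abs_condExp_of_ae_bdd_abs
        (Eventually.of_forall (hfk i))
  have ha0 (i) : ∀ᵐ ω ∂P, 0 ≤ a i ω := by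
    have h1 := hU.2.1 i (i + 1) (Nat.le_succ i)
    have h2 : a i =ᵐ[P] P[U (i + 1) | 𝓖 i] - P[U i | 𝓖 i] :=
      condExp_sub (hU.2.2 (i + 1)) (hU.2.2 i) _
    filter_upwards [h1, h2] with ω h1 h2
    rw [h2, Pi.sub_apply, condExp_of_stronglyMeasurable (𝓖.le i) (hU.1 i) (hU.2.2 i)]
    linarith
  have hdk (i) : ∀ᵐ ω ∂P, |d i ω| ≤ 2 * k := by
    filter_upwards [hak i] with ω h
    calc |d i ω| ≤ |f i ω| + |a i ω| := abs_sub _ _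
      _ ≤ 2 * k := by linarith [hfk i ω]
  have hK0 (ω : Ω) : 0 ≤ K := (abs_nonneg _).trans (heK 0 ω)
  -- the martingale part
  set S : ℕ → Ω → ℝ := fun m ω => ∑ i ∈ Finset.range m, e i ω * d i ω with hS_def
  have hSm (m) : StronglyMeasurable (S m) :=
    Finset.stronglyMeasurable_fun_sum _ fun i _ => (hem i).mul (hdm i)
  have hSm' (m) : StronglyMeasurable[𝓖 m] (S m) := by
    refine Finset.stronglyMeasurable_fun_sum _ fun i hi => ?_
    have hi' : i < m := Finset.mem_range.1 hi
    refine ((he i).mono (𝓖.mono hi'.le)).mul ?_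
    exact (((hU.1 (i + 1)).mono (𝓖.mono hi')).sub ((hU.1 i).mono (𝓖.mono hi'.le))).sub
      ((ham i).mono (𝓖.mono hi'.le))
  have hSk (m) : ∀ᵐ ω ∂P, |S m ω| ≤ m * (K * (2 * k)) := by
    have : ∀ᵐ ω ∂P, ∀ i, |d i ω| ≤ 2 * k := ae_all_iff.2 hdk
    filter_upwards [this] with ω h
    calc |S m ω| ≤ ∑ i ∈ Finset.range m, |e i ω * d i ω| := Finset.abs_sum_le_sum_abs _ _
      _ ≤ ∑ i ∈ Finset.range m, K * (2 * k) := by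
        refine Finset.sum_le_sum fun i _ => ?_
        rw [abs_mul]
        exact mul_le_mul (heK i ω) (h i) (abs_nonneg _) (hK0 ω)
      _ = m * (K * (2 * k)) := by simp
  have hterm (i) : ∫ ω, (e i ω * d i ω) ^ 2 ∂P
      ≤ ∫ ω, e i ω ^ 2 * (U (i + 1) ω ^ 2 - U i ω ^ 2) ∂P := by
    have heb : ∀ᵐ ω ∂P, |e i ω ^ 2| ≤ K ^ 2 := Eventually.of_forall fun ω => by
      rw [abs_pow]; exact pow_le_pow_left₀ (abs_nonneg _) (heK i ω) 2
    have hem2 : StronglyMeasurable[𝓖 i] (fun ω => e i ω ^ 2) := (he i).pow 2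
    have h1 := integral_mul_sub_condExp (P := P) (𝓖.le i) (hfi i)
      (g := fun ω => e i ω ^ 2 * a i ω) (hem2.mul (ham i)) (K := K ^ 2 * k) (by
        filter_upwards [heb, hak i] with ω h1 h2
        rw [abs_mul]; exact mul_le_mul h1 h2 (abs_nonneg _) (by positivity))
    have h2 := integral_mul_sub_condExp (P := P) (𝓖.le i) (hfi i)
      (g := fun ω => e i ω ^ 2 * U i ω) (hem2.mul (hU.1 i)) (K := K ^ 2 * k) (by
        filter_upwards [heb] with ω h1
        rw [abs_mul]
        exact mul_le_mul h1 (by rw [abs_of_nonneg (hU0 i ω)]; exact hUk i ω) (abs_nonneg _)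
          (by positivity))
    have hi1 : Integrable (fun ω => e i ω ^ 2 * a i ω * (f i ω - a i ω)) P :=
      integrable_of_abs_le (K := K ^ 2 * k * (2 * k))
        ((((hem i).pow 2).mul (ham' i)).mul (hdm i)).aestronglyMeasurable (by
          filter_upwards [heb, hak i, hdk i] with ω h1 h2 h3
          rw [abs_mul, abs_mul]
          have hk0 := (abs_nonneg _).trans (hfk i ω)
          exact mul_le_mul (mul_le_mul h1 h2 (abs_nonneg _) (by positivity)) h3 (abs_nonneg _)
            (by positivity))
    have hi2 : Integrable (fun ω => e i ω ^ 2 * U i ω * (f i ω - a i ω)) P :=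
      integrable_of_abs_le (K := K ^ 2 * k * (2 * k))
        ((((hem i).pow 2).mul (hUm i)).mul (hdm i)).aestronglyMeasurable (by
          filter_upwards [heb, hdk i] with ω h1 h3
          rw [abs_mul, abs_mul, abs_of_nonneg (hU0 i ω)]
          have hk0 := (abs_nonneg _).trans (hfk i ω)
          exact mul_le_mul (mul_le_mul h1 (hUk i ω) (hU0 i ω) (by positivity)) h3 (abs_nonneg _)
            (by positivity))
    have hi3 : Integrable (fun ω => (e i ω * d i ω) ^ 2) P :=
      integrable_of_abs_le (K := (K * (2 * k)) ^ 2)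
        (((hem i).mul (hdm i)).pow 2).aestronglyMeasurable (by
          filter_upwards [hdk i] with ω h
          rw [abs_pow, abs_mul]
          exact pow_le_pow_left₀ (by positivity)
            (mul_le_mul (heK i ω) h (abs_nonneg _) (hK0 ω)) 2)
    have hi4 : Integrable (fun ω => e i ω ^ 2 * (a i ω ^ 2 + 2 * (U i ω * a i ω))) P :=
      integrable_of_abs_le (K := K ^ 2 * (k ^ 2 + 2 * (k * k)))
        (((hem i).pow 2).mul (((ham' i).pow 2).add
          (((hUm i).mul (ham' i)).const_mul 2))).aestronglyMeasurable (by
          filter_upwards [heb, hak i, ha0 i] with ω h1 h2 h3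
          have hk0 := (abs_nonneg _).trans (hfk i ω)
          rw [abs_of_nonneg h3] at h2
          rw [abs_mul, abs_of_nonneg (a := _ + _) (by have := hU0 i ω; positivity)]
          refine mul_le_mul h1 ?_ (by have := hU0 i ω; positivity) (by positivity)
          gcongr; exact hUk i ω)
    have hi4' : 0 ≤ ∫ ω, e i ω ^ 2 * (a i ω ^ 2 + 2 * (U i ω * a i ω)) ∂P :=
      integral_nonneg_of_ae <| (ha0 i).mono fun ω h => by
        have := hU0 i ω; simp only [Pi.zero_apply]; positivity
    -- Substitute `U (i+1) = U i + a i + d i`. The terms linear in `d i` have mean zero by `h1` and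
    -- `h2`, and the remaining term is nonnegative because `U i` and `a i` are; dropping it gives
    -- the inequality.
    have hexp : (fun ω => e i ω ^ 2 * (U (i + 1) ω ^ 2 - U i ω ^ 2)) =
        fun ω => (e i ω * d i ω) ^ 2 + 2 * (e i ω ^ 2 * a i ω * (f i ω - a i ω)
          + e i ω ^ 2 * U i ω * (f i ω - a i ω))
          + e i ω ^ 2 * (a i ω ^ 2 + 2 * (U i ω * a i ω)) := by
      funext ω; simp only [hd_def, hf_def]; ring
    have hi12 : Integrable (fun ω => e i ω ^ 2 * a i ω * (f i ω - a i ω)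
        + e i ω ^ 2 * U i ω * (f i ω - a i ω)) P := hi1.add hi2
    rw [hexp, integral_add_two_mul_add hi3 hi12 hi4, integral_add hi1 hi2, h1, h2]
    linarith
  have hSsq (m) : ∫ ω, S m ω ^ 2 ∂P
      ≤ ∑ i ∈ Finset.range m, ∫ ω, e i ω ^ 2 * (U (i + 1) ω ^ 2 - U i ω ^ 2) ∂P := by
    induction m with
    | zero => simp [hS_def]
    | succ m ih =>
      have hz : ∫ ω, S m ω * e m ω * (f m ω - a m ω) ∂P = 0 := by
        refine integral_mul_sub_condExp (𝓖.le m) (hfi m) ((hSm' m).mul (he m))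
          (K := m * (K * (2 * k)) * K) ?_
        filter_upwards [hSk m] with ω h
        rw [abs_mul]
        exact mul_le_mul h (heK m ω) (abs_nonneg _) ((abs_nonneg _).trans h)
      have hexp : (fun ω => S (m + 1) ω ^ 2) = fun ω => S m ω ^ 2
          + 2 * (S m ω * e m ω * (f m ω - a m ω)) + (e m ω * d m ω) ^ 2 := by
        funext ω; simp only [hS_def, Finset.sum_range_succ, hd_def]; ring
      have hj1 : Integrable (fun ω => S m ω ^ 2) P :=
        integrable_of_abs_le ((hSm m).pow 2).aestronglyMeasurable (K := (m * (K * (2 * k))) ^ 2)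
          ((hSk m).mono fun ω h => by
            rw [abs_pow]; exact pow_le_pow_left₀ (abs_nonneg _) h 2)
      have hj2 : Integrable (fun ω => S m ω * e m ω * (f m ω - a m ω)) P :=
        integrable_of_abs_le (((hSm m).mul (hem m)).mul (hdm m)).aestronglyMeasurable
          (K := m * (K * (2 * k)) * K * (2 * k)) (by
          filter_upwards [hSk m, hdk m] with ω h1 h2
          rw [abs_mul, abs_mul]
          have := (abs_nonneg _).trans h1
          have := hK0 ω
          exact mul_le_mul (mul_le_mul h1 (heK m ω) (abs_nonneg _) (by positivity)) h2
            (abs_nonneg _) (by positivity))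
      have hj3 : Integrable (fun ω => (e m ω * d m ω) ^ 2) P :=
        integrable_of_abs_le (K := (K * (2 * k)) ^ 2)
          (((hem m).mul (hdm m)).pow 2).aestronglyMeasurable (by
            filter_upwards [hdk m] with ω h
            rw [abs_pow, abs_mul]
            exact pow_le_pow_left₀ (by positivity)
              (mul_le_mul (heK m ω) h (abs_nonneg _) (hK0 ω)) 2)
      rw [hexp, integral_add_two_mul_add hj1 hj2 hj3, hz, Finset.sum_range_succ]
      linarith [hterm m]
  have hSL2 : MemLp (S n) 2 P := MemLp.of_bound (hSm n).aestronglyMeasurable _ (hSk n)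
  have hea (i) : Integrable (fun ω => |e i ω| * a i ω) P :=
    integrable_condExp.bdd_mul (c := K) (continuous_abs.comp_stronglyMeasurable (hem i)).aestronglyMeasurable
      (Eventually.of_forall fun ω => by simpa using heK i ω)
  have hea' (i) : ∫ ω, |e i ω| * a i ω ∂P = ∫ ω, |e i ω| * f i ω ∂P := by
    have h := integral_mul_sub_condExp (P := P) (𝓖.le i) (hfi i) (g := fun ω => |e i ω|)
      (continuous_abs.comp_stronglyMeasurable (he i)) (K := K)
      (Eventually.of_forall fun ω => by simpa using heK i ω)
    simp_rw [mul_sub] at h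
    rw [integral_sub ((hfi i).bdd_mul (c := K)
      (continuous_abs.comp_stronglyMeasurable (hem i)).aestronglyMeasurable
      (Eventually.of_forall fun ω => by simpa using heK i ω)) (hea i)] at h
    linarith
  calc ∫ ω, |∑ i ∈ Finset.range n, e i ω * (U (i + 1) ω - U i ω)| ∂P
      ≤ ∫ ω, (|S n ω| + ∑ i ∈ Finset.range n, |e i ω| * a i ω) ∂P := by
        refine integral_mono_of_nonneg (Eventually.of_forall fun ω => abs_nonneg _)
          ((hSL2.integrable (by norm_num)).abs.add (integrable_finsetSum _ fun i _ => hea i)) ?_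
        filter_upwards [ae_all_iff.2 ha0] with ω h0
        have : ∑ i ∈ Finset.range n, e i ω * (U (i + 1) ω - U i ω)
            = S n ω + ∑ i ∈ Finset.range n, e i ω * a i ω := by
          rw [hS_def, ← Finset.sum_add_distrib]
          refine Finset.sum_congr rfl fun i _ => ?_
          simp only [hd_def, hf_def]; ring
        rw [this]
        refine (abs_add_le _ _).trans (add_le_add le_rfl ?_)
        refine (Finset.abs_sum_le_sum_abs _ _).trans (Finset.sum_le_sum fun i _ => ?_)
        rw [abs_mul, abs_of_nonneg (h0 i)]
    _ = ∫ ω, |S n ω| ∂P + ∑ i ∈ Finset.range n, ∫ ω, |e i ω| * a i ω ∂P := by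
        rw [integral_add (hSL2.integrable (by norm_num)).abs (integrable_finsetSum _ fun i _ => hea i),
          integral_finsetSum _ fun i _ => hea i]
    _ ≤ _ := by
        refine add_le_add ((integral_abs_le_sqrt hSL2).trans (Real.sqrt_le_sqrt (hSsq n))) ?_
        exact (Finset.sum_congr rfl fun i _ => hea' i).le

end

section

variable {Ω : Type*} {mΩ : MeasurableSpace Ω}

/-! ### Dyadic predictable step processes -/

/-- The grid point `i 2⁻ⁿ`. -/
def dyPt (n i : ℕ) : ℝ≥0 := (i : ℝ≥0) / 2 ^ n

lemma dyPt_eq_of_le {n m : ℕ} (h : n ≤ m) (i : ℕ) : dyPt n i = dyPt m (i * 2 ^ (m - n)) := by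
  obtain ⟨k, rfl⟩ := Nat.exists_eq_add_of_le h
  simp only [dyPt, Nat.add_sub_cancel_left]
  push_cast
  rw [pow_add, div_eq_div_iff (by positivity) (by positivity)]
  ring

lemma dyPt_mono (n : ℕ) : Monotone (dyPt n) := fun i j h => by
  unfold dyPt; gcongr

lemma dyPt_le_iff {n i j : ℕ} : dyPt n i ≤ dyPt n j ↔ i ≤ j := by
  unfold dyPt
  rw [div_le_div_iff_of_pos_right (by positivity)]
  exact Nat.cast_le

lemma dyPt_lt_iff {n i j : ℕ} : dyPt n i < dyPt n j ↔ i < j := by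
  simpa using (dyPt_le_iff (n := n) (i := j) (j := i)).not

lemma dyCeil_eq_dyPt (n : ℕ) (u : ℝ≥0) : dyCeil n u = dyPt n ⌈u * 2 ^ n⌉₊ := rfl

@[simp] lemma dyPt_zero (n : ℕ) : dyPt n 0 = 0 := by simp [dyPt]

lemma dyPt_mul_pow (n i : ℕ) : dyPt n (i * 2 ^ n) = i := by
  simp [dyPt]

lemma dyFloor_dyPt_self (n i : ℕ) : dyFloor n (dyPt n i) = dyPt n i := by
  simp only [dyFloor, dyPt, div_mul_cancel₀ _ (show (2 : ℝ≥0) ^ n ≠ 0 by positivity), Nat.floor_natCast]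

lemma dyCeil_le_dyPt_iff {n i : ℕ} {u : ℝ≥0} : dyCeil n u ≤ dyPt n i ↔ u ≤ dyPt n i := by
  rw [dyCeil_le_iff, dyFloor_dyPt_self]

/-- Coarse grid points belong to every finer grid, so rounding up on the fine grid cannot jump past
the coarse ceiling. This is why a step process at one scale is one at every finer scale. -/
lemma dyCeil_dyCeil {n m : ℕ} (h : n ≤ m) (u : ℝ≥0) : dyCeil n (dyCeil m u) = dyCeil n u := by
  refine le_antisymm ?_ (dyCeil_mono n (le_dyCeil m u))
  rw [dyCeil_eq_dyPt n u, dyCeil_le_dyPt_iff, dyPt_eq_of_le h, dyCeil_le_dyPt_iff,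
    ← dyPt_eq_of_le h, ← dyCeil_eq_dyPt]
  exact le_dyCeil n u

/-- The point `u > 0` lies in a unique dyadic cell. -/
lemma exists_cell (n : ℕ) {u : ℝ≥0} (hu : 0 < u) :
    ∃ i, dyPt n i < u ∧ u ≤ dyPt n (i + 1) ∧ dyCeil n u = dyPt n (i + 1) := by
  have hpos : 0 < ⌈u * 2 ^ n⌉₊ := Nat.ceil_pos.2 (by positivity)
  obtain ⟨i, hi⟩ := Nat.exists_eq_succ_of_ne_zero hpos.ne'
  have hc : dyCeil n u = dyPt n (i + 1) := by rw [dyCeil_eq_dyPt, hi]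
  refine ⟨i, ?_, hc ▸ le_dyCeil n u, hc⟩
  by_contra h
  have := dyCeil_le_dyPt_iff.2 (not_lt.1 h)
  rw [hc, dyPt_le_iff] at this
  omega

lemma dyCeil_eq_of_mem {n i : ℕ} {u : ℝ≥0} (h1 : dyPt n i < u) (h2 : u ≤ dyPt n (i + 1)) :
    dyCeil n u = dyPt n (i + 1) := by
  obtain ⟨j, hj1, hj2, hj⟩ := exists_cell n (zero_le.trans_lt h1)
  have h3 := dyPt_lt_iff.1 (hj1.trans_le h2)
  have h4 := dyPt_lt_iff.1 (h1.trans_le hj2)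
  rw [hj]; congr 1; omega

/-- Processes constant on the cells `(i 2⁻ⁿ, (i+1) 2⁻ⁿ]`, with value known at the left end. -/
structure IsDyadicStep (𝓕 : Filtration ℝ≥0 mΩ) (n : ℕ) (φ : ℝ≥0 → Ω → ℝ) : Prop where
  zero : ∀ ω, φ 0 ω = 0
  cell : ∀ u ω, φ (dyCeil n u) ω = φ u ω
  meas : ∀ i : ℕ, Measurable[𝓕 (dyPt n i)] (φ (dyPt n (i + 1)))

variable {𝓕 : Filtration ℝ≥0 mΩ}

lemma IsDyadicStep.mono {n m : ℕ} (h : n ≤ m) {φ : ℝ≥0 → Ω → ℝ} (hφ : IsDyadicStep 𝓕 n φ) :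
    IsDyadicStep 𝓕 m φ where
  zero := hφ.zero
  cell u ω := by rw [← hφ.cell (dyCeil m u), dyCeil_dyCeil h, hφ.cell]
  meas j := by
    have hpos : 0 < dyPt m (j + 1) := by unfold dyPt; positivity
    obtain ⟨i, hi1, hi2, hi⟩ := exists_cell n hpos
    have : φ (dyPt m (j + 1)) = φ (dyPt n (i + 1)) := by
      funext ω; rw [← hφ.cell, hi]
    rw [this]
    refine (hφ.meas i).mono (𝓕.mono ?_) le_rfl
    rw [dyPt_eq_of_le h, dyPt_lt_iff] at hi1
    rw [dyPt_eq_of_le h, dyPt_le_iff]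
    omega

lemma IsDyadicStep.comp₂ {n : ℕ} {φ ψ : ℝ≥0 → Ω → ℝ} (hφ : IsDyadicStep 𝓕 n φ)
    (hψ : IsDyadicStep 𝓕 n ψ) {g : ℝ → ℝ → ℝ} (hg : Measurable (Function.uncurry g))
    (hg0 : g 0 0 = 0) : IsDyadicStep 𝓕 n (fun u ω => g (φ u ω) (ψ u ω)) where
  zero ω := by simp only [hφ.zero, hψ.zero, hg0]
  cell u ω := by rw [hφ.cell, hψ.cell]
  meas i := hg.comp ((hφ.meas i).prodMk (hψ.meas i))

/-- The integral of a step process against the increments of `Λ` on `[0, M]`. -/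
def stepInt (P : Measure Ω) (Λ : ℝ≥0 → Ω → ℝ) (M n : ℕ) (φ : ℝ≥0 → Ω → ℝ) : ℝ :=
  ∑ i ∈ Finset.range (M * 2 ^ n),
    ∫ ω, φ (dyPt n (i + 1)) ω * (Λ (dyPt n (i + 1)) ω - Λ (dyPt n i) ω) ∂P

lemma sum_range_mul_two (f : ℕ → ℝ) (m : ℕ) :
    ∑ j ∈ Finset.range (m * 2), f j = ∑ i ∈ Finset.range m, (f (i * 2) + f (i * 2 + 1)) := by
  induction m with
  | zero => simp
  | succ m ih =>
    rw [Finset.sum_range_succ, ← ih, Nat.succ_mul, Finset.sum_range_succ, Finset.sum_range_succ]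
    ring

/-- Halving a cell leaves `φ` unchanged on both halves, and the two increments of `Λ` telescope. The
sum is thus independent of the scale, which makes the content on the dyadic ring well defined
although a scale has to be chosen for each set. -/
lemma IsDyadicStep.stepInt_eq {P : Measure Ω} [IsFiniteMeasure P] {Λ : ℝ≥0 → Ω → ℝ}
    (hΛ : ∀ u, Integrable (Λ u) P) {n m : ℕ} (h : n ≤ m) (M : ℕ) {φ : ℝ≥0 → Ω → ℝ}
    (hφ : IsDyadicStep 𝓕 n φ) {K : ℝ} (hK : ∀ u ω, |φ u ω| ≤ K) :
    stepInt P Λ M m φ = stepInt P Λ M n φ := by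
  induction m, h using Nat.le_induction with
  | base => rfl
  | succ m hm ih =>
    rw [← ih]
    have hφ' := hφ.mono hm
    unfold stepInt
    rw [pow_succ, ← mul_assoc, sum_range_mul_two]
    refine Finset.sum_congr rfl fun i _ => ?_
    have e0 : dyPt (m + 1) (i * 2) = dyPt m i := by
      rw [dyPt_eq_of_le (Nat.le_succ m)]; simp
    have e2 : dyPt (m + 1) (i * 2 + 1 + 1) = dyPt m (i + 1) := by
      rw [dyPt_eq_of_le (Nat.le_succ m)]; simp; congr 1; omega
    have e1 (ω : Ω) : φ (dyPt (m + 1) (i * 2 + 1)) ω = φ (dyPt m (i + 1)) ω := by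
      rw [← hφ'.cell]; congr 1
      refine dyCeil_eq_of_mem ?_ ?_
      · rw [← e0, dyPt_lt_iff]; omega
      · rw [← e2, dyPt_le_iff]; omega
    have hi (a b : ℝ≥0) : Integrable (fun ω => φ (dyPt m (i + 1)) ω * (Λ a ω - Λ b ω)) P :=
      ((hΛ a).sub (hΛ b)).bdd_mul (((hφ'.meas i).mono (𝓕.le _) le_rfl)).aestronglyMeasurable
        (Eventually.of_forall fun ω => hK _ ω)
    simp only [e0, e1, e2]
    rw [← integral_add (hi _ _) (hi _ _)]
    refine integral_congr_ae (Eventually.of_forall fun ω => ?_)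
    ring

/-- The indicator process of a set. -/
def indProc (D : Set (ℝ≥0 × Ω)) (u : ℝ≥0) (ω : Ω) : ℝ := D.indicator (fun _ => (1 : ℝ)) (u, ω)

lemma indProc_of_mem {D : Set (ℝ≥0 × Ω)} {u : ℝ≥0} {ω : Ω} (h : (u, ω) ∈ D) : indProc D u ω = 1 :=
  indicator_of_mem h _

lemma indProc_of_notMem {D : Set (ℝ≥0 × Ω)} {u : ℝ≥0} {ω : Ω} (h : (u, ω) ∉ D) :
    indProc D u ω = 0 := indicator_of_notMem h _

lemma indProc_nonneg (D : Set (ℝ≥0 × Ω)) (u : ℝ≥0) (ω : Ω) : 0 ≤ indProc D u ω :=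
  indicator_nonneg (fun _ _ => zero_le_one) _

lemma abs_indProc_le (D : Set (ℝ≥0 × Ω)) (u : ℝ≥0) (ω : Ω) : |indProc D u ω| ≤ 1 := by
  by_cases h : (u, ω) ∈ D
  · simp [indProc_of_mem h]
  · simp [indProc_of_notMem h]

/-- The ring of dyadic predictable sets. -/
def dyRing (𝓕 : Filtration ℝ≥0 mΩ) : Set (Set (ℝ≥0 × Ω)) :=
  {D | ∃ n, IsDyadicStep 𝓕 n (indProc D)}

/-- At a common scale, union and difference correspond to `max a b` and `a * (1 - b)` on indicators.
Both operations fix `0` at time `0`, whereas complementation does not: hence a ring and not an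
algebra. -/
lemma isSetRing_dyRing (𝓕 : Filtration ℝ≥0 mΩ) : IsSetRing (dyRing 𝓕) where
  empty_mem := ⟨0, by
    have : indProc (∅ : Set (ℝ≥0 × Ω)) = fun _ _ => 0 := by funext u ω; simp [indProc]
    rw [this]
    exact ⟨fun _ => rfl, fun _ _ => rfl, fun _ => measurable_const⟩⟩
  union_mem := by
    rintro D E ⟨n, hD⟩ ⟨m, hE⟩
    refine ⟨max n m, ?_⟩
    have : indProc (D ∪ E) = fun u ω => max (indProc D u ω) (indProc E u ω) := by
      funext u ω
      by_cases h1 : (u, ω) ∈ D <;> by_cases h2 : (u, ω) ∈ E <;> simp [indProc, h1, h2]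
    rw [this]
    exact (hD.mono (le_max_left _ _)).comp₂ (hE.mono (le_max_right _ _)) (g := max)
      (measurable_fst.max measurable_snd) (by simp)
  sdiff_mem := by
    rintro D E ⟨n, hD⟩ ⟨m, hE⟩
    refine ⟨max n m, ?_⟩
    have : indProc (D \ E) = fun u ω => indProc D u ω * (1 - indProc E u ω) := by
      funext u ω
      by_cases h1 : (u, ω) ∈ D <;> by_cases h2 : (u, ω) ∈ E <;> simp [indProc, h1, h2]
    rw [this]
    exact (hD.mono (le_max_left _ _)).comp₂ (hE.mono (le_max_right _ _))
      (g := fun a b => a * (1 - b)) (by fun_prop) (by simp)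

/-- The dyadic predictable σ-algebra. -/
@[reducible] def dySigma (𝓕 : Filtration ℝ≥0 mΩ) : MeasurableSpace (ℝ≥0 × Ω) :=
  MeasurableSpace.generateFrom (dyRing 𝓕)

end

section

variable {Ω : Type*} {mΩ : MeasurableSpace Ω}

/-! ### The measure of a bounded right-continuous submartingale -/

variable {𝓕 : Filtration ℝ≥0 mΩ}

/-- Split `Λ v - Λ s` at the conditional mean of `Λ v` given `𝓕 s`: one piece integrates to zero
against `g`, the other is nonnegative. This is the source of positivity for all the contents and
measures attached to submartingales. -/
lemma submartingale_integral_mul_nonneg {P : Measure Ω} [IsFiniteMeasure P] {Λ : ℝ≥0 → Ω → ℝ}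
    (hΛ : Submartingale Λ 𝓕 P) {s v : ℝ≥0} (hsv : s ≤ v) {g : Ω → ℝ} (hg : Measurable[𝓕 s] g)
    (hg0 : ∀ ω, 0 ≤ g ω) {K : ℝ} (hK : ∀ ω, |g ω| ≤ K) :
    0 ≤ ∫ ω, g ω * (Λ v ω - Λ s ω) ∂P := by
  have hgs : StronglyMeasurable[𝓕 s] g := hg.stronglyMeasurable
  have h := integral_mul_sub_condExp (P := P) (𝓕.le s) (hΛ.integrable v) hgs
    (Eventually.of_forall hK)
  have hb (f : Ω → ℝ) (hf : Integrable f P) : Integrable (fun ω => g ω * f ω) P :=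
    hf.bdd_mul (hgs.mono (𝓕.le s)).aestronglyMeasurable (Eventually.of_forall hK)
  have h1 : 0 ≤ ∫ ω, g ω * ((P[Λ v | 𝓕 s]) ω - Λ s ω) ∂P := by
    refine integral_nonneg_of_ae ?_
    filter_upwards [hΛ.2.1 s v hsv] with ω h
    exact mul_nonneg (hg0 ω) (by linarith)
  calc (0 : ℝ) ≤ ∫ ω, g ω * (Λ v ω - (P[Λ v | 𝓕 s]) ω) ∂P
        + ∫ ω, g ω * ((P[Λ v | 𝓕 s]) ω - Λ s ω) ∂P := by rw [h]; linarith
    _ = _ := by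
      rw [← integral_add
        (hb (fun ω => Λ v ω - (P[Λ v | 𝓕 s]) ω) ((hΛ.integrable v).sub integrable_condExp))
        (hb (fun ω => (P[Λ v | 𝓕 s]) ω - Λ s ω) (integrable_condExp.sub (hΛ.integrable s)))]
      exact integral_congr_ae (Eventually.of_forall fun ω => by ring)

lemma IsDyadicStep.stepInt_nonneg {P : Measure Ω} [IsFiniteMeasure P] {Λ : ℝ≥0 → Ω → ℝ}
    (hΛ : Submartingale Λ 𝓕 P) (M : ℕ) {n : ℕ} {D : Set (ℝ≥0 × Ω)}
    (hD : IsDyadicStep 𝓕 n (indProc D)) : 0 ≤ stepInt P Λ M n (indProc D) :=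
  Finset.sum_nonneg fun i _ => submartingale_integral_mul_nonneg hΛ (dyPt_mono n (Nat.le_succ i))
    (hD.meas i) (fun ω => indProc_nonneg D _ ω) (fun ω => abs_indProc_le D _ ω)

lemma integrable_indProc_mul {P : Measure Ω} [IsFiniteMeasure P] {Λ : ℝ≥0 → Ω → ℝ}
    (hΛ : Submartingale Λ 𝓕 P) {n : ℕ} {D : Set (ℝ≥0 × Ω)}
    (hD : IsDyadicStep 𝓕 n (indProc D)) (i : ℕ) (a b : ℝ≥0) :
    Integrable (fun ω => indProc D (dyPt n (i + 1)) ω * (Λ a ω - Λ b ω)) P :=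
  ((hΛ.integrable a).sub (hΛ.integrable b)).bdd_mul
    ((hD.meas i).mono (𝓕.le _) le_rfl).aestronglyMeasurable
    (Eventually.of_forall fun ω => abs_indProc_le D _ ω)

open Classical in
/-- The additive content `D ↦ E ∫ 1_D dΛ` on the dyadic ring. -/
def dyContent {P : Measure Ω} [IsFiniteMeasure P] {Λ : ℝ≥0 → Ω → ℝ}
    (hΛ : Submartingale Λ 𝓕 P) (M : ℕ) : AddContent ℝ≥0∞ (dyRing 𝓕) :=
  (isSetRing_dyRing 𝓕).addContent_of_union
    (fun D => if h : D ∈ dyRing 𝓕 then ENNReal.ofReal (stepInt P Λ M h.choose (indProc D)) else 0)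
    (by
      have h0 : indProc (∅ : Set (ℝ≥0 × Ω)) = fun _ _ => 0 := by funext u ω; simp [indProc]
      have h1 (n : ℕ) : stepInt P Λ M n (indProc (∅ : Set (ℝ≥0 × Ω))) = 0 := by
        rw [h0]; simp [stepInt]
      rw [dif_pos (isSetRing_dyRing 𝓕).empty_mem, h1, ENNReal.ofReal_zero])
    (by
      intro D E hD hE hdis
      have hDE := (isSetRing_dyRing 𝓕).union_mem hD hE
      rw [dif_pos hD, dif_pos hE, dif_pos hDE]
      set n := max hDE.choose (max hD.choose hE.choose)
      have h1 := hD.choose_spec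
      have h2 := hE.choose_spec
      have h3 := hDE.choose_spec
      have l1 : hD.choose ≤ n := (le_max_left _ _).trans (le_max_right _ _)
      have l2 : hE.choose ≤ n := (le_max_right _ _).trans (le_max_right _ _)
      have l3 : hDE.choose ≤ n := le_max_left _ _
      rw [← h1.stepInt_eq (fun u => hΛ.integrable u) l1 M (abs_indProc_le D),
        ← h2.stepInt_eq (fun u => hΛ.integrable u) l2 M (abs_indProc_le E),
        ← h3.stepInt_eq (fun u => hΛ.integrable u) l3 M (abs_indProc_le _),
        ← ENNReal.ofReal_add ((h1.mono l1).stepInt_nonneg hΛ M) ((h2.mono l2).stepInt_nonneg hΛ M)]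
      congr 1
      unfold stepInt
      rw [← Finset.sum_add_distrib]
      refine Finset.sum_congr rfl fun i _ => ?_
      rw [← integral_add (integrable_indProc_mul hΛ (h1.mono l1) i _ _)
        (integrable_indProc_mul hΛ (h2.mono l2) i _ _)]
      refine integral_congr_ae (Eventually.of_forall fun ω => ?_)
      simp only
      rw [← add_mul]
      congr 1
      have hd : ∀ z, z ∈ D → z ∉ E := fun z h h' => disjoint_left.1 hdis h h'
      by_cases m1 : (dyPt n (i + 1), ω) ∈ D
      · rw [indProc_of_mem m1, indProc_of_notMem (hd _ m1), indProc_of_mem (Or.inl m1), add_zero]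
      · by_cases m2 : (dyPt n (i + 1), ω) ∈ E
        · rw [indProc_of_notMem m1, indProc_of_mem m2, indProc_of_mem (Or.inr m2), zero_add]
        · rw [indProc_of_notMem m1, indProc_of_notMem m2, indProc_of_notMem (by simp [m1, m2]),
            add_zero])

lemma dyContent_apply {P : Measure Ω} [IsFiniteMeasure P] {Λ : ℝ≥0 → Ω → ℝ}
    (hΛ : Submartingale Λ 𝓕 P) (M : ℕ) {n : ℕ} {D : Set (ℝ≥0 × Ω)}
    (hD : IsDyadicStep 𝓕 n (indProc D)) :
    dyContent hΛ M D = ENNReal.ofReal (stepInt P Λ M n (indProc D)) := by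
  have hmem : D ∈ dyRing 𝓕 := ⟨n, hD⟩
  have h1 := hmem.choose_spec
  classical
  change (if h : D ∈ dyRing 𝓕 then ENNReal.ofReal (stepInt P Λ M h.choose (indProc D)) else 0) = _
  rw [dif_pos hmem,
    ← hD.stepInt_eq (fun u => hΛ.integrable u) (le_max_left n hmem.choose) M (abs_indProc_le D),
    ← h1.stepInt_eq (fun u => hΛ.integrable u) (le_max_right n hmem.choose) M (abs_indProc_le D)]

lemma isDyadicStep_rect (n i j : ℕ) {B : Set Ω} (hB : MeasurableSet[𝓕 (dyPt n i)] B) :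
    IsDyadicStep 𝓕 n (indProc (Ioc (dyPt n i) (dyPt n j) ×ˢ B)) where
  zero ω := indProc_of_notMem fun h => by simp at h
  cell u ω := by
    have h : (dyCeil n u, ω) ∈ Ioc (dyPt n i) (dyPt n j) ×ˢ B ↔
        (u, ω) ∈ Ioc (dyPt n i) (dyPt n j) ×ˢ B := by
      simp only [mem_prod, mem_Ioc, dyCeil_le_dyPt_iff, ← not_le]
    by_cases h' : (u, ω) ∈ Ioc (dyPt n i) (dyPt n j) ×ˢ B
    · rw [indProc_of_mem h', indProc_of_mem (h.2 h')]
    · rw [indProc_of_notMem h', indProc_of_notMem (mt h.1 h')]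
  meas k := by
    by_cases hk : dyPt n (k + 1) ∈ Ioc (dyPt n i) (dyPt n j)
    · have : indProc (Ioc (dyPt n i) (dyPt n j) ×ˢ B) (dyPt n (k + 1))
          = B.indicator fun _ => (1 : ℝ) := by
        funext ω
        by_cases hω : ω ∈ B
        · rw [indProc_of_mem (show (dyPt n (k + 1), ω) ∈ Ioc (dyPt n i) (dyPt n j) ×ˢ B from ⟨hk, hω⟩), indicator_of_mem hω]
        · rw [indProc_of_notMem fun h => hω h.2, indicator_of_notMem hω]
      rw [this]
      refine measurable_const.indicator (𝓕.mono ?_ _ hB)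
      rw [dyPt_le_iff]
      have := dyPt_lt_iff.1 hk.1
      omega
    · have : indProc (Ioc (dyPt n i) (dyPt n j) ×ˢ B) (dyPt n (k + 1)) = fun _ => 0 := by
        funext ω; exact indProc_of_notMem fun h => hk h.1
      rw [this]; exact measurable_const

lemma stepInt_rect (P : Measure Ω) (Λ : ℝ≥0 → Ω → ℝ) (M n i : ℕ) (hi : i < M * 2 ^ n)
    {B : Set Ω} (hB : MeasurableSet B) :
    stepInt P Λ M n (indProc (Ioc (dyPt n i) (dyPt n (i + 1)) ×ˢ B))
      = ∫ ω in B, (Λ (dyPt n (i + 1)) ω - Λ (dyPt n i) ω) ∂P := by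
  unfold stepInt
  rw [Finset.sum_eq_single i]
  · rw [← integral_indicator hB]
    refine integral_congr_ae (Eventually.of_forall fun ω => ?_)
    have hk : dyPt n (i + 1) ∈ Ioc (dyPt n i) (dyPt n (i + 1)) := ⟨dyPt_lt_iff.2 (by omega), le_rfl⟩
    by_cases hω : ω ∈ B
    · simp only [indProc_of_mem (show (dyPt n (i + 1), ω) ∈ Ioc (dyPt n i) (dyPt n (i + 1)) ×ˢ B
        from ⟨hk, hω⟩), one_mul,
        indicator_of_mem hω]
    · simp only [indProc_of_notMem (show (dyPt n (i + 1), ω) ∉ Ioc (dyPt n i) (dyPt n (i + 1)) ×ˢ B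
        from fun h => hω h.2), zero_mul, indicator_of_notMem hω]
  · intro j _ hj
    refine integral_eq_zero_of_ae (Eventually.of_forall fun ω => ?_)
    have : (dyPt n (j + 1), ω) ∉ Ioc (dyPt n i) (dyPt n (i + 1)) ×ˢ B := by
      rintro ⟨⟨h1, h2⟩, -⟩
      rw [dyPt_lt_iff] at h1
      rw [dyPt_le_iff] at h2
      omega
    simp [indProc_of_notMem this]
  · intro h; exact absurd (Finset.mem_range.2 hi) h

/-- The content of a dyadic set is controlled by the probability of its projection. -/
lemma stepInt_le_of_proj {P : Measure Ω} [IsFiniteMeasure P] {Λ : ℝ≥0 → Ω → ℝ}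
    (hΛ : Submartingale Λ 𝓕 P) (h0 : ∀ u ω, 0 ≤ Λ u ω) {c : ℝ} (hc : ∀ u ω, Λ u ω ≤ c) (M : ℕ)
    {n : ℕ} {D : Set (ℝ≥0 × Ω)} (hD : IsDyadicStep 𝓕 n (indProc D)) {A : Set Ω}
    (hA : MeasurableSet A) (hDA : ∀ i < M * 2 ^ n, ∀ ω, (dyPt n (i + 1), ω) ∈ D → ω ∈ A) :
    stepInt P Λ M n (indProc D) ≤ c * P.real A := by
  classical
  -- Enlarge `D` to the set that, once entered along a scenario, is never left. Each increment is
  -- then weighted by a predictable indicator nondecreasing in time, so summation by parts with `Λ ≥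
  -- 0` leaves only the final value of `Λ` on the projection.
  set B : ℕ → Set Ω := fun i => {ω | ∃ j ≤ i, (dyPt n (j + 1), ω) ∈ D} with hB_def
  set b : ℕ → Ω → ℝ := fun i => (B i).indicator fun _ => 1 with hb_def
  have hsec (j : ℕ) : MeasurableSet[𝓕 (dyPt n j)] {ω | (dyPt n (j + 1), ω) ∈ D} := by
    have : {ω | (dyPt n (j + 1), ω) ∈ D} = indProc D (dyPt n (j + 1)) ⁻¹' {1} := by
      ext ω
      by_cases h : (dyPt n (j + 1), ω) ∈ D
      · simp [h, indProc_of_mem h]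
      · simp [h, indProc_of_notMem h]
    rw [this]; exact hD.meas j (measurableSet_singleton _)
  have hBm (i : ℕ) : MeasurableSet[𝓕 (dyPt n i)] (B i) := by
    have : B i = ⋃ j ∈ Finset.range (i + 1), {ω | (dyPt n (j + 1), ω) ∈ D} := by
      ext ω; simp [hB_def]
    rw [this]
    refine Finset.measurableSet_biUnion _ fun j hj => 𝓕.mono ?_ _ (hsec j)
    rw [dyPt_le_iff]; have := Finset.mem_range.1 hj; omega
  have hbm (i : ℕ) : Measurable[𝓕 (dyPt n i)] (b i) := measurable_const.indicator (hBm i)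
  have hb1 (i ω) : |b i ω| ≤ 1 := by
    by_cases h : ω ∈ B i <;> simp [hb_def, h]
  have hbmono (i ω) : b i ω ≤ b (i + 1) ω := by
    refine indicator_le_indicator_of_subset (fun ω' h => ?_) (fun _ => zero_le_one) ω
    obtain ⟨j, hj, h⟩ := h
    exact ⟨j, by omega, h⟩
  have hbi (i : ℕ) (u v : ℝ≥0) : Integrable (fun ω => b i ω * (Λ u ω - Λ v ω)) P :=
    ((hΛ.integrable u).sub (hΛ.integrable v)).bdd_mul
      ((hbm i).mono (𝓕.le _) le_rfl).aestronglyMeasurable (Eventually.of_forall fun ω => hb1 i ω)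
  have hstep (i : ℕ) : ∫ ω, indProc D (dyPt n (i + 1)) ω * (Λ (dyPt n (i + 1)) ω - Λ (dyPt n i) ω) ∂P
      ≤ ∫ ω, b i ω * (Λ (dyPt n (i + 1)) ω - Λ (dyPt n i) ω) ∂P := by
    have hd (ω) : 0 ≤ b i ω - indProc D (dyPt n (i + 1)) ω := by
      by_cases h : (dyPt n (i + 1), ω) ∈ D
      · have : ω ∈ B i := ⟨i, le_rfl, h⟩
        simp [hb_def, this, indProc_of_mem h]
      · rw [indProc_of_notMem h, sub_zero]
        exact indicator_nonneg (fun _ _ => zero_le_one) _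
    have hd1 (ω) : |b i ω - indProc D (dyPt n (i + 1)) ω| ≤ 1 := by
      rw [abs_of_nonneg (hd ω)]
      linarith [(abs_le.1 (hb1 i ω)).2, indProc_nonneg D (dyPt n (i + 1)) ω]
    have := submartingale_integral_mul_nonneg hΛ (dyPt_mono n (Nat.le_succ i))
      ((hbm i).sub (hD.meas i)) hd hd1
    have heq : (fun ω => (b i ω - indProc D (dyPt n (i + 1)) ω)
        * (Λ (dyPt n (i + 1)) ω - Λ (dyPt n i) ω)) = fun ω =>
        b i ω * (Λ (dyPt n (i + 1)) ω - Λ (dyPt n i) ω)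
        - indProc D (dyPt n (i + 1)) ω * (Λ (dyPt n (i + 1)) ω - Λ (dyPt n i) ω) := by
      funext ω; ring
    simp only [Pi.sub_apply] at this
    rw [heq, integral_sub (hbi i _ _) (integrable_indProc_mul hΛ hD i _ _)] at this
    linarith
  have htel (m : ℕ) (ω : Ω) : ∑ i ∈ Finset.range (m + 1),
      b i ω * (Λ (dyPt n (i + 1)) ω - Λ (dyPt n i) ω) ≤ b m ω * Λ (dyPt n (m + 1)) ω := by
    induction m with
    | zero =>
      have : 0 ≤ b 0 ω := indicator_nonneg (fun _ _ => zero_le_one) _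
      simp only [zero_add, Finset.sum_range_one]
      nlinarith [h0 (dyPt n 0) ω]
    | succ m ih =>
      rw [Finset.sum_range_succ]
      nlinarith [hbmono m ω, h0 (dyPt n (m + 1)) ω]
  have hA0 : 0 ≤ ∫ ω in A, c ∂P := by
    rcases isEmpty_or_nonempty Ω with hΩ | ⟨⟨ω₀⟩⟩
    · simp [eq_empty_of_isEmpty A]
    · exact setIntegral_nonneg hA fun _ _ => (h0 0 ω₀).trans (hc 0 ω₀)
  have hAc : c * P.real A = ∫ ω in A, c ∂P := by simp [mul_comm]
  rw [hAc]
  unfold stepInt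
  rcases Nat.eq_zero_or_pos (M * 2 ^ n) with hN | hN
  · simpa [hN] using hA0
  obtain ⟨m, hm⟩ := Nat.exists_eq_succ_of_ne_zero hN.ne'
  rw [hm] at hDA ⊢
  refine (Finset.sum_le_sum fun i _ => hstep i).trans ?_
  rw [← integral_finsetSum _ fun i _ => hbi i _ _, ← integral_indicator hA]
  refine integral_mono (integrable_finsetSum _ fun i _ => hbi i _ _)
    ((integrable_const c).indicator hA) fun ω => ?_
  refine (htel m ω).trans ?_
  by_cases hω : ω ∈ B m
  · obtain ⟨j, hj, h⟩ := hω
    have hωA : ω ∈ A := hDA j (by omega) ω h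
    have hωB : ω ∈ B m := ⟨j, hj, h⟩
    simp only [hb_def, indicator_of_mem hωB, indicator_of_mem hωA, one_mul]
    exact hc _ ω
  · simp only [hb_def, indicator_of_notMem hω, zero_mul]
    exact indicator_nonneg (fun ω' _ => (h0 0 ω').trans (hc 0 ω')) _

end

/-! ### Countable additivity of the content of a bounded right-continuous submartingale. -/

section

variable {Ω : Type*} {mΩ : MeasurableSpace Ω} {𝓕 : Filtration ℝ≥0 mΩ}

lemma isDyadicStep_Ioc_univ (𝓕 : Filtration ℝ≥0 mΩ) (n i j : ℕ) :
    IsDyadicStep 𝓕 n (indProc (Ioc (dyPt n i) (dyPt n j) ×ˢ (univ : Set Ω))) :=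
  isDyadicStep_rect n i j MeasurableSet.univ

/-- The part of a cell `(i 2⁻ⁿ, (i+1) 2⁻ⁿ]` that is cut off by shrinking to scale `2⁻ᵐ`. -/
def subcell (Ω : Type*) (n m i : ℕ) : Set (ℝ≥0 × Ω) :=
  Ioc (dyPt m (i * 2 ^ (m - n))) (dyPt m (i * 2 ^ (m - n) + 1)) ×ˢ univ

lemma subcell_mem (n m i : ℕ) : subcell Ω n m i ∈ dyRing 𝓕 :=
  ⟨m, isDyadicStep_Ioc_univ 𝓕 m _ _⟩

/-- The mass of the cut-off strip is the mean increment of `Λ` over an interval shrinking to its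
left endpoint; right continuity and boundedness send it to zero. This is the only place where right
continuity of `Λ` enters the construction of the measure. -/
lemma tendsto_dyContent_subcell {P : Measure Ω} [IsFiniteMeasure P] {Λ : ℝ≥0 → Ω → ℝ}
    (hΛ : Submartingale Λ 𝓕 P) (h0 : ∀ u ω, 0 ≤ Λ u ω) {c : ℝ} (hc : ∀ u ω, Λ u ω ≤ c)
    (hrc : ∀ ω u, ContinuousWithinAt (fun u => Λ u ω) (Ici u) u) (M : ℕ) {n i : ℕ}
    (hi : i < M * 2 ^ n) :
    Tendsto (fun m => dyContent hΛ M (subcell Ω n m i)) atTop (𝓝 0) := by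
  have hb (u : ℝ≥0) (ω : Ω) : |Λ u ω| ≤ c := by rw [abs_of_nonneg (h0 u ω)]; exact hc u ω
  have hpt : Tendsto (fun m => dyPt m (i * 2 ^ (m - n) + 1)) atTop (𝓝[≥] (dyPt n i)) := by
    have h1 : Tendsto (fun m : ℕ => dyPt n i + (1 / 2 : ℝ≥0) ^ m) atTop (𝓝 (dyPt n i)) := by
      have : Tendsto (fun m : ℕ => (1 / 2 : ℝ≥0) ^ m) atTop (𝓝 0) :=
        NNReal.tendsto_pow_atTop_nhds_zero_of_lt_one (by rw [← NNReal.coe_lt_coe]; norm_num)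
      simpa using this.const_add (dyPt n i)
    refine tendsto_nhdsWithin_iff.2 ⟨h1.congr' ?_, ?_⟩ <;>
      filter_upwards [eventually_ge_atTop n] with m hm
    · rw [dyPt_eq_of_le hm i, one_div, inv_pow]
      simp only [dyPt, Nat.cast_add, Nat.cast_one, add_div, one_div]
    · rw [dyPt_eq_of_le hm i, mem_Ici, dyPt_le_iff]; omega
  have hlim : Tendsto (fun m => ∫ ω, (Λ (dyPt m (i * 2 ^ (m - n) + 1)) ω - Λ (dyPt n i) ω) ∂P)
      atTop (𝓝 (∫ _, (0 : ℝ) ∂P)) := by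
    refine tendsto_integral_of_dominated_convergence (fun _ => c + c)
      (fun m => ((hΛ.integrable _).sub (hΛ.integrable _)).aestronglyMeasurable)
      (integrable_const _) (fun m => Eventually.of_forall fun ω => ?_)
      (Eventually.of_forall fun ω => ?_)
    · exact (abs_sub _ _).trans (add_le_add (hb _ _) (hb _ _))
    · have := ((hrc ω (dyPt n i)).tendsto.comp hpt).sub_const (Λ (dyPt n i) ω)
      simpa using this
  have h := ENNReal.tendsto_ofReal hlim
  simp only [integral_zero, ENNReal.ofReal_zero] at h
  refine h.congr' ?_
  filter_upwards [eventually_ge_atTop n] with m hm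
  have hi' : i * 2 ^ (m - n) < M * 2 ^ m := by
    have : M * 2 ^ m = M * 2 ^ n * 2 ^ (m - n) := by
      rw [mul_assoc, ← pow_add, Nat.add_sub_cancel' hm]
    rw [this]; exact Nat.mul_lt_mul_of_pos_right hi (by positivity)
  rw [subcell, dyContent_apply hΛ M (isDyadicStep_Ioc_univ 𝓕 m _ _),
    stepInt_rect P Λ M m _ hi' MeasurableSet.univ, setIntegral_univ, dyPt_eq_of_le hm i]

/-- The dyadic sets beyond the horizon `M` are not charged. -/
lemma dyContent_beyond {P : Measure Ω} [IsFiniteMeasure P] {Λ : ℝ≥0 → Ω → ℝ}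
    (hΛ : Submartingale Λ 𝓕 P) (M : ℕ) {D : Set (ℝ≥0 × Ω)} (hD : D ∈ dyRing 𝓕)
    (hM : ∀ z ∈ D, (M : ℝ≥0) < z.1) : dyContent hΛ M D = 0 := by
  obtain ⟨n, hn⟩ := hD
  rw [dyContent_apply hΛ M hn]
  have : stepInt P Λ M n (indProc D) = 0 := by
    refine Finset.sum_eq_zero fun i hi => ?_
    refine integral_eq_zero_of_ae (Eventually.of_forall fun ω => ?_)
    have hle : dyPt n (i + 1) ≤ M := by
      rw [← dyPt_mul_pow n M, dyPt_le_iff]; exact Finset.mem_range.1 hi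
    have : (dyPt n (i + 1), ω) ∉ D := fun h => absurd (hM _ h) (not_lt.2 hle)
    simp [indProc_of_notMem this]
  rw [this, ENNReal.ofReal_zero]

/-- Inner approximation by sets with compact sections. From each `D j` a small strip is removed at
the left end of every cell, together with the uncharged part beyond `M`, at a total cost of at most
`ε / 2`. For each scenario the sections of the remaining sets `K j` lie in compact subsets of the
sections of the `D j`, whose intersection is empty, so they are eventually empty. The projections of
the `K j` therefore decrease to the empty set, and their probability controls the content. -/
lemma tendsto_dyContent_zero {P : Measure Ω} [IsFiniteMeasure P] {Λ : ℝ≥0 → Ω → ℝ}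
    (hΛ : Submartingale Λ 𝓕 P) (h0 : ∀ u ω, 0 ≤ Λ u ω) {c : ℝ} (hc : ∀ u ω, Λ u ω ≤ c)
    (hrc : ∀ ω u, ContinuousWithinAt (fun u => Λ u ω) (Ici u) u) (M : ℕ)
    {D : ℕ → Set (ℝ≥0 × Ω)} (hD : ∀ j, D j ∈ dyRing 𝓕) (hanti : Antitone D)
    (hempty : ⋂ j, D j = ∅) : Tendsto (fun j => dyContent hΛ M (D j)) atTop (𝓝 0) := by
  classical
  have hring := isSetRing_dyRing 𝓕
  rw [ENNReal.tendsto_nhds_zero]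
  intro ε hε
  obtain ⟨δ, hδ0, hδ⟩ := ENNReal.exists_pos_sum_of_countable' (ENNReal.half_pos hε.ne').ne' ℕ
  choose n hn using hD
  -- the scale at which to shrink
  have hm (j : ℕ) : ∃ m, n j ≤ m ∧
      ∑ i ∈ Finset.range (M * 2 ^ n j), dyContent hΛ M (subcell Ω (n j) m i) ≤ δ j := by
    have : Tendsto (fun m => ∑ i ∈ Finset.range (M * 2 ^ n j), dyContent hΛ M (subcell Ω (n j) m i))
        atTop (𝓝 (∑ i ∈ Finset.range (M * 2 ^ n j), 0)) :=
      tendsto_finsetSum _ fun i hi =>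
        tendsto_dyContent_subcell hΛ h0 hc hrc M (Finset.mem_range.1 hi)
    rw [Finset.sum_const_zero] at this
    have h2 := (ENNReal.tendsto_nhds_zero.1 this (δ j) (hδ0 j)).and (eventually_ge_atTop (n j))
    obtain ⟨m, h, h'⟩ := h2.exists
    exact ⟨m, h', h⟩
  choose m hnm hm using hm
  set U : Set (ℝ≥0 × Ω) := Ioc (dyPt 0 0) (dyPt 0 M) ×ˢ univ with hU_def
  have hU : U ∈ dyRing 𝓕 := ⟨0, isDyadicStep_Ioc_univ 𝓕 0 _ _⟩
  have hUM (z : ℝ≥0 × Ω) (hz : z ∉ U) (hz0 : 0 < z.1) : (M : ℝ≥0) < z.1 := by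
    by_contra h
    refine hz ⟨⟨by simpa using hz0, ?_⟩, trivial⟩
    simpa [dyPt] using h
  have hDpos (j) (z : ℝ≥0 × Ω) (hz : z ∈ D j) : 0 < z.1 := by
    by_contra h
    have h1 : z.1 = 0 := by simpa using h
    have := (hn j).zero z.2
    rw [indProc_of_mem (by rw [← h1]; exact hz)] at this
    exact one_ne_zero this
  set E : ℕ → Set (ℝ≥0 × Ω) := fun j =>
    ⋃ i ∈ Finset.range (M * 2 ^ n j), subcell Ω (n j) (m j) i with hE_def
  have hE (j : ℕ) : E j ∈ dyRing 𝓕 := hring.biUnion_mem _ fun i _ => subcell_mem _ _ _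
  set Bad : ℕ → Set (ℝ≥0 × Ω) := fun j => E j ∪ (D j \ U) with hBad_def
  have hDr (j : ℕ) : D j ∈ dyRing 𝓕 := ⟨n j, hn j⟩
  have hBad (j : ℕ) : Bad j ∈ dyRing 𝓕 := hring.union_mem (hE j) (hring.sdiff_mem (hDr j) hU)
  have hBadle (j : ℕ) : dyContent hΛ M (Bad j) ≤ δ j := by
    calc dyContent hΛ M (Bad j) ≤ dyContent hΛ M (E j) + dyContent hΛ M (D j \ U) :=
          addContent_union_le hring (hE j) (hring.sdiff_mem (hDr j) hU)
      _ = dyContent hΛ M (E j) := by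
          rw [dyContent_beyond hΛ M (hring.sdiff_mem (hDr j) hU), add_zero]
          exact fun z hz => hUM z hz.2 (hDpos j z hz.1)
      _ ≤ _ := (addContent_biUnion_le hring fun i _ => subcell_mem _ _ _).trans (hm j)
  set K : ℕ → Set (ℝ≥0 × Ω) := fun j => D j \ ⋃ i ∈ Finset.range (j + 1), Bad i with hK_def
  have hbU (j : ℕ) : (⋃ i ∈ Finset.range (j + 1), Bad i) ∈ dyRing 𝓕 :=
    hring.biUnion_mem _ fun i _ => hBad i
  have hK (j : ℕ) : K j ∈ dyRing 𝓕 := hring.sdiff_mem (hDr j) (hbU j)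
  have hKanti : Antitone K := fun i j hij => by
    refine sdiff_le_sdiff (hanti hij) (iUnion₂_subset fun l hl => ?_)
    refine subset_iUnion₂_of_subset l ?_ subset_rfl
    rw [Finset.mem_range] at hl ⊢; omega
  have hDle (j : ℕ) : dyContent hΛ M (D j) ≤ dyContent hΛ M (K j) + ε / 2 := by
    calc dyContent hΛ M (D j) ≤ dyContent hΛ M (K j ∪ ⋃ i ∈ Finset.range (j + 1), Bad i) :=
          addContent_mono hring.isSetSemiring (hDr j) (hring.union_mem (hK j) (hbU j))
            (by rw [hK_def]; simp only [sdiff_union_self]; exact subset_union_left)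
      _ ≤ dyContent hΛ M (K j) + ∑ i ∈ Finset.range (j + 1), dyContent hΛ M (Bad i) :=
          (addContent_union_le hring (hK j) (hbU j)).trans
            (add_le_add le_rfl (addContent_biUnion_le hring fun i _ => hBad i))
      _ ≤ dyContent hΛ M (K j) + ∑' i, δ i :=
          add_le_add le_rfl ((Finset.sum_le_sum fun i _ => hBadle i).trans
            (ENNReal.sum_le_tsum _))
      _ ≤ _ := add_le_add le_rfl hδ.le
  -- compact sections
  set A : ℕ → Set Ω := fun j => {ω | ∃ u, (u, ω) ∈ K j} with hA_def
  have hAanti : Antitone A := fun i j hij ω ⟨u, h⟩ => ⟨u, hKanti hij h⟩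
  have hAempty : ⋂ j, A j = ∅ := by
    by_contra hne
    obtain ⟨ω, hω⟩ := nonempty_iff_ne_empty.2 hne
    rw [mem_iInter] at hω
    -- Once the strip at its left end is cut off, the half-open cell fits into a closed interval
    -- that still lies inside the cell, hence in the section of `D j`.
    set C : ℕ → Set ℝ≥0 := fun j => ⋃ i ∈ (Finset.range (M * 2 ^ n j)).filter
      (fun i => (dyPt (n j) (i + 1), ω) ∈ D j),
      Icc (dyPt (m j) (i * 2 ^ (m j - n j) + 1)) (dyPt (n j) (i + 1)) with hC_def
    have hCc (j : ℕ) : IsCompact (C j) := Finset.isCompact_biUnion _ fun i _ => isCompact_Icc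
    have hCD (j : ℕ) (u : ℝ≥0) (hu : u ∈ C j) : (u, ω) ∈ D j := by
      simp only [hC_def, mem_iUnion, Finset.mem_filter, Finset.mem_range] at hu
      obtain ⟨i, ⟨hi, hD'⟩, hu1, hu2⟩ := hu
      have hlt : dyPt (n j) i < u := by
        refine lt_of_lt_of_le ?_ hu1
        rw [dyPt_eq_of_le (hnm j), dyPt_lt_iff]; omega
      have hce := (hn j).cell u ω
      rw [dyCeil_eq_of_mem hlt hu2, indProc_of_mem hD'] at hce
      by_contra h
      rw [indProc_of_notMem h] at hce
      exact one_ne_zero hce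
    have hKC (i j : ℕ) (hij : i ≤ j) (u : ℝ≥0) (hu : (u, ω) ∈ K j) : u ∈ C i := by
      have huD : (u, ω) ∈ D i := hanti hij hu.1
      have hub : (u, ω) ∉ Bad i := fun h => hu.2
        (mem_biUnion (by simp; omega) h)
      obtain ⟨l, hl1, hl2, hl⟩ := exists_cell (n i) (hDpos i _ huD)
      simp only at hl1 hl2 hl
      have huU : (u, ω) ∈ U := by
        by_contra h; exact hub (Or.inr ⟨huD, h⟩)
      have huM : u ≤ dyPt (n i) (M * 2 ^ n i) := by
        rw [dyPt_mul_pow]; simpa [dyPt] using huU.1.2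
      have hlM : l < M * 2 ^ n i := dyPt_lt_iff.1 (hl1.trans_le huM)
      have hlD : (dyPt (n i) (l + 1), ω) ∈ D i := by
        have hce := (hn i).cell u ω
        rw [hl, indProc_of_mem huD] at hce
        by_contra h
        rw [indProc_of_notMem h] at hce
        exact zero_ne_one hce
      simp only [hC_def, mem_iUnion, Finset.mem_filter, Finset.mem_range]
      refine ⟨l, ⟨hlM, hlD⟩, ?_, hl2⟩
      by_contra hlt
      refine hub (Or.inl (mem_biUnion (Finset.mem_coe.2 (Finset.mem_range.2 hlM)) ?_))
      refine ⟨⟨?_, (not_le.1 hlt).le⟩, trivial⟩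
      rw [← dyPt_eq_of_le (hnm i)]; exact hl1
    have hCempty : ⋂ j, C j = ∅ := by
      refine eq_empty_of_forall_notMem fun u hu => ?_
      have : (u, ω) ∈ ⋂ j, D j := mem_iInter.2 fun j => hCD j u (mem_iInter.1 hu j)
      rw [hempty] at this; exact this
    obtain ⟨N, hN⟩ := isCompactSystem_isCompact ℝ≥0 C hCc hCempty
    obtain ⟨u, hu⟩ := hω N
    have : u ∈ dissipate C N := by
      rw [dissipate, mem_iInter₂]
      exact fun i hi => hKC i N hi u hu
    rw [hN] at this; exact this
  have hKcell (j : ℕ) : ∃ N, IsDyadicStep 𝓕 N (indProc (K j)) ∧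
      A j = ⋃ i ∈ Finset.range (M * 2 ^ N), {ω | (dyPt N (i + 1), ω) ∈ K j} := by
    obtain ⟨N, hN⟩ := hK j
    refine ⟨N, hN, ?_⟩
    ext ω
    simp only [hA_def, Set.mem_ofPred_eq, mem_iUnion, Finset.mem_range, exists_prop]
    refine ⟨fun ⟨u, hu⟩ => ?_, fun ⟨i, _, h⟩ => ⟨_, h⟩⟩
    obtain ⟨l, hl1, hl2, hl⟩ := exists_cell N (hDpos j _ hu.1)
    simp only at hl1 hl2 hl
    have huU : (u, ω) ∈ U := by
      by_contra h
      exact hu.2 (mem_biUnion (show j ∈ (Finset.range (j + 1) : Set ℕ) by simp)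
        (Or.inr ⟨hu.1, h⟩))
    have huM : u ≤ dyPt N (M * 2 ^ N) := by
      rw [dyPt_mul_pow]; simpa [dyPt] using huU.1.2
    refine ⟨l, dyPt_lt_iff.1 (hl1.trans_le huM), ?_⟩
    have hce := hN.cell u ω
    rw [hl, indProc_of_mem hu] at hce
    by_contra h
    rw [indProc_of_notMem h] at hce
    exact zero_ne_one hce
  have hAm (j : ℕ) : MeasurableSet (A j) := by
    obtain ⟨N, hN, hAN⟩ := hKcell j
    rw [hAN]
    refine Finset.measurableSet_biUnion _ fun i _ => ?_
    have : {ω | (dyPt N (i + 1), ω) ∈ K j} = indProc (K j) (dyPt N (i + 1)) ⁻¹' {1} := by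
      ext ω
      by_cases h : (dyPt N (i + 1), ω) ∈ K j
      · simp [h, indProc_of_mem h]
      · simp [h, indProc_of_notMem h]
    rw [this]
    exact 𝓕.le _ _ (hN.meas i (measurableSet_singleton _))
  have hKle (j : ℕ) : dyContent hΛ M (K j) ≤ ENNReal.ofReal c * P (A j) := by
    obtain ⟨N, hN, hAN⟩ := hKcell j
    rw [dyContent_apply hΛ M hN]
    have := stepInt_le_of_proj hΛ h0 hc M hN (hAm j) fun i _ ω h => ⟨_, h⟩
    refine (ENNReal.ofReal_le_ofReal this).trans ?_
    rcases le_or_gt 0 c with hc0 | hc0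
    · rw [ENNReal.ofReal_mul hc0, measureReal_def, ENNReal.ofReal_toReal (measure_ne_top _ _)]
    · rw [ENNReal.ofReal_of_nonpos (mul_nonpos_of_nonpos_of_nonneg hc0.le measureReal_nonneg)]
      exact zero_le
  have hPA : Tendsto (fun j => ENNReal.ofReal c * P (A j)) atTop (𝓝 0) := by
    have h1 := tendsto_measure_iInter_atTop (μ := P) (fun j => (hAm j).nullMeasurableSet) hAanti
      ⟨0, measure_ne_top _ _⟩
    rw [hAempty, measure_empty] at h1
    simpa using ENNReal.Tendsto.const_mul h1 (Or.inr ENNReal.ofReal_ne_top)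
  filter_upwards [ENNReal.tendsto_nhds_zero.1 hPA (ε / 2) (ENNReal.half_pos hε.ne')] with j hj
  calc dyContent hΛ M (D j) ≤ dyContent hΛ M (K j) + ε / 2 := hDle j
    _ ≤ ε / 2 + ε / 2 := add_le_add ((hKle j).trans hj) le_rfl
    _ = ε := ENNReal.add_halves ε

/-- The measure on the dyadic predictable σ-algebra of a bounded right-continuous submartingale. -/
theorem exists_dyMeasure {P : Measure Ω} [IsFiniteMeasure P] {Λ : ℝ≥0 → Ω → ℝ}
    (hΛ : Submartingale Λ 𝓕 P) (h0 : ∀ u ω, 0 ≤ Λ u ω) {c : ℝ} (hc : ∀ u ω, Λ u ω ≤ c)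
    (hrc : ∀ ω u, ContinuousWithinAt (fun u => Λ u ω) (Ici u) u) (M : ℕ) :
    ∃ μ : @Measure (ℝ≥0 × Ω) (dySigma 𝓕), μ univ < ∞ ∧
      μ {z | ¬ (0 < z.1 ∧ z.1 ≤ M)} = 0 ∧
      ∀ n D, IsDyadicStep 𝓕 n (indProc D) → μ D = ENNReal.ofReal (stepInt P Λ M n (indProc D)) := by
  let _ : MeasurableSpace (ℝ≥0 × Ω) := dySigma 𝓕
  have hring := isSetRing_dyRing 𝓕
  have hsub : (dyContent hΛ M).IsSigmaSubadditive := by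
    refine isSigmaSubadditive_of_addContent_iUnion_eq_tsum hring fun f hf hU hdis => ?_
    refine addContent_iUnion_eq_sum_of_tendsto_zero hring (dyContent hΛ M) ?_ ?_ hf hU hdis
    · rintro D ⟨n, hn⟩
      rw [dyContent_apply hΛ M hn]; exact ENNReal.ofReal_ne_top
    · exact fun D hD hanti hemp => tendsto_dyContent_zero hΛ h0 hc hrc M hD hanti hemp
  set ν : Measure (ℝ≥0 × Ω) := (dyContent hΛ M).measure hring.isSetSemiring le_rfl hsub with hν_def
  have hν (n) (D) (hD : IsDyadicStep 𝓕 n (indProc D)) :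
      ν D = ENNReal.ofReal (stepInt P Λ M n (indProc D)) := by
    rw [hν_def, AddContent.measure_eq _ hring.isSetSemiring rfl hsub ⟨n, hD⟩,
      dyContent_apply hΛ M hD]
  set U : Set (ℝ≥0 × Ω) := Ioc (dyPt 0 0) (dyPt 0 M) ×ˢ univ with hU_def
  have hUs := isDyadicStep_Ioc_univ 𝓕 0 0 M
  have hUm : MeasurableSet U := MeasurableSpace.measurableSet_generateFrom ⟨0, hUs⟩
  have hUeq : {z : ℝ≥0 × Ω | ¬ (0 < z.1 ∧ z.1 ≤ M)} = Uᶜ := by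
    ext z; simp [hU_def, dyPt]
  -- The extension is not controlled on sets that the ring does not cover, such as `{0} × Ω`.
  -- Restricting to `(0, M] × Ω` makes the measure finite and does not change its value on ring
  -- sets, which avoid time `0` and carry no mass beyond `M`.
  refine ⟨ν.restrict U, ?_, ?_, fun n D hD => ?_⟩
  · rw [Measure.restrict_apply_univ, hν 0 U hUs]; exact ENNReal.ofReal_lt_top
  · rw [hUeq, Measure.restrict_apply hUm.compl, compl_inter_self, measure_empty]
  · have hDm : MeasurableSet D := MeasurableSpace.measurableSet_generateFrom ⟨n, hD⟩
    rw [Measure.restrict_apply hDm]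
    have hDr : D ∈ dyRing 𝓕 := ⟨n, hD⟩
    have hUr : U ∈ dyRing 𝓕 := ⟨0, hUs⟩
    have hz : ν (D \ U) = 0 := by
      have hmem := hring.sdiff_mem hDr hUr
      rw [hν_def, AddContent.measure_eq _ hring.isSetSemiring rfl hsub hmem]
      refine dyContent_beyond hΛ M hmem fun z hz => ?_
      by_contra h
      have hzU : z ∉ U := hz.2
      have h0 : z.1 = 0 := by
        by_contra h'
        exact hzU ⟨⟨by simpa using pos_iff_ne_zero.2 h', by simpa [dyPt] using h⟩, trivial⟩
      have := hD.zero z.2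
      rw [indProc_of_mem (by rw [← h0]; exact hz.1)] at this
      exact one_ne_zero this
    rw [← hν n D hD, ← measure_inter_add_sdiff D hUm, hz, add_zero]

end

section

variable {Ω : Type*} {mΩ : MeasurableSpace Ω} {𝓕 : Filtration ℝ≥0 mΩ}

/-! ### Integrals of dyadic step processes -/

/-- Because `φ` vanishes at time `0`, the preimage of a set avoiding the value `0` is itself in the
ring; a set containing `0` is handled through its complement. -/
lemma IsDyadicStep.measurable_uncurry {n : ℕ} {φ : ℝ≥0 → Ω → ℝ} (hφ : IsDyadicStep 𝓕 n φ) :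
    Measurable[dySigma 𝓕] (Function.uncurry φ) := by
  have key : ∀ S : Set ℝ, MeasurableSet S → (0 : ℝ) ∉ S →
      MeasurableSet[dySigma 𝓕] (Function.uncurry φ ⁻¹' S) := fun S hS h0 => by
    refine MeasurableSpace.measurableSet_generateFrom ⟨n, ?_⟩
    have : indProc (Function.uncurry φ ⁻¹' S) =
        fun u ω => S.indicator (fun _ => (1 : ℝ)) (φ u ω) := rfl
    rw [this]
    exact hφ.comp₂ (g := fun a _ => S.indicator (fun _ => (1 : ℝ)) a) hφ
      ((measurable_const.indicator hS).comp measurable_fst) (indicator_of_notMem h0 _)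
  intro S hS
  by_cases h0 : (0 : ℝ) ∈ S
  · have := key Sᶜ hS.compl (fun h => h h0)
    rw [preimage_compl] at this
    exact (MeasurableSet.compl_iff (m := dySigma 𝓕)).1 this
  · exact key S hS h0

lemma IsDyadicStep.measurable_at_time {n : ℕ} {φ : ℝ≥0 → Ω → ℝ} (hφ : IsDyadicStep 𝓕 n φ)
    {κ : Ω → ℝ≥0} (hκ : Measurable κ) : Measurable (fun ω => φ (κ ω) ω) := by
  have h1 : Measurable (fun ω => ⌈κ ω * 2 ^ n⌉₊) := Nat.measurable_ceil.comp (hκ.mul_const _)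
  have h2 : Measurable (fun z : ℕ × Ω => φ (dyPt n z.1) z.2) := by
    refine measurable_from_prod_countable_right fun i => ?_
    cases i with
    | zero =>
      have : (fun x => φ (dyPt n (0, x).1) (0, x).2) = fun _ => (0 : ℝ) := by
        funext ω; simp [hφ.zero]
      simpa using (show Measurable (fun x : Ω => φ (dyPt n 0) x) by
        rw [show (fun x : Ω => φ (dyPt n 0) x) = fun _ => (0 : ℝ) by funext ω; simp [hφ.zero]]
        exact measurable_const)
    | succ i => exact (hφ.meas i).mono (𝓕.le _) le_rfl
  have h3 : (fun ω => φ (κ ω) ω) = (fun z : ℕ × Ω => φ (dyPt n z.1) z.2) ∘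
      fun ω => (⌈κ ω * 2 ^ n⌉₊, ω) := by
    funext ω
    simp only [Function.comp]
    rw [← dyCeil_eq_dyPt, hφ.cell]
  rw [h3]
  exact h2.comp (h1.prodMk measurable_id)

/-- It allows a measure on scenarios to be pushed onto the graph of `κ`, so that values of an
integrand at `κ` can be measured by a measure on the dyadic predictable σ-algebra. -/
lemma measurable_graph (𝓕 : Filtration ℝ≥0 mΩ) {κ : Ω → ℝ≥0} (hκ : Measurable κ) :
    Measurable[mΩ, dySigma 𝓕] (fun ω => (κ ω, ω)) := by
  refine @measurable_generateFrom _ _ mΩ _ _ ?_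
  rintro D ⟨n, hD⟩
  have : (fun ω => (κ ω, ω)) ⁻¹' D = (fun ω => indProc D (κ ω) ω) ⁻¹' {1} := by
    ext ω
    by_cases h : (κ ω, ω) ∈ D
    · simp [h, indProc_of_mem h]
    · simp [h, indProc_of_notMem h]
  rw [this]
  exact hD.measurable_at_time hκ (measurableSet_singleton _)

lemma measurable_cell (𝓕 : Filtration ℝ≥0 mΩ) (n i : ℕ) {f : Ω → ℝ≥0∞}
    (hf : Measurable[𝓕 (dyPt n i)] f) : Measurable[dySigma 𝓕]
      ((Ioc (dyPt n i) (dyPt n (i + 1)) ×ˢ (univ : Set Ω)).indicator fun z => f z.2) := by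
  have hrect : ∀ B, MeasurableSet[𝓕 (dyPt n i)] B →
      MeasurableSet[dySigma 𝓕] (Ioc (dyPt n i) (dyPt n (i + 1)) ×ˢ B) := fun B hB =>
    MeasurableSpace.measurableSet_generateFrom ⟨n, isDyadicStep_rect n i (i + 1) hB⟩
  intro S hS
  rw [indicator_preimage]
  have h1 : (Ioc (dyPt n i) (dyPt n (i + 1)) ×ˢ (univ : Set Ω)).ite
      ((fun z : ℝ≥0 × Ω => f z.2) ⁻¹' S) ((0 : ℝ≥0 × Ω → ℝ≥0∞) ⁻¹' S)
      = Ioc (dyPt n i) (dyPt n (i + 1)) ×ˢ (f ⁻¹' S) ∪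
        ((0 : ℝ≥0 × Ω → ℝ≥0∞) ⁻¹' S \ Ioc (dyPt n i) (dyPt n (i + 1)) ×ˢ (univ : Set Ω)) := by
    ext z
    simp only [Set.ite, mem_union, mem_inter_iff, mem_prod, mem_preimage, mem_univ, and_true,
      Set.mem_sdiff]
    tauto
  rw [h1]
  refine @MeasurableSet.union _ (dySigma 𝓕) _ _ (hrect _ (hf hS)) ?_
  refine @MeasurableSet.diff _ (dySigma 𝓕) _ _ ?_ (hrect _ MeasurableSet.univ)
  exact (@measurable_const _ _ _ (dySigma 𝓕) (0 : ℝ≥0∞)) hS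

/-- Extension from rectangles by monotone approximation. The difference of the two expectations is
written as a sum, with the earlier term on the left: sums of extended nonnegative quantities pass to
suprema, differences do not. -/
lemma lintegral_cell {P : Measure Ω} [IsFiniteMeasure P] {Λ : ℝ≥0 → Ω → ℝ}
    (hΛ : Submartingale Λ 𝓕 P) (h0 : ∀ u ω, 0 ≤ Λ u ω) {M : ℕ}
    {μ : @Measure (ℝ≥0 × Ω) (dySigma 𝓕)}
    (hμ : ∀ n D, IsDyadicStep 𝓕 n (indProc D) → μ D = ENNReal.ofReal (stepInt P Λ M n (indProc D)))
    {n i : ℕ} (hi : i < M * 2 ^ n) {f : Ω → ℝ≥0∞} (hf : Measurable[𝓕 (dyPt n i)] f) :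
    ∫⁻ z, (Ioc (dyPt n i) (dyPt n (i + 1)) ×ˢ (univ : Set Ω)).indicator (fun z => f z.2) z ∂μ
      + ∫⁻ ω, f ω * ENNReal.ofReal (Λ (dyPt n i) ω) ∂P
      = ∫⁻ ω, f ω * ENNReal.ofReal (Λ (dyPt n (i + 1)) ω) ∂P := by
  have hle := 𝓕.le (dyPt n i)
  have hm : ∀ u, AEMeasurable (fun ω => ENNReal.ofReal (Λ u ω)) P := fun u =>
    ((hΛ.stronglyMeasurable u).mono (𝓕.le u)).measurable.ennreal_ofReal.aemeasurable
  have hm' : ∀ u, Measurable (fun ω => ENNReal.ofReal (Λ u ω)) := fun u =>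
    ((hΛ.stronglyMeasurable u).mono (𝓕.le u)).measurable.ennreal_ofReal
  refine @Measurable.ennreal_induction Ω (𝓕 (dyPt n i)) (fun f =>
    ∫⁻ z, (Ioc (dyPt n i) (dyPt n (i + 1)) ×ˢ (univ : Set Ω)).indicator (fun z => f z.2) z ∂μ
      + ∫⁻ ω, f ω * ENNReal.ofReal (Λ (dyPt n i) ω) ∂P
      = ∫⁻ ω, f ω * ENNReal.ofReal (Λ (dyPt n (i + 1)) ω) ∂P) ?_ ?_ ?_ f hf
  · intro c B hB
    have hrect : MeasurableSet[dySigma 𝓕] (Ioc (dyPt n i) (dyPt n (i + 1)) ×ˢ B) :=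
      MeasurableSpace.measurableSet_generateFrom ⟨n, isDyadicStep_rect n i (i + 1) hB⟩
    have e1 : (Ioc (dyPt n i) (dyPt n (i + 1)) ×ˢ (univ : Set Ω)).indicator
        (fun z => B.indicator (fun _ => c) z.2)
        = (Ioc (dyPt n i) (dyPt n (i + 1)) ×ˢ B).indicator fun _ => c := by
      ext z
      by_cases h1 : z.1 ∈ Ioc (dyPt n i) (dyPt n (i + 1)) <;> by_cases h2 : z.2 ∈ B <;>
        simp [indicator, h1, h2, -mem_Ioc]
    have e2 : ∀ u, ∫⁻ ω, B.indicator (fun _ => c) ω * ENNReal.ofReal (Λ u ω) ∂P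
        = c * ENNReal.ofReal (∫ ω in B, Λ u ω ∂P) := fun u => by
      rw [ofReal_integral_eq_lintegral_ofReal (hΛ.integrable u).integrableOn
        (ae_of_all _ fun ω => h0 u ω), ← lintegral_indicator (hle _ hB),
        ← lintegral_const_mul _ ((hm' u).indicator (hle _ hB))]
      refine lintegral_congr fun ω => ?_
      by_cases h : ω ∈ B <;> simp [h]
    rw [e1, lintegral_indicator hrect, lintegral_const, Measure.restrict_apply_univ, e2, e2,
      hμ n _ (isDyadicStep_rect n i (i + 1) hB), stepInt_rect P Λ M n i hi (hle _ hB), ← mul_add,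
      integral_sub (hΛ.integrable _).integrableOn (hΛ.integrable _).integrableOn,
      ← ENNReal.ofReal_add _ (integral_nonneg fun ω => h0 _ ω)]
    · congr 2; ring
    · rw [sub_nonneg]
      exact hΛ.setIntegral_le (dyPt_mono n (Nat.le_succ i)) hB
  · intro f g _ hf hg ihf ihg
    have e1 : (Ioc (dyPt n i) (dyPt n (i + 1)) ×ˢ (univ : Set Ω)).indicator
        (fun z => (f + g) z.2)
        = fun z => (Ioc (dyPt n i) (dyPt n (i + 1)) ×ˢ (univ : Set Ω)).indicator (fun z => f z.2) z
          + (Ioc (dyPt n i) (dyPt n (i + 1)) ×ˢ (univ : Set Ω)).indicator (fun z => g z.2) z := by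
      ext z
      by_cases h1 : z ∈ Ioc (dyPt n i) (dyPt n (i + 1)) ×ˢ (univ : Set Ω) <;> simp [indicator, h1]
    have e2 : ∀ u, ∫⁻ ω, (f + g) ω * ENNReal.ofReal (Λ u ω) ∂P
        = ∫⁻ ω, f ω * ENNReal.ofReal (Λ u ω) ∂P + ∫⁻ ω, g ω * ENNReal.ofReal (Λ u ω) ∂P :=
      fun u => by
        have hfu : Measurable fun ω => f ω * ENNReal.ofReal (Λ u ω) :=
          (hf.mono hle le_rfl).mul (hm' u)
        rw [← lintegral_add_left hfu]
        simp [add_mul]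
    rw [e1, lintegral_add_left (measurable_cell 𝓕 n i hf), e2, e2, ← ihf, ← ihg]
    ring
  · intro f hf hmono ih
    have e1 : (Ioc (dyPt n i) (dyPt n (i + 1)) ×ˢ (univ : Set Ω)).indicator
        (fun z => ⨆ j, f j z.2)
        = fun z => ⨆ j, (Ioc (dyPt n i) (dyPt n (i + 1)) ×ˢ (univ : Set Ω)).indicator
          (fun z => f j z.2) z := by
      ext z
      by_cases h1 : z ∈ Ioc (dyPt n i) (dyPt n (i + 1)) ×ˢ (univ : Set Ω) <;> simp [indicator, h1]
    have e2 : ∀ u, ∫⁻ ω, (⨆ j, f j ω) * ENNReal.ofReal (Λ u ω) ∂P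
        = ⨆ j, ∫⁻ ω, f j ω * ENNReal.ofReal (Λ u ω) ∂P := fun u => by
      have hfu : ∀ j, Measurable fun ω => f j ω * ENNReal.ofReal (Λ u ω) :=
        fun j => ((hf j).mono hle le_rfl).mul (hm' u)
      rw [← lintegral_iSup hfu
        (fun a b hab ω => by have := hmono hab ω; dsimp only; gcongr)]
      simp [ENNReal.iSup_mul]
    have mono1 : Monotone fun j => (Ioc (dyPt n i) (dyPt n (i + 1)) ×ˢ (univ : Set Ω)).indicator
          (fun z => f j z.2) := fun a b hab z =>
      indicator_le_indicator (hmono hab z.2)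
    rw [e1, lintegral_iSup (fun j => measurable_cell 𝓕 n i (hf j)) mono1, e2, e2,
      ENNReal.iSup_add_iSup_of_monotone]
    · exact iSup_congr ih
    · exact fun a b hab => lintegral_mono (mono1 hab)
    · exact fun a b hab => lintegral_mono fun ω => by have := hmono hab ω; dsimp only; gcongr

/-- Since `μ` lives on `(0, M]`, the square is almost everywhere a finite sum over the cells that
enter `stepInt`. This identifies the quadratic term of the `L¹` bound as a squared `L²(μ)` norm. -/
lemma IsDyadicStep.lintegral_sq {P : Measure Ω} [IsFiniteMeasure P] {Λ : ℝ≥0 → Ω → ℝ}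
    (hΛ : Submartingale Λ 𝓕 P) (h0 : ∀ u ω, 0 ≤ Λ u ω) {M : ℕ}
    {μ : @Measure (ℝ≥0 × Ω) (dySigma 𝓕)} (hμ0 : μ {z | ¬ (0 < z.1 ∧ z.1 ≤ M)} = 0)
    (hμ : ∀ n D, IsDyadicStep 𝓕 n (indProc D) → μ D = ENNReal.ofReal (stepInt P Λ M n (indProc D)))
    {n : ℕ} {φ : ℝ≥0 → Ω → ℝ} (hφ : IsDyadicStep 𝓕 n φ) {K : ℝ} (hK : ∀ u ω, |φ u ω| ≤ K) :
    ∫⁻ z, ‖φ z.1 z.2‖ₑ ^ 2 ∂μ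
      = ENNReal.ofReal (stepInt P Λ M n fun u ω => φ u ω ^ 2) := by
  have hφ2 : ∀ i ω, (φ (dyPt n (i + 1)) ω) ^ 2 ≤ K ^ 2 := fun i ω => by
    rw [← sq_abs]; exact pow_le_pow_left₀ (abs_nonneg _) (hK _ _) 2
  have hmeas : ∀ i, Measurable[𝓕 (dyPt n i)] fun ω => ‖φ (dyPt n (i + 1)) ω‖ₑ ^ 2 := fun i =>
    (measurable_enorm.pow_const 2).comp (hφ.meas i)
  have e1 : ∀ᵐ z ∂μ, ‖φ z.1 z.2‖ₑ ^ 2 = ∑ i ∈ Finset.range (M * 2 ^ n),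
      (Ioc (dyPt n i) (dyPt n (i + 1)) ×ˢ (univ : Set Ω)).indicator
        (fun z => ‖φ (dyPt n (i + 1)) z.2‖ₑ ^ 2) z := by
    have : ∀ᵐ z ∂μ, 0 < z.1 ∧ z.1 ≤ (M : ℝ≥0) := hμ0
    filter_upwards [this] with z hz
    obtain ⟨i, hi1, hi2, hi⟩ := exists_cell n hz.1
    have hiM : i < M * 2 ^ n := by
      rw [← dyPt_lt_iff (n := n), dyPt_mul_pow]; exact hi1.trans_le hz.2
    rw [Finset.sum_eq_single_of_mem i (Finset.mem_range.2 hiM), indicator_of_mem, ← hi, hφ.cell]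
    · exact ⟨⟨hi1, hi2⟩, mem_univ _⟩
    · intro j _ hj
      refine indicator_of_notMem (fun h => hj ?_) _
      have h1 := dyPt_lt_iff.1 (h.1.1.trans_le hi2)
      have h2 := dyPt_lt_iff.1 (hi1.trans_le h.1.2)
      omega
  rw [lintegral_congr_ae e1, lintegral_finsetSum _ fun i _ => measurable_cell 𝓕 n i (hmeas i)]
  unfold stepInt
  rw [ENNReal.ofReal_sum_of_nonneg]
  · refine Finset.sum_congr rfl fun i hi => ?_
    have hc := lintegral_cell hΛ h0 hμ (Finset.mem_range.1 hi) (hmeas i)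
    have hint : ∀ u, Integrable (fun ω => φ (dyPt n (i + 1)) ω ^ 2 * Λ u ω) P := fun u => by
      refine (hΛ.integrable u).bdd_mul (c := K ^ 2)
        (((hφ.meas i).mono (𝓕.le _) le_rfl).pow_const 2).aestronglyMeasurable
        (ae_of_all _ fun ω => ?_)
      rw [Real.norm_of_nonneg (sq_nonneg _)]; exact hφ2 i ω
    have e2 : ∀ u, ∫⁻ ω, ‖φ (dyPt n (i + 1)) ω‖ₑ ^ 2 * ENNReal.ofReal (Λ u ω) ∂P
        = ENNReal.ofReal (∫ ω, φ (dyPt n (i + 1)) ω ^ 2 * Λ u ω ∂P) := fun u => by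
      rw [ofReal_integral_eq_lintegral_ofReal (hint u)
        (ae_of_all _ fun ω => mul_nonneg (sq_nonneg _) (h0 u ω))]
      refine lintegral_congr fun ω => ?_
      rw [ENNReal.ofReal_mul (sq_nonneg _), ← sq_abs, ENNReal.ofReal_pow (abs_nonneg _),
        Real.enorm_eq_ofReal_abs]
    rw [e2, e2] at hc
    have e3 : ∫ ω, φ (dyPt n (i + 1)) ω ^ 2 * (Λ (dyPt n (i + 1)) ω - Λ (dyPt n i) ω) ∂P
        = ∫ ω, φ (dyPt n (i + 1)) ω ^ 2 * Λ (dyPt n (i + 1)) ω ∂P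
          - ∫ ω, φ (dyPt n (i + 1)) ω ^ 2 * Λ (dyPt n i) ω ∂P := by
      rw [← integral_sub (hint _) (hint _)]
      simp only [mul_sub]
    rw [e3, ENNReal.ofReal_sub _
      (integral_nonneg fun ω => mul_nonneg (sq_nonneg _) (h0 _ ω)), ← hc,
      ENNReal.add_sub_cancel_right ENNReal.ofReal_ne_top]
  · intro i _
    refine submartingale_integral_mul_nonneg hΛ (dyPt_mono n (Nat.le_succ i))
      ((hφ.meas i).pow_const 2) (fun ω => sq_nonneg _) (K := K ^ 2) fun ω => ?_
    rw [abs_of_nonneg (sq_nonneg _)]; exact hφ2 i ω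

end

section

variable {Ω : Type*} {mΩ : MeasurableSpace Ω} {𝓕 : Filtration ℝ≥0 mΩ}

/-! ### A nonnegative martingale killed at a stopping time -/

/-- The process `p` killed at `κ`. -/
def killed (p : ℝ≥0 → Ω → ℝ) (κ : Ω → ℝ≥0) (u : ℝ≥0) (ω : Ω) : ℝ :=
  if u < κ ω then p u ω else 0

variable {P : Measure Ω} [IsProbabilityMeasure P] {p : ℝ≥0 → Ω → ℝ} {κ : Ω → ℝ≥0}

lemma measurableSet_lt_stopTime (hκ : IsStoppingTime 𝓕 (fun ω => (κ ω : WithTop ℝ≥0))) (u : ℝ≥0) :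
    MeasurableSet[𝓕 u] {ω | u < κ ω} := by
  have h := (hκ u).compl
  have e : {ω | u < κ ω} = {ω | (κ ω : WithTop ℝ≥0) ≤ u}ᶜ := by
    ext ω
    simp only [mem_compl_iff, Set.mem_ofPred_eq, WithTop.coe_le_coe, not_le]
  rwa [e]

lemma measurable_killed (hp : Martingale p 𝓕 P)
    (hκ : IsStoppingTime 𝓕 (fun ω => (κ ω : WithTop ℝ≥0))) (u : ℝ≥0) :
    Measurable[𝓕 u] (killed p κ u) :=
  Measurable.ite (measurableSet_lt_stopTime hκ u) (hp.1 u).measurable measurable_const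

lemma killed_rightCont (hrc : ∀ ω u, ContinuousWithinAt (fun u => p u ω) (Ici u) u) (ω : Ω)
    (u : ℝ≥0) : ContinuousWithinAt (fun u => killed p κ u ω) (Ici u) u := by
  by_cases h : u < κ ω
  · refine (hrc ω u).congr_of_eventuallyEq ?_ (by simp [killed, h])
    filter_upwards [mem_nhdsWithin_of_mem_nhds (Iio_mem_nhds h)] with v hv
    simp only [killed, if_pos (show v < κ ω from hv)]
  · refine (continuousWithinAt_const (b := (0 : ℝ))).congr (fun v hv => ?_) (by simp [killed, h])
    simp only [killed, if_neg (show ¬ v < κ ω from fun h' => h (lt_of_le_of_lt hv h'))]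

lemma integrable_killed (hp : Martingale p 𝓕 P)
    (hκ : IsStoppingTime 𝓕 (fun ω => (κ ω : WithTop ℝ≥0))) (u : ℝ≥0) :
    Integrable (killed p κ u) P := by
  have : killed p κ u = {ω | u < κ ω}.indicator (p u) := by
    funext ω; simp [killed, indicator]
  rw [this]
  exact (hp.integrable u).indicator (𝓕.le u _ (measurableSet_lt_stopTime hκ u))

/-- The value of `p` at `κ` on `{s < κ ≤ v}`. -/
def jumpPart (p : ℝ≥0 → Ω → ℝ) (κ : Ω → ℝ≥0) (s v : ℝ≥0) : Ω → ℝ :=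
  {ω | s < κ ω ∧ κ ω ≤ v}.indicator fun ω => p (κ ω) ω

lemma measurableSet_jump (hκ : IsStoppingTime 𝓕 (fun ω => (κ ω : WithTop ℝ≥0))) (s v : ℝ≥0) :
    MeasurableSet {ω | s < κ ω ∧ κ ω ≤ v} := by
  have := measurable_of_isStoppingTime hκ
  have h1 : MeasurableSet {ω | s < κ ω} := measurableSet_lt measurable_const this
  have h2 : MeasurableSet {ω | κ ω ≤ v} := measurableSet_le this measurable_const
  exact h1.inter h2

lemma integrable_jumpPart (hκ : IsStoppingTime 𝓕 (fun ω => (κ ω : WithTop ℝ≥0)))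
    (hpκ : Integrable (fun ω => p (κ ω) ω) P) (s v : ℝ≥0) : Integrable (jumpPart p κ s v) P :=
  hpκ.indicator (measurableSet_jump hκ s v)

/-- Optional stopping at `s ∨ (κ ∧ v)` on the part of `B` where `κ > s`: there the stopped
martingale is either still alive at `v` or has been caught at `κ ∈ (s, v]`. -/
lemma setIntegral_killed_sub (hp : Martingale p 𝓕 P)
    (hrc : ∀ ω u, ContinuousWithinAt (fun u => p u ω) (Ici u) u)
    (hκ : IsStoppingTime 𝓕 (fun ω => (κ ω : WithTop ℝ≥0)))
    (hpκ : Integrable (fun ω => p (κ ω) ω) P) {s v : ℝ≥0} (hsv : s ≤ v) {B : Set Ω}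
    (hB : MeasurableSet[𝓕 s] B) :
    ∫ ω in B, killed p κ s ω ∂P = ∫ ω in B, killed p κ v ω ∂P + ∫ ω in B, jumpPart p κ s v ω ∂P := by
  set ρ : Ω → ℝ≥0 := fun ω => max s (min (κ ω) v) with hρdef
  have hρ : IsStoppingTime 𝓕 (fun ω => (ρ ω : WithTop ℝ≥0)) := by
    intro u
    simp only [WithTop.coe_le_coe, hρdef, max_le_iff, min_le_iff]
    by_cases hsu : s ≤ u
    · have h := hκ u
      simp only [WithTop.coe_le_coe] at h
      by_cases hvu : v ≤ u
      · simp [hsu, hvu]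
      · simpa [hsu, hvu] using h
    · simp [hsu]
  set B' := B ∩ {ω | s < κ ω} with hB'
  have hB'm : MeasurableSet[𝓕 s] B' := hB.inter (measurableSet_lt_stopTime hκ s)
  have hB'0 := 𝓕.le s _ hB'm
  have hB0 := 𝓕.le s _ hB
  have hB'ρ : MeasurableSet[hρ.measurableSpace] B' := by
    have h1 := (isStoppingTime_const 𝓕 s).measurableSpace_mono hρ
      (fun ω => WithTop.coe_le_coe.2 (le_max_left _ _))
    rw [IsStoppingTime.measurableSpace_const] at h1
    exact h1 _ hB'm
  have hos := (optional_stopping hp hrc hρ (T := v)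
    (fun ω => max_le hsv (min_le_right _ _))).2 B' hB'ρ
  rw [← hp.setIntegral_eq hsv hB'm] at hos
  have e1 : ∫ ω in B, killed p κ s ω ∂P = ∫ ω in B', p s ω ∂P := by
    rw [← integral_indicator hB0, ← integral_indicator hB'0]
    congr 1; funext ω
    by_cases h1 : ω ∈ B <;> by_cases h2 : s < κ ω <;> simp [indicator, killed, hB', h1, h2]
  have e2 : ∫ ω in B', p (ρ ω) ω ∂P
      = ∫ ω in B, (killed p κ v ω + jumpPart p κ s v ω) ∂P := by
    rw [← integral_indicator hB0, ← integral_indicator hB'0]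
    congr 1; funext ω
    by_cases h1 : ω ∈ B
    · by_cases h2 : s < κ ω
      · by_cases h3 : κ ω ≤ v
        · have : ρ ω = κ ω := by simp only [hρdef, min_eq_left h3, max_eq_right h2.le]
          simp [indicator, killed, jumpPart, hB', h1, h2, h3, this, not_lt.2 h3]
        · have : ρ ω = v := by simp only [hρdef, min_eq_right (not_le.1 h3).le, max_eq_right hsv]
          simp [indicator, killed, jumpPart, hB', h1, h2, h3, this, not_le.1 h3]
      · have h3 : ¬ v < κ ω := fun h => h2 (hsv.trans_lt h)
        simp [indicator, killed, jumpPart, hB', h1, h2, h3]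
    · simp [indicator, hB', h1]
  rw [e1, ← hos, e2, integral_add (integrable_killed hp hκ v).integrableOn
    (integrable_jumpPart hκ hpκ s v).integrableOn]

/-- By the balance on events of `𝓕 s`, the increment of the killed process plus the lost value
`jumpPart` has zero conditional mean given `𝓕 s`; it is therefore orthogonal to every bounded `g`
known at `s`. -/
lemma integral_mul_killed_sub (hp : Martingale p 𝓕 P)
    (hrc : ∀ ω u, ContinuousWithinAt (fun u => p u ω) (Ici u) u)
    (hκ : IsStoppingTime 𝓕 (fun ω => (κ ω : WithTop ℝ≥0)))
    (hpκ : Integrable (fun ω => p (κ ω) ω) P) {s v : ℝ≥0} (hsv : s ≤ v) {g : Ω → ℝ}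
    (hg : Measurable[𝓕 s] g) {K : ℝ} (hK : ∀ ω, |g ω| ≤ K) :
    ∫ ω, g ω * (killed p κ v ω - killed p κ s ω) ∂P = - ∫ ω, g ω * jumpPart p κ s v ω ∂P := by
  have hs := integrable_killed hp hκ s
  have hv := integrable_killed hp hκ v
  have hj := integrable_jumpPart hκ hpκ s v
  have hf : Integrable (fun ω => (killed p κ v ω + jumpPart p κ s v ω) - killed p κ s ω) P :=
    (hv.add hj).sub hs
  have h0 : P[fun ω => (killed p κ v ω + jumpPart p κ s v ω) - killed p κ s ω | 𝓕 s]
      =ᵐ[P] fun _ => 0 := by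
    symm
    refine ae_eq_condExp_of_forall_setIntegral_eq (𝓕.le s) hf
      (fun _ _ _ => (integrable_zero _ _ _).integrableOn) (fun B hB _ => ?_)
      stronglyMeasurable_const.aestronglyMeasurable
    have hadd : Integrable (fun ω => killed p κ v ω + jumpPart p κ s v ω) P := hv.add hj
    rw [integral_sub hadd.integrableOn hs.integrableOn,
      integral_add hv.integrableOn hj.integrableOn,
      setIntegral_killed_sub hp hrc hκ hpκ hsv hB]
    simp
  have h1 := integral_mul_sub_condExp (𝓕.le s) hf hg.stronglyMeasurable (ae_of_all _ hK)
  have h2 : ∫ ω, g ω * ((killed p κ v ω + jumpPart p κ s v ω) - killed p κ s ω) ∂P = 0 := by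
    rw [← h1]
    refine integral_congr_ae ?_
    filter_upwards [h0] with ω hω
    rw [hω, sub_zero]
  have hgm : AEStronglyMeasurable g P := (hg.mono (𝓕.le s) le_rfl).aestronglyMeasurable
  have hgb : ∀ᵐ ω ∂P, ‖g ω‖ ≤ K := ae_of_all _ hK
  have i1 : Integrable (fun ω => g ω * (killed p κ v ω - killed p κ s ω)) P :=
    (hv.sub hs).bdd_mul hgm hgb
  have i2 : Integrable (fun ω => g ω * jumpPart p κ s v ω) P := hj.bdd_mul hgm hgb
  rw [eq_neg_iff_add_eq_zero, ← integral_add i1 i2, ← h2]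
  congr 1; funext ω; ring

lemma submartingale_sub_killed (hp : Martingale p 𝓕 P) (hp0 : ∀ u ω, 0 ≤ p u ω)
    (hrc : ∀ ω u, ContinuousWithinAt (fun u => p u ω) (Ici u) u)
    (hκ : IsStoppingTime 𝓕 (fun ω => (κ ω : WithTop ℝ≥0)))
    (hpκ : Integrable (fun ω => p (κ ω) ω) P) (k : ℝ) :
    Submartingale (fun u ω => k - killed p κ u ω) 𝓕 P := by
  refine submartingale_of_setIntegral_le
    (fun u => (measurable_const.sub (measurable_killed hp hκ u)).stronglyMeasurable)
    (fun u => (integrable_const k).sub (integrable_killed hp hκ u)) fun s v hsv B hB => ?_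
  rw [integral_sub (integrable_const k) (integrable_killed hp hκ s).integrableOn,
    integral_sub (integrable_const k) (integrable_killed hp hκ v).integrableOn,
    setIntegral_killed_sub hp hrc hκ hpκ hsv hB]
  have : 0 ≤ ∫ ω in B, jumpPart p κ s v ω ∂P :=
    integral_nonneg fun ω => indicator_nonneg (fun _ _ => hp0 _ _) _
  linarith

/-- From `U v ^ 2 - U s ^ 2 - 2 * U s * (U v - U s) = (U v - U s) ^ 2 ≥ 0`, where the cross term has
nonnegative mean because `U s ≥ 0` is a weight known at `s`. -/
lemma submartingale_sq {U : ℝ≥0 → Ω → ℝ} (hU : Submartingale U 𝓕 P) (h0 : ∀ u ω, 0 ≤ U u ω) {k : ℝ}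
    (hk : ∀ u ω, U u ω ≤ k) : Submartingale (fun u ω => U u ω ^ 2) 𝓕 P := by
  have hm : ∀ u, AEStronglyMeasurable (U u) P := fun u => (hU.integrable u).1
  have hb : ∀ u, ∀ᵐ ω ∂P, ‖U u ω‖ ≤ k := fun u => ae_of_all _ fun ω => by
    rw [Real.norm_of_nonneg (h0 u ω)]; exact hk u ω
  have hint : ∀ a b, Integrable (fun ω => U a ω * U b ω) P := fun a b =>
    (hU.integrable b).bdd_mul (hm a) (hb a)
  have hsq : ∀ a, Integrable (fun ω => U a ω ^ 2) P := fun a => by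
    simpa only [sq] using hint a a
  refine submartingale_of_setIntegral_le
    (fun u => (hU.stronglyMeasurable u).measurable.pow_const 2 |>.stronglyMeasurable) hsq
    fun s v hsv B hB => ?_
  have hg : Measurable[𝓕 s] (B.indicator (U s)) :=
    (hU.stronglyMeasurable s).measurable.indicator hB
  have h1 := submartingale_integral_mul_nonneg hU hsv hg
    (fun ω => indicator_nonneg (fun _ _ => h0 _ _) _) (K := k) (fun ω => by
      rw [abs_of_nonneg (indicator_nonneg (fun _ _ => h0 _ _) _)]
      exact (indicator_le_self' (fun _ _ => h0 s ω) ω).trans (hk s ω))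
  have h2 : ∫ ω, B.indicator (U s) ω * (U v ω - U s ω) ∂P
      = ∫ ω in B, (U s ω * U v ω - U s ω ^ 2) ∂P := by
    rw [← integral_indicator (𝓕.le s _ hB)]
    congr 1; funext ω
    by_cases h : ω ∈ B <;> simp [h]; ring
  rw [h2] at h1
  have h3 : 0 ≤ ∫ ω in B, ((U v ω ^ 2 - U s ω ^ 2) - 2 * (U s ω * U v ω - U s ω ^ 2)) ∂P :=
    integral_nonneg fun ω => by
      simp only [Pi.zero_apply]; nlinarith [sq_nonneg (U v ω - U s ω)]
  have i1 : Integrable (fun ω => U v ω ^ 2 - U s ω ^ 2) P := (hsq v).sub (hsq s)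
  have i2 : Integrable (fun ω => 2 * (U s ω * U v ω - U s ω ^ 2)) P :=
    ((hint s v).sub (hsq s)).const_mul 2
  rw [integral_sub i1.integrableOn i2.integrableOn, integral_const_mul,
    integral_sub (hsq v).integrableOn (hsq s).integrableOn] at h3
  linarith

/-! ### Step integrals of the killed process -/

/-- The pathwise integral of a step process against `Y` on `[0, M]`. -/
def stepSum (M n : ℕ) (φ Y : ℝ≥0 → Ω → ℝ) (ω : Ω) : ℝ :=
  ∑ i ∈ Finset.range (M * 2 ^ n),
    φ (dyPt n (i + 1)) ω * (Y (dyPt n (i + 1)) ω - Y (dyPt n i) ω)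

/-- A sum over cells picks the cell of `κ`. -/
lemma IsDyadicStep.sum_cell {n M : ℕ} {φ : ℝ≥0 → Ω → ℝ} (hφ : IsDyadicStep 𝓕 n φ) {ω : Ω}
    {v : ℝ≥0} (hM : v ≤ M) (c : ℝ) :
    ∑ i ∈ Finset.range (M * 2 ^ n),
      φ (dyPt n (i + 1)) ω * (if dyPt n i < v ∧ v ≤ dyPt n (i + 1) then c else 0) = φ v ω * c := by
  rcases eq_or_ne v 0 with rfl | hv
  · rw [hφ.zero, zero_mul]
    exact Finset.sum_eq_zero fun i _ => by simp
  · obtain ⟨i, hi1, hi2, hi⟩ := exists_cell n (pos_iff_ne_zero.2 hv)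
    have hiM : i < M * 2 ^ n := by
      rw [← dyPt_lt_iff (n := n), dyPt_mul_pow]; exact hi1.trans_le hM
    rw [Finset.sum_eq_single_of_mem i (Finset.mem_range.2 hiM), if_pos ⟨hi1, hi2⟩, ← hi, hφ.cell]
    intro j _ hj
    rw [if_neg, mul_zero]
    rintro ⟨h1, h2⟩
    have h1 := dyPt_lt_iff.1 (h1.trans_le hi2)
    have h2 := dyPt_lt_iff.1 (hi1.trans_le h2)
    omega

lemma jumpPart_eq_ite (p : ℝ≥0 → Ω → ℝ) (κ : Ω → ℝ≥0) (s v : ℝ≥0) (ω : Ω) :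
    jumpPart p κ s v ω = if s < κ ω ∧ κ ω ≤ v then p (κ ω) ω else 0 := by
  simp [jumpPart, indicator]

/-- The mean of a step integral of the killed process. -/
lemma IsDyadicStep.sum_integral_killed (hp : Martingale p 𝓕 P)
    (hrc : ∀ ω u, ContinuousWithinAt (fun u => p u ω) (Ici u) u)
    (hκ : IsStoppingTime 𝓕 (fun ω => (κ ω : WithTop ℝ≥0)))
    (hpκ : Integrable (fun ω => p (κ ω) ω) P) {M : ℕ} (hM : ∀ ω, κ ω ≤ M) {n : ℕ}
    {φ : ℝ≥0 → Ω → ℝ} (hφ : IsDyadicStep 𝓕 n φ) {K : ℝ} (hK : ∀ u ω, |φ u ω| ≤ K) :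
    ∑ i ∈ Finset.range (M * 2 ^ n), ∫ ω, φ (dyPt n (i + 1)) ω *
      (killed p κ (dyPt n (i + 1)) ω - killed p κ (dyPt n i) ω) ∂P
      = - ∫ ω, φ (κ ω) ω * p (κ ω) ω ∂P := by
  rw [Finset.sum_congr rfl fun i _ => integral_mul_killed_sub hp hrc hκ hpκ
    (dyPt_mono n (Nat.le_succ i)) (hφ.meas i) (hK _), Finset.sum_neg_distrib, ← integral_finsetSum]
  · congr 2; funext ω
    simp only [jumpPart_eq_ite]
    exact hφ.sum_cell (hM ω) _
  · intro i _
    exact (integrable_jumpPart hκ hpκ _ _).bdd_mul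
      ((hφ.meas i).mono (𝓕.le _) le_rfl).aestronglyMeasurable (ae_of_all _ (hK _))

lemma integrable_step_mul {Y : Ω → ℝ} (hY : Integrable Y P) {n : ℕ} {φ : ℝ≥0 → Ω → ℝ}
    (hφ : IsDyadicStep 𝓕 n φ) {K : ℝ} (hK : ∀ u ω, |φ u ω| ≤ K) (i : ℕ) :
    Integrable (fun ω => φ (dyPt n (i + 1)) ω * Y ω) P :=
  hY.bdd_mul ((hφ.meas i).mono (𝓕.le _) le_rfl).aestronglyMeasurable (ae_of_all _ (hK _))

lemma integrable_stepSum {Y : ℝ≥0 → Ω → ℝ} (hY : ∀ u, Integrable (Y u) P) (M : ℕ) {n : ℕ}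
    {φ : ℝ≥0 → Ω → ℝ} (hφ : IsDyadicStep 𝓕 n φ) {K : ℝ} (hK : ∀ u ω, |φ u ω| ≤ K) :
    Integrable (stepSum M n φ Y) P :=
  integrable_finsetSum _ fun i _ => integrable_step_mul ((hY _).sub (hY _)) hφ hK i

/-- The `L¹` estimate for step integrals of the killed process. -/
lemma IsDyadicStep.integral_abs_stepSum_killed_le (hp : Martingale p 𝓕 P) (hp0 : ∀ u ω, 0 ≤ p u ω)
    (hrc : ∀ ω u, ContinuousWithinAt (fun u => p u ω) (Ici u) u)
    (hκ : IsStoppingTime 𝓕 (fun ω => (κ ω : WithTop ℝ≥0)))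
    (hpκ : Integrable (fun ω => p (κ ω) ω) P) {M : ℕ} (hM : ∀ ω, κ ω ≤ M) {k : ℝ} (hk0 : 0 ≤ k)
    (hk : ∀ ω u, u < κ ω → p u ω ≤ k) {n : ℕ}
    {φ : ℝ≥0 → Ω → ℝ} (hφ : IsDyadicStep 𝓕 n φ) {K : ℝ} (hK : ∀ u ω, |φ u ω| ≤ K) :
    ∫ ω, |stepSum M n φ (killed p κ) ω| ∂P
      ≤ √(stepInt P (fun u ω => (k - killed p κ u ω) ^ 2) M n fun u ω => φ u ω ^ 2)
        + ∫ ω, |φ (κ ω) ω| * p (κ ω) ω ∂P := by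
  have hsub := submartingale_sub_killed hp hp0 hrc hκ hpκ k
  have hN0 : ∀ u ω, 0 ≤ killed p κ u ω := fun u ω => by
    unfold killed; split_ifs; exacts [hp0 _ _, le_rfl]
  have hNk : ∀ u ω, killed p κ u ω ≤ k := fun u ω => by
    unfold killed; split_ifs with h; exacts [hk _ _ h, hk0]
  let 𝓖 : Filtration ℕ mΩ :=
    { seq := fun i => 𝓕 (dyPt n i)
      mono' := fun i j hij => 𝓕.mono (dyPt_mono n hij)
      le' := fun i => 𝓕.le _ }
  have hU : Submartingale (fun i ω => k - killed p κ (dyPt n i) ω) 𝓖 P :=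
    ⟨fun i => hsub.1 _, fun i j hij => hsub.2.1 _ _ (dyPt_mono n hij), fun i => hsub.2.2 _⟩
  have h := integral_abs_transform_le hU (fun i ω => sub_nonneg.2 (hNk _ _))
    (fun i ω => sub_le_self k (hN0 _ _)) (e := fun i => φ (dyPt n (i + 1)))
    (fun i => (hφ.meas i).stronglyMeasurable) (fun i ω => hK _ ω) (M * 2 ^ n)
  have hφa : IsDyadicStep 𝓕 n (fun u ω => |φ u ω|) :=
    hφ.comp₂ (g := fun a _ => |a|) hφ (measurable_norm.comp measurable_fst) abs_zero
  have h2 := hφa.sum_integral_killed hp hrc hκ hpκ hM (K := K)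
    (fun u ω => by rw [abs_abs]; exact hK u ω)
  have e1 : ∀ ω, |∑ i ∈ Finset.range (M * 2 ^ n), φ (dyPt n (i + 1)) ω *
      ((k - killed p κ (dyPt n (i + 1)) ω) - (k - killed p κ (dyPt n i) ω))|
      = |stepSum M n φ (killed p κ) ω| := fun ω => by
    rw [← abs_neg, ← Finset.sum_neg_distrib]
    congr 1
    exact Finset.sum_congr rfl fun i _ => by ring
  have e2 : ∑ i ∈ Finset.range (M * 2 ^ n), ∫ ω, |φ (dyPt n (i + 1)) ω| *
      ((k - killed p κ (dyPt n (i + 1)) ω) - (k - killed p κ (dyPt n i) ω)) ∂P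
      = ∫ ω, |φ (κ ω) ω| * p (κ ω) ω ∂P := by
    rw [← neg_inj, ← h2, ← Finset.sum_neg_distrib]
    refine Finset.sum_congr rfl fun i _ => ?_
    rw [← integral_neg]
    congr 1; funext ω; ring
  simp only [e1] at h
  rw [e2] at h
  exact h

end

section

variable {Ω : Type*} {mΩ : MeasurableSpace Ω} {𝓕 : Filtration ℝ≥0 mΩ}

/-! ### The control measure of a stopped killed martingale -/

/-- The minimum of an extended time and a finite time. -/
def minTime (τ : Ω → ℝ≥0∞) (ρ : Ω → ℝ≥0) (ω : Ω) : ℝ≥0 := (min (τ ω) (ρ ω)).toNNReal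

lemma coe_minTime (τ : Ω → ℝ≥0∞) (ρ : Ω → ℝ≥0) (ω : Ω) :
    (minTime τ ρ ω : ℝ≥0∞) = min (τ ω) (ρ ω) :=
  ENNReal.coe_toNNReal (ne_top_of_le_ne_top ENNReal.coe_ne_top (min_le_right _ _))

lemma lt_minTime_iff {τ : Ω → ℝ≥0∞} {ρ : Ω → ℝ≥0} {ω : Ω} {u : ℝ≥0} :
    u < minTime τ ρ ω ↔ (u : ℝ≥0∞) < τ ω ∧ u < ρ ω := by
  rw [← ENNReal.coe_lt_coe, coe_minTime, lt_min_iff, ENNReal.coe_lt_coe]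

lemma minTime_le (τ : Ω → ℝ≥0∞) (ρ : Ω → ℝ≥0) (ω : Ω) : minTime τ ρ ω ≤ ρ ω := by
  rw [← ENNReal.coe_le_coe, coe_minTime]; exact min_le_right _ _

lemma minTime_of_lt {τ : Ω → ℝ≥0∞} {ρ : Ω → ℝ≥0} {ω : Ω} (h : (ρ ω : ℝ≥0∞) < τ ω) :
    minTime τ ρ ω = ρ ω := by
  rw [← ENNReal.coe_inj, coe_minTime, min_eq_right h.le]

lemma minTime_of_le {τ : Ω → ℝ≥0∞} {ρ : Ω → ℝ≥0} {ω : Ω} (h : τ ω ≤ ρ ω) :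
    minTime τ ρ ω = (τ ω).toNNReal := by
  rw [minTime, min_eq_left h]

lemma isStoppingTime_minTime {τ : Ω → ℝ≥0∞} (hτ : ∀ u : ℝ≥0, MeasurableSet[𝓕 u] {ω | τ ω ≤ u})
    {ρ : Ω → ℝ≥0} (hρ : IsStoppingTime 𝓕 (fun ω => (ρ ω : WithTop ℝ≥0))) :
    IsStoppingTime 𝓕 (fun ω => (minTime τ ρ ω : WithTop ℝ≥0)) := by
  intro u
  have e : {ω | (minTime τ ρ ω : WithTop ℝ≥0) ≤ u}
      = {ω | τ ω ≤ u} ∪ {ω | (ρ ω : WithTop ℝ≥0) ≤ u} := by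
    ext ω
    simp only [Set.mem_ofPred_eq, mem_union, WithTop.coe_le_coe]
    rw [← ENNReal.coe_le_coe, coe_minTime, min_le_iff, ENNReal.coe_le_coe]
  rw [e]
  exact (hτ u).union (hρ u)

/-- The value at `τ` of the integrand `H` times `p`, on `{τ ≤ ρ}`. -/
def jumpAt (τ : Ω → ℝ≥0∞) (ρ : Ω → ℝ≥0) (p H : ℝ≥0 → Ω → ℝ) (ω : Ω) : ℝ :=
  if τ ω ≤ ρ ω then H (τ ω).toNNReal ω * p (τ ω).toNNReal ω else 0

/-- `ν` controls the step integrals of the stopped process `F^ρ`, where `F = p 1_{· < τ}`. -/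
structure IsControl (P : Measure Ω) (𝓕 : Filtration ℝ≥0 mΩ) (p F : ℝ≥0 → Ω → ℝ) (τ : Ω → ℝ≥0∞)
    (ρ : Ω → ℝ≥0) (M : ℕ) (c : ℝ≥0) (ν : @Measure (ℝ≥0 × Ω) (dySigma 𝓕)) : Prop where
  finite : ν univ < ∞
  bound : ∀ (n : ℕ) (φ : ℝ≥0 → Ω → ℝ) (K : ℝ), IsDyadicStep 𝓕 n φ → (∀ u ω, |φ u ω| ≤ K) →
    ∫⁻ ω, ‖stepSum M n φ (fun u ω => F (min u (ρ ω)) ω) ω‖ₑ ∂P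
      ≤ c * (∫⁻ z, ‖φ z.1 z.2‖ₑ ^ 2 ∂ν) ^ (1 / 2 : ℝ)
  integrable : ∀ (n : ℕ) (φ : ℝ≥0 → Ω → ℝ) (K : ℝ), IsDyadicStep 𝓕 n φ → (∀ u ω, |φ u ω| ≤ K) →
    Integrable (stepSum M n φ (fun u ω => F (min u (ρ ω)) ω)) P
  mean : ∀ (n : ℕ) (φ : ℝ≥0 → Ω → ℝ) (K : ℝ), IsDyadicStep 𝓕 n φ → (∀ u ω, |φ u ω| ≤ K) →
    ∫ ω, stepSum M n φ (fun u ω => F (min u (ρ ω)) ω) ω ∂P = - ∫ ω, jumpAt τ ρ p φ ω ∂P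
  measurable_jump : ∀ (H : ℝ≥0 → Ω → ℝ), Measurable[dySigma 𝓕] (Function.uncurry H) →
    Measurable (jumpAt τ ρ p H)
  jump : ∀ (H : ℝ≥0 → Ω → ℝ), Measurable[dySigma 𝓕] (Function.uncurry H) →
    ∫⁻ ω, ‖jumpAt τ ρ p H ω‖ₑ ∂P ≤ c * (∫⁻ z, ‖H z.1 z.2‖ₑ ^ 2 ∂ν) ^ (1 / 2 : ℝ)
  supp : ∀ s : ℝ≥0, (∀ ω, ρ ω ≤ s) → ν {z | s < z.1} = 0

/-- The stopped process `F^ρ` is the process killed at `τ ∧ ρ` plus the constant `F (ρ ω) ω` from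
`ρ` on. The second piece has a single jump, seen only by the cell that contains `ρ`. -/
lemma stepSum_stopped {F : ℝ≥0 → Ω → ℝ} {p : ℝ≥0 → Ω → ℝ} {τ : Ω → ℝ≥0∞}
    (hF : ∀ u ω, F u ω = if (u : ℝ≥0∞) < τ ω then p u ω else 0) {ρ : Ω → ℝ≥0} {M : ℕ}
    (hM : ∀ ω, ρ ω ≤ M) {n : ℕ} {φ : ℝ≥0 → Ω → ℝ} (hφ : IsDyadicStep 𝓕 n φ) (ω : Ω) :
    stepSum M n φ (fun u ω => F (min u (ρ ω)) ω) ω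
      = stepSum M n φ (killed p (minTime τ ρ)) ω + φ (ρ ω) ω * F (ρ ω) ω := by
  have hdec : ∀ u, F (min u (ρ ω)) ω
      = killed p (minTime τ ρ) u ω + if ρ ω ≤ u then F (ρ ω) ω else 0 := fun u => by
    by_cases h : ρ ω ≤ u
    · have : ¬ u < minTime τ ρ ω := fun h' => not_lt.2 h (lt_minTime_iff.1 h').2
      simp [killed, h, this]
    · rw [if_neg h, add_zero, min_eq_left (not_le.1 h).le, hF, killed]
      simp only [lt_minTime_iff, not_le.1 h, and_true]
  rw [← hφ.sum_cell (hM ω) (F (ρ ω) ω)]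
  unfold stepSum
  rw [← Finset.sum_add_distrib]
  refine Finset.sum_congr rfl fun i _ => ?_
  dsimp only
  rw [hdec, hdec, ← mul_add]
  congr 1
  have hlt : dyPt n i ≤ dyPt n (i + 1) := dyPt_mono n (Nat.le_succ i)
  by_cases h1 : ρ ω ≤ dyPt n i
  · simp [h1, h1.trans hlt, not_lt.2 h1]
  · by_cases h2 : ρ ω ≤ dyPt n (i + 1)
    · simp [h1, h2, not_le.1 h1]; ring
    · simp [h1, h2]

/-- With `κ = τ ∧ ρ`, the killed process is bounded by `k` even if `p` jumps above `k` at `ρ`, so `k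
- killed p κ` is a bounded submartingale. The control is `ν = μ + ν₂`: `μ` is the measure of the
square of this submartingale and handles the martingale part, while `ν₂` is the image of `p_κ dP`
under the graph of `κ` and handles all values taken at `κ`, by Cauchy–Schwarz. The mean of the
killed part is `-E[φ_κ p_κ]`; the value restored on `{ρ < τ}` leaves exactly the contribution of `{τ
≤ ρ}`. -/
theorem exists_control {P : Measure Ω} [IsProbabilityMeasure P] {p : ℝ≥0 → Ω → ℝ}
    (hp : Martingale p 𝓕 P) (hp0 : ∀ u ω, 0 ≤ p u ω)
    (hrc : ∀ ω u, ContinuousWithinAt (fun u => p u ω) (Ici u) u) {τ : Ω → ℝ≥0∞}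
    (hτ : ∀ u : ℝ≥0, MeasurableSet[𝓕 u] {ω | τ ω ≤ u}) {F : ℝ≥0 → Ω → ℝ}
    (hF : ∀ u ω, F u ω = if (u : ℝ≥0∞) < τ ω then p u ω else 0) {ρ : Ω → ℝ≥0}
    (hρ : IsStoppingTime 𝓕 (fun ω => (ρ ω : WithTop ℝ≥0))) {M : ℕ} (hM : ∀ ω, ρ ω ≤ M) {k : ℝ}
    (hk0 : 0 ≤ k) (hk : ∀ ω u, u < ρ ω → p u ω ≤ k) :
    ∃ (c : ℝ≥0) (ν : @Measure (ℝ≥0 × Ω) (dySigma 𝓕)), IsControl P 𝓕 p F τ ρ M c ν := by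
  set κ := minTime τ ρ with hκdef
  have hκ : IsStoppingTime 𝓕 (fun ω => (κ ω : WithTop ℝ≥0)) := isStoppingTime_minTime hτ hρ
  have hκm := measurable_of_isStoppingTime hκ
  have hκM : ∀ ω, κ ω ≤ M := fun ω => (minTime_le τ ρ ω).trans (hM ω)
  have hpκ := (optional_stopping hp hrc hκ hκM).1
  have hpm : Measurable (fun ω => p (κ ω) ω) :=
    (measurable_uncurry_of_rightCont (fun u => ((hp.1 u).mono (𝓕.le u)).measurable) hrc).comp
      (hκm.prodMk measurable_id)
  have hτm : Measurable τ := by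
    refine measurable_of_Iic fun a => ?_
    induction a with
    | top => simp
    | coe a => exact 𝓕.le a _ (hτ a)
  have hρm := measurable_of_isStoppingTime hρ
  have hset : MeasurableSet {ω | τ ω ≤ ρ ω} := measurableSet_le hτm (by fun_prop)
  have hsub := submartingale_sub_killed hp hp0 hrc hκ hpκ k
  have hN0 : ∀ u ω, 0 ≤ killed p κ u ω := fun u ω => by
    unfold killed; split_ifs; exacts [hp0 _ _, le_rfl]
  have hkκ : ∀ ω u, u < κ ω → p u ω ≤ k := fun ω u h => hk ω u (lt_minTime_iff.1 h).2
  have hNk : ∀ u ω, killed p κ u ω ≤ k := fun u ω => by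
    unfold killed; split_ifs with h; exacts [hkκ _ _ h, hk0]
  have hΛ := submartingale_sq hsub (fun u ω => sub_nonneg.2 (hNk u ω)) (k := k)
    (fun u ω => sub_le_self k (hN0 u ω))
  have hΛrc : ∀ ω u, ContinuousWithinAt (fun u => (k - killed p κ u ω) ^ 2) (Ici u) u :=
    fun ω u => (continuousWithinAt_const.sub (killed_rightCont hrc ω u)).pow 2
  obtain ⟨μ, hμfin, hμ0, hμ⟩ := exists_dyMeasure hΛ (fun u ω => sq_nonneg _) (c := k ^ 2)
    (fun u ω => pow_le_pow_left₀ (sub_nonneg.2 (hNk u ω)) (sub_le_self k (hN0 u ω)) 2) hΛrc M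
  set Q : Measure Ω := P.withDensity fun ω => ENNReal.ofReal (p (κ ω) ω) with hQ
  have hQfin : IsFiniteMeasure Q := isFiniteMeasure_withDensity_ofReal hpκ.2
  have hgr := measurable_graph 𝓕 hκm
  set ν₂ : @Measure (ℝ≥0 × Ω) (dySigma 𝓕) :=
    @Measure.map _ _ mΩ (dySigma 𝓕) (fun ω => (κ ω, ω)) Q with hν₂
  set c' : ℝ≥0 := ((Q univ) ^ (1 / 2 : ℝ)).toNNReal with hc'
  have hc'coe : (c' : ℝ≥0∞) = (Q univ) ^ (1 / 2 : ℝ) :=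
    ENNReal.coe_toNNReal (ENNReal.rpow_ne_top_of_nonneg (by norm_num) (measure_ne_top _ _))
  -- Cauchy–Schwarz for the values at `κ`
  have hCS : ∀ (H : ℝ≥0 → Ω → ℝ), Measurable[dySigma 𝓕] (Function.uncurry H) →
      ∫⁻ ω, ‖H (κ ω) ω‖ₑ * ENNReal.ofReal (p (κ ω) ω) ∂P
        ≤ c' * (∫⁻ z, ‖H z.1 z.2‖ₑ ^ 2 ∂(μ + ν₂)) ^ (1 / 2 : ℝ) := fun H hH => by
    have hHκ : Measurable fun ω => H (κ ω) ω := hH.comp hgr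
    have h1 : ∫⁻ ω, ‖H (κ ω) ω‖ₑ * ENNReal.ofReal (p (κ ω) ω) ∂P = ∫⁻ ω, ‖H (κ ω) ω‖ₑ ∂Q := by
      rw [hQ, lintegral_withDensity_eq_lintegral_mul _ hpm.ennreal_ofReal hHκ.enorm]
      refine lintegral_congr fun ω => ?_
      simp only [Pi.mul_apply]; rw [mul_comm]
    have h2 := ENNReal.lintegral_mul_le_Lp_mul_Lq Q Real.HolderConjugate.two_two
      (f := fun ω => ‖H (κ ω) ω‖ₑ) (g := fun _ => 1) hHκ.enorm.aemeasurable aemeasurable_const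
    simp only [Pi.mul_apply, mul_one, ENNReal.one_rpow, lintegral_const, one_mul] at h2
    have h3 : ∫⁻ ω, ‖H (κ ω) ω‖ₑ ^ (2 : ℝ) ∂Q ≤ ∫⁻ z, ‖H z.1 z.2‖ₑ ^ 2 ∂(μ + ν₂) := by
      have hm2 : Measurable[dySigma 𝓕] fun z : ℝ≥0 × Ω => ‖H z.1 z.2‖ₑ ^ 2 :=
        (measurable_enorm.pow_const 2).comp hH
      rw [lintegral_add_measure, hν₂, @lintegral_map _ _ mΩ (dySigma 𝓕) _ _ _ hm2 hgr]
      simp only [ENNReal.rpow_ofNat]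
      exact le_add_self
    rw [h1, mul_comm, hc'coe]
    refine h2.trans ?_
    gcongr
  have hpt : ∀ (H : ℝ≥0 → Ω → ℝ) ω, ‖jumpAt τ ρ p H ω‖ₑ
      ≤ ‖H (κ ω) ω‖ₑ * ENNReal.ofReal (p (κ ω) ω) := fun H ω => by
    unfold jumpAt
    split_ifs with h
    · rw [← minTime_of_le h, enorm_mul, Real.enorm_of_nonneg (hp0 _ _)]
    · simp
  have hjm : ∀ (H : ℝ≥0 → Ω → ℝ), Measurable[dySigma 𝓕] (Function.uncurry H) →
      Measurable (jumpAt τ ρ p H) := fun H hH => by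
    have hHκ : Measurable fun ω => H (κ ω) ω := hH.comp hgr
    have : jumpAt τ ρ p H = {ω | τ ω ≤ ρ ω}.indicator fun ω => H (κ ω) ω * p (κ ω) ω := by
      funext ω
      by_cases h : τ ω ≤ ρ ω
      · simp [jumpAt, indicator, h, hκdef, minTime_of_le h]
      · simp [jumpAt, indicator, h]
    rw [this]
    exact (hHκ.mul hpm).indicator hset
  have hFm : Measurable fun ω => F (ρ ω) ω := by
    have hpρ : Measurable (fun ω => p (ρ ω) ω) :=
      (measurable_uncurry_of_rightCont (fun u => ((hp.1 u).mono (𝓕.le u)).measurable) hrc).comp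
        (hρm.prodMk measurable_id)
    simp only [hF]
    exact Measurable.ite (measurableSet_lt (by fun_prop) hτm) hpρ measurable_const
  have hφF : ∀ (φ : ℝ≥0 → Ω → ℝ) ω, φ (ρ ω) ω * F (ρ ω) ω
      = φ (κ ω) ω * p (κ ω) ω - jumpAt τ ρ p φ ω := fun φ ω => by
    unfold jumpAt
    rw [hF]
    by_cases h : (ρ ω : ℝ≥0∞) < τ ω
    · simp [h, hκdef, minTime_of_lt h, not_le.2 h]
    · simp [h, hκdef, minTime_of_le (not_lt.1 h), not_lt.1 h]
  have hκint : ∀ (n : ℕ) (φ : ℝ≥0 → Ω → ℝ) (K : ℝ), IsDyadicStep 𝓕 n φ → (∀ u ω, |φ u ω| ≤ K) →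
      Integrable (fun ω => φ (κ ω) ω * p (κ ω) ω) P := fun n φ K hφ hK =>
    hpκ.bdd_mul (hφ.measurable_at_time hκm).aestronglyMeasurable (ae_of_all _ fun ω => hK _ _)
  have hjint : ∀ (n : ℕ) (φ : ℝ≥0 → Ω → ℝ) (K : ℝ), IsDyadicStep 𝓕 n φ → (∀ u ω, |φ u ω| ≤ K) →
      Integrable (jumpAt τ ρ p φ) P := fun n φ K hφ hK => by
    refine (hκint n φ K hφ hK).mono (hjm φ hφ.measurable_uncurry).aestronglyMeasurable
      (ae_of_all _ fun ω => ?_)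
    have := hpt φ ω
    rw [← Real.enorm_of_nonneg (hp0 _ _), ← enorm_mul] at this
    exact enorm_le_iff_norm_le.1 this
  have hSint : ∀ (n : ℕ) (φ : ℝ≥0 → Ω → ℝ) (K : ℝ), IsDyadicStep 𝓕 n φ → (∀ u ω, |φ u ω| ≤ K) →
      Integrable (stepSum M n φ (killed p κ)) P := fun n φ K hφ hK =>
    integrable_stepSum (fun u => integrable_killed hp hκ u) M hφ hK
  have hrepr : ∀ (n : ℕ) (φ : ℝ≥0 → Ω → ℝ), IsDyadicStep 𝓕 n φ →
      stepSum M n φ (fun u ω => F (min u (ρ ω)) ω) = fun ω => stepSum M n φ (killed p κ) ω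
        + (φ (κ ω) ω * p (κ ω) ω - jumpAt τ ρ p φ ω) := fun n φ hφ => by
    funext ω
    rw [stepSum_stopped hF hM hφ, hφF]
  -- In the constant, `1` comes from the quadratic term, one `c'` from the drift of the killed
  -- process and one `c'` from the value restored at `ρ`, where `c' ^ 2` is the mean of `p_κ`.
  refine ⟨1 + 2 * c', μ + ν₂, ?_, ?_, ?_, ?_, hjm, ?_, ?_⟩
  · rw [Measure.add_apply, ENNReal.add_lt_top]
    refine ⟨hμfin, ?_⟩
    rw [hν₂, Measure.map_apply hgr MeasurableSet.univ]
    exact measure_lt_top _ _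
  · intro n φ K hφ hK
    have h1 := hφ.integral_abs_stepSum_killed_le hp hp0 hrc hκ hpκ hκM hk0 hkκ hK
    have h2 := hφ.lintegral_sq hΛ (fun u ω => sq_nonneg _) hμ0 hμ hK
    have h3 := hCS φ hφ.measurable_uncurry
    have hA : ∫⁻ ω, ‖stepSum M n φ (killed p κ) ω‖ₑ ∂P
        ≤ (∫⁻ z, ‖φ z.1 z.2‖ₑ ^ 2 ∂(μ + ν₂)) ^ (1 / 2 : ℝ)
          + c' * (∫⁻ z, ‖φ z.1 z.2‖ₑ ^ 2 ∂(μ + ν₂)) ^ (1 / 2 : ℝ) := by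
      rw [← ofReal_integral_norm_eq_lintegral_enorm (hSint n φ K hφ hK)]
      refine (ENNReal.ofReal_le_ofReal h1).trans (ENNReal.ofReal_add_le.trans ?_)
      refine add_le_add ?_ (le_trans (le_of_eq ?_) h3)
      · rcases le_total 0 (stepInt P (fun u ω => (k - killed p κ u ω) ^ 2) M n
          fun u ω => φ u ω ^ 2) with h | h
        · rw [Real.sqrt_eq_rpow, ← ENNReal.ofReal_rpow_of_nonneg h (by norm_num), ← h2,
            lintegral_add_measure]
          gcongr
          exact le_self_add
        · rw [Real.sqrt_eq_zero_of_nonpos h, ENNReal.ofReal_zero]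
          exact zero_le
      · rw [ofReal_integral_eq_lintegral_ofReal]
        · refine lintegral_congr fun ω => ?_
          rw [ENNReal.ofReal_mul (abs_nonneg _), Real.enorm_eq_ofReal_abs]
        · have := (hκint n φ K hφ hK).norm
          simpa only [norm_mul, Real.norm_eq_abs, abs_of_nonneg (hp0 _ _)] using this
        · exact ae_of_all _ fun ω => mul_nonneg (abs_nonneg _) (hp0 _ _)
    have hB : ∫⁻ ω, ‖φ (ρ ω) ω * F (ρ ω) ω‖ₑ ∂P
        ≤ c' * (∫⁻ z, ‖φ z.1 z.2‖ₑ ^ 2 ∂(μ + ν₂)) ^ (1 / 2 : ℝ) := by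
      refine (lintegral_mono fun ω => ?_).trans h3
      rw [hF, ]
      by_cases h : (ρ ω : ℝ≥0∞) < τ ω
      · simp only [h, if_true, hκdef, minTime_of_lt h, enorm_mul, Real.enorm_of_nonneg (hp0 _ _)]
        exact le_rfl
      · simp [h]
    have hm : AEMeasurable (fun ω => ‖stepSum M n φ (killed p κ) ω‖ₑ) P :=
      (hSint n φ K hφ hK).1.enorm
    calc ∫⁻ ω, ‖stepSum M n φ (fun u ω => F (min u (ρ ω)) ω) ω‖ₑ ∂P
        ≤ ∫⁻ ω, (‖stepSum M n φ (killed p κ) ω‖ₑ + ‖φ (ρ ω) ω * F (ρ ω) ω‖ₑ) ∂P := by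
          refine lintegral_mono fun ω => ?_
          rw [stepSum_stopped hF hM hφ]
          exact enorm_add_le _ _
      _ = ∫⁻ ω, ‖stepSum M n φ (killed p κ) ω‖ₑ ∂P + ∫⁻ ω, ‖φ (ρ ω) ω * F (ρ ω) ω‖ₑ ∂P :=
          lintegral_add_left' hm _
      _ ≤ _ := by
          refine (add_le_add hA hB).trans (le_of_eq ?_)
          push_cast; ring
  · intro n φ K hφ hK
    rw [hrepr n φ hφ]
    exact (hSint n φ K hφ hK).add ((hκint n φ K hφ hK).sub (hjint n φ K hφ hK))
  · intro n φ K hφ hK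
    rw [hrepr n φ hφ]
    have i2 : Integrable (fun ω => φ (κ ω) ω * p (κ ω) ω - jumpAt τ ρ p φ ω) P :=
      (hκint n φ K hφ hK).sub (hjint n φ K hφ hK)
    rw [integral_add (hSint n φ K hφ hK) i2,
      integral_sub (hκint n φ K hφ hK) (hjint n φ K hφ hK)]
    have h1 := hφ.sum_integral_killed hp hrc hκ hpκ hκM hK
    rw [← integral_finsetSum] at h1
    · have h2 : ∫ ω, stepSum M n φ (killed p κ) ω ∂P = - ∫ ω, φ (κ ω) ω * p (κ ω) ω ∂P := h1
      rw [h2]; ring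
    · exact fun i _ => integrable_step_mul
        ((integrable_killed hp hκ _).sub (integrable_killed hp hκ _)) hφ hK i
  · intro H hH
    refine (lintegral_mono (hpt H)).trans ((hCS H hH).trans ?_)
    gcongr
    rw [two_mul, ← add_assoc]
    exact le_add_self
  · intro s hs
    rw [Measure.add_apply, add_eq_zero]
    set D : ℕ → ℕ → Set (ℝ≥0 × Ω) := fun n j =>
      Ioc (dyPt n ⌈s * 2 ^ n⌉₊) (dyPt n j) ×ˢ (univ : Set Ω) with hD
    have hDs : ∀ n j, IsDyadicStep 𝓕 n (indProc (D n j)) := fun n j => isDyadicStep_Ioc_univ 𝓕 n _ j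
    have hUD : {z : ℝ≥0 × Ω | s < z.1} = ⋃ n, ⋃ j, D n j := by
      ext z
      simp only [Set.mem_ofPred_eq, mem_iUnion, hD, mem_prod, mem_univ, and_true, mem_Ioc,
        ← dyCeil_eq_dyPt]
      constructor
      · intro h
        obtain ⟨n, hn⟩ := ((tendsto_nhds_of_tendsto_nhdsWithin (tendsto_dyCeil s)).eventually
          (Iio_mem_nhds h)).exists
        exact ⟨n, _, hn, le_dyCeil n z.1⟩
      · rintro ⟨n, j, h, -⟩
        exact (le_dyCeil n s).trans_lt h
    have hms : MeasurableSet[dySigma 𝓕] {z : ℝ≥0 × Ω | s < z.1} := by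
      rw [hUD]
      exact @MeasurableSet.iUnion _ _ (dySigma 𝓕) _ _ fun n =>
        @MeasurableSet.iUnion _ _ (dySigma 𝓕) _ _ fun j =>
          MeasurableSpace.measurableSet_generateFrom ⟨n, hDs n j⟩
    constructor
    · rw [hUD, measure_iUnion_null_iff]
      refine fun n => measure_iUnion_null_iff.2 fun j => ?_
      rw [hμ n _ (hDs n j), ENNReal.ofReal_eq_zero]
      refine le_of_eq (Finset.sum_eq_zero fun i _ => ?_)
      rw [← integral_zero Ω ℝ]
      congr 1; funext ω
      by_cases h : dyPt n (i + 1) ∈ Ioc (dyPt n ⌈s * 2 ^ n⌉₊) (dyPt n j)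
      · have h1 : s ≤ dyPt n i := (le_dyCeil n s).trans
          (dyPt_le_iff.2 (Nat.lt_succ_iff.1 (dyPt_lt_iff.1 h.1)))
        have h2 : ∀ u, s ≤ u → killed p κ u ω = 0 := fun u hu => if_neg
          (not_lt.2 (((minTime_le τ ρ ω).trans (hs ω)).trans hu))
        dsimp only
        rw [h2 _ h1, h2 _ (h1.trans (dyPt_mono n (Nat.le_succ i)))]
        simp
      · rw [indProc_of_notMem (fun h' => h h'.1), zero_mul]
    · rw [hν₂, Measure.map_apply hgr hms]
      have : (fun ω => (κ ω, ω)) ⁻¹' {z : ℝ≥0 × Ω | s < z.1} = ∅ := by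
        ext ω
        simp only [mem_preimage, Set.mem_ofPred_eq, mem_empty_iff_false, iff_false, not_lt]
        exact (minTime_le τ ρ ω).trans (hs ω)
      rw [this, measure_empty]

end

/-! ### From elementary integrals to the general stochastic integral. -/

section

variable {Ω : Type*} {mΩ : MeasurableSpace Ω} {𝓕 : Filtration ℝ≥0 mΩ}

/-! ### Approximation of bounded stochastic integrals by step integrals -/

lemma IsDyadicStep.stepSum_eq {n m : ℕ} (h : n ≤ m) (M : ℕ) {φ : ℝ≥0 → Ω → ℝ}
    (hφ : IsDyadicStep 𝓕 n φ) (Y : ℝ≥0 → Ω → ℝ) (ω : Ω) :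
    stepSum M m φ Y ω = stepSum M n φ Y ω := by
  induction m, h using Nat.le_induction with
  | base => rfl
  | succ m hm ih =>
    rw [← ih]
    have hφ' := hφ.mono hm
    unfold stepSum
    rw [pow_succ, ← mul_assoc, sum_range_mul_two]
    refine Finset.sum_congr rfl fun i _ => ?_
    have e0 : dyPt (m + 1) (i * 2) = dyPt m i := by
      rw [dyPt_eq_of_le (Nat.le_succ m)]; simp
    have e2 : dyPt (m + 1) (i * 2 + 1 + 1) = dyPt m (i + 1) := by
      rw [dyPt_eq_of_le (Nat.le_succ m)]; congr 1; simp [Nat.add_mul]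
    have e1 : φ (dyPt (m + 1) (i * 2 + 1)) ω = φ (dyPt m (i + 1)) ω := by
      rw [← hφ'.cell (dyPt (m + 1) (i * 2 + 1)), dyCeil_eq_of_mem (n := m) (i := i)]
      · rw [← e0]; exact dyPt_lt_iff.2 (by omega)
      · rw [← e2]; exact dyPt_le_iff.2 (by omega)
    rw [e0, e1, e2]
    ring

lemma stepSum_add (M n : ℕ) (φ ψ Y : ℝ≥0 → Ω → ℝ) (ω : Ω) :
    stepSum M n (fun u ω => φ u ω + ψ u ω) Y ω = stepSum M n φ Y ω + stepSum M n ψ Y ω := by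
  simp only [stepSum, ← Finset.sum_add_distrib, add_mul]

lemma stepSum_smul (M n : ℕ) (c : ℝ) (φ Y : ℝ≥0 → Ω → ℝ) (ω : Ω) :
    stepSum M n (fun u ω => c * φ u ω) Y ω = c * stepSum M n φ Y ω := by
  simp only [stepSum, Finset.mul_sum, mul_assoc]

lemma stepSum_sub (M n : ℕ) (φ ψ Y : ℝ≥0 → Ω → ℝ) (ω : Ω) :
    stepSum M n (fun u ω => φ u ω - ψ u ω) Y ω = stepSum M n φ Y ω - stepSum M n ψ Y ω := by
  simp only [stepSum, ← Finset.sum_sub_distrib, sub_mul]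

lemma stepSum_rect (M n i j : ℕ) (hij : i ≤ j) (A : Set Ω) (Y : ℝ≥0 → Ω → ℝ) (ω : Ω) :
    stepSum M n (indProc (Ioc (dyPt n i) (dyPt n j) ×ˢ A)) Y ω
      = A.indicator (fun ω => Y (min (dyPt n j) M) ω - Y (min (dyPt n i) M) ω) ω := by
  have hmin : ∀ i : ℕ, min (dyPt n i) (M : ℝ≥0) = dyPt n (min i (M * 2 ^ n)) := fun i => by
    rw [← dyPt_mul_pow n M, (dyPt_mono n).map_min]
  by_cases hω : ω ∈ A
  · have h1 : ∀ N, ∑ l ∈ Finset.range N, indProc (Ioc (dyPt n i) (dyPt n j) ×ˢ A) (dyPt n (l + 1)) ω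
        * (Y (dyPt n (l + 1)) ω - Y (dyPt n l) ω)
        = Y (dyPt n (min j N)) ω - Y (dyPt n (min i N)) ω := fun N => by
      induction N with
      | zero => simp
      | succ N ih =>
        rw [Finset.sum_range_succ, ih]
        by_cases h : i ≤ N ∧ N + 1 ≤ j
        · rw [indProc_of_mem (show (dyPt n (N + 1), ω) ∈ Ioc (dyPt n i) (dyPt n j) ×ˢ A from
            ⟨⟨dyPt_lt_iff.2 (by omega), dyPt_le_iff.2 h.2⟩, hω⟩)]
          rw [show min j N = N by omega, show min i N = i by omega,
            show min j (N + 1) = N + 1 by omega, show min i (N + 1) = i by omega]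
          ring
        · rw [indProc_of_notMem (fun h' => h ⟨by
            have := dyPt_lt_iff.1 h'.1.1; omega, dyPt_le_iff.1 h'.1.2⟩), zero_mul, add_zero]
          rcases not_and_or.1 h with h | h
          · rw [show min j N = N by omega, show min i N = N by omega,
              show min j (N + 1) = N + 1 by omega, show min i (N + 1) = N + 1 by omega]
            simp
          · rw [show min j N = j by omega, show min i N = i by omega,
              show min j (N + 1) = j by omega, show min i (N + 1) = i by omega]
    rw [indicator_of_mem hω, hmin, hmin]
    exact h1 _
  · rw [indicator_of_notMem hω]
    exact Finset.sum_eq_zero fun l _ => by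
      rw [indProc_of_notMem (fun h => hω h.2), zero_mul]

/-- `(H, J)` is approximated by step processes in `L²(ν)` and their integrals at `ρ` in
probability. -/
structure IsStepApprox (P : Measure Ω) (𝓕 : Filtration ℝ≥0 mΩ) (F : ℝ≥0 → Ω → ℝ)
    (ρ : Ω → ℝ≥0) (M : ℕ) (ν : @Measure (ℝ≥0 × Ω) (dySigma 𝓕)) (H J : ℝ≥0 → Ω → ℝ) : Prop where
  measurable : Measurable[dySigma 𝓕] (Function.uncurry H)
  bdd : ∃ K : ℝ, ∀ u ω, |H u ω| ≤ K
  approx : ∀ δ > (0 : ℝ), ∃ (n : ℕ) (φ : ℝ≥0 → Ω → ℝ) (K : ℝ), IsDyadicStep 𝓕 n φ ∧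
    (∀ u ω, |φ u ω| ≤ K) ∧ ∫⁻ z, ‖φ z.1 z.2 - H z.1 z.2‖ₑ ^ 2 ∂ν ≤ ENNReal.ofReal δ ∧
    P {ω | δ < |stepSum M n φ (fun u ω => F (min u (ρ ω)) ω) ω - J (ρ ω) ω|} ≤ ENNReal.ofReal δ

lemma enorm_add_sq_le (a b : ℝ) : ‖a + b‖ₑ ^ 2 ≤ 2 * ‖a‖ₑ ^ 2 + 2 * ‖b‖ₑ ^ 2 := by
  have h : ∀ x : ℝ, ‖x‖ₑ ^ 2 = ENNReal.ofReal (x ^ 2) := fun x => by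
    rw [Real.enorm_eq_ofReal_abs, ← ENNReal.ofReal_pow (abs_nonneg _), sq_abs]
  rw [h, h, h, show (2 : ℝ≥0∞) = ENNReal.ofReal 2 by simp, ← ENNReal.ofReal_mul (by norm_num),
    ← ENNReal.ofReal_mul (by norm_num), ← ENNReal.ofReal_add (by positivity) (by positivity)]
  exact ENNReal.ofReal_le_ofReal (by nlinarith [sq_nonneg (a - b)])

lemma lintegral_add_sq_le {α : Type*} {m : MeasurableSpace α} {ν : Measure α} {f g : α → ℝ}
    (hf : Measurable f) :
    ∫⁻ z, ‖f z + g z‖ₑ ^ 2 ∂ν ≤ 2 * ∫⁻ z, ‖f z‖ₑ ^ 2 ∂ν + 2 * ∫⁻ z, ‖g z‖ₑ ^ 2 ∂ν := by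
  have hf2 : Measurable fun z => 2 * ‖f z‖ₑ ^ 2 := by fun_prop
  calc ∫⁻ z, ‖f z + g z‖ₑ ^ 2 ∂ν ≤ ∫⁻ z, (2 * ‖f z‖ₑ ^ 2 + 2 * ‖g z‖ₑ ^ 2) ∂ν :=
        lintegral_mono fun z => enorm_add_sq_le _ _
    _ = _ := by
        rw [lintegral_add_left hf2, lintegral_const_mul' _ _ (by simp),
          lintegral_const_mul' _ _ (by simp)]

variable {P : Measure Ω} [IsProbabilityMeasure P] {F : ℝ≥0 → Ω → ℝ} {ρ : Ω → ℝ≥0} {M : ℕ}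
  {ν : @Measure (ℝ≥0 × Ω) (dySigma 𝓕)}

lemma tendsto_lintegral_sq {α : Type*} {m : MeasurableSpace α} {ν : Measure α} (hν : ν univ < ∞)
    {f : ℕ → α → ℝ} {g : α → ℝ} (hf : ∀ n, Measurable (f n)) (hg : Measurable g) {K : ℝ}
    (hK : ∀ n z, |f n z| ≤ K) (hlim : ∀ z, Tendsto (fun n => f n z) atTop (𝓝 (g z))) :
    Tendsto (fun n => ∫⁻ z, ‖f n z - g z‖ₑ ^ 2 ∂ν) atTop (𝓝 0) := by
  have hg' : ∀ z, |g z| ≤ K := fun z => le_of_tendsto (hlim z).abs (Eventually.of_forall fun n => hK n z)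
  have h := tendsto_lintegral_of_dominated_convergence (μ := ν)
    (F := fun n z => ‖f n z - g z‖ₑ ^ 2) (f := fun _ => 0) (fun _ => ENNReal.ofReal (2 * K) ^ 2)
    (fun n => ((hf n).sub hg).enorm.pow_const 2) (fun n => ae_of_all _ fun z => ?_) ?_
    (ae_of_all _ fun z => ?_)
  · simpa using h
  · dsimp only
    rw [Real.enorm_eq_ofReal_abs]
    gcongr
    calc |f n z - g z| ≤ |f n z| + |g z| := abs_sub _ _
      _ ≤ 2 * K := by linarith [hK n z, hg' z]
  · rw [lintegral_const]
    exact ENNReal.mul_ne_top (ENNReal.pow_ne_top ENNReal.ofReal_ne_top) hν.ne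
  · have h1 : Tendsto (fun n => f n z - g z) atTop (𝓝 0) := by
      simpa using (hlim z).sub_const (g z)
    have h2 := (ENNReal.continuous_pow 2).continuousAt.tendsto.comp
      ((continuous_enorm.tendsto (0 : ℝ)).comp h1)
    simpa [Function.comp_def] using h2

lemma measurable_add_fun {α : Type*} {m : MeasurableSpace α} {f g : α → ℝ} (hf : Measurable f)
    (hg : Measurable g) : Measurable fun z => f z + g z := hf.add hg

lemma measurable_sub_fun {α : Type*} {m : MeasurableSpace α} {f g : α → ℝ} (hf : Measurable f)
    (hg : Measurable g) : Measurable fun z => f z - g z := hf.sub hg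

lemma measurable_const_mul_fun {α : Type*} {m : MeasurableSpace α} {f : α → ℝ} (hf : Measurable f)
    (c : ℝ) : Measurable fun z => c * f z := hf.const_mul c

lemma tendsto_measure_lt_abs_sub {f : ℕ → Ω → ℝ} {g : Ω → ℝ} (hf : ∀ n, Measurable (f n))
    (hlim : ∀ ω, Tendsto (fun n => f n ω) atTop (𝓝 (g ω))) {δ : ℝ} (hδ : 0 < δ) :
    Tendsto (fun n => P {ω | δ < |f n ω - g ω|}) atTop (𝓝 0) := by
  have h := tendstoInMeasure_iff_norm.1 (tendstoInMeasure_of_tendsto_ae (μ := P)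
    (fun n => (hf n).aestronglyMeasurable) (ae_of_all _ hlim)) δ hδ
  refine tendsto_of_tendsto_of_tendsto_of_le_of_le tendsto_const_nhds h (fun _ => zero_le)
    fun n => measure_mono fun ω hω => ?_
  exact (show δ < |f n ω - g ω| from hω).le

lemma tendsto_indProc_dyCeil (s v : ℝ≥0) (A : Set Ω) (z : ℝ≥0 × Ω) :
    Tendsto (fun n => indProc (Ioc (dyCeil n s) (dyCeil n v) ×ˢ A) z.1 z.2) atTop
      (𝓝 ((Ioc s v ×ˢ A).indicator (fun _ => (1 : ℝ)) (z.1, z.2))) := by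
  obtain ⟨u, ω⟩ := z
  have hev : ∀ s, s < u → ∀ᶠ n in atTop, dyCeil n s < u := fun s hs =>
    (tendsto_nhds_of_tendsto_nhdsWithin (tendsto_dyCeil s)).eventually (Iio_mem_nhds hs)
  have key : ∀ᶠ n in atTop, ((u, ω) ∈ Ioc (dyCeil n s) (dyCeil n v) ×ˢ A ↔ (u, ω) ∈ Ioc s v ×ˢ A) := by
    by_cases hs : s < u
    · by_cases hv : u ≤ v
      · filter_upwards [hev s hs] with n hn
        simp [hs, hv, hn, hv.trans (le_dyCeil n v)]
      · filter_upwards [hev v (not_le.1 hv)] with n hn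
        simp [hv, not_le.2 hn]
    · refine Eventually.of_forall fun n => ?_
      simp [hs, not_lt.2 ((not_lt.1 hs).trans (le_dyCeil n s))]
  refine tendsto_const_nhds.congr' ?_
  filter_upwards [key] with n hn
  by_cases h : (u, ω) ∈ Ioc s v ×ˢ A
  · rw [indicator_of_mem h, indProc_of_mem (hn.2 h)]
  · rw [indicator_of_notMem h, indProc_of_notMem (fun h' => h (hn.1 h'))]

/-- Induction on the construction of the integral. For an elementary integrand, rounding the
endpoints up keeps `A` observable and converges by right continuity of `F`. For a bounded limit,
convergence of the integrands in `L²(ν)` is dominated convergence for the finite measure `ν`, and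
ucp convergence on `[0, M]` controls the integrals at the random time `ρ ≤ M`. -/
theorem isStepApprox_of_isBddStochIntegral (hFrc : ∀ ω u, ContinuousWithinAt (fun u => F u ω) (Ici u) u)
    (hFm : ∀ u, Measurable (F u)) (hρm : Measurable ρ)
    (hM : ∀ ω, ρ ω ≤ M) (hν : ν univ < ∞) {H J : ℝ≥0 → Ω → ℝ}
    (hHJ : IsBddStochIntegral 𝓕 P F H J) : IsStepApprox P 𝓕 F ρ M ν H J := by
  induction hHJ with
  | step s v A hsv hA =>
    set φ : ℕ → ℝ≥0 → Ω → ℝ := fun n => indProc (Ioc (dyCeil n s) (dyCeil n v) ×ˢ A) with hφdef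
    have hφ : ∀ n, IsDyadicStep 𝓕 n (φ n) := fun n =>
      isDyadicStep_rect n _ _ (𝓕.mono (le_dyCeil n s) _ hA)
    have hlim : ∀ z : ℝ≥0 × Ω, Tendsto (fun n => φ n z.1 z.2) atTop
        (𝓝 ((Ioc s v ×ˢ A).indicator (fun _ => (1 : ℝ)) (z.1, z.2))) := fun z => tendsto_indProc_dyCeil s v A z
    have hmeas : Measurable[dySigma 𝓕] fun z : ℝ≥0 × Ω =>
        (Ioc s v ×ˢ A).indicator (fun _ => (1 : ℝ)) (z.1, z.2) :=
      @measurable_of_tendsto_metrizable _ _ (dySigma 𝓕) _ _ _ _ _ _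
        (fun n => (hφ n).measurable_uncurry) (tendsto_pi_nhds.2 hlim)
    refine ⟨hmeas, ⟨1, fun u ω => ?_⟩, fun δ hδ => ?_⟩
    · exact abs_indProc_le _ u ω
    · have h1 := tendsto_lintegral_sq hν (fun n => (hφ n).measurable_uncurry) hmeas
        (fun n z => abs_indProc_le _ z.1 z.2) hlim
      have h2 : ∀ ω, Tendsto (fun n => stepSum M n (φ n) (fun u ω => F (min u (ρ ω)) ω) ω) atTop
          (𝓝 (A.indicator (fun ω' => F (min (ρ ω) v) ω' - F (min (ρ ω) s) ω') ω)) := fun ω => by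
        have h0 : ∀ s : ℝ≥0, Tendsto (fun n => F (min (dyCeil n s) (ρ ω)) ω) atTop
            (𝓝 (F (min (ρ ω) s) ω)) := fun s => by
          refine (hFrc ω (min (ρ ω) s)).tendsto.comp (tendsto_nhdsWithin_iff.2 ⟨?_, ?_⟩)
          · rw [min_comm]
            exact (tendsto_nhds_of_tendsto_nhdsWithin (tendsto_dyCeil s)).min tendsto_const_nhds
          · exact Eventually.of_forall fun n => le_min ((min_le_right _ _).trans (le_dyCeil n s))
              (min_le_left _ _)
        have h1 : ∀ n, stepSum M n (φ n) (fun u ω => F (min u (ρ ω)) ω) ω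
            = A.indicator (fun ω => F (min (dyCeil n v) (ρ ω)) ω - F (min (dyCeil n s) (ρ ω)) ω) ω :=
          fun n => by
            have hij : ⌈s * 2 ^ n⌉₊ ≤ ⌈v * 2 ^ n⌉₊ := Nat.ceil_mono (by gcongr)
            have := stepSum_rect M n _ _ hij A (fun u ω => F (min u (ρ ω)) ω) ω
            simp only [min_assoc, min_eq_right (hM _), ← dyCeil_eq_dyPt] at this
            exact this
        simp only [h1]
        by_cases hω : ω ∈ A
        · simp only [indicator_of_mem hω]
          exact (h0 v).sub (h0 s)
        · simp only [indicator_of_notMem hω]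
          exact tendsto_const_nhds
      have h3 : Tendsto (fun n => P {ω | δ < |stepSum M n (φ n) (fun u ω => F (min u (ρ ω)) ω) ω
          - A.indicator (fun ω' => F (min (ρ ω) v) ω' - F (min (ρ ω) s) ω') ω|}) atTop (𝓝 0) := by
        refine tendsto_measure_lt_abs_sub (fun n => ?_) h2 hδ
        have hY : ∀ u, Measurable fun ω => F (min u (ρ ω)) ω := fun u =>
          (measurable_uncurry_of_rightCont hFm hFrc).comp
            ((measurable_const.min hρm).prodMk measurable_id)
        exact Finset.measurable_fun_sum _ fun i _ =>
          (((hφ n).meas i).mono (𝓕.le _) le_rfl).mul ((hY _).sub (hY _))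
      have hδ' : (0 : ℝ≥0∞) < ENNReal.ofReal δ := ENNReal.ofReal_pos.2 hδ
      obtain ⟨n, hn1, hn2⟩ := ((h1.eventually_le_const hδ').and (h3.eventually_le_const hδ')).exists
      exact ⟨n, φ n, 1, hφ n, fun u ω => abs_indProc_le _ u ω, hn1, hn2⟩
  | @add H H' J J' _ _ ih ih' =>
    obtain ⟨K, hK⟩ := ih.bdd
    obtain ⟨K', hK'⟩ := ih'.bdd
    refine ⟨measurable_add_fun ih.measurable ih'.measurable, ⟨K + K', fun u ω =>
      (abs_add_le _ _).trans (add_le_add (hK u ω) (hK' u ω))⟩, fun δ hδ => ?_⟩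
    obtain ⟨n, φ, C, hφ, hC, hφ2, hφ3⟩ := ih.approx (δ / 4) (by positivity)
    obtain ⟨n', φ', C', hφ', hC', hφ2', hφ3'⟩ := ih'.approx (δ / 4) (by positivity)
    have hs := hφ.mono (le_max_left n n')
    have hs' := hφ'.mono (le_max_right n n')
    refine ⟨max n n', fun u ω => φ u ω + φ' u ω, C + C',
      hs.comp₂ (g := fun a b => a + b) hs' (measurable_fst.add measurable_snd) (add_zero 0),
      fun u ω => (abs_add_le _ _).trans (add_le_add (hC u ω) (hC' u ω)), ?_, ?_⟩
    · have hm : Measurable[dySigma 𝓕] fun z : ℝ≥0 × Ω => φ z.1 z.2 - H z.1 z.2 :=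
        measurable_sub_fun hφ.measurable_uncurry ih.measurable
      have e : ∀ z : ℝ≥0 × Ω, φ z.1 z.2 + φ' z.1 z.2 - (H z.1 z.2 + H' z.1 z.2)
          = (φ z.1 z.2 - H z.1 z.2) + (φ' z.1 z.2 - H' z.1 z.2) := fun z => by ring
      simp only [e]
      refine (lintegral_add_sq_le hm).trans ?_
      calc _ ≤ 2 * ENNReal.ofReal (δ / 4) + 2 * ENNReal.ofReal (δ / 4) := by gcongr
        _ = ENNReal.ofReal δ := by
          rw [show (2 : ℝ≥0∞) = ENNReal.ofReal 2 by simp, ← ENNReal.ofReal_mul (by norm_num),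
            ← ENNReal.ofReal_add (by positivity) (by positivity)]
          congr 1; ring
    · refine (measure_mono (t := {ω | δ / 4 < |stepSum M n φ (fun u ω => F (min u (ρ ω)) ω) ω
          - J (ρ ω) ω|} ∪ {ω | δ / 4 < |stepSum M n' φ' (fun u ω => F (min u (ρ ω)) ω) ω
          - J' (ρ ω) ω|}) ?_).trans ?_
      · intro ω hω
        simp only [Set.mem_ofPred_eq, mem_union, stepSum_add, hφ.stepSum_eq (le_max_left n n'),
          hφ'.stepSum_eq (le_max_right n n')] at hω ⊢
        by_contra! h
        have := abs_add_le (stepSum M n φ (fun u ω => F (min u (ρ ω)) ω) ω - J (ρ ω) ω)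
          (stepSum M n' φ' (fun u ω => F (min u (ρ ω)) ω) ω - J' (ρ ω) ω)
        rw [show stepSum M n φ (fun u ω => F (min u (ρ ω)) ω) ω - J (ρ ω) ω +
          (stepSum M n' φ' (fun u ω => F (min u (ρ ω)) ω) ω - J' (ρ ω) ω) =
          stepSum M n φ (fun u ω => F (min u (ρ ω)) ω) ω +
          stepSum M n' φ' (fun u ω => F (min u (ρ ω)) ω) ω - (J (ρ ω) ω + J' (ρ ω) ω) by ring] at this
        linarith
      · refine (measure_union_le _ _).trans ((add_le_add hφ3 hφ3').trans ?_)
        rw [← ENNReal.ofReal_add (by positivity) (by positivity)]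
        exact ENNReal.ofReal_le_ofReal (by linarith)
  | @smul c H J _ ih =>
    obtain ⟨K, hK⟩ := ih.bdd
    refine ⟨measurable_const_mul_fun ih.measurable c, ⟨|c| * K, fun u ω => by
      rw [abs_mul]; exact mul_le_mul_of_nonneg_left (hK u ω) (abs_nonneg c)⟩, fun δ hδ => ?_⟩
    have hc := abs_nonneg c
    have h1c : 0 < (1 + |c|) ^ 2 := by positivity
    -- The factor `(1 + |c|) ^ 2` dominates `c ^ 2`, needed for the squared error, as well as `|c|`,
    -- needed for the deviation in probability, and `1`, needed for the probability itself.
    obtain ⟨n, φ, C, hφ, hC, hφ2, hφ3⟩ := ih.approx (δ / (1 + |c|) ^ 2) (by positivity)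
    refine ⟨n, fun u ω => c * φ u ω, |c| * C,
      hφ.comp₂ (g := fun a _ => c * a) hφ (measurable_fst.const_mul c) (mul_zero c), fun u ω => by
      rw [abs_mul]; exact mul_le_mul_of_nonneg_left (hC u ω) (abs_nonneg c), ?_, ?_⟩
    · simp only [← mul_sub, enorm_mul, mul_pow]
      rw [lintegral_const_mul' _ _ (by simp)]
      calc _ ≤ ‖c‖ₑ ^ 2 * ENNReal.ofReal (δ / (1 + |c|) ^ 2) := by gcongr
        _ ≤ ENNReal.ofReal δ := by
          rw [Real.enorm_eq_ofReal_abs, ← ENNReal.ofReal_pow hc, ← ENNReal.ofReal_mul (by positivity)]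
          refine ENNReal.ofReal_le_ofReal ?_
          rw [mul_div_assoc', div_le_iff₀ h1c, mul_comm]
          gcongr
          linarith
    · refine (measure_mono ?_).trans (hφ3.trans (ENNReal.ofReal_le_ofReal
        (div_le_self hδ.le (one_le_pow₀ (by linarith)))))
      intro ω hω
      simp only [Set.mem_ofPred_eq, stepSum_smul, ← mul_sub, abs_mul] at hω ⊢
      rw [div_lt_iff₀ h1c]
      refine hω.trans_le ?_
      rw [mul_comm]
      gcongr
      nlinarith
  | limit H J H' J' K hH hlim _ hJlim ih =>
    have hmeas : Measurable[dySigma 𝓕] (Function.uncurry H') :=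
      @measurable_of_tendsto_metrizable _ _ (dySigma 𝓕) _ _ _ _ _ _
        (fun n => (ih n).measurable) (tendsto_pi_nhds.2 fun z => hlim z.1 z.2)
    refine ⟨hmeas, ⟨K, fun u ω => le_of_tendsto (hlim u ω).abs
      (Eventually.of_forall fun n => hH n u ω)⟩, fun δ hδ => ?_⟩
    have h1 := tendsto_lintegral_sq hν (fun n => (ih n).measurable) hmeas
      (fun n z => hH n z.1 z.2) (fun z => hlim z.1 z.2)
    have h2 := hJlim M (δ / 4) (by positivity)
    have hδ' : (0 : ℝ≥0∞) < ENNReal.ofReal (δ / 4) := ENNReal.ofReal_pos.2 (by positivity)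
    obtain ⟨i, hi1, hi2⟩ := ((h1.eventually_le_const hδ').and (h2.eventually_le_const hδ')).exists
    obtain ⟨n, φ, C, hφ, hC, hφ2, hφ3⟩ := (ih i).approx (δ / 4) (by positivity)
    refine ⟨n, φ, C, hφ, hC, ?_, ?_⟩
    · have hm : Measurable[dySigma 𝓕] fun z : ℝ≥0 × Ω => φ z.1 z.2 - H i z.1 z.2 :=
        measurable_sub_fun hφ.measurable_uncurry (ih i).measurable
      have e : ∀ z : ℝ≥0 × Ω, φ z.1 z.2 - H' z.1 z.2
          = (φ z.1 z.2 - H i z.1 z.2) + (H i z.1 z.2 - H' z.1 z.2) := fun z => by ring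
      simp only [e]
      refine (lintegral_add_sq_le hm).trans ?_
      calc _ ≤ 2 * ENNReal.ofReal (δ / 4) + 2 * ENNReal.ofReal (δ / 4) := by gcongr; exact hi1
        _ = ENNReal.ofReal δ := by
          rw [show (2 : ℝ≥0∞) = ENNReal.ofReal 2 by simp, ← ENNReal.ofReal_mul (by norm_num),
            ← ENNReal.ofReal_add (by positivity) (by positivity)]
          congr 1; ring
    · refine (measure_mono (t := {ω | δ / 4 < |stepSum M n φ (fun u ω => F (min u (ρ ω)) ω) ω
          - J i (ρ ω) ω|} ∪ {ω | ∃ u ≤ (M : ℝ≥0), δ / 4 < |J i u ω - J' u ω|}) ?_).trans ?_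
      · intro ω hω
        simp only [Set.mem_ofPred_eq, mem_union] at hω ⊢
        by_contra! h
        have h3 := h.2 (ρ ω) (hM ω)
        have := abs_sub_le (stepSum M n φ (fun u ω => F (min u (ρ ω)) ω) ω) (J i (ρ ω) ω)
          (J' (ρ ω) ω)
        linarith [h.1]
      · refine (measure_union_le _ _).trans ((add_le_add hφ3 hi2).trans ?_)
        rw [← ENNReal.ofReal_add (by positivity) (by positivity)]
        exact ENNReal.ofReal_le_ofReal (by linarith)

end

section

variable {Ω : Type*} {mΩ : MeasurableSpace Ω} {𝓕 : Filtration ℝ≥0 mΩ}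
variable {P : Measure Ω} [IsProbabilityMeasure P] {p F : ℝ≥0 → Ω → ℝ} {τ : Ω → ℝ≥0∞} {ρ : Ω → ℝ≥0}
  {M : ℕ} {ν : @Measure (ℝ≥0 × Ω) (dySigma 𝓕)}

/-! ### The mean of a bounded stochastic integral at a stopping time -/

/-- Borel–Cantelli with the same summable sequence as tolerance and as probability. -/
lemma ae_tendsto_of_measure_lt_le {S : ℕ → Ω → ℝ} {g : Ω → ℝ} {d : ℕ → ℝ} (hd0 : ∀ j, 0 ≤ d j)
    (hd : Summable d) (h : ∀ j, P {ω | d j < |S j ω - g ω|} ≤ ENNReal.ofReal (d j)) :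
    ∀ᵐ ω ∂P, Tendsto (fun j => S j ω) atTop (𝓝 (g ω)) := by
  have hsum : ∑' j, P {ω | d j < |S j ω - g ω|} ≠ ∞ := by
    refine ne_top_of_le_ne_top ?_ (ENNReal.tsum_le_tsum h)
    rw [← ENNReal.ofReal_tsum_of_nonneg hd0 hd]
    exact ENNReal.ofReal_ne_top
  filter_upwards [ae_eventually_notMem hsum] with ω hω
  rw [tendsto_iff_norm_sub_tendsto_zero]
  refine squeeze_zero' (Eventually.of_forall fun _ => norm_nonneg _) ?_ hd.tendsto_atTop_zero
  filter_upwards [hω] with j hj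
  exact not_lt.1 hj

lemma jumpAt_sub (τ : Ω → ℝ≥0∞) (ρ : Ω → ℝ≥0) (p H H' : ℝ≥0 → Ω → ℝ) (ω : Ω) :
    jumpAt τ ρ p (fun u ω => H u ω - H' u ω) ω = jumpAt τ ρ p H ω - jumpAt τ ρ p H' ω := by
  unfold jumpAt; split_ifs <;> ring

/-- Step approximations with error `2⁻ʲ` converge almost surely at `ρ` along the sequence, and the
control bound makes their integrals Cauchy in `L¹`. The limit in `L¹` is therefore `J` at `ρ`, and
both sides of the mean formula pass to the limit. The same bound shows that an integrand vanishing
`ν`-almost everywhere has a null integral at `ρ`; this is later used with `ρ ∧ t`. -/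
theorem IsStepApprox.mean {c : ℝ≥0} (hc : IsControl P 𝓕 p F τ ρ M c ν) {H J : ℝ≥0 → Ω → ℝ}
    (h : IsStepApprox P 𝓕 F ρ M ν H J) :
    Integrable (fun ω => J (ρ ω) ω) P ∧ ∫ ω, J (ρ ω) ω ∂P = - ∫ ω, jumpAt τ ρ p H ω ∂P ∧
      (∫⁻ z, ‖H z.1 z.2‖ₑ ^ 2 ∂ν = 0 → ∀ᵐ ω ∂P, J (ρ ω) ω = 0) := by
  set d : ℕ → ℝ := fun j => (1 / 2) ^ j with hd
  have hd0 : ∀ j, 0 < d j := fun j => by positivity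
  choose n φ K hφ hK hφH hφJ using fun j => h.approx (d j) (hd0 j)
  set S : ℕ → Ω → ℝ := fun j => stepSum M (n j) (φ j) (fun u ω => F (min u (ρ ω)) ω) with hS
  have hSint : ∀ j, Integrable (S j) P := fun j => hc.integrable _ _ _ (hφ j) (hK j)
  have hSlim : ∀ᵐ ω ∂P, Tendsto (fun j => S j ω) atTop (𝓝 (J (ρ ω) ω)) :=
    ae_tendsto_of_measure_lt_le (fun j => (hd0 j).le) summable_geometric_two hφJ
  have hJm : AEStronglyMeasurable (fun ω => J (ρ ω) ω) P :=
    aestronglyMeasurable_of_tendsto_ae _ (fun j => (hSint j).1) hSlim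
  have hdlim : Tendsto d atTop (𝓝 0) := tendsto_pow_atTop_nhds_zero_of_lt_one (by norm_num) (by norm_num)
  have hdanti : ∀ i j, i ≤ j → d j ≤ d i := fun i j hij =>
    pow_le_pow_of_le_one (by norm_num) (by norm_num) hij
  -- Cauchy estimate
  have hSS : ∀ i j, i ≤ j → ∫⁻ ω, ‖S i ω - S j ω‖ₑ ∂P
      ≤ c * (ENNReal.ofReal (4 * d i)) ^ (1 / 2 : ℝ) := fun i j hij => by
    have hs := (hφ i).mono (le_max_left (n i) (n j))
    have hs' := (hφ j).mono (le_max_right (n i) (n j))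
    have e : ∀ ω, S i ω - S j ω = stepSum M (max (n i) (n j)) (fun u ω => φ i u ω - φ j u ω)
        (fun u ω => F (min u (ρ ω)) ω) ω := fun ω => by
      rw [stepSum_sub, (hφ i).stepSum_eq (le_max_left (n i) (n j)),
        (hφ j).stepSum_eq (le_max_right (n i) (n j))]
    simp only [e]
    refine (hc.bound _ _ (K i + K j)
      (hs.comp₂ (g := fun a b => a - b) hs' (measurable_fst.sub measurable_snd) (sub_zero 0))
      (fun u ω => (abs_sub _ _).trans (add_le_add (hK i u ω) (hK j u ω)))).trans ?_
    gcongr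
    have hm : Measurable[dySigma 𝓕] fun z : ℝ≥0 × Ω => φ i z.1 z.2 - H z.1 z.2 :=
      measurable_sub_fun (hφ i).measurable_uncurry h.measurable
    have e' : ∀ z : ℝ≥0 × Ω, φ i z.1 z.2 - φ j z.1 z.2
        = (φ i z.1 z.2 - H z.1 z.2) + (-(φ j z.1 z.2 - H z.1 z.2)) := fun z => by ring
    simp only [e']
    refine (lintegral_add_sq_le hm).trans ?_
    simp only [enorm_neg]
    calc _ ≤ 2 * ENNReal.ofReal (d i) + 2 * ENNReal.ofReal (d j) := by
          gcongr; exacts [hφH i, hφH j]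
      _ ≤ 2 * ENNReal.ofReal (d i) + 2 * ENNReal.ofReal (d i) := by
          gcongr; exact hdanti i j hij
      _ = ENNReal.ofReal (4 * d i) := by
          rw [ENNReal.ofReal_mul (by norm_num)]
          simp only [ENNReal.ofReal_ofNat]
          ring
  -- Fatou's lemma in `j`, applied to the Cauchy estimate along the almost surely convergent
  -- sequence.
  have hSJ : ∀ i, ∫⁻ ω, ‖S i ω - J (ρ ω) ω‖ₑ ∂P ≤ c * (ENNReal.ofReal (4 * d i)) ^ (1 / 2 : ℝ) :=
    fun i => by
      have h1 : ∀ᵐ ω ∂P, ‖S i ω - J (ρ ω) ω‖ₑ = liminf (fun j => ‖S i ω - S j ω‖ₑ) atTop := by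
        filter_upwards [hSlim] with ω hω
        exact (((continuous_enorm.tendsto _).comp (tendsto_const_nhds.sub hω)).liminf_eq).symm
      rw [lintegral_congr_ae h1]
      refine (lintegral_liminf_le' fun j => ((hSint i).sub (hSint j)).1.enorm).trans ?_
      refine liminf_le_of_frequently_le' (Eventually.frequently ?_)
      filter_upwards [eventually_ge_atTop i] with j hj
      exact hSS i j hj
  have hzero : ∀ b : ℝ, Tendsto (fun i => (c : ℝ≥0∞) * (ENNReal.ofReal (b * d i)) ^ (1 / 2 : ℝ))
      atTop (𝓝 0) := fun b => by
    have h1 : Tendsto (fun i => ENNReal.ofReal (b * d i)) atTop (𝓝 0) := by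
      have := (ENNReal.continuous_ofReal.tendsto _).comp (hdlim.const_mul b)
      simpa [Function.comp_def] using this
    have h2 := (ENNReal.continuous_rpow_const (y := (1 / 2 : ℝ))).tendsto 0 |>.comp h1
    rw [ENNReal.zero_rpow_of_pos (by norm_num)] at h2
    have h3 := ENNReal.Tendsto.const_mul (a := (c : ℝ≥0∞)) h2 (Or.inr ENNReal.coe_ne_top)
    simpa [Function.comp_def] using h3
  have hL1 : Tendsto (fun i => ∫⁻ ω, ‖S i ω - J (ρ ω) ω‖ₑ ∂P) atTop (𝓝 0) :=
    tendsto_of_tendsto_of_tendsto_of_le_of_le tendsto_const_nhds (hzero 4) (fun _ => zero_le) hSJ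
  have hJint : Integrable (fun ω => J (ρ ω) ω) P := by
    have h1 : Integrable (fun ω => S 0 ω - J (ρ ω) ω) P := by
      refine ⟨(hSint 0).1.sub hJm, (hSJ 0).trans_lt ?_⟩
      exact ENNReal.mul_lt_top ENNReal.coe_lt_top
        (ENNReal.rpow_lt_top_of_nonneg (by norm_num) ENNReal.ofReal_ne_top)
    refine ((hSint 0).sub h1).congr (ae_of_all _ fun ω => ?_)
    simp
  have hjb : ∀ i, ∫⁻ ω, ‖jumpAt τ ρ p (φ i) ω - jumpAt τ ρ p H ω‖ₑ ∂P
      ≤ c * (ENNReal.ofReal (1 * d i)) ^ (1 / 2 : ℝ) := fun i => by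
    simp only [← jumpAt_sub]
    refine (hc.jump (fun u ω => φ i u ω - H u ω) (measurable_sub_fun (hφ i).measurable_uncurry h.measurable)).trans ?_
    gcongr
    rw [one_mul]
    exact hφH i
  have hjfin : ∀ H : ℝ≥0 → Ω → ℝ, Measurable[dySigma 𝓕] (Function.uncurry H) →
      (∃ K : ℝ, ∀ u ω, |H u ω| ≤ K) → Integrable (jumpAt τ ρ p H) P := fun H hH ⟨K, hK⟩ => by
    refine ⟨(hc.measurable_jump H hH).aestronglyMeasurable, (hc.jump H hH).trans_lt ?_⟩
    refine ENNReal.mul_lt_top ENNReal.coe_lt_top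
      (ENNReal.rpow_lt_top_of_nonneg (by norm_num) (ne_of_lt ?_))
    calc ∫⁻ z, ‖H z.1 z.2‖ₑ ^ 2 ∂ν ≤ ∫⁻ z, ENNReal.ofReal K ^ 2 ∂ν := by
          refine lintegral_mono fun z => ?_
          rw [Real.enorm_eq_ofReal_abs]
          gcongr
          exact hK _ _
      _ < ∞ := by
          rw [lintegral_const]
          exact ENNReal.mul_lt_top (ENNReal.pow_lt_top ENNReal.ofReal_lt_top) hc.finite
  have hjL1 := tendsto_of_tendsto_of_tendsto_of_le_of_le tendsto_const_nhds (hzero 1)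
    (fun _ => zero_le) hjb
  refine ⟨hJint, ?_, fun h0 => ?_⟩
  · have h1 := tendsto_integral_of_L1 _ hJint.1 (Eventually.of_forall hSint) hL1
    have h2 := tendsto_integral_of_L1 _ (hjfin H h.measurable h.bdd).1
      (Eventually.of_forall fun i => hjfin _ (hφ i).measurable_uncurry ⟨K i, hK i⟩) hjL1
    have h3 : ∀ i, ∫ ω, S i ω ∂P = - ∫ ω, jumpAt τ ρ p (φ i) ω ∂P := fun i =>
      hc.mean _ _ _ (hφ i) (hK i)
    simp only [h3] at h1
    exact tendsto_nhds_unique h1 h2.neg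
  · have hb : ∀ i, ∫⁻ ω, ‖J (ρ ω) ω‖ₑ ∂P ≤ c * (ENNReal.ofReal (4 * d i)) ^ (1 / 2 : ℝ)
        + c * (ENNReal.ofReal (4 * d i)) ^ (1 / 2 : ℝ) := fun i => by
      have hS0 : ∫⁻ ω, ‖S i ω‖ₑ ∂P ≤ c * (ENNReal.ofReal (4 * d i)) ^ (1 / 2 : ℝ) := by
        refine (hc.bound _ _ _ (hφ i) (hK i)).trans ?_
        gcongr
        have e' : ∀ z : ℝ≥0 × Ω, φ i z.1 z.2 = (φ i z.1 z.2 - H z.1 z.2) + H z.1 z.2 :=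
          fun z => by ring
        have hm : Measurable[dySigma 𝓕] fun z : ℝ≥0 × Ω => φ i z.1 z.2 - H z.1 z.2 :=
          measurable_sub_fun (hφ i).measurable_uncurry h.measurable
        calc ∫⁻ z, ‖φ i z.1 z.2‖ₑ ^ 2 ∂ν
            = ∫⁻ z, ‖(φ i z.1 z.2 - H z.1 z.2) + H z.1 z.2‖ₑ ^ 2 ∂ν := by simp only [← e']
          _ ≤ 2 * ENNReal.ofReal (d i) + 2 * 0 := by
              refine (lintegral_add_sq_le hm).trans ?_
              rw [h0]
              gcongr
              exact hφH i
          _ ≤ ENNReal.ofReal (4 * d i) := by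
              rw [mul_zero, add_zero, ENNReal.ofReal_mul (by norm_num)]
              gcongr
              simp only [ENNReal.ofReal_ofNat]
              norm_num
      calc ∫⁻ ω, ‖J (ρ ω) ω‖ₑ ∂P ≤ ∫⁻ ω, (‖S i ω‖ₑ + ‖S i ω - J (ρ ω) ω‖ₑ) ∂P := by
            refine lintegral_mono fun ω => ?_
            calc ‖J (ρ ω) ω‖ₑ = ‖S i ω - (S i ω - J (ρ ω) ω)‖ₑ := by congr 1; ring
              _ ≤ _ := enorm_sub_le
        _ = ∫⁻ ω, ‖S i ω‖ₑ ∂P + ∫⁻ ω, ‖S i ω - J (ρ ω) ω‖ₑ ∂P :=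
            lintegral_add_left' (hSint i).1.enorm _
        _ ≤ _ := add_le_add hS0 (hSJ i)
    have hz : ∫⁻ ω, ‖J (ρ ω) ω‖ₑ ∂P = 0 := by
      have := ge_of_tendsto' ((hzero 4).add (hzero 4)) hb
      rw [add_zero] at this
      exact le_antisymm this zero_le
    rw [lintegral_eq_zero_iff' hJm.enorm] at hz
    filter_upwards [hz] with ω hω
    simpa using hω

end

section

variable {Ω : Type*} {mΩ : MeasurableSpace Ω} {𝓕 : Filtration ℝ≥0 mΩ}

/-! ### Paths of stochastic integrals -/

/-- Each point has a neighbourhood on which the path is bounded, from the left limit on one side and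
right continuity on the other; compactness gives a global bound. -/
lemma IsCadlag.bdd_Icc {f : ℝ≥0 → ℝ} (hf : IsCadlag f) (T : ℝ≥0) :
    ∃ K : ℝ, ∀ u ≤ T, |f u| ≤ K := by
  have hT : IsCompact (Icc 0 T) := isCompact_Icc
  have key : ∃ K : ℝ, ∀ u ∈ Icc 0 T, |f u| ≤ K := by
    refine hT.induction_on (p := fun s => ∃ K : ℝ, ∀ u ∈ s, |f u| ≤ K) ⟨0, by simp⟩
      (fun s t hst ⟨K, hK⟩ => ⟨K, fun u hu => hK u (hst hu)⟩) ?_ ?_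
    · rintro s t ⟨K, hK⟩ ⟨K', hK'⟩
      exact ⟨max K K', fun u hu => hu.elim (fun h => (hK u h).trans (le_max_left _ _))
        fun h => (hK' u h).trans (le_max_right _ _)⟩
    · intro u _
      obtain ⟨y, hy⟩ := hf.2 u
      have h1 : ∀ᶠ v in 𝓝[<] u, |f v| ≤ |y| + 1 :=
        (hy.abs.eventually (Iio_mem_nhds (lt_add_one |y|))).mono fun v hv => le_of_lt hv
      have h2 : ∀ᶠ v in 𝓝[≥] u, |f v| ≤ |f u| + 1 :=
        ((hf.1 u).tendsto.abs.eventually (Iio_mem_nhds (lt_add_one |f u|))).mono fun v hv => le_of_lt hv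
      have h3 : ∀ᶠ v in 𝓝 u, |f v| ≤ max (|y| + 1) (|f u| + 1) := by
        rw [← nhdsLT_sup_nhdsGE, eventually_sup]
        exact ⟨h1.mono fun v hv => hv.trans (le_max_left _ _),
          h2.mono fun v hv => hv.trans (le_max_right _ _)⟩
      exact ⟨_, mem_nhdsWithin_of_mem_nhds h3, _, fun v hv => hv⟩
  obtain ⟨K, hK⟩ := key
  exact ⟨K, fun u hu => hK u ⟨zero_le, hu⟩⟩

/-- The debut of a right-open adapted random set, capped at `T`, is a stopping time. -/
lemma exists_debut (hrc : 𝓕.IsRightContinuous) {A : ℝ≥0 → Set Ω}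
    (hA : ∀ u, MeasurableSet[𝓕 u] (A u)) (hopen : ∀ ω u, ω ∈ A u → ∀ᶠ v in 𝓝[≥] u, ω ∈ A v)
    (T : ℝ≥0) : ∃ ρ : Ω → ℝ≥0, IsStoppingTime 𝓕 (fun ω => (ρ ω : WithTop ℝ≥0)) ∧
      (∀ ω, ρ ω ≤ T) ∧ (∀ ω u, u < ρ ω → ω ∉ A u) ∧
      ∀ ω, (∀ u ≤ T, ω ∉ A u) → ρ ω = T := by
  set ρ : Ω → ℝ≥0 := fun ω => sInf ({u | ω ∈ A u} ∪ {T}) with hρ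
  have hne : ∀ ω, ({u | ω ∈ A u} ∪ {T}).Nonempty := fun ω => ⟨T, Or.inr rfl⟩
  have hle : ∀ ω, ρ ω ≤ T := fun ω => csInf_le (OrderBot.bddBelow _) (Or.inr rfl)
  have hle' : ∀ ω u, ω ∈ A u → ρ ω ≤ u := fun ω u h => csInf_le (OrderBot.bddBelow _) (Or.inl h)
  refine ⟨ρ, ?_, hle, fun ω u hu h => not_le.2 hu (hle' ω u h), fun ω h => ?_⟩
  · refine isStoppingTime_of_measurableSet_lt_of_isRightContinuous fun i => ?_
    simp only [WithTop.coe_lt_coe]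
    by_cases hT : T < i
    · have : {ω | ρ ω < i} = univ := eq_univ_of_forall fun ω =>
        (hle ω).trans_lt hT
      rw [this]; exact MeasurableSet.univ
    · have : {ω | ρ ω < i} = ⋃ n : ℕ, ⋃ j : ℕ, ⋃ _ : dyPt n j < i, A (dyPt n j) := by
        ext ω
        simp only [Set.mem_ofPred_eq, mem_iUnion]
        constructor
        · intro h
          obtain ⟨u, hu, hui⟩ := exists_lt_of_csInf_lt (hne ω) h
          have huA : ω ∈ A u := hu.resolve_right fun h' => hT (by rwa [← (h' : u = T)])
          obtain ⟨n, hn1, hn2⟩ := ((tendsto_dyCeil u).eventually ((hopen ω u huA).and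
            (mem_nhdsWithin_of_mem_nhds (Iio_mem_nhds hui)))).exists
          exact ⟨n, _, hn2, hn1⟩
        · rintro ⟨n, j, hj, h⟩
          exact (hle' ω _ h).trans_lt hj
      rw [this]
      exact MeasurableSet.iUnion fun n => MeasurableSet.iUnion fun j => MeasurableSet.iUnion fun h =>
        𝓕.mono h.le _ (hA _)
  · refine le_antisymm (hle ω) (le_csInf (hne ω) ?_)
    rintro u (hu | hu)
    · by_contra hlt
      exact h u (not_le.1 hlt).le hu
    · exact (show u = T from hu).ge

variable {P : Measure Ω} [IsProbabilityMeasure P]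

lemma IsCompleteFiltration.measurable_of_ae_eq (hc : IsCompleteFiltration 𝓕 P) {u : ℝ≥0}
    {f g : Ω → ℝ} (hg : Measurable[𝓕 u] g) (hfg : f =ᵐ[P] g) : Measurable[𝓕 u] f := by
  have hnull : ∀ N : Set Ω, P N = 0 → MeasurableSet[𝓕 u] N := fun N hN =>
    𝓕.mono (zero_le (a := u)) _ (hc N hN)
  have hN : P {ω | f ω ≠ g ω} = 0 := hfg
  intro S hS
  have : f ⁻¹' S = (g ⁻¹' S \ {ω | f ω ≠ g ω}) ∪ (f ⁻¹' S ∩ {ω | f ω ≠ g ω}) := by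
    ext ω
    by_cases h : f ω = g ω <;> simp [h]
  rw [this]
  exact ((hg hS).diff (hnull _ hN)).union (hnull _ (measure_mono_null inter_subset_right hN))

lemma IsCompleteFiltration.measurable_of_ae_tendsto (hc : IsCompleteFiltration 𝓕 P) {u : ℝ≥0}
    {f : ℕ → Ω → ℝ} {g : Ω → ℝ} (hf : ∀ n, Measurable[𝓕 u] (f n))
    (hlim : ∀ᵐ ω ∂P, Tendsto (fun n => f n ω) atTop (𝓝 (g ω))) : Measurable[𝓕 u] g := by
  have hN : P {ω | ¬ Tendsto (fun n => f n ω) atTop (𝓝 (g ω))} = 0 := hlim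
  have hG : MeasurableSet[𝓕 u] {ω | Tendsto (fun n => f n ω) atTop (𝓝 (g ω))} := by
    have := (𝓕.mono (zero_le (a := u)) _ (hc _ hN)).compl
    rwa [show {ω | ¬ Tendsto (fun n => f n ω) atTop (𝓝 (g ω))}ᶜ
      = {ω | Tendsto (fun n => f n ω) atTop (𝓝 (g ω))} by ext; simp] at this
  refine hc.measurable_of_ae_eq (g := {ω | Tendsto (fun n => f n ω) atTop (𝓝 (g ω))}.indicator g)
    ?_ ?_
  · refine @measurable_of_tendsto_metrizable _ _ (𝓕 u) _ _ _ _
      (fun n => {ω | Tendsto (fun n => f n ω) atTop (𝓝 (g ω))}.indicator (f n)) _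
      (fun n => (hf n).indicator hG) (tendsto_pi_nhds.2 fun ω => ?_)
    by_cases h : Tendsto (fun n => f n ω) atTop (𝓝 (g ω))
    · simpa only [indicator, if_pos (show ω ∈ {ω | Tendsto (fun n => f n ω) atTop (𝓝 (g ω))} from h)] using h
    · simp [indicator, h]
  · filter_upwards [hlim] with ω hω
    rw [indicator_of_mem hω]

/-- The `k`-th index is chosen for the horizon `k` and the tolerance `2⁻ᵏ`, so that Borel–Cantelli
yields one exceptional null set valid for all horizons and tolerances. -/
lemma TendstoUCP.exists_subseq {J : ℕ → ℝ≥0 → Ω → ℝ} {J' : ℝ≥0 → Ω → ℝ} (h : TendstoUCP P J J') :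
    ∃ φ : ℕ → ℕ, StrictMono φ ∧ ∀ᵐ ω ∂P, ∀ S : ℝ≥0, ∀ δ > (0 : ℝ),
      ∀ᶠ k in atTop, ∀ u ≤ S, |J (φ k) u ω - J' u ω| ≤ δ := by
  set d : ℕ → ℝ := fun j => (1 / 2) ^ j with hd
  have hd0 : ∀ j, 0 < d j := fun j => by positivity
  have hex : ∀ k : ℕ, ∀ᶠ n in atTop,
      P {ω | ∃ u ≤ (k : ℝ≥0), d k < |J n u ω - J' u ω|} ≤ ENNReal.ofReal (d k) := fun k =>
    (h k (d k) (hd0 k)).eventually_le_const (ENNReal.ofReal_pos.2 (hd0 k))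
  obtain ⟨φ, hφ, hφ'⟩ := extraction_forall_of_eventually hex
  refine ⟨φ, hφ, ?_⟩
  have hsum : ∑' k : ℕ, P {ω | ∃ u ≤ (k : ℝ≥0), d k < |J (φ k) u ω - J' u ω|} ≠ ∞ := by
    refine ne_top_of_le_ne_top ?_ (ENNReal.tsum_le_tsum hφ')
    rw [← ENNReal.ofReal_tsum_of_nonneg (fun j => (hd0 j).le) summable_geometric_two]
    exact ENNReal.ofReal_ne_top
  have hdlim : Tendsto d atTop (𝓝 0) := tendsto_pow_atTop_nhds_zero_of_lt_one (by norm_num) (by norm_num)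
  filter_upwards [ae_eventually_notMem hsum] with ω hω S δ hδ
  obtain ⟨N, hN⟩ := exists_nat_ge S
  filter_upwards [hω, eventually_ge_atTop N, hdlim.eventually_le_const hδ] with k hk hkN hkd u hu
  have hk' : ¬ ∃ u ≤ (k : ℝ≥0), d k < |J (φ k) u ω - J' u ω| := hk
  push Not at hk'
  exact (hk' u (hu.trans (hN.trans (by exact_mod_cast hkN)))).trans hkd

/-- The path property of the stochastic integral `j` of `h` against the càdlàg path `f`. -/
structure IsIntegralPath (f h j : ℝ≥0 → ℝ) : Prop where
  zero : j 0 = 0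
  right : ∀ u, ContinuousWithinAt j (Ici u) u
  left : ∀ u y, Tendsto f (𝓝[<] u) (𝓝 y) → Tendsto j (𝓝[<] u) (𝓝 (j u - h u * (f u - y)))

lemma IsIntegralPath.isCadlag {f h j : ℝ≥0 → ℝ} (hj : IsIntegralPath f h j) (hf : IsCadlag f) :
    IsCadlag j :=
  ⟨hj.right, fun u => let ⟨y, hy⟩ := hf.2 u; ⟨_, hj.left u y hy⟩⟩

/-- Locally uniform convergence permits the exchange with one-sided limits, so right continuity and
the jump relation survive even though the integrands converge only pointwise. -/
lemma IsIntegralPath.of_tendsto {f : ℝ≥0 → ℝ} {h j : ℕ → ℝ≥0 → ℝ} {h' j' : ℝ≥0 → ℝ}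
    (hj : ∀ n, IsIntegralPath f (h n) (j n)) (hh : ∀ u, Tendsto (fun n => h n u) atTop (𝓝 (h' u)))
    (hlim : ∀ S : ℝ≥0, ∀ δ > (0 : ℝ), ∀ᶠ k in atTop, ∀ u ≤ S, |j k u - j' u| ≤ δ) :
    IsIntegralPath f h' j' := by
  have hpt : ∀ u, Tendsto (fun k => j k u) atTop (𝓝 (j' u)) := fun u => by
    rw [Metric.tendsto_atTop']
    intro δ hδ
    obtain ⟨N, hN⟩ := eventually_atTop.1 (hlim u (δ / 2) (by positivity))
    exact ⟨N, fun n hn => by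
      rw [Real.dist_eq]; exact (hN n hn.le u le_rfl).trans_lt (by linarith)⟩
  have hunif : ∀ u, TendstoUniformlyOnFilter j j' atTop (𝓝 u) := fun u => by
    rw [Metric.tendstoUniformlyOnFilter_iff]
    intro δ hδ
    have h1 := hlim (u + 1) (δ / 2) (by positivity)
    have h2 : ∀ᶠ v in 𝓝 u, v ≤ u + 1 := (Iic_mem_nhds (lt_add_one u))
    filter_upwards [h1.prod_mk h2] with z hz
    rw [dist_comm, Real.dist_eq]
    exact (hz.1 z.2 hz.2).trans_lt (by linarith)
  refine ⟨?_, fun u => ?_, fun u y hy => ?_⟩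
  · have := hpt 0
    simp only [(hj _).zero] at this
    exact (tendsto_nhds_unique this tendsto_const_nhds)
  · exact ((hunif u).mono_right nhdsWithin_le_nhds).tendsto_of_eventually_tendsto
      (Eventually.of_forall fun n => (hj n).right u) (hpt u)
  · exact ((hunif u).mono_right nhdsWithin_le_nhds).tendsto_of_eventually_tendsto
      (Eventually.of_forall fun n => (hj n).left u y hy) ((hpt u).sub ((hh u).mul_const _))

lemma isIntegralPath_step {f : ℝ≥0 → ℝ} (hf : IsCadlag f) {s v : ℝ≥0} (hsv : s ≤ v) :
    IsIntegralPath f ((Ioc s v).indicator fun _ => 1) (fun u => f (min u v) - f (min u s)) := by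
  refine ⟨by simp, fun u => ?_, fun u y hy => ?_⟩
  · have h0 : ∀ a, ContinuousWithinAt (fun u => f (min u a)) (Ici u) u := fun a => by
      refine ContinuousWithinAt.comp (t := Ici (min u a)) (hf.1 _) ?_ fun x hx =>
        min_le_min_right a hx
      fun_prop
    exact (h0 v).sub (h0 s)
  · have hlt : ∀ᶠ r in 𝓝[<] u, r < u := eventually_mem_nhdsWithin
    rcases le_or_gt u s with hus | hus
    · have : u ∉ Ioc s v := fun h => not_lt.2 hus h.1
      simp only [indicator_of_notMem this, zero_mul, min_eq_left hus,
        min_eq_left (hus.trans hsv), sub_self]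
      refine tendsto_const_nhds.congr' ?_
      filter_upwards [hlt] with r hr
      rw [min_eq_left (hr.le.trans hus), min_eq_left (hr.le.trans (hus.trans hsv)), sub_self]
    · rcases le_or_gt u v with huv | huv
      · rw [indicator_of_mem (show u ∈ Ioc s v from ⟨hus, huv⟩), min_eq_left huv,
          min_eq_right hus.le, one_mul, show f u - f s - (f u - y) = y - f s by ring]
        refine (hy.sub_const (f s)).congr' ?_
        filter_upwards [hlt, mem_nhdsWithin_of_mem_nhds (Ioi_mem_nhds hus)] with r hr hr'
        rw [min_eq_left (hr.le.trans huv), min_eq_right (le_of_lt hr')]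
      · have : u ∉ Ioc s v := fun h => not_lt.2 h.2 huv
        simp only [indicator_of_notMem this, zero_mul, sub_zero, min_eq_right huv.le,
          min_eq_right hus.le]
        refine tendsto_const_nhds.congr' ?_
        filter_upwards [mem_nhdsWithin_of_mem_nhds (Ioi_mem_nhds huv)] with r hr
        rw [min_eq_right (le_of_lt hr), min_eq_right (hsv.trans (le_of_lt hr))]

/-- The jump relation `ΔJ = H ΔF` is what later dominates the integrals of the truncations at the
localizing times. It holds for elementary integrals and is stable under the operations of the
construction; completeness of the filtration keeps the almost sure limits adapted. -/
theorem IsBddStochIntegral.path {F : ℝ≥0 → Ω → ℝ} (hc : IsCompleteFiltration 𝓕 P)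
    (hFm : ∀ u, Measurable[𝓕 u] (F u)) (hF : ∀ ω, IsCadlag fun u => F u ω) {H J : ℝ≥0 → Ω → ℝ}
    (hHJ : IsBddStochIntegral 𝓕 P F H J) :
    (∀ u, Measurable[𝓕 u] (J u)) ∧
      ∀ᵐ ω ∂P, IsIntegralPath (fun u => F u ω) (fun u => H u ω) (fun u => J u ω) := by
  induction hHJ with
  | step s v A hsv hA =>
    refine ⟨fun u => ?_, ae_of_all _ fun ω => ?_⟩
    · rcases le_total u s with hus | hus
      · have : (fun ω => A.indicator (fun ω' => F (min u v) ω' - F (min u s) ω') ω) = fun _ => 0 := by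
          funext ω
          simp [min_eq_left hus, min_eq_left (hus.trans hsv)]
        dsimp only
        rw [this]; exact measurable_const
      · exact (((hFm _).mono (𝓕.mono (min_le_left _ _)) le_rfl).sub
          ((hFm _).mono (𝓕.mono (min_le_left _ _)) le_rfl)).indicator (𝓕.mono hus _ hA)
    · by_cases hω : ω ∈ A
      · have h1 := isIntegralPath_step (hF ω) hsv
        convert h1 using 2
        · simp [indicator, hω]
        · simp [hω]
      · simp only [indicator_of_notMem hω]
        have : ∀ r, (Ioc s v ×ˢ A).indicator (fun _ => (1 : ℝ)) (r, ω) = 0 := fun r =>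
          indicator_of_notMem (fun h => hω h.2) _
        simp only [this]
        exact ⟨rfl, fun u => continuousWithinAt_const, fun u y _ => by
          simp only [zero_mul, sub_zero]; exact tendsto_const_nhds⟩
  | add _ _ ih ih' =>
    refine ⟨fun u => (ih.1 u).add (ih'.1 u), ?_⟩
    filter_upwards [ih.2, ih'.2] with ω h h'
    refine ⟨by simp [h.zero, h'.zero], fun u => (h.right u).add (h'.right u), fun u y hy => ?_⟩
    convert (h.left u y hy).add (h'.left u y hy) using 2
    ring
  | smul c _ ih =>
    refine ⟨fun u => (ih.1 u).const_mul c, ?_⟩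
    filter_upwards [ih.2] with ω h
    refine ⟨by simp [h.zero], fun u => (h.right u).const_smul c, fun u y hy => ?_⟩
    convert (h.left u y hy).const_mul c using 2
    ring
  | limit H J H' J' K hH hlim _ hJlim ih =>
    obtain ⟨φ, hφ, hφ'⟩ := hJlim.exists_subseq
    have hall : ∀ᵐ ω ∂P, ∀ n, IsIntegralPath (fun u => F u ω) (fun u => H n u ω)
      (fun u => J n u ω) := ae_all_iff.2 fun n => (ih n).2
    refine ⟨fun u => ?_, ?_⟩
    · refine hc.measurable_of_ae_tendsto (fun n => (ih (φ n)).1 u) ?_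
      filter_upwards [hφ'] with ω hω
      rw [Metric.tendsto_atTop']
      intro δ hδ
      obtain ⟨N, hN⟩ := eventually_atTop.1 (hω u (δ / 2) (by positivity))
      exact ⟨N, fun n hn => by
        rw [Real.dist_eq]; exact (hN n hn.le u le_rfl).trans_lt (by linarith)⟩
    · filter_upwards [hφ', hall] with ω hω hω'
      exact IsIntegralPath.of_tendsto (fun n => hω' (φ n))
        (fun u => (hlim u ω).comp hφ.tendsto_atTop) hω

end

section

variable {Ω : Type*} {mΩ : MeasurableSpace Ω} {𝓕 : Filtration ℝ≥0 mΩ}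
variable {P : Measure Ω} [IsProbabilityMeasure P] {p F : ℝ≥0 → Ω → ℝ} {τ : Ω → ℝ≥0∞}

/-! ### The conditional mean of the stochastic integral against a killed martingale -/

lemma truncProc_apply (n : ℕ) (H : ℝ≥0 → Ω → ℝ) (u : ℝ≥0) (ω : Ω) :
    truncProc n H u ω = if |H u ω| ≤ n then H u ω else 0 := by
  simp [truncProc, indicator]

lemma abs_truncProc_le (n : ℕ) (H : ℝ≥0 → Ω → ℝ) (u : ℝ≥0) (ω : Ω) :
    |truncProc n H u ω| ≤ |H u ω| := by
  rw [truncProc_apply]; split_ifs <;> simp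

lemma tendsto_truncProc (H : ℝ≥0 → Ω → ℝ) (u : ℝ≥0) (ω : Ω) :
    Tendsto (fun n => truncProc n H u ω) atTop (𝓝 (H u ω)) := by
  refine tendsto_const_nhds.congr' ?_
  obtain ⟨N, hN⟩ := exists_nat_ge |H u ω|
  filter_upwards [eventually_ge_atTop N] with n hn
  rw [truncProc_apply, if_pos (hN.trans (by exact_mod_cast hn))]

lemma isCadlag_killed {f g : ℝ≥0 → ℝ} (hf : IsCadlag f) {a : ℝ≥0∞}
    (hg : ∀ u : ℝ≥0, g u = if (u : ℝ≥0∞) < a then f u else 0) : IsCadlag g := by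
  have hopen : ∀ u : ℝ≥0, (u : ℝ≥0∞) < a → ∀ᶠ v : ℝ≥0 in 𝓝 u, (v : ℝ≥0∞) < a := fun u hu =>
    (ENNReal.continuous_coe.tendsto u).eventually (Iio_mem_nhds hu)
  refine ⟨fun u => ?_, fun u => ?_⟩
  · by_cases h : (u : ℝ≥0∞) < a
    · refine (hf.1 u).congr_of_eventuallyEq ?_ (by rw [hg, if_pos h])
      filter_upwards [mem_nhdsWithin_of_mem_nhds (hopen u h)] with v hv
      rw [hg, if_pos hv]
    · refine (continuousWithinAt_const (b := (0 : ℝ))).congr (fun v hv => ?_) (by rw [hg, if_neg h])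
      rw [hg, if_neg]
      exact fun h' => h (lt_of_le_of_lt (ENNReal.coe_le_coe.2 hv) h')
  · by_cases h : ∃ r < u, a ≤ (r : ℝ≥0∞)
    · obtain ⟨r, hr, hra⟩ := h
      refine ⟨0, tendsto_const_nhds.congr' ?_⟩
      filter_upwards [mem_nhdsWithin_of_mem_nhds (Ioi_mem_nhds hr)] with v hv
      rw [hg, if_neg]
      exact not_lt.2 (hra.trans (ENNReal.coe_le_coe.2 (le_of_lt hv)))
    · push Not at h
      obtain ⟨y, hy⟩ := hf.2 u
      refine ⟨y, hy.congr' ?_⟩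
      filter_upwards [self_mem_nhdsWithin] with v hv
      rw [hg, if_pos (h v hv)]

lemma IsClassD.uniformIntegrable_seq {T : ℝ≥0} {I : ℝ≥0 → Ω → ℝ} (hD : IsClassD 𝓕 P T I)
    {ρ : ℕ → Ω → ℝ≥0} (hρ : ∀ m, IsStoppingTime 𝓕 (fun ω => (ρ m ω : WithTop ℝ≥0)))
    (hT : ∀ m ω, ρ m ω ≤ T) : UniformIntegrable (fun m ω => I (ρ m ω) ω) 1 P := by
  set σ : ℕ → {ρ : Ω → WithTop ℝ≥0 // IsStoppingTime 𝓕 ρ ∧ ∀ ω, ρ ω ≤ (T : WithTop ℝ≥0)} :=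
    fun m => ⟨fun ω => (ρ m ω : WithTop ℝ≥0), hρ m, fun ω => WithTop.coe_le_coe.2 (hT m ω)⟩
  have e : (fun m ω => I (ρ m ω) ω) = fun m => stoppedValue I (σ m).1 := by
    funext m ω; simp only [stoppedValue, σ, WithTop.untopA, WithTop.untopD_coe]
  rw [e]
  exact ⟨fun m => hD.1 (σ m), fun ε hε => let ⟨δ, hδ, h⟩ := hD.2.1 hε; ⟨δ, hδ, fun m => h (σ m)⟩,
    let ⟨C, hC⟩ := hD.2.2; ⟨C, fun m => hC (σ m)⟩⟩

/-- A bounded stochastic integral whose integrand vanishes on `(0, t]`, stopped at `ρ`. -/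
theorem IsBddStochIntegral.setIntegral_eq (hp : Martingale p 𝓕 P) (hp0 : ∀ u ω, 0 ≤ p u ω)
    (hpc : ∀ ω, IsCadlag fun u => p u ω) (hτ : ∀ u : ℝ≥0, MeasurableSet[𝓕 u] {ω | τ ω ≤ u})
    (hF : ∀ u ω, F u ω = if (u : ℝ≥0∞) < τ ω then p u ω else 0) {ρ : Ω → ℝ≥0}
    (hρ : IsStoppingTime 𝓕 (fun ω => (ρ ω : WithTop ℝ≥0))) {T : ℝ≥0} (hT : ∀ ω, ρ ω ≤ T) {k : ℝ}
    (hk0 : 0 ≤ k) (hk : ∀ ω u, u < ρ ω → p u ω ≤ k) {H J : ℝ≥0 → Ω → ℝ}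
    (hHJ : IsBddStochIntegral 𝓕 P F H J) {t : ℝ≥0} (hH : ∀ u ≤ t, ∀ ω, H u ω = 0) {B : Set Ω}
    (hB : MeasurableSet[𝓕 t] B) :
    Measurable (jumpAt τ ρ p H) ∧
      ∫ ω in B, J (ρ ω) ω ∂P = - ∫ ω in B, jumpAt τ ρ p H ω ∂P := by
  have hprc : ∀ ω u, ContinuousWithinAt (fun u => p u ω) (Ici u) u := fun ω => (hpc ω).1
  have hFrc : ∀ ω u, ContinuousWithinAt (fun u => F u ω) (Ici u) u := fun ω =>
    (isCadlag_killed (hpc ω) fun u => hF u ω).1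
  have hFm : ∀ u, Measurable (F u) := fun u => by
    have : F u = fun ω => if (u : ℝ≥0∞) < τ ω then p u ω else 0 := funext (hF u)
    rw [this]
    refine Measurable.ite ?_ ((hp.1 u).mono (𝓕.le u)).measurable measurable_const
    have := (𝓕.le u _ (hτ u)).compl
    rwa [show {ω | τ ω ≤ u}ᶜ = {ω | (u : ℝ≥0∞) < τ ω} by ext; simp] at this
  obtain ⟨M, hM⟩ := exists_nat_ge T
  have happ : ∀ {σ : Ω → ℝ≥0}, IsStoppingTime 𝓕 (fun ω => (σ ω : WithTop ℝ≥0)) →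
      (∀ ω, σ ω ≤ ρ ω) → ∃ (c : ℝ≥0) (ν : @Measure (ℝ≥0 × Ω) (dySigma 𝓕)),
        IsControl P 𝓕 p F τ σ M c ν ∧ IsStepApprox P 𝓕 F σ M ν H J := fun {σ} hσ hσρ => by
    have hσM : ∀ ω, σ ω ≤ M := fun ω => (hσρ ω).trans ((hT ω).trans hM)
    obtain ⟨c, ν, hν⟩ := exists_control hp hp0 hprc hτ hF hσ hσM hk0
      fun ω u hu => hk ω u (hu.trans_le (hσρ ω))
    exact ⟨c, ν, hν, isStepApprox_of_isBddStochIntegral hFrc hFm (measurable_of_isStoppingTime hσ)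
      hσM hν.finite hHJ⟩
  obtain ⟨c, ν, hν, hap⟩ := happ hρ fun ω => le_rfl
  refine ⟨hν.measurable_jump H hap.measurable, ?_⟩
  -- the integral vanishes at `ρ ∧ t`
  have hρt : IsStoppingTime 𝓕 (fun ω => ((min (ρ ω) t : ℝ≥0) : WithTop ℝ≥0)) := by
    have := hρ.min (isStoppingTime_const 𝓕 t)
    simpa only [WithTop.coe_min] using this
  obtain ⟨c₀, ν₀, hν₀, hap₀⟩ := happ hρt fun ω => min_le_left _ _
  have hJ0 := (hap₀.mean hν₀).2.2 (by
    have h0 : ∀ᵐ z ∂ν₀, ¬ t < z.1 := measure_eq_zero_iff_ae_notMem.1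
      (hν₀.supp t fun ω => min_le_right _ _)
    rw [lintegral_congr_ae (g := fun _ => 0), lintegral_zero]
    filter_upwards [h0] with z hz
    rw [hH _ (not_lt.1 hz)]; simp)
  -- the stopping time equal to `ρ` on `B` and to `ρ ∧ t` off `B`
  classical
  set σ : Ω → ℝ≥0 := fun ω => if ω ∈ B then ρ ω else min (ρ ω) t with hσdef
  have hσ : IsStoppingTime 𝓕 (fun ω => (σ ω : WithTop ℝ≥0)) := fun u => by
    by_cases htu : t ≤ u
    · have : {ω | (σ ω : WithTop ℝ≥0) ≤ u} = {ω | (ρ ω : WithTop ℝ≥0) ≤ u} ∪ Bᶜ := by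
        ext ω
        simp only [Set.mem_ofPred_eq, WithTop.coe_le_coe, mem_union, mem_compl_iff]
        by_cases h : ω ∈ B <;> simp [hσdef, h, htu]
      rw [this]
      exact (hρ u).union (𝓕.mono htu _ hB).compl
    · have : {ω | (σ ω : WithTop ℝ≥0) ≤ u} = {ω | (ρ ω : WithTop ℝ≥0) ≤ u} := by
        ext ω
        simp only [Set.mem_ofPred_eq, WithTop.coe_le_coe]
        by_cases h : ω ∈ B <;> simp [hσdef, h, htu]
      rw [this]; exact hρ u
  have hσρ : ∀ ω, σ ω ≤ ρ ω := fun ω => by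
    simp only [hσdef]; split_ifs; exacts [le_rfl, min_le_left _ _]
  obtain ⟨c₁, ν₁, hν₁, hap₁⟩ := happ hσ hσρ
  have hmean := (hap₁.mean hν₁).2.1
  have hB0 := 𝓕.le t _ hB
  have e1 : ∫ ω, J (σ ω) ω ∂P = ∫ ω in B, J (ρ ω) ω ∂P := by
    rw [← integral_indicator hB0]
    refine integral_congr_ae ?_
    filter_upwards [hJ0] with ω hω
    by_cases h : ω ∈ B <;> simp [hσdef, h, hω]
  have e2 : ∫ ω, jumpAt τ σ p H ω ∂P = ∫ ω in B, jumpAt τ ρ p H ω ∂P := by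
    rw [← integral_indicator hB0]
    congr 1; funext ω
    by_cases h : ω ∈ B
    · simp [jumpAt, hσdef, h]
    · rw [indicator_of_notMem h]
      unfold jumpAt
      split_ifs with h'
      · rw [hH _ ?_ ω, zero_mul]
        have h'' : τ ω ≤ t := h'.trans (by simp [hσdef, h])
        simpa using ENNReal.toNNReal_mono ENNReal.coe_ne_top h''
      · rfl
  rw [← e1, ← e2, hmean]

/-- Localize at the first time `ρ m` when `p` or one of the integrals of the truncations exceeds
`m`. Before `ρ m` everything is bounded by `m`. At `ρ m` the truncated integral can jump no further
than the full one, whose jump is bounded through `I` at `ρ m`, an integrable variable by class (D).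
Dominated convergence removes the truncation for fixed `m`; uniform integrability, again from class
(D), then lets `m` tend to infinity. -/
theorem IsStochIntegral.setIntegral_eq (hrc : 𝓕.IsRightContinuous) (hc : IsCompleteFiltration 𝓕 P)
    (hp : Martingale p 𝓕 P) (hp0 : ∀ u ω, 0 ≤ p u ω)
    (hpc : ∀ ω, IsCadlag fun u => p u ω) (hτ : ∀ u : ℝ≥0, MeasurableSet[𝓕 u] {ω | τ ω ≤ u})
    (hF : ∀ u ω, F u ω = if (u : ℝ≥0∞) < τ ω then p u ω else 0) {t T : ℝ≥0}
    {H I : ℝ≥0 → Ω → ℝ} (hI : IsStochIntegral 𝓕 P F H I) (hD : IsClassD 𝓕 P T I)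
    (hH : ∀ u ≤ t, ∀ ω, H u ω = 0) (hHint : Integrable (jumpAt τ (fun _ => T) p H) P) :
    Integrable (I T) P ∧ ∀ B, MeasurableSet[𝓕 t] B →
      ∫ ω in B, I T ω ∂P = - ∫ ω in B, jumpAt τ (fun _ => T) p H ω ∂P := by
  obtain ⟨Jn, hJn, hJI⟩ := hI
  obtain ⟨φ, hφ, hφ'⟩ := hJI.exists_subseq
  have hFc : ∀ ω, IsCadlag fun u => F u ω := fun ω => isCadlag_killed (hpc ω) fun u => hF u ω
  have hFm : ∀ u, Measurable[𝓕 u] (F u) := fun u => by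
    have : F u = fun ω => if (u : ℝ≥0∞) < τ ω then p u ω else 0 := funext (hF u)
    rw [this]
    refine Measurable.ite ?_ (hp.1 u).measurable measurable_const
    have := (hτ u).compl
    rwa [show {ω | τ ω ≤ u}ᶜ = {ω | (u : ℝ≥0∞) < τ ω} by ext; simp] at this
  set J : ℕ → ℝ≥0 → Ω → ℝ := fun k => Jn (φ k) with hJdef
  set Hk : ℕ → ℝ≥0 → Ω → ℝ := fun k => truncProc (φ k) H with hHk
  have hJpath := fun k => (hJn (φ k)).path hc hFm hFc
  have hHk0 : ∀ k, ∀ u ≤ t, ∀ ω, Hk k u ω = 0 := fun k u hu ω => by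
    simp only [hHk, truncProc_apply, hH u hu, ite_self]
  have hHklim : ∀ u ω, Tendsto (fun k => Hk k u ω) atTop (𝓝 (H u ω)) := fun u ω =>
    (tendsto_truncProc H u ω).comp hφ.tendsto_atTop
  set Good : Set Ω := {ω | (∀ k, IsIntegralPath (fun u => F u ω) (fun u => Hk k u ω)
    fun u => J k u ω) ∧ ∀ S : ℝ≥0, ∀ δ > (0 : ℝ), ∀ᶠ k in atTop, ∀ u ≤ S, |J k u ω - I u ω| ≤ δ}
    with hGood
  have hGoodae : ∀ᵐ ω ∂P, ω ∈ Good := by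
    filter_upwards [ae_all_iff.2 fun k => (hJpath k).2, hφ'] with ω h1 h2
    exact ⟨h1, h2⟩
  have hGoodm : ∀ u, MeasurableSet[𝓕 u] Good := fun u => by
    have h0 : P Goodᶜ = 0 := hGoodae
    have := (𝓕.mono (zero_le (a := u)) _ (hc _ h0)).compl
    rwa [compl_compl] at this
  have hpt : ∀ ω ∈ Good, ∀ u, Tendsto (fun k => J k u ω) atTop (𝓝 (I u ω)) := fun ω hω u => by
    rw [Metric.tendsto_atTop']
    intro δ hδ
    obtain ⟨N, hN⟩ := eventually_atTop.1 (hω.2 u (δ / 2) (by positivity))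
    exact ⟨N, fun n hn => by
      rw [Real.dist_eq]; exact (hN n hn.le u le_rfl).trans_lt (by linarith)⟩
  have hIpath : ∀ ω ∈ Good, IsIntegralPath (fun u => F u ω) (fun u => H u ω) fun u => I u ω :=
    fun ω hω => IsIntegralPath.of_tendsto hω.1 (fun u => hHklim u ω) hω.2
  -- the localizing sequence
  set A : ℕ → ℝ≥0 → Set Ω := fun m u =>
    (Good ∩ ⋃ k, {ω | (m : ℝ) < |J k u ω|}) ∪ {ω | (m : ℝ) < p u ω} with hA
  have hAm : ∀ m u, MeasurableSet[𝓕 u] (A m u) := fun m u => by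
    refine ((hGoodm u).inter (MeasurableSet.iUnion fun k => ?_)).union ?_
    · exact (measurable_norm.comp ((hJpath k).1 u)) measurableSet_Ioi
    · exact (hp.1 u).measurable measurableSet_Ioi
  have hAopen : ∀ m ω u, ω ∈ A m u → ∀ᶠ v in 𝓝[≥] u, ω ∈ A m v := fun m ω u h => by
    rcases h with ⟨hg, h⟩ | h
    · obtain ⟨k, hk⟩ := mem_iUnion.1 h
      filter_upwards [((hg.1 k).right u).tendsto.abs.eventually (Ioi_mem_nhds hk)] with v hv
      exact Or.inl ⟨hg, mem_iUnion.2 ⟨k, hv⟩⟩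
    · filter_upwards [((hpc ω).1 u).tendsto.eventually (Ioi_mem_nhds h)] with v hv
      exact Or.inr hv
  choose ρ hρ hρT hρA hρeq using fun m => exists_debut hrc (hAm m) (hAopen m) T
  -- The bound must be uniform over all truncations: from rank `N` on they lie within `1` of `I` on
  -- `[0, T]`, and finitely many bounded paths remain.
  have hev : ∀ ω ∈ Good, ∀ᶠ m in atTop, ρ m ω = T := fun ω hω => by
    obtain ⟨K₁, hK₁⟩ := (hpc ω).bdd_Icc T
    obtain ⟨K₂, hK₂⟩ := ((hIpath ω hω).isCadlag (hFc ω)).bdd_Icc T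
    obtain ⟨N, hN⟩ := eventually_atTop.1 (hω.2 T 1 one_pos)
    choose K₃ hK₃ using fun k => ((hω.1 k).isCadlag (hFc ω)).bdd_Icc T
    obtain ⟨m₀, hm₀⟩ := exists_nat_ge (max K₁ (max (K₂ + 1) (∑ k ∈ Finset.range N, |K₃ k|)))
    filter_upwards [eventually_ge_atTop m₀] with m hm
    have hm' : max K₁ (max (K₂ + 1) (∑ k ∈ Finset.range N, |K₃ k|)) ≤ m :=
      hm₀.trans (by exact_mod_cast hm)
    rw [max_le_iff, max_le_iff] at hm'
    refine hρeq m ω fun u hu h => ?_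
    rcases h with ⟨-, h⟩ | h
    · obtain ⟨k, hk⟩ := mem_iUnion.1 h
      have hk : (m : ℝ) < |J k u ω| := hk
      rcases lt_or_ge k N with hkN | hkN
      · have h1 := Finset.single_le_sum (f := fun k => |K₃ k|) (fun i _ => abs_nonneg _)
          (Finset.mem_range.2 hkN)
        linarith [hK₃ k u hu, le_abs_self (K₃ k), hm'.2.2]
      · have h1 := hN k hkN u hu
        have h2 := abs_sub_abs_le_abs_sub (J k u ω) (I u ω)
        linarith [hK₂ u hu, hm'.2.1]
    · have h : (m : ℝ) < p u ω := h
      linarith [hK₁ u hu, le_abs_self (p u ω), hm'.1]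
  have hUI := hD.uniformIntegrable_seq hρ hρT
  have hIρ : ∀ m, Integrable (fun ω => I (ρ m ω) ω) P := fun m =>
    memLp_one_iff_integrable.1 (hUI.memLp m)
  have hIT : ∀ᵐ ω ∂P, Tendsto (fun m => I (ρ m ω) ω) atTop (𝓝 (I T ω)) := by
    filter_upwards [hGoodae] with ω hω
    refine tendsto_const_nhds.congr' ?_
    filter_upwards [hev ω hω] with m hm
    rw [hm]
  have hITmem : MemLp (I T) 1 P := hUI.memLp_of_ae_tendsto hIT
  -- the bound at the localizing times
  have hbound : ∀ m k, ∀ ω ∈ Good, |J k (ρ m ω) ω| ≤ 2 * m + |I (ρ m ω) ω| := fun m k ω hω => by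
    rcases eq_or_ne (ρ m ω) 0 with h0 | h0
    · rw [h0, (hω.1 k).zero, abs_zero]; positivity
    · have hpos : 0 < ρ m ω := pos_iff_ne_zero.2 h0
      have hne : (𝓝[<] (ρ m ω)).NeBot := nhdsLT_neBot_of_exists_lt ⟨0, hpos⟩
      obtain ⟨y, hy⟩ := (hFc ω).2 (ρ m ω)
      have hJm : ∀ u < ρ m ω, ∀ k, |J k u ω| ≤ m := fun u hu k => by
        by_contra h
        exact hρA m ω u hu (Or.inl ⟨hω, mem_iUnion.2 ⟨k, not_le.1 h⟩⟩)
      have hIm : ∀ u < ρ m ω, |I u ω| ≤ m := fun u hu =>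
        le_of_tendsto (hpt ω hω u).abs (Eventually.of_forall fun k => hJm u hu k)
      have h1 := le_of_tendsto ((hω.1 k).left _ y hy).abs
        (eventually_mem_nhdsWithin.mono fun u hu => hJm u hu k)
      have h2 := le_of_tendsto ((hIpath ω hω).left _ y hy).abs
        (eventually_mem_nhdsWithin.mono fun u hu => hIm u hu)
      -- Truncation can only shrink the integrand, so the jump of the truncated integral at `ρ m` is
      -- at most that of `I`. Since `I` is bounded by `m` on the left of `ρ m`, that jump is at most
      -- `m + |I|`; the left limit of the truncated integral adds another `m`.
      have h3 : |Hk k (ρ m ω) ω * (F (ρ m ω) ω - y)| ≤ |H (ρ m ω) ω * (F (ρ m ω) ω - y)| := by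
        rw [abs_mul, abs_mul]
        exact mul_le_mul_of_nonneg_right (abs_truncProc_le _ _ _ _) (abs_nonneg _)
      have h4 := abs_sub_abs_le_abs_sub (J k (ρ m ω) ω) (Hk k (ρ m ω) ω * (F (ρ m ω) ω - y))
      have h5 := abs_sub_abs_le_abs_sub (H (ρ m ω) ω * (F (ρ m ω) ω - y)) (I (ρ m ω) ω)
      rw [abs_sub_comm] at h2
      linarith
  have hjle : ∀ m k ω, |jumpAt τ (ρ m) p (Hk k) ω| ≤ |jumpAt τ (fun _ => T) p H ω| := fun m k ω => by
    unfold jumpAt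
    by_cases h : τ ω ≤ ρ m ω
    · have h' : τ ω ≤ T := h.trans (ENNReal.coe_le_coe.2 (hρT m ω))
      rw [if_pos h, if_pos h', abs_mul, abs_mul]
      exact mul_le_mul_of_nonneg_right (abs_truncProc_le _ _ _ _) (abs_nonneg _)
    · rw [if_neg h, abs_zero]; exact abs_nonneg _
  have hjlim : ∀ m ω, Tendsto (fun k => jumpAt τ (ρ m) p (Hk k) ω) atTop
      (𝓝 (jumpAt τ (ρ m) p H ω)) := fun m ω => by
    unfold jumpAt
    split_ifs
    · exact (hHklim _ ω).mul_const _
    · exact tendsto_const_nhds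
  have hset := fun m k B (hB : MeasurableSet[𝓕 t] B) =>
    (hJn (φ k)).setIntegral_eq hp hp0 hpc hτ hF (hρ m) (hρT m) (Nat.cast_nonneg m)
      (fun ω u hu => not_lt.1 fun h => hρA m ω u hu (Or.inr h)) (hHk0 k) hB
  have hjm : ∀ m, Measurable (jumpAt τ (ρ m) p H) := fun m =>
    measurable_of_tendsto_metrizable (fun k => (hset m k univ MeasurableSet.univ).1)
      (tendsto_pi_nhds.2 (hjlim m))
  have hJmeas : ∀ m k, AEStronglyMeasurable (fun ω => J k (ρ m ω) ω) P := fun m k => by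
    have hm : Measurable (Function.uncurry fun u ω => Good.indicator (J k u) ω) := by
      refine measurable_uncurry_of_rightCont (fun u => ?_) fun ω u => ?_
      · exact ((hJpath k).1 u |>.mono (𝓕.le u) le_rfl).indicator (𝓕.le u _ (hGoodm u))
      · by_cases h : ω ∈ Good
        · simpa [indicator, h] using (h.1 k).right u
        · simp only [indicator_of_notMem h]; exact continuousWithinAt_const
    have hm' := hm.comp ((measurable_of_isStoppingTime (hρ m)).prodMk measurable_id)
    refine hm'.aestronglyMeasurable.congr ?_
    filter_upwards [hGoodae] with ω hω
    simp [Function.uncurry, hω]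
  have hm_eq : ∀ m B, MeasurableSet[𝓕 t] B →
      ∫ ω in B, I (ρ m ω) ω ∂P = - ∫ ω in B, jumpAt τ (ρ m) p H ω ∂P := fun m B hB => by
    have h1 : Tendsto (fun k => ∫ ω in B, J k (ρ m ω) ω ∂P) atTop
        (𝓝 (∫ ω in B, I (ρ m ω) ω ∂P)) := by
      refine tendsto_integral_of_dominated_convergence (fun ω => 2 * m + |I (ρ m ω) ω|)
        (fun k => (hJmeas m k).restrict)
        ((integrable_const _).add (hIρ m).abs).integrableOn (fun k => ?_) ?_
      · exact ae_restrict_of_ae (hGoodae.mono fun ω hω => hbound m k ω hω)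
      · exact ae_restrict_of_ae (hGoodae.mono fun ω hω => hpt ω hω _)
    have h2 : Tendsto (fun k => ∫ ω in B, jumpAt τ (ρ m) p (Hk k) ω ∂P) atTop
        (𝓝 (∫ ω in B, jumpAt τ (ρ m) p H ω ∂P)) := by
      refine tendsto_integral_of_dominated_convergence (fun ω => |jumpAt τ (fun _ => T) p H ω|)
        (fun k => (hset m k B hB).1.aestronglyMeasurable) hHint.abs.integrableOn
        (fun k => ae_of_all _ fun ω => hjle m k ω) (ae_of_all _ fun ω => hjlim m ω)
    exact tendsto_nhds_unique (h1.congr fun k => (hset m k B hB).2) h2.neg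
  refine ⟨memLp_one_iff_integrable.1 hITmem, fun B hB => ?_⟩
  have hL1 := tendsto_Lp_finite_of_tendsto_ae le_rfl ENNReal.one_ne_top hUI.1 hITmem hUI.2.1 hIT
  have h1 : Tendsto (fun m => ∫ ω in B, I (ρ m ω) ω ∂P) atTop (𝓝 (∫ ω in B, I T ω ∂P)) :=
    tendsto_setIntegral_of_L1' _ hITmem.1 (Eventually.of_forall hIρ) hL1 B
  have h2 : Tendsto (fun m => ∫ ω in B, jumpAt τ (ρ m) p H ω ∂P) atTop
      (𝓝 (∫ ω in B, jumpAt τ (fun _ => T) p H ω ∂P)) := by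
    refine tendsto_integral_of_dominated_convergence (fun ω => |jumpAt τ (fun _ => T) p H ω|)
      (fun m => (hjm m).aestronglyMeasurable) hHint.abs.integrableOn
      (fun m => ae_of_all _ fun ω =>
        le_of_tendsto (hjlim m ω).abs (Eventually.of_forall fun k => hjle m k ω)) ?_
    refine ae_restrict_of_ae (hGoodae.mono fun ω hω => tendsto_const_nhds.congr' ?_)
    filter_upwards [hev ω hω] with m hm
    simp only [jumpAt, hm]
  exact tendsto_nhds_unique (h1.congr fun m => hm_eq m B hB) h2.neg

end

/-! ### The default time for a given barrier. -/

section

variable {Ω : Type*} {mΩ : MeasurableSpace Ω} {𝓕 : Filtration ℝ≥0 mΩ} {X : ℝ≥0 → Ω → ℝ}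

/-! ### The running infimum and the default time -/

lemma runInf_bddBelow (hX : ∀ ω, IsCadlag fun s => X s ω) (u : ℝ≥0) (ω : Ω) :
    BddBelow (range fun s : Iic u => X s ω) := by
  obtain ⟨K, hK⟩ := (hX ω).bdd_Icc u
  exact ⟨-K, by rintro _ ⟨s, rfl⟩; exact (abs_le.1 (hK s s.2)).1⟩

lemma runInf_le (hX : ∀ ω, IsCadlag fun s => X s ω) {s u : ℝ≥0} (h : s ≤ u) (ω : Ω) :
    runInf X u ω ≤ X s ω :=
  ciInf_le (runInf_bddBelow hX u ω) (⟨s, h⟩ : Iic u)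

lemma le_runInf {u : ℝ≥0} {ω : Ω} {c : ℝ} (h : ∀ s ≤ u, c ≤ X s ω) : c ≤ runInf X u ω := by
  have : Nonempty (Iic u) := ⟨⟨u, mem_Iic.2 le_rfl⟩⟩
  exact le_ciInf fun s => h s s.2

lemma runInf_anti (hX : ∀ ω, IsCadlag fun s => X s ω) (ω : Ω) : Antitone fun u => runInf X u ω :=
  fun _ _ huv => le_runInf fun _ hs => runInf_le hX (hs.trans huv) ω

lemma runInf_lt_iff (hX : ∀ ω, IsCadlag fun s => X s ω) {u : ℝ≥0} {ω : Ω} {c : ℝ} :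
    runInf X u ω < c ↔ ∃ s ≤ u, X s ω < c := by
  constructor
  · intro h
    by_contra! h'
    exact not_le.2 h (le_runInf h')
  · rintro ⟨s, hs, h⟩
    exact (runInf_le hX hs ω).trans_lt h

lemma runInf_rightCont (hX : ∀ ω, IsCadlag fun s => X s ω) (ω : Ω) (u : ℝ≥0) :
    ContinuousWithinAt (fun u => runInf X u ω) (Ici u) u := by
  rw [ContinuousWithinAt, tendsto_order]
  constructor
  · intro c hc
    obtain ⟨c', hc1, hc2⟩ := exists_between hc
    have h1 : ∀ᶠ v in 𝓝[≥] u, c' < X v ω := ((hX ω).1 u).tendsto.eventually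
      (Ioi_mem_nhds (hc2.trans_le (runInf_le hX le_rfl ω)))
    obtain ⟨b, hb, hb'⟩ := (mem_nhdsGE_iff_exists_Ico_subset (a := u)).1 h1
    filter_upwards [Ico_mem_nhdsGE hb] with v hv
    refine hc1.trans_le (le_runInf fun s hs => ?_)
    rcases le_total s u with h | h
    · exact hc2.le.trans (runInf_le hX h ω)
    · exact le_of_lt (hb' ⟨h, hs.trans_lt hv.2⟩)
  · intro c hc
    filter_upwards [self_mem_nhdsWithin] with v hv
    exact (runInf_anti hX ω hv).trans_lt hc

lemma measurable_runInf (hX : ∀ ω, IsCadlag fun s => X s ω) (hXm : ∀ s, Measurable[𝓕 s] (X s))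
    (u : ℝ≥0) : Measurable[𝓕 u] (runInf X u) := by
  refine @measurable_of_Iio ℝ Ω _ _ _ (𝓕 u) _ _ _ _ fun c => ?_
  -- Right continuity brings a time `s < u` to a dyadic time still before `u`. The endpoint `u` is
  -- listed separately, since rounding it up would leave `[0, u]`.
  have : runInf X u ⁻¹' Iio c = X u ⁻¹' Iio c ∪ ⋃ n, ⋃ j, ⋃ _ : dyPt n j ≤ u,
      X (dyPt n j) ⁻¹' Iio c := by
    ext ω
    simp only [mem_preimage, mem_Iio, mem_union, mem_iUnion, runInf_lt_iff hX]
    constructor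
    · rintro ⟨s, hs, h⟩
      rcases hs.eq_or_lt with rfl | hs
      · exact Or.inl h
      · have h1 := ((hX ω).1 s).tendsto.eventually (Iio_mem_nhds h)
        obtain ⟨n, hn1, hn2⟩ := ((tendsto_dyCeil s).eventually (h1.and
          (mem_nhdsWithin_of_mem_nhds (Iio_mem_nhds hs)))).exists
        exact Or.inr ⟨n, _, le_of_lt hn2, hn1⟩
    · rintro (h | ⟨n, j, hj, h⟩)
      exacts [⟨u, le_rfl, h⟩, ⟨_, hj, h⟩]
  rw [this]
  exact ((hXm u) measurableSet_Iio).union (MeasurableSet.iUnion fun n => MeasurableSet.iUnion fun j =>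
    MeasurableSet.iUnion fun h => 𝓕.mono h _ ((hXm _) measurableSet_Iio))

/-- For the strict inequality, right continuity of the running infimum is essential: if it exceeds
the barrier at `u`, it does so on some `[u, b)`, so the infimum of default dates is at least `b >
u`. -/
lemma lt_defaultTime_iff (hX : ∀ ω, IsCadlag fun s => X s ω) {L : Ω → ℝ} {ω : Ω} {u : ℝ≥0} :
    (u : ℝ≥0∞) < defaultTime X L ω ↔ L ω < runInf X u ω := by
  constructor
  · intro h
    by_contra h'
    exact not_le.2 h (show defaultTime X L ω ≤ (u : ℝ≥0∞) from iInf₂_le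
      (f := fun (t : ℝ≥0) (_ : runInf X t ω ≤ L ω) => (t : ℝ≥0∞)) u (not_lt.1 h'))
  · intro h
    have h1 := (runInf_rightCont hX ω u).tendsto.eventually (Ioi_mem_nhds h)
    obtain ⟨b, hb, hb'⟩ := (mem_nhdsGE_iff_exists_Ico_subset (a := u)).1 h1
    refine (ENNReal.coe_lt_coe.2 (mem_Ioi.1 hb)).trans_le (le_iInf₂ fun s hs => ?_)
    rw [ENNReal.coe_le_coe]
    by_contra hsb
    have : L ω < runInf X s ω := by
      rcases le_total s u with h' | h'
      · exact h.trans_le (runInf_anti hX ω h')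
      · exact hb' ⟨h', not_le.1 hsb⟩
    exact not_le.2 this hs

lemma defaultTime_le_iff (hX : ∀ ω, IsCadlag fun s => X s ω) {L : Ω → ℝ} {ω : Ω} {u : ℝ≥0} :
    defaultTime X L ω ≤ u ↔ runInf X u ω ≤ L ω := by
  rw [← not_lt, lt_defaultTime_iff hX, not_lt]

lemma measurableSet_defaultTime_le (hX : ∀ ω, IsCadlag fun s => X s ω)
    (hXm : ∀ s, Measurable[𝓕 s] (X s)) (x : ℝ) (u : ℝ≥0) :
    MeasurableSet[𝓕 u] {ω | defaultTime X (fun _ => x) ω ≤ u} := by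
  simp only [defaultTime_le_iff hX]
  exact (measurable_runInf hX hXm u) measurableSet_Iic

lemma FM_eq (hX : ∀ ω, IsCadlag fun s => X s ω) (p : ℝ≥0 → ℝ → Ω → ℝ) (x : ℝ) (u : ℝ≥0) (ω : Ω) :
    FM X p x u ω = if (u : ℝ≥0∞) < defaultTime X (fun _ => x) ω then p u x ω else 0 := by
  simp [FM, indicator, lt_defaultTime_iff hX]

/-! ### Progressive processes and optional stopping -/

variable {P : Measure Ω} [IsProbabilityMeasure P]

/-- Optional stopping for nonnegative weights measurable at the stopping time. -/
lemma lintegral_mul_stopped {p : ℝ≥0 → Ω → ℝ} (hp : Martingale p 𝓕 P) (hp0 : ∀ u ω, 0 ≤ p u ω)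
    (hrc : ∀ ω u, ContinuousWithinAt (fun u => p u ω) (Ici u) u) {ρ : Ω → ℝ≥0}
    (hρ : IsStoppingTime 𝓕 (fun ω => (ρ ω : WithTop ℝ≥0))) {T : ℝ≥0} (hT : ∀ ω, ρ ω ≤ T)
    {ξ : Ω → ℝ≥0∞} (hξ : Measurable[hρ.measurableSpace] ξ) :
    ∫⁻ ω, ENNReal.ofReal (p (ρ ω) ω) * ξ ω ∂P = ∫⁻ ω, ENNReal.ofReal (p T ω) * ξ ω ∂P := by
  have hle := hρ.measurableSpace_le
  obtain ⟨hint, hos⟩ := optional_stopping hp hrc hρ hT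
  have hpT : Measurable fun ω => ENNReal.ofReal (p T ω) :=
    ((hp.1 T).mono (𝓕.le T)).measurable.ennreal_ofReal
  have hpρ : Measurable fun ω => ENNReal.ofReal (p (ρ ω) ω) :=
    ((measurable_uncurry_of_rightCont (fun u => ((hp.1 u).mono (𝓕.le u)).measurable) hrc).comp
      ((measurable_of_isStoppingTime hρ).prodMk measurable_id)).ennreal_ofReal
  have hξ' := hξ.mono hle le_rfl
  -- The integral of `ξ` sees only the trace of the weighted measure on the stopped σ-algebra, and
  -- optional stopping says that the weights `p_ρ` and `p_T` have the same trace there.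
  have key : ∀ f : Ω → ℝ≥0∞, Measurable f → ∫⁻ ω, f ω * ξ ω ∂P
      = ∫⁻ ω, ξ ω ∂((P.withDensity f).trim hle) := fun f hf => by
    rw [lintegral_trim hle hξ, lintegral_withDensity_eq_lintegral_mul _ hf hξ']
    rfl
  rw [key _ hpρ, key _ hpT]
  congr 1
  refine @Measure.ext _ hρ.measurableSpace _ _ fun A hA => ?_
  rw [trim_measurableSet_eq hle hA, trim_measurableSet_eq hle hA, withDensity_apply _ (hle _ hA),
    withDensity_apply _ (hle _ hA), ← ofReal_integral_eq_lintegral_ofReal hint.integrableOn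
      (ae_of_all _ fun ω => hp0 _ _), ← ofReal_integral_eq_lintegral_ofReal
      (hp.integrable T).integrableOn (ae_of_all _ fun ω => hp0 _ _), hos A hA]

end

/-! ### Dividends: integrals against adapted paths of finite variation. -/

section

variable {Ω : Type*} {mΩ : MeasurableSpace Ω} {𝓕 : Filtration ℝ≥0 mΩ}

/-! ### Time change of an integral against an increasing process -/

/-- The right inverse of `u ↦ f u - f t` on `[t,T]`. -/
def invTime (f : StieltjesFunction ℝ≥0) (t T : ℝ≥0) (s : ℝ) : ℝ≥0 :=
  sInf {u | t ≤ u ∧ (s ≤ f u - f t ∨ T ≤ u)}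

/-- The infimum is attained because `f` is right-continuous. Adding `T ≤ u` to the condition caps
the inverse at `T`, so the set is never empty. -/
lemma invTime_le_iff (f : StieltjesFunction ℝ≥0) {t T : ℝ≥0} (htT : t ≤ T) (s : ℝ) (u : ℝ≥0) :
    invTime f t T s ≤ u ↔ t ≤ u ∧ (s ≤ f u - f t ∨ T ≤ u) := by
  have hne : {u | t ≤ u ∧ (s ≤ f u - f t ∨ T ≤ u)}.Nonempty := ⟨T, htT, Or.inr le_rfl⟩
  have hbdd : BddBelow {u | t ≤ u ∧ (s ≤ f u - f t ∨ T ≤ u)} := OrderBot.bddBelow _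
  refine ⟨fun h => ?_, fun h => csInf_le hbdd h⟩
  have hlt : ∀ v, invTime f t T s < v → t ≤ v ∧ (s ≤ f v - f t ∨ T ≤ v) := fun v hv => by
    obtain ⟨w, hw, hwv⟩ := exists_lt_of_csInf_lt hne hv
    refine ⟨hw.1.trans hwv.le, hw.2.imp (fun h' => h'.trans ?_) fun h' => h'.trans hwv.le⟩
    have := f.mono hwv.le
    linarith
  have hge : t ≤ u := (le_csInf hne fun v hv => hv.1).trans h
  refine ⟨hge, ?_⟩
  by_contra! hcon
  have h1 : Tendsto f (𝓝[>] u) (𝓝 (f u)) := (f.right_continuous u).mono Ioi_subset_Ici_self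
  have h2 := h1.eventually (Iio_mem_nhds (show f u < s + f t by linarith [hcon.1]))
  have h3 := (Iio_mem_nhds hcon.2 : Iio T ∈ 𝓝 u)
  obtain ⟨v, ⟨hv1, hv2⟩, hv3⟩ := ((h2.and (mem_nhdsWithin_of_mem_nhds h3)).and self_mem_nhdsWithin).exists
  replace hv1 : f v < s + f t := hv1
  replace hv2 : v < T := hv2
  replace hv3 : u < v := hv3
  rcases (hlt v (h.trans_lt hv3)).2 with h' | h'
  · linarith
  · exact not_lt.2 h' hv2

lemma invTime_le (f : StieltjesFunction ℝ≥0) {t T : ℝ≥0} (htT : t ≤ T) (s : ℝ) :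
    invTime f t T s ≤ T := (invTime_le_iff f htT s T).2 ⟨htT, Or.inr le_rfl⟩

lemma measurable_invTime (f : StieltjesFunction ℝ≥0) {t T : ℝ≥0} (htT : t ≤ T) :
    Measurable (invTime f t T) := by
  refine measurable_of_Iic fun u => ?_
  have : invTime f t T ⁻¹' Iic u = {s | t ≤ u ∧ (s ≤ f u - f t ∨ T ≤ u)} := by
    ext s; exact invTime_le_iff f htT s u
  rw [this]
  exact (MeasurableSet.const _).inter (measurableSet_Iic.union (MeasurableSet.const _))

/-- Both finite measures give the ray `Iic u` the mass `f (u ∧ T) - f t` when `u ≥ t`, and nothing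
otherwise. The fixed Lebesgue measure replaces a measure that depends on the scenario, so Fubini
becomes available. -/
lemma map_invTime (f : StieltjesFunction ℝ≥0) {t T : ℝ≥0} (htT : t ≤ T) :
    (volume.restrict (Ioc 0 (f T - f t))).map (invTime f t T) = f.measure.restrict (Ioc t T) := by
  have : IsFiniteMeasure (volume.restrict (Ioc 0 (f T - f t))) := ⟨by simp⟩
  have hm := measurable_invTime f htT
  refine Measure.ext_of_Iic _ _ fun u => ?_
  rw [Measure.map_apply hm measurableSet_Iic, Measure.restrict_apply (hm measurableSet_Iic),
    Measure.restrict_apply measurableSet_Iic, show Iic u ∩ Ioc t T = Ioc t (min u T) by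
      ext v; simp; tauto, f.measure_Ioc]
  rcases lt_or_ge u t with hu | hu
  · have : invTime f t T ⁻¹' Iic u = ∅ := by
      ext s
      simp only [mem_preimage, mem_Iic, invTime_le_iff f htT, mem_empty_iff_false, iff_false]
      exact fun h => not_le.2 hu h.1
    rw [this, empty_inter, measure_empty, ENNReal.ofReal_of_nonpos]
    have := f.mono ((min_le_left u T).trans hu.le)
    linarith
  · have : invTime f t T ⁻¹' Iic u ∩ Ioc 0 (f T - f t) = Ioc 0 (f (min u T) - f t) := by
      ext s
      simp only [mem_inter_iff, mem_preimage, mem_Iic, invTime_le_iff f htT, mem_Ioc]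
      rcases le_total u T with h | h
      · rw [min_eq_left h]
        have := f.mono h
        constructor
        · rintro ⟨⟨_, h1 | h1⟩, h2, h3⟩
          exacts [⟨h2, h1⟩, ⟨h2, by rw [le_antisymm h h1]; exact h3⟩]
        · rintro ⟨h2, h3⟩
          exact ⟨⟨hu, Or.inl h3⟩, h2, by linarith⟩
      · rw [min_eq_right h]
        exact ⟨fun h' => h'.2, fun h' => ⟨⟨hu, Or.inr h⟩, h'⟩⟩
    rw [this, Real.volume_Ioc, sub_zero]

lemma setLIntegral_stieltjes (f : StieltjesFunction ℝ≥0) {t T : ℝ≥0} (htT : t ≤ T) {h : ℝ≥0 → ℝ≥0∞}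
    (hh : Measurable h) :
    ∫⁻ u in Ioc t T, h u ∂f.measure = ∫⁻ s, (Ioc 0 (f T - f t)).indicator
      (fun s => h (invTime f t T s)) s := by
  rw [← map_invTime f htT, lintegral_map hh (measurable_invTime f htT),
    lintegral_indicator measurableSet_Ioc]

lemma measurable_invTime_uncurry {m : MeasurableSpace Ω} {f : Ω → StieltjesFunction ℝ≥0}
    {t T : ℝ≥0} (htT : t ≤ T) (hf : ∀ u ≤ T, Measurable fun ω => f ω u) :
    Measurable fun z : Ω × ℝ => invTime (f z.1) t T z.2 := by
  refine measurable_of_Iic fun u => ?_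
  rcases le_total T u with hu | hu
  · convert MeasurableSet.univ
    ext z
    simp only [mem_preimage, mem_Iic, mem_univ, iff_true]
    exact (invTime_le _ htT _).trans hu
  have : (fun z : Ω × ℝ => invTime (f z.1) t T z.2) ⁻¹' Iic u
      = {z | t ≤ u ∧ (z.2 ≤ f z.1 u - f z.1 t ∨ T ≤ u)} := by
    ext z; exact invTime_le_iff _ htT _ _
  rw [this]
  exact (MeasurableSet.const _).inter ((measurableSet_le measurable_snd
    (((hf u hu).comp measurable_fst).sub ((hf t htT).comp measurable_fst))).union
    (MeasurableSet.const _))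

lemma measurableSet_timeChange {m : MeasurableSpace Ω} {f : Ω → StieltjesFunction ℝ≥0}
    {t T : ℝ≥0} (htT : t ≤ T) (hf : ∀ u ≤ T, Measurable fun ω => f ω u) :
    MeasurableSet {z : Ω × ℝ | z.2 ∈ Ioc 0 (f z.1 T - f z.1 t)} :=
  (measurableSet_lt measurable_const measurable_snd).inter (measurableSet_le measurable_snd
    (((hf T le_rfl).comp measurable_fst).sub ((hf t htT).comp measurable_fst)))

/-- Integrals against the measures of a measurable family of Stieltjes functions are measurable. -/
lemma measurable_setLIntegral_stieltjes {m : MeasurableSpace Ω} {f : Ω → StieltjesFunction ℝ≥0}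
    {t T : ℝ≥0} (htT : t ≤ T) (hf : ∀ u ≤ T, Measurable fun ω => f ω u)
    {h : ℝ≥0 → Ω → ℝ≥0∞} (hh : Measurable (Function.uncurry h)) :
    Measurable fun ω => ∫⁻ u in Ioc t T, h u ω ∂(f ω).measure := by
  have : ∀ ω, ∫⁻ u in Ioc t T, h u ω ∂(f ω).measure = ∫⁻ s : ℝ,
      {z : Ω × ℝ | z.2 ∈ Ioc 0 (f z.1 T - f z.1 t)}.indicator
        (fun z => h (invTime (f z.1) t T z.2) z.1) (ω, s) := fun ω => by
    rw [setLIntegral_stieltjes (f ω) htT (h := fun u => h u ω)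
      (hh.comp (measurable_id.prodMk measurable_const))]
    rfl
  simp_rw [this]
  exact Measurable.lintegral_prod_right' (f := fun z : Ω × ℝ =>
    {z : Ω × ℝ | z.2 ∈ Ioc 0 (f z.1 T - f z.1 t)}.indicator
        (fun z => h (invTime (f z.1) t T z.2) z.1) z) ((hh.comp ((measurable_invTime_uncurry htT hf).prodMk
    measurable_fst)).indicator (measurableSet_timeChange htT hf))

lemma isStoppingTime_invTime {f : Ω → StieltjesFunction ℝ≥0} {t T : ℝ≥0} (htT : t ≤ T)
    (hf : ∀ u, Measurable[𝓕 u] fun ω => f ω u) (s : ℝ) :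
    IsStoppingTime 𝓕 fun ω => (invTime (f ω) t T s : WithTop ℝ≥0) := by
  intro u
  simp only [WithTop.coe_le_coe, invTime_le_iff _ htT]
  by_cases hu : t ≤ u
  · simp only [hu, true_and]
    exact (measurableSet_le measurable_const
      ((hf u).sub ((hf t).mono (𝓕.mono hu) le_rfl))).union (MeasurableSet.const _)
  · simp [hu]

/-- The event looks at `f` up to `T`, but if the level `s` has been reached by some `u < T`, then
monotonicity already decides it: only the sign of `s` is left to check. -/
lemma measurableSet_le_timeChange {f : Ω → StieltjesFunction ℝ≥0} {t T : ℝ≥0} (htT : t ≤ T)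
    (hf : ∀ u, Measurable[𝓕 u] fun ω => f ω u) (s : ℝ) :
    MeasurableSet[(isStoppingTime_invTime (𝓕 := 𝓕) htT hf s).measurableSpace]
      {ω | s ∈ Ioc 0 (f ω T - f ω t)} := by
  have hA : MeasurableSet[𝓕 T] {ω | s ∈ Ioc 0 (f ω T - f ω t)} :=
    (MeasurableSet.const _).inter (measurableSet_le measurable_const
      ((hf T).sub ((hf t).mono (𝓕.mono htT) le_rfl)))
  refine ⟨le_iSup (fun u => (𝓕 u : MeasurableSpace Ω)) T _ hA, fun u => ?_⟩
  rcases le_or_gt T u with hu | hu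
  · exact (𝓕.mono hu _ hA).inter (isStoppingTime_invTime (𝓕 := 𝓕) htT hf s u)
  · have : {ω | s ∈ Ioc 0 (f ω T - f ω t)} ∩ {ω | (invTime (f ω) t T s : WithTop ℝ≥0) ≤ u}
        = {ω | 0 < s} ∩ {ω | (invTime (f ω) t T s : WithTop ℝ≥0) ≤ u} := by
      ext ω
      simp only [mem_inter_iff, Set.mem_ofPred_eq, mem_Ioc, WithTop.coe_le_coe, invTime_le_iff _ htT]
      constructor
      · exact fun h => ⟨h.1.1, h.2⟩
      · rintro ⟨h1, h2, h3 | h3⟩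
        · exact ⟨⟨h1, by have := (f ω).mono hu.le; linarith⟩, h2, Or.inl h3⟩
        · exact absurd h3 (not_le.2 hu)
    rw [this]
    exact (MeasurableSet.const _).inter (isStoppingTime_invTime (𝓕 := 𝓕) htT hf s u)

variable {P : Measure Ω} [IsProbabilityMeasure P]

/-- In an integral against an adapted increasing process, a martingale may be replaced by its
terminal value under the expectation. -/
theorem lintegral_setLIntegral_mul_stieltjes {p : ℝ≥0 → Ω → ℝ} (hp : Martingale p 𝓕 P)
    (hp0 : ∀ u ω, 0 ≤ p u ω) (hrc : ∀ ω u, ContinuousWithinAt (fun u => p u ω) (Ici u) u)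
    {f : Ω → StieltjesFunction ℝ≥0} {t T : ℝ≥0} (htT : t ≤ T)
    (hf : ∀ u, Measurable[𝓕 u] fun ω => f ω u)
    {h : ℝ≥0 → Ω → ℝ≥0∞} (hh : Measurable (Function.uncurry h))
    (hstopped : ∀ ρ : Ω → ℝ≥0, ∀ hρ : IsStoppingTime 𝓕 (fun ω => (ρ ω : WithTop ℝ≥0)),
      (∀ ω, t ≤ ρ ω ∧ ρ ω ≤ T) → Measurable[hρ.measurableSpace] fun ω => h (ρ ω) ω) :
    ∫⁻ ω, ∫⁻ u in Ioc t T, ENNReal.ofReal (p u ω) * h u ω ∂(f ω).measure ∂P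
      = ∫⁻ ω, ENNReal.ofReal (p T ω) * ∫⁻ u in Ioc t T, h u ω ∂(f ω).measure ∂P := by
  have hf' : ∀ u ≤ T, Measurable fun ω => f ω u := fun u _ => (hf u).mono (𝓕.le u) le_rfl
  have hpm : Measurable (Function.uncurry p) :=
    measurable_uncurry_of_rightCont (fun u => ((hp.1 u).mono (𝓕.le u)).measurable) hrc
  have hsec : ∀ {h : ℝ≥0 → Ω → ℝ≥0∞} (_ : Measurable (Function.uncurry h)) (ω : Ω),
      ∫⁻ u in Ioc t T, h u ω ∂(f ω).measure = ∫⁻ s : ℝ,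
      {z : Ω × ℝ | z.2 ∈ Ioc 0 (f z.1 T - f z.1 t)}.indicator
        (fun z => h (invTime (f z.1) t T z.2) z.1) (ω, s) := fun {h} hh ω => by
    rw [setLIntegral_stieltjes (f ω) htT (h := fun u => h u ω)
      (hh.comp (measurable_id.prodMk measurable_const))]
    rfl
  have hmeas : ∀ {h : ℝ≥0 → Ω → ℝ≥0∞} (_ : Measurable (Function.uncurry h)),
      Measurable fun z : Ω × ℝ => {z : Ω × ℝ | z.2 ∈ Ioc 0 (f z.1 T - f z.1 t)}.indicator
        (fun z => h (invTime (f z.1) t T z.2) z.1) z := fun hh =>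
    (hh.comp ((measurable_invTime_uncurry htT hf').prodMk measurable_fst)).indicator
      (measurableSet_timeChange htT hf')
  have h1 : Measurable (Function.uncurry fun u ω => ENNReal.ofReal (p u ω) * h u ω) :=
    hpm.ennreal_ofReal.mul hh
  have hpT : Measurable fun ω => ENNReal.ofReal (p T ω) :=
    ((hp.1 T).mono (𝓕.le T)).measurable.ennreal_ofReal
  simp_rw [hsec h1]
  rw [lintegral_lintegral_swap (hmeas h1).aemeasurable]
  have h2 : ∀ ω, ENNReal.ofReal (p T ω) * ∫⁻ u in Ioc t T, h u ω ∂(f ω).measure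
      = ∫⁻ s : ℝ, ENNReal.ofReal (p T ω) * {z : Ω × ℝ | z.2 ∈ Ioc 0 (f z.1 T - f z.1 t)}.indicator
        (fun z => h (invTime (f z.1) t T z.2) z.1) (ω, s) := fun ω => by
    rw [hsec hh]
    exact (lintegral_const_mul _ ((hmeas hh).comp
      (measurable_const (a := ω) |>.prodMk measurable_id))).symm
  simp_rw [h2]
  refine Eq.trans ?_ (lintegral_lintegral_swap
    ((hpT.comp measurable_fst).mul (hmeas hh)).aemeasurable).symm
  refine lintegral_congr fun s => ?_
  -- At a fixed level `s` the martingale enters only through its value at one stopping time bounded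
  -- by `T`, with a weight known at that time; optional stopping replaces this value by `p T`.
  have hρ := isStoppingTime_invTime (𝓕 := 𝓕) htT hf s
  have hξ : Measurable[hρ.measurableSpace] ({ω | s ∈ Ioc 0 (f ω T - f ω t)}.indicator
      fun ω => h (invTime (f ω) t T s) ω) :=
    (hstopped _ hρ fun ω => ⟨((invTime_le_iff (f ω) htT s _).1 le_rfl).1, invTime_le _ htT _⟩).indicator
      (measurableSet_le_timeChange htT hf s)
  have := lintegral_mul_stopped hp hp0 hrc hρ (fun ω => invTime_le _ htT _) hξ
  refine (lintegral_congr fun ω => ?_).trans this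
  by_cases hs : s ∈ Ioc 0 (f ω T - f ω t)
  · rw [indicator_of_mem (show (ω, s) ∈ {z : Ω × ℝ | z.2 ∈ Ioc 0 (f z.1 T - f z.1 t)} from hs),
      indicator_of_mem (show ω ∈ {ω | s ∈ Ioc 0 (f ω T - f ω t)} from hs)]
  · rw [indicator_of_notMem (show (ω, s) ∉ {z : Ω × ℝ | z.2 ∈ Ioc 0 (f z.1 T - f z.1 t)} from hs),
      indicator_of_notMem (show ω ∉ {ω | s ∈ Ioc 0 (f ω T - f ω t)} from hs), mul_zero]

end

section

variable {Ω : Type*} {mΩ : MeasurableSpace Ω} {𝓕 : Filtration ℝ≥0 mΩ}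

/-! ### The Jordan decomposition of a continuous path of finite variation -/

variable {g : ℝ≥0 → ℝ}

/-- The positive variation of a continuous function, up to a constant. -/
def upVar (hb : BoundedVariationOn g univ) (hc : Continuous g) : StieltjesFunction ℝ≥0 where
  toFun u := (variationOnFromTo g univ 0 u + g u) / 2
  mono' a b hab := by
    have := variationOnFromTo.add_self_monotoneOn hb.locallyBoundedVariationOn (mem_univ 0)
      (mem_univ a) (mem_univ b) hab
    simp only [Pi.add_apply] at this
    linarith
  right_continuous' x := ((hb.continuousWithinAt_variationOnFromTo_Ici
    hc.continuousWithinAt).add hc.continuousWithinAt).div_const 2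

/-- The negative variation of a continuous function, up to a constant. -/
def downVar (hb : BoundedVariationOn g univ) (hc : Continuous g) : StieltjesFunction ℝ≥0 where
  toFun u := (variationOnFromTo g univ 0 u - g u) / 2
  mono' a b hab := by
    have := variationOnFromTo.sub_self_monotoneOn hb.locallyBoundedVariationOn (mem_univ 0)
      (mem_univ a) (mem_univ b) hab
    simp only [Pi.sub_apply] at this
    linarith
  right_continuous' x := ((hb.continuousWithinAt_variationOnFromTo_Ici
    hc.continuousWithinAt).sub hc.continuousWithinAt).div_const 2

instance (f : StieltjesFunction ℝ≥0) (t T : ℝ≥0) : IsFiniteMeasure (f.measure.restrict (Ioc t T)) :=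
  ⟨by simp [f.measure_Ioc]⟩

lemma Iic_inter_Ioc (a t T : ℝ≥0) : Iic a ∩ Ioc t T = Ioc t (min a T) := by
  ext v; simp; tauto

/-- Both sides are compared on the π-system of rays `Iic a`, whose traces on `(t, T]` are half-open
intervals. Continuity of `g` identifies right limits with values, and `upVar - downVar = g`. -/
lemma vectorMeasure_restrict_eq (hb : BoundedVariationOn g univ) (hc : Continuous g) (t T : ℝ≥0) :
    hb.vectorMeasure.restrict (Ioc t T)
      = ((upVar hb hc).measure.restrict (Ioc t T)).toSignedMeasure
        - ((downVar hb hc).measure.restrict (Ioc t T)).toSignedMeasure := by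
  have key : ∀ a b, hb.vectorMeasure (Ioc a b)
      = (upVar hb hc).measure.real (Ioc a b) - (downVar hb hc).measure.real (Ioc a b) := fun a b => by
    rcases le_total a b with hab | hab
    · have hlim : ∀ x, g.rightLim x = g x := fun x => by
        rcases eq_or_neBot (𝓝[>] x) with h | h
        · exact absurd h (NeBot.ne inferInstance)
        · exact rightLim_eq_of_tendsto (hc.continuousWithinAt)
      rw [hb.vectorMeasure_Ioc hab, hlim, hlim, measureReal_def, measureReal_def,
        StieltjesFunction.measure_Ioc, StieltjesFunction.measure_Ioc, ENNReal.toReal_ofReal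
        (sub_nonneg.2 ((upVar hb hc).mono hab)), ENNReal.toReal_ofReal
        (sub_nonneg.2 ((downVar hb hc).mono hab))]
      simp only [upVar, downVar]
      ring
    · simp [Ioc_eq_empty (not_lt.2 hab)]
  have hset : ∀ s, MeasurableSet s → (∃ a b, s ∩ Ioc t T = Ioc a b) →
      hb.vectorMeasure.restrict (Ioc t T) s
      = (((upVar hb hc).measure.restrict (Ioc t T)).toSignedMeasure
        - ((downVar hb hc).measure.restrict (Ioc t T)).toSignedMeasure) s := by
    rintro s hs ⟨a, b, hab⟩
    rw [VectorMeasure.restrict_apply _ measurableSet_Ioc hs, sub_apply,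
      Measure.toSignedMeasure_apply_measurable hs, Measure.toSignedMeasure_apply_measurable hs,
      measureReal_restrict_apply hs, measureReal_restrict_apply hs, hab, key]
  refine VectorMeasure.ext_of_generateFrom (range Iic) ?_ (BorelSpace.measurable_eq.trans
    (borel_eq_generateFrom_Iic ℝ≥0)) (by
      rintro _ ⟨a, rfl⟩ _ ⟨b, rfl⟩ -; exact ⟨min a b, by rw [Iic_inter_Iic]⟩) ?_
  · rintro _ ⟨a, rfl⟩
    exact hset _ measurableSet_Iic ⟨t, min a T, Iic_inter_Ioc a t T⟩
  · exact hset _ MeasurableSet.univ ⟨t, T, by simp⟩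

/-- One inequality is subadditivity of variation. For the other, `upVar + downVar` is the variation
function of `g`, and each partition sum of `g` is a sum of absolute masses of disjoint intervals.
The minimality matters: with it, integrability against `|dG|` yields integrability against both
monotone parts. -/
lemma variation_restrict_eq (hb : BoundedVariationOn g univ) (hc : Continuous g) (t T : ℝ≥0) :
    hb.vectorMeasure.variation.restrict (Ioc t T)
      = (upVar hb hc).measure.restrict (Ioc t T) + (downVar hb hc).measure.restrict (Ioc t T) := by
  have hle : hb.vectorMeasure.variation.restrict (Ioc t T)
      ≤ (upVar hb hc).measure.restrict (Ioc t T) + (downVar hb hc).measure.restrict (Ioc t T) := by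
    rw [← VectorMeasure.variation_restrict measurableSet_Ioc, vectorMeasure_restrict_eq hb hc]
    refine (VectorMeasure.variation_sub_le).trans ?_
    simp
  have : IsFiniteMeasure (hb.vectorMeasure.variation.restrict (Ioc t T)) :=
    isFiniteMeasure_of_le _ hle
  refine Measure.ext_of_Iic _ _ fun a => le_antisymm (hle _) ?_
  rw [Measure.add_apply, Measure.restrict_apply measurableSet_Iic,
    Measure.restrict_apply measurableSet_Iic, Measure.restrict_apply measurableSet_Iic,
    Iic_inter_Ioc, StieltjesFunction.measure_Ioc, StieltjesFunction.measure_Ioc]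
  rcases lt_or_ge (min a T) t with hb' | hb'
  · rw [ENNReal.ofReal_of_nonpos (sub_nonpos.2 ((upVar hb hc).mono hb'.le)),
      ENNReal.ofReal_of_nonpos (sub_nonpos.2 ((downVar hb hc).mono hb'.le))]
    simp
  rw [← ENNReal.ofReal_add (sub_nonneg.2 ((upVar hb hc).mono hb'))
    (sub_nonneg.2 ((downVar hb hc).mono hb'))]
  have h1 : (upVar hb hc) (min a T) - (upVar hb hc) t + ((downVar hb hc) (min a T)
      - (downVar hb hc) t) = variationOnFromTo g univ t (min a T) := by
    rw [← variationOnFromTo.add hb.locallyBoundedVariationOn (mem_univ t) (mem_univ 0)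
      (mem_univ (min a T)), variationOnFromTo.eq_neg_swap g univ t 0]
    simp only [upVar, downVar]
    ring
  rw [h1, variationOnFromTo.eq_of_le _ _ hb', univ_inter, ENNReal.ofReal_toReal
    (hb.mono (subset_univ _))]
  refine iSup_le fun ⟨n, v, hv, hvs⟩ => ?_
  have hlim : ∀ x, g.rightLim x = g x := fun x => rightLim_eq_of_tendsto hc.continuousWithinAt
  calc ∑ i ∈ Finset.range n, edist (g (v (i + 1))) (g (v i))
      ≤ ∑ i ∈ Finset.range n, hb.vectorMeasure.variation (Ioc (v i) (v (i + 1))) :=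
        Finset.sum_le_sum fun i _ => by
          rw [edist_eq_enorm_sub, ← hlim, ← hlim (v i), ← hb.vectorMeasure_Ioc (hv (Nat.le_succ i))]
          exact VectorMeasure.enorm_measure_le_variation _ _
    _ = hb.vectorMeasure.variation (⋃ i ∈ Finset.range n, Ioc (v i) (v (i + 1))) := by
        rw [measure_biUnion_finset _ fun _ _ => measurableSet_Ioc]
        exact fun i _ j _ hij => hv.pairwise_disjoint_on_Ioc_succ hij
    _ ≤ _ := by
        refine measure_mono (iUnion₂_subset fun i _ => Ioc_subset_Ioc (hvs i).1 (hvs (i + 1)).2)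

end

section

variable {Ω : Type*} {mΩ : MeasurableSpace Ω} {𝓕 : Filtration ℝ≥0 mΩ}

/-! ### Pathwise Lebesgue–Stieltjes integrals through the Jordan decomposition -/

lemma boundedVariationOn_stopped {G : ℝ≥0 → ℝ} (h : LocallyBoundedVariationOn G univ) (T : ℝ≥0) :
    BoundedVariationOn (fun u => G (min u T)) univ := by
  refine ne_top_of_le_ne_top (h 0 T (mem_univ _) (mem_univ _))
    (eVariationOn.comp_le_of_monotoneOn G (fun u => min u T)
      (fun a _ b _ hab => min_le_min_right T hab) fun u _ => ⟨mem_univ _, zero_le, min_le_right u T⟩)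

lemma lsVariationIntegral_eq {G : ℝ≥0 → ℝ} {t T : ℝ≥0}
    (hb : BoundedVariationOn (fun u => G (min u T)) univ) (hc : Continuous fun u => G (min u T))
    (f : ℝ≥0 → ℝ≥0∞) : lsVariationIntegral G t T f
      = ∫⁻ u in Ioc t T, f u ∂(upVar hb hc).measure + ∫⁻ u in Ioc t T, f u ∂(downVar hb hc).measure := by
  rw [lsVariationIntegral, dif_pos hb, variation_restrict_eq hb hc, lintegral_add_measure]

lemma lsIntegral_eq {G : ℝ≥0 → ℝ} {t T : ℝ≥0}
    (hb : BoundedVariationOn (fun u => G (min u T)) univ) (hc : Continuous fun u => G (min u T))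
    {f : ℝ≥0 → ℝ} (hU : IntegrableOn f (Ioc t T) (upVar hb hc).measure)
    (hD : IntegrableOn f (Ioc t T) (downVar hb hc).measure) : lsIntegral G t T f
      = ∫ u in Ioc t T, f u ∂(upVar hb hc).measure - ∫ u in Ioc t T, f u ∂(downVar hb hc).measure := by
  have hflip : ContinuousLinearMap.lsmul ℝ ℝ = (ContinuousLinearMap.lsmul ℝ (E := ℝ) ℝ).flip := by
    ext
    simp
  have hint : ∀ (m : Measure ℝ≥0) [IsFiniteMeasure m], Integrable f m →
      VectorMeasure.Integrable m.toSignedMeasure f := fun m _ hm => by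
    rwa [VectorMeasure.Integrable, Measure.variation_toSignedMeasure]
  rw [lsIntegral, dif_pos hb, vectorMeasure_restrict_eq hb hc, hflip,
    VectorMeasure.integral_sub_vectorMeasure (hint _ hU) (hint _ hD),
    VectorMeasure.integral_toSignedMeasure, VectorMeasure.integral_toSignedMeasure]

/-- For a continuous path, lower semicontinuity of the variation reduces all partitions to dyadic
ones. The variation becomes a countable supremum of functions of finitely many values, hence
adapted. -/
lemma eVariationOn_Icc_eq_iSup {f : ℝ≥0 → ℝ} (hf : Continuous f) (u : ℝ≥0) :
    eVariationOn f (Icc 0 u) = ⨆ n, ∑ i ∈ Finset.range ⌈u * 2 ^ n⌉₊,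
      edist (f (min (dyPt n i) u)) (f (min (dyPt n (i + 1)) u)) := by
  have hmono : ∀ n, Monotone fun i => min (dyPt n i) u := fun n i j hij => by
    refine min_le_min_right u ?_
    unfold dyPt
    gcongr
  have himg : ∀ n, ∑ i ∈ Finset.range ⌈u * 2 ^ n⌉₊,
      edist (f (min (dyPt n i) u)) (f (min (dyPt n (i + 1)) u))
      = eVariationOn f ((fun i => min (dyPt n i) u) '' Iic ⌈u * 2 ^ n⌉₊) := fun n =>
    (eVariationOn.image_range_of_monotone f (hmono n) _).symm
  simp_rw [himg]
  refine le_antisymm (le_of_forall_lt fun v hv => ?_) (iSup_le fun n => eVariationOn.mono f ?_)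
  · have hlim : ∀ x ∈ Icc 0 u, Tendsto (fun n => (f ∘ fun x => min (dyCeil n x) u) x) atTop
        (𝓝 (f x)) := fun x hx => by
      refine (hf.tendsto x).comp ?_
      have := ((tendsto_dyCeil x).mono_right nhdsWithin_le_nhds).min
        (tendsto_const_nhds (x := u) (f := atTop))
      rwa [min_eq_left hx.2] at this
    obtain ⟨n, hn⟩ := (eVariationOn.lowerSemicontinuous_aux hlim hv).exists
    refine hn.trans_le (le_iSup_of_le n (eVariationOn.comp_le_of_monotoneOn f _
      (fun a _ b _ hab => min_le_min_right u (dyCeil_mono n hab)) fun x hx => ?_))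
    exact ⟨⌈x * 2 ^ n⌉₊, Nat.ceil_le_ceil (by gcongr; exact hx.2), rfl⟩
  · rintro _ ⟨i, -, rfl⟩
    exact ⟨zero_le, min_le_right _ _⟩

lemma measurable_variationOnFromTo {m : MeasurableSpace Ω} {g : ℝ≥0 → Ω → ℝ}
    (hc : ∀ ω, Continuous fun u => g u ω) {u : ℝ≥0} (hg : ∀ v ≤ u, Measurable (g v)) :
    Measurable fun ω => variationOnFromTo (fun v => g v ω) univ 0 u := by
  simp_rw [variationOnFromTo.eq_of_le _ _ (zero_le (a := u)), univ_inter, eVariationOn_Icc_eq_iSup (hc _)]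
  refine (Measurable.iSup fun n => Finset.measurable_fun_sum _ fun i _ => ?_).ennreal_toReal
  exact (hg _ (min_le_right _ _)).edist (hg _ (min_le_right _ _))

/-- The two monotone parts of an adapted process are adapted. -/
lemma measurable_upVar_downVar {g : ℝ≥0 → Ω → ℝ} (hb : ∀ ω, BoundedVariationOn (fun u => g u ω) univ)
    (hc : ∀ ω, Continuous fun u => g u ω) (hg : ∀ u, Measurable[𝓕 u] (g u)) (u : ℝ≥0) :
    (Measurable[𝓕 u] fun ω => upVar (hb ω) (hc ω) u)
      ∧ Measurable[𝓕 u] fun ω => downVar (hb ω) (hc ω) u := by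
  have h := measurable_variationOnFromTo (m := 𝓕 u) hc (u := u)
    fun v hv => (hg v).mono (𝓕.mono hv) le_rfl
  exact ⟨(h.add (hg u)).div_const 2, (h.sub (hg u)).div_const 2⟩

end

section

variable {Ω : Type*} {mΩ : MeasurableSpace Ω} {𝓕 : Filtration ℝ≥0 mΩ}

/-! ### Dividends -/

lemma measurable_of_measurableSet_le {τ : Ω → ℝ≥0∞}
    (hτ : ∀ u : ℝ≥0, MeasurableSet[𝓕 u] {ω | τ ω ≤ u}) : Measurable τ := by
  refine measurable_of_Iic fun a => ?_
  by_cases ha : a = ∞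
  · simp [ha]
  · lift a to ℝ≥0 using ha
    exact 𝓕.le a _ (hτ a)

lemma measurable_uncurry_of_predictable {R : ℝ≥0 → Ω → ℝ} (hR : IsStronglyPredictable 𝓕 R) :
    Measurable (Function.uncurry R) := by
  refine (StronglyMeasurable.measurable hR).mono ?_ le_rfl
  exact measurableSpace_le_predictable_of_measurableSet
    (fun A hA => (measurableSet_singleton _).prod (𝓕.le _ _ hA))
    fun i A hA => measurableSet_Ioi.prod (𝓕.le _ _ hA)

lemma measurable_stopped {R : ℝ≥0 → Ω → ℝ} (hR : IsStronglyPredictable 𝓕 R) {ρ : Ω → ℝ≥0}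
    (hρ : IsStoppingTime 𝓕 (fun ω => (ρ ω : WithTop ℝ≥0))) :
    Measurable[hρ.measurableSpace] fun ω => R (ρ ω) ω := by
  have := measurable_stoppedValue hR.isStronglyProgressive hρ
  convert! this using 1

/-- Stopping the clock at `T` turns progressive measurability into joint measurability with respect
to `𝓕 T` on all of `ℝ≥0 × Ω`, the form needed to make the cash flows `𝓕 T`-measurable in the
scenario. -/
lemma measurable_min_uncurry {R : ℝ≥0 → Ω → ℝ} (hR : IsStronglyPredictable 𝓕 R) (T : ℝ≥0) :
    @Measurable (ℝ≥0 × Ω) ℝ (@Prod.instMeasurableSpace _ _ _ (𝓕 T)) _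
      (fun z => R (min z.1 T) z.2) := by
  let _ : MeasurableSpace Ω := 𝓕 T
  have h := (hR.isStronglyProgressive T).measurable
  exact h.comp (f := fun z : ℝ≥0 × Ω => ((⟨min z.1 T, mem_Iic.2 (min_le_right _ _)⟩ : Iic T), z.2))
    (((measurable_fst.min measurable_const).subtype_mk).prodMk measurable_snd)

lemma measurableSet_lt_stopped {τ : Ω → ℝ≥0∞} (hτ : ∀ u : ℝ≥0, MeasurableSet[𝓕 u] {ω | τ ω ≤ u})
    {ρ : Ω → ℝ≥0} (hρ : IsStoppingTime 𝓕 (fun ω => (ρ ω : WithTop ℝ≥0))) :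
    MeasurableSet[hρ.measurableSpace] {ω | (ρ ω : ℝ≥0∞) < τ ω} := by
  have h1 : IsStoppingTime 𝓕 (fun ω => (τ ω : WithTop ℝ≥0)) := fun u => hτ u
  have := (h1.measurableSet_stopping_time_le hρ).compl
  convert! this using 1
  ext ω
  exact (not_le (a := τ ω) (b := (ρ ω : ℝ≥0∞))).symm

variable {P : Measure Ω} [IsProbabilityMeasure P]

/-- The event `B` is moved into the integrand. At a stopping time `ρ ≥ t` the resulting weight is
known: `R` is progressive, `{ρ < τ}` belongs to the stopped σ-algebra, and so does `B` because it is
known at `t`. -/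
lemma lintegral_setLIntegral_mul_alive {p : ℝ≥0 → Ω → ℝ} (hp : Martingale p 𝓕 P)
    (hp0 : ∀ u ω, 0 ≤ p u ω) (hpc : ∀ ω, IsCadlag fun u => p u ω)
    {τ : Ω → ℝ≥0∞} (hτ : ∀ u : ℝ≥0, MeasurableSet[𝓕 u] {ω | τ ω ≤ u})
    {R : ℝ≥0 → Ω → ℝ} (hR : IsStronglyPredictable 𝓕 R)
    {f : Ω → StieltjesFunction ℝ≥0} {t T : ℝ≥0} (htT : t ≤ T)
    (hf : ∀ u, Measurable[𝓕 u] fun ω => f ω u) {B : Set Ω} (hB : MeasurableSet[𝓕 t] B) :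
    ∫⁻ ω in B, ∫⁻ u in Ioc t T, ENNReal.ofReal (p u ω) *
        {u' : ℝ≥0 | (u' : ℝ≥0∞) < τ ω}.indicator (fun u' => ENNReal.ofReal (R u' ω)⁻¹) u
        ∂(f ω).measure ∂P
      = ∫⁻ ω in B, ENNReal.ofReal (p T ω) * ∫⁻ u in Ioc t T,
        {u' : ℝ≥0 | (u' : ℝ≥0∞) < τ ω}.indicator (fun u' => ENNReal.ofReal (R u' ω)⁻¹) u
        ∂(f ω).measure ∂P := by
  have hτm := measurable_of_measurableSet_le hτ
  have hRm := measurable_uncurry_of_predictable hR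
  set h : ℝ≥0 → Ω → ℝ≥0∞ := fun u ω =>
    {u' : ℝ≥0 | (u' : ℝ≥0∞) < τ ω}.indicator (fun u' => ENNReal.ofReal (R u' ω)⁻¹) u with hdef
  have hh : Measurable (Function.uncurry fun u ω => B.indicator (h u) ω) := by
    have h1 : Measurable fun z : ℝ≥0 × Ω => {z : ℝ≥0 × Ω | (z.1 : ℝ≥0∞) < τ z.2 ∧ z.2 ∈ B}.indicator
        (fun z => ENNReal.ofReal (R z.1 z.2)⁻¹) z :=
      (hRm.inv.ennreal_ofReal).indicator ((measurableSet_lt (measurable_fst.coe_nnreal_ennreal)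
        (hτm.comp measurable_snd)).inter (measurable_snd (𝓕.le t _ hB)))
    convert! h1 using 1
    ext ⟨u, ω⟩
    by_cases h2 : ω ∈ B <;> by_cases h3 : (u : ℝ≥0∞) < τ ω <;>
      simp [Function.uncurry, hdef, indicator, h2, h3]
  have key := lintegral_setLIntegral_mul_stieltjes hp hp0 (fun ω => (hpc ω).1) htT hf hh ?_
  · have e1 : ∀ w : Ω → ℝ≥0 → ℝ≥0∞, ∀ ω, ∫⁻ u in Ioc t T, w ω u * B.indicator (h u) ω ∂(f ω).measure
        = B.indicator (fun ω => ∫⁻ u in Ioc t T, w ω u * h u ω ∂(f ω).measure) ω := fun w ω => by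
      by_cases hω : ω ∈ B <;> simp [hω]
    have e2 := e1 fun _ _ => 1
    simp only [one_mul] at e2
    have hBm : MeasurableSet B := 𝓕.le t _ hB
    rw [← lintegral_indicator hBm, ← lintegral_indicator hBm]
    refine Eq.trans (lintegral_congr fun ω => (e1 (fun ω u => ENNReal.ofReal (p u ω)) ω).symm)
      (key.trans (lintegral_congr fun ω => ?_))
    rw [e2]
    by_cases hω : ω ∈ B <;> simp [hω, hdef]
  · intro ρ hρ hρb
    have hBρ : MeasurableSet[hρ.measurableSpace] B := by
      refine ⟨le_iSup (fun u => (𝓕 u : MeasurableSpace Ω)) t _ hB, fun u => ?_⟩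
      rcases le_or_gt t u with hu | hu
      · exact (𝓕.mono hu _ hB).inter (hρ u)
      · convert! MeasurableSet.empty
        ext ω
        simp only [mem_inter_iff, Set.mem_ofPred_eq, WithTop.coe_le_coe, mem_empty_iff_false,
          iff_false, not_and, not_le]
        exact fun _ => hu.trans_le (hρb ω).1
    have h1 := (measurable_stopped hR hρ).inv.ennreal_ofReal.indicator
      ((measurableSet_lt_stopped hτ hρ).inter hBρ)
    convert! h1 using 1
    ext ω
    by_cases h2 : ω ∈ B <;> by_cases h3 : (ρ ω : ℝ≥0∞) < τ ω <;> simp [hdef, indicator, h2, h3]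

lemma lsIntegral_toReal {G : ℝ≥0 → ℝ} {t T : ℝ≥0}
    (hb : BoundedVariationOn (fun u => G (min u T)) univ) (hc : Continuous fun u => G (min u T))
    {k : ℝ≥0 → ℝ≥0∞} (hk : Measurable k) (hk' : ∀ u, k u < ∞)
    (hU : ∫⁻ u in Ioc t T, k u ∂(upVar hb hc).measure ≠ ∞)
    (hD : ∫⁻ u in Ioc t T, k u ∂(downVar hb hc).measure ≠ ∞) :
    lsIntegral G t T (fun u => (k u).toReal)
      = (∫⁻ u in Ioc t T, k u ∂(upVar hb hc).measure).toReal
        - (∫⁻ u in Ioc t T, k u ∂(downVar hb hc).measure).toReal := by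
  rw [lsIntegral_eq hb hc (integrable_toReal_of_lintegral_ne_top hk.aemeasurable hU)
    (integrable_toReal_of_lintegral_ne_top hk.aemeasurable hD),
    integral_toReal hk.aemeasurable (ae_of_all _ hk'),
    integral_toReal hk.aemeasurable (ae_of_all _ hk')]

lemma measurable_alive_uncurry {τ : Ω → ℝ≥0∞} (hτ : Measurable τ) {R : ℝ≥0 → Ω → ℝ}
    (hR : Measurable (Function.uncurry R)) : Measurable (Function.uncurry fun (u : ℝ≥0) ω =>
      {u' : ℝ≥0 | (u' : ℝ≥0∞) < τ ω}.indicator (fun u' => ENNReal.ofReal (R u' ω)⁻¹) u) := by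
  have h1 : Measurable fun z : ℝ≥0 × Ω => {z : ℝ≥0 × Ω | (z.1 : ℝ≥0∞) < τ z.2}.indicator
      (fun z => ENNReal.ofReal (R z.1 z.2)⁻¹) z :=
    (hR.inv.ennreal_ofReal).indicator (measurableSet_lt (measurable_fst.coe_nnreal_ennreal)
      (hτ.comp measurable_snd))
  exact h1

/-- The expected dividends: the density of the barrier may be taken at maturity. -/
theorem setIntegral_dividend {p F : ℝ≥0 → Ω → ℝ} (hp : Martingale p 𝓕 P)
    (hp0 : ∀ u ω, 0 ≤ p u ω) (hpc : ∀ ω, IsCadlag fun u => p u ω)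
    {τ : Ω → ℝ≥0∞} (hτ : ∀ u : ℝ≥0, MeasurableSet[𝓕 u] {ω | τ ω ≤ u})
    (hF : ∀ u ω, F u ω = if (u : ℝ≥0∞) < τ ω then p u ω else 0)
    {R : ℝ≥0 → Ω → ℝ} (hR : IsStronglyPredictable 𝓕 R) (hRpos : ∀ s ω, 0 < R s ω)
    {t T : ℝ≥0} (htT : t ≤ T) {G : ℝ≥0 → Ω → ℝ} (hG : ∀ s, Measurable[𝓕 s] (G s))
    (hGcont : ∀ ω, Continuous fun s => G s ω)
    (hGvar : ∀ ω, LocallyBoundedVariationOn (fun s => G s ω) univ)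
    (hfin : ∫⁻ ω, ENNReal.ofReal (p T ω) * dividendVariation τ R G t T ω ∂P ≠ ∞) :
    Integrable (fun ω => lsIntegral (fun u => G u ω) t T fun u => F u ω * (R u ω)⁻¹) P ∧
    Integrable (fun ω => p T ω * dividendPart τ R G t T ω) P ∧
    ∀ B, MeasurableSet[𝓕 t] B →
      ∫ ω in B, lsIntegral (fun u => G u ω) t T (fun u => F u ω * (R u ω)⁻¹) ∂P
        = ∫ ω in B, p T ω * dividendPart τ R G t T ω ∂P := by
  have hb := fun ω => boundedVariationOn_stopped (hGvar ω) T
  have hc : ∀ ω, Continuous fun u => G (min u T) ω := fun ω =>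
    (hGcont ω).comp (continuous_id.min continuous_const)
  have hUD := measurable_upVar_downVar (𝓕 := 𝓕) (g := fun u => G (min u T)) hb hc
    fun u => (hG _).mono (𝓕.mono (min_le_left u T)) le_rfl
  set U : Ω → StieltjesFunction ℝ≥0 := fun ω => upVar (hb ω) (hc ω) with hU
  set D : Ω → StieltjesFunction ℝ≥0 := fun ω => downVar (hb ω) (hc ω) with hD
  set h : ℝ≥0 → Ω → ℝ≥0∞ := fun u ω =>
    {u' : ℝ≥0 | (u' : ℝ≥0∞) < τ ω}.indicator (fun u' => ENNReal.ofReal (R u' ω)⁻¹) u with hdef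
  have hh : Measurable (Function.uncurry h) := measurable_alive_uncurry
    (measurable_of_measurableSet_le hτ) (measurable_uncurry_of_predictable hR)
  have hhfin : ∀ u ω, h u ω < ∞ := fun u ω => by
    simp only [hdef, indicator]; split_ifs <;> simp
  have hpm : Measurable (Function.uncurry p) := measurable_uncurry_of_rightCont
    (fun u => ((hp.1 u).mono (𝓕.le u)).measurable) fun ω => (hpc ω).1
  have hph : Measurable (Function.uncurry fun u ω => ENNReal.ofReal (p u ω) * h u ω) :=
    hpm.ennreal_ofReal.mul hh
  have hpT : Measurable fun ω => ENNReal.ofReal (p T ω) :=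
    ((hp.1 T).mono (𝓕.le T)).measurable.ennreal_ofReal
  let a : (Ω → StieltjesFunction ℝ≥0) → Ω → ℝ≥0∞ := fun W ω =>
    ∫⁻ u in Ioc t T, ENNReal.ofReal (p u ω) * h u ω ∂(W ω).measure
  let b : (Ω → StieltjesFunction ℝ≥0) → Ω → ℝ≥0∞ := fun W ω =>
    ENNReal.ofReal (p T ω) * ∫⁻ u in Ioc t T, h u ω ∂(W ω).measure
  have ham : ∀ W : Ω → StieltjesFunction ℝ≥0, (∀ u, Measurable[𝓕 u] fun ω => W ω u) →
      Measurable (a W) := fun W hW =>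
    measurable_setLIntegral_stieltjes htT (fun u _ => (hW u).mono (𝓕.le u) le_rfl) hph
  have hbm : ∀ W : Ω → StieltjesFunction ℝ≥0, (∀ u, Measurable[𝓕 u] fun ω => W ω u) →
      Measurable (b W) := fun W hW => hpT.mul
    (measurable_setLIntegral_stieltjes htT (fun u _ => (hW u).mono (𝓕.le u) le_rfl) hh)
  have hab : ∀ W : Ω → StieltjesFunction ℝ≥0, (∀ u, Measurable[𝓕 u] fun ω => W ω u) →
      ∀ B, MeasurableSet[𝓕 t] B → ∫⁻ ω in B, a W ω ∂P = ∫⁻ ω in B, b W ω ∂P := fun W hW B hB =>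
    lintegral_setLIntegral_mul_alive hp hp0 hpc hτ hR htT hW hB
  have hvar : ∀ ω, ENNReal.ofReal (p T ω) * dividendVariation τ R G t T ω = b U ω + b D ω := fun ω => by
    have h1 : dividendVariation τ R G t T ω = ∫⁻ u in Ioc t T, h u ω ∂(U ω).measure
        + ∫⁻ u in Ioc t T, h u ω ∂(D ω).measure :=
      lsVariationIntegral_eq (G := fun u => G u ω) (hb ω) (hc ω) fun u => h u ω
    rw [h1, mul_add]
  have hUm := fun u => (hUD u).1
  have hDm := fun u => (hUD u).2
  have hbfin : ∫⁻ ω, b U ω ∂P ≠ ∞ ∧ ∫⁻ ω, b D ω ∂P ≠ ∞ := by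
    simp_rw [hvar] at hfin
    rw [lintegral_add_left (hbm U hUm)] at hfin
    exact ENNReal.add_ne_top.1 hfin
  have hafin : ∀ W : Ω → StieltjesFunction ℝ≥0, (∀ u, Measurable[𝓕 u] fun ω => W ω u) →
      ∫⁻ ω, b W ω ∂P ≠ ∞ → ∫⁻ ω, a W ω ∂P ≠ ∞ := fun W hW h' => by
    have := hab W hW univ (@MeasurableSet.univ _ (𝓕 t))
    rw [Measure.restrict_univ] at this
    rwa [this]
  have haU := hafin U hUm hbfin.1
  have haD := hafin D hDm hbfin.2
  have e1 : (fun ω => lsIntegral (fun u => G u ω) t T fun u => F u ω * (R u ω)⁻¹)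
      =ᵐ[P] fun ω => (a U ω).toReal - (a D ω).toReal := by
    filter_upwards [ae_lt_top (ham U hUm) haU, ae_lt_top (ham D hDm) haD] with ω h1 h2
    have : (fun u => F u ω * (R u ω)⁻¹) = fun u => (ENNReal.ofReal (p u ω) * h u ω).toReal := by
      ext u
      rw [hF, ENNReal.toReal_mul, ENNReal.toReal_ofReal (hp0 u ω)]
      by_cases hu : (u : ℝ≥0∞) < τ ω
      · simp [hdef, hu, (hRpos u ω).le]
      · simp [hdef, hu]
    rw [this]
    exact lsIntegral_toReal (G := fun u => G u ω) (hb ω) (hc ω) (k := fun u => ENNReal.ofReal (p u ω) * h u ω)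
      (hph.comp (measurable_id.prodMk measurable_const))
      (fun u => ENNReal.mul_lt_top ENNReal.ofReal_lt_top (hhfin u ω)) h1.ne h2.ne
  have e2 : (fun ω => p T ω * dividendPart τ R G t T ω)
      =ᵐ[P] fun ω => (b U ω).toReal - (b D ω).toReal := by
    filter_upwards [ae_lt_top (hbm U hUm) hbfin.1, ae_lt_top (hbm D hDm) hbfin.2] with ω h1 h2
    simp only [b, ENNReal.toReal_mul, ENNReal.toReal_ofReal (hp0 T ω)]
    rw [← mul_sub]
    -- Finiteness is only known for the integrals multiplied by `p T`. Where `p T` vanishes the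
    -- unweighted integrals may be infinite, but both sides are then zero; elsewhere the factor can
    -- be cancelled.
    rcases (hp0 T ω).eq_or_lt with h0 | h0
    · simp [← h0]
    have hne : ENNReal.ofReal (p T ω) ≠ 0 := by simpa using h0
    congr 1
    have : (fun u => {u' : ℝ≥0 | (u' : ℝ≥0∞) < τ ω}.indicator (fun u' => (R u' ω)⁻¹) u)
        = fun u => (h u ω).toReal := by
      ext u
      by_cases hu : (u : ℝ≥0∞) < τ ω
      · simp [hdef, hu, (hRpos u ω).le]
      · simp [hdef, hu]
    rw [dividendPart, this]
    exact lsIntegral_toReal (G := fun u => G u ω) (hb ω) (hc ω) (k := fun u => h u ω)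
      (hh.comp (measurable_id.prodMk measurable_const)) (fun u => hhfin u ω)
      (ENNReal.lt_top_of_mul_ne_top_right h1.ne hne).ne
      (ENNReal.lt_top_of_mul_ne_top_right h2.ne hne).ne
  have iaU := integrable_toReal_of_lintegral_ne_top (ham U hUm).aemeasurable haU
  have iaD := integrable_toReal_of_lintegral_ne_top (ham D hDm).aemeasurable haD
  have ibU := integrable_toReal_of_lintegral_ne_top (hbm U hUm).aemeasurable hbfin.1
  have ibD := integrable_toReal_of_lintegral_ne_top (hbm D hDm).aemeasurable hbfin.2
  refine ⟨(iaU.sub iaD).congr e1.symm, (ibU.sub ibD).congr e2.symm, fun B hB => ?_⟩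
  rw [integral_congr_ae (ae_restrict_of_ae e1), integral_congr_ae (ae_restrict_of_ae e2),
    integral_sub iaU.integrableOn iaD.integrableOn, integral_sub ibU.integrableOn ibD.integrableOn,
    integral_toReal (ham U hUm).aemeasurable (ae_restrict_of_ae (ae_lt_top (ham U hUm) haU)),
    integral_toReal (ham D hDm).aemeasurable (ae_restrict_of_ae (ae_lt_top (ham D hDm) haD)),
    integral_toReal (hbm U hUm).aemeasurable (ae_restrict_of_ae (ae_lt_top (hbm U hUm) hbfin.1)),
    integral_toReal (hbm D hDm).aemeasurable (ae_restrict_of_ae (ae_lt_top (hbm D hDm) hbfin.2)),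
    hab U hUm B hB, hab D hDm B hB]

end

/-! ### Joint laws and joint measurability in the scenario and the barrier. -/

section

variable {Ω : Type*} {mΩ : MeasurableSpace Ω} {𝓕 : Filtration ℝ≥0 mΩ}
  {P : Measure Ω} [IsProbabilityMeasure P]

/-! ### Expectations of functions of the barrier and of the noisy barrier -/

lemma lintegral_comp_condDistrib {α : Type*} {mα : MeasurableSpace α} {Y : Ω → α} (hY : Measurable Y)
    {L : Ω → ℝ} (hL : Measurable L) {φ : α × ℝ → ℝ≥0∞} (hφ : Measurable φ) :
    ∫⁻ ω, φ (Y ω, L ω) ∂P = ∫⁻ ω, ∫⁻ x, φ (Y ω, x) ∂(condDistrib L Y P (Y ω)) ∂P := by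
  have h1 := compProd_map_condDistrib (mβ := mα) (X := Y) (μ := P) hL.aemeasurable
  rw [← lintegral_map hφ (hY.prodMk hL), ← h1, Measure.lintegral_compProd hφ,
    lintegral_map hφ.lintegral_kernel_prod_right' hY]

lemma lintegral_comp_withDensity {α : Type*} {mα : MeasurableSpace α} {Y : Ω → α} (hY : Measurable Y)
    {E : Ω → ℝ} (hE : Measurable E) (hind : IndepFun Y E P) {q : ℝ → ℝ≥0∞} (hq : Measurable q)
    (hqE : P.map E = volume.withDensity q) {φ : α × ℝ → ℝ≥0∞} (hφ : Measurable φ) :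
    ∫⁻ ω, φ (Y ω, E ω) ∂P = ∫⁻ ω, (∫⁻ y : ℝ, q y * φ (Y ω, y)) ∂P := by
  have h1 := (indepFun_iff_map_prod_eq_prod_map_map hY.aemeasurable hE.aemeasurable).1 hind
  have : IsProbabilityMeasure (P.map E) := Measure.isProbabilityMeasure_map hE.aemeasurable
  rw [← lintegral_map hφ (hY.prodMk hE), h1, lintegral_prod _ hφ.aemeasurable,
    lintegral_map hφ.lintegral_prod_right' hY]
  refine lintegral_congr fun ω => ?_
  have hφω : Measurable fun y => φ (Y ω, y) := hφ.comp measurable_prodMk_left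
  rw [hqE, lintegral_withDensity_eq_lintegral_mul _ hq hφω]
  rfl

variable {L : Ω → ℝ} {p : ℝ≥0 → ℝ → Ω → ℝ}

lemma IsCondDensity.measurable_ofReal (hp : IsCondDensity 𝓕 P L p) (u : ℝ≥0) :
    @Measurable (Ω × ℝ) ℝ≥0∞ ((𝓕 u).prod inferInstance) _
      (fun z => ENNReal.ofReal (p u z.2 z.1)) :=
  ENNReal.measurable_ofReal.comp (hp.measurable u)

/-- Disintegration of the law of the pair `(id, L)` when the first coordinate carries only the
σ-algebra `𝓕 u`, followed by insertion of the density. Thus `L` may be replaced by an independent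
copy at the price of the weight `p u`. -/
lemma IsCondDensity.lintegral_eq (hp : IsCondDensity 𝓕 P L p) (hL : Measurable L) (u : ℝ≥0)
    {φ : Ω × ℝ → ℝ≥0∞} (hφ : @Measurable (Ω × ℝ) ℝ≥0∞ ((𝓕 u).prod inferInstance) _ φ) :
    ∫⁻ ω, φ (ω, L ω) ∂P
      = ∫⁻ ω, ∫⁻ x, ENNReal.ofReal (p u x ω) * φ (ω, x) ∂(P.map L) ∂P := by
  have h1 := @lintegral_comp_condDistrib Ω mΩ P _ Ω (𝓕 u) id (measurable_id'' (𝓕.le u)) L hL φ hφ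
  refine Eq.trans h1 (lintegral_congr_ae ?_)
  filter_upwards [hp.density u] with ω hω
  have h2 : ∫⁻ x, φ (ω, x) ∂(condLaw P (𝓕 u) L ω)
      = ∫⁻ x, ENNReal.ofReal (p u x ω) * φ (ω, x) ∂(P.map L) := by
    have hd : Measurable fun x => ENNReal.ofReal (p u x ω) :=
      (hp.measurable_ofReal u).comp (@measurable_prodMk_left Ω ℝ (𝓕 u) _ ω)
    have hφω : Measurable fun x => φ (ω, x) := hφ.comp (@measurable_prodMk_left Ω ℝ (𝓕 u) _ ω)
    rw [hω, lintegral_withDensity_eq_lintegral_mul _ hd hφω]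
    rfl
  exact h2

/-- The joint law of the information at time `u`, the barrier and the noisy barrier. -/
lemma IsCondDensity.lintegral_noisy_eq (hp : IsCondDensity 𝓕 P L p) (hL : Measurable L)
    {E : Ω → ℝ} (hE : Measurable E)
    (hind : Indep (MeasurableSpace.comap E inferInstance)
      ((⨆ s, 𝓕 s) ⊔ MeasurableSpace.comap L inferInstance) P)
    {q : ℝ → ℝ} (hq : Measurable q)
    (hqE : P.map E = volume.withDensity fun y => ENNReal.ofReal (q y)) (u : ℝ≥0)
    {φ : (Ω × ℝ) × ℝ → ℝ≥0∞}
    (hφ : @Measurable ((Ω × ℝ) × ℝ) ℝ≥0∞ (((𝓕 u).prod inferInstance).prod inferInstance) _ φ) :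
    ∫⁻ ω, φ ((ω, L ω), L ω + E ω) ∂P = ∫⁻ ω, ∫⁻ x, (ENNReal.ofReal (p u x ω) *
      ∫⁻ z : ℝ, ENNReal.ofReal (q (z - x)) * φ ((ω, x), z)) ∂(P.map L) ∂P := by
  let m : MeasurableSpace (Ω × ℝ) := (𝓕 u).prod inferInstance
  have hY : @Measurable Ω (Ω × ℝ) mΩ m fun ω => (ω, L ω) :=
    @Measurable.prodMk Ω mΩ Ω ℝ (𝓕 u) _ _ _ (measurable_id'' (𝓕.le u)) hL
  have hle : m.comap (fun ω => (ω, L ω)) ≤ (⨆ s, 𝓕 s) ⊔ MeasurableSpace.comap L inferInstance := by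
    refine Measurable.comap_le ?_
    refine @Measurable.prodMk Ω ((⨆ s, 𝓕 s) ⊔ MeasurableSpace.comap L inferInstance) Ω ℝ (𝓕 u) _ _ _
      (measurable_id'' ((le_iSup (fun s => (𝓕 s : MeasurableSpace Ω)) u).trans le_sup_left)) ?_
    exact (comap_measurable L).mono le_sup_right le_rfl
  have hindF : @IndepFun Ω (Ω × ℝ) ℝ mΩ m _ (fun ω => (ω, L ω)) E P :=
    (indep_of_indep_of_le_right hind hle).symm
  have hadd : @Measurable ((Ω × ℝ) × ℝ) ((Ω × ℝ) × ℝ) (m.prod inferInstance) (m.prod inferInstance)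
      fun w => (w.1, w.1.2 + w.2) :=
    measurable_fst.prodMk (((@measurable_snd Ω ℝ (𝓕 u) _).comp measurable_fst).add measurable_snd)
  have h1 := @lintegral_comp_withDensity Ω mΩ P _ (Ω × ℝ) m _ hY E hE hindF
    (fun y => ENNReal.ofReal (q y)) hq.ennreal_ofReal hqE _ (hφ.comp hadd)
  have h2 : ∀ ω x, ∫⁻ y, ENNReal.ofReal (q y) * φ ((ω, x), x + y)
      = ∫⁻ z, ENNReal.ofReal (q (z - x)) * φ ((ω, x), z) := fun ω x => by
    rw [← lintegral_add_left_eq_self (fun z => ENNReal.ofReal (q (z - x)) * φ ((ω, x), z)) x]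
    simp
  have hψ : @Measurable (Ω × ℝ) ℝ≥0∞ m _ fun w => ∫⁻ z, ENNReal.ofReal (q (z - w.2)) * φ (w, z) := by
    refine @Measurable.lintegral_prod_right' (Ω × ℝ) ℝ m _ volume _
      (fun w => ENNReal.ofReal (q (w.2 - w.1.2)) * φ w) ?_
    exact ((hq.comp (measurable_snd.sub ((@measurable_snd Ω ℝ (𝓕 u) _).comp
      measurable_fst))).ennreal_ofReal).mul hφ
  refine Eq.trans h1 (Eq.trans ?_ (hp.lintegral_eq hL u hψ))
  exact lintegral_congr fun ω => h2 ω (L ω)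

end

section

/-! ### Joint measurability of the cash flows in the scenario and the barrier -/

section Joint

variable {Ω : Type*} {m : MeasurableSpace Ω} {X : ℝ≥0 → Ω → ℝ} {T : ℝ≥0}

lemma measurableSet_alive (hX : ∀ ω, IsCadlag fun s => X s ω) {u : ℝ≥0}
    (hXm : Measurable (runInf X u)) :
    MeasurableSet {z : Ω × ℝ | (u : ℝ≥0∞) < defaultTime X (fun _ => z.2) z.1} := by
  simp only [lt_defaultTime_iff hX]
  exact measurableSet_lt measurable_snd (hXm.comp measurable_fst)

/-- The cap at `T` means that only survival events up to `T` are used; this is what makes the map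
measurable with information up to `T` in the scenario. -/
lemma measurable_defaultTime_min (hX : ∀ ω, IsCadlag fun s => X s ω)
    (hXm : ∀ u ≤ T, Measurable (runInf X u)) :
    Measurable fun z : Ω × ℝ => min (defaultTime X (fun _ => z.2) z.1) (T : ℝ≥0∞) := by
  refine measurable_of_Iic fun a => ?_
  rcases le_or_gt (T : ℝ≥0∞) a with ha | ha
  · convert MeasurableSet.univ
    ext z
    simp [ha]
  · lift a to ℝ≥0 using ha.ne_top
    convert! (measurableSet_alive hX (hXm a (ENNReal.coe_lt_coe.1 ha).le)).compl using 1
    ext z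
    simp [not_le.2 ha]

lemma measurable_terminalPart (hX : ∀ ω, IsCadlag fun s => X s ω)
    (hXm : ∀ u ≤ T, Measurable (runInf X u)) {R : ℝ≥0 → Ω → ℝ} {C : Ω → ℝ} (hC : Measurable C)
    (hR : Measurable fun z : ℝ≥0 × Ω => R (min z.1 T) z.2) :
    Measurable fun z : Ω × ℝ => terminalPart (defaultTime X fun _ => z.2) R C T z.1 := by
  have hRT : Measurable (R T) := by
    simpa [Function.comp_def] using hR.comp (measurable_const (a := T) |>.prodMk measurable_id)
  have h1 := ((hC.mul hRT.inv).comp measurable_fst).indicator (measurableSet_alive hX (hXm T le_rfl))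
  exact h1

lemma measurable_recoveryPart (hX : ∀ ω, IsCadlag fun s => X s ω)
    (hXm : ∀ u ≤ T, Measurable (runInf X u)) {R Z : ℝ≥0 → Ω → ℝ}
    (hR : Measurable fun z : ℝ≥0 × Ω => R (min z.1 T) z.2)
    (hZ : Measurable fun z : ℝ≥0 × Ω => Z (min z.1 T) z.2) :
    Measurable fun z : Ω × ℝ => recoveryPart (defaultTime X fun _ => z.2) R Z T z.1 := by
  have hρ : Measurable fun z : Ω × ℝ =>
      ((min (defaultTime X (fun _ => z.2) z.1) (T : ℝ≥0∞)).toNNReal, z.1) :=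
    ((measurable_defaultTime_min hX hXm).ennreal_toNNReal).prodMk measurable_fst
  have h1 := ((hZ.comp hρ).mul (hR.comp hρ).inv).indicator
    (measurableSet_alive hX (hXm T le_rfl)).compl
  convert! h1 using 1
  ext z
  by_cases h : (T : ℝ≥0∞) < defaultTime X (fun _ => z.2) z.1
  · simp [recoveryPart, h]
  · have h2 := not_lt.1 h
    have h3 : (defaultTime X (fun _ => z.2) z.1).toNNReal ≤ T := by
      simpa using ENNReal.toNNReal_mono ENNReal.coe_ne_top h2
    simp [recoveryPart, h2, h3]

/-- The integral of `1_{u < τ} R_u⁻¹` over `(t,T]` against a Stieltjes measure. -/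
def aliveIntegral (τ : Ω → ℝ≥0∞) (R : ℝ≥0 → Ω → ℝ) (f : Ω → StieltjesFunction ℝ≥0) (t T : ℝ≥0)
    (ω : Ω) : ℝ≥0∞ :=
  ∫⁻ u in Ioc t T, {u' : ℝ≥0 | (u' : ℝ≥0∞) < τ ω}.indicator
    (fun u' => ENNReal.ofReal (R u' ω)⁻¹) u ∂(f ω).measure

lemma measurable_aliveIntegral (hX : ∀ ω, IsCadlag fun s => X s ω)
    (hXm : ∀ u ≤ T, Measurable (runInf X u)) {R : ℝ≥0 → Ω → ℝ}
    (hR : Measurable fun z : ℝ≥0 × Ω => R (min z.1 T) z.2)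
    {f : Ω → StieltjesFunction ℝ≥0} (hf : ∀ u ≤ T, Measurable fun ω => f ω u) {t : ℝ≥0}
    (htT : t ≤ T) :
    Measurable fun z : Ω × ℝ => aliveIntegral (defaultTime X fun _ => z.2) R f t T z.1 := by
  have hρ := measurable_defaultTime_min hX hXm
  have hA : MeasurableSet {w : ℝ≥0 × (Ω × ℝ) |
      ((min w.1 T : ℝ≥0) : ℝ≥0∞) < defaultTime X (fun _ => w.2.2) w.2.1} := by
    have h1 : MeasurableSet {w : ℝ≥0 × (Ω × ℝ) | ((min w.1 T : ℝ≥0) : ℝ≥0∞)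
        < min (defaultTime X (fun _ => w.2.2) w.2.1) (T : ℝ≥0∞)} :=
      measurableSet_lt (measurable_fst.min measurable_const).coe_nnreal_ennreal
        (hρ.comp measurable_snd)
    have h2 : MeasurableSet {w : ℝ≥0 × (Ω × ℝ) | (T : ℝ≥0∞) < defaultTime X (fun _ => w.2.2) w.2.1} :=
      measurable_snd (measurableSet_alive hX (hXm T le_rfl))
    convert! h1.union h2 using 1
    ext w
    simp only [Set.mem_ofPred_eq, mem_union, lt_min_iff, ENNReal.coe_lt_coe]
    constructor
    · intro h
      rcases lt_or_ge w.1 T with h' | h'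
      · exact Or.inl ⟨h, (min_le_left _ _).trans_lt h'⟩
      · rw [min_eq_right h'] at h
        exact Or.inr h
    · rintro (h | h)
      · exact h.1
      · exact lt_of_le_of_lt (by exact_mod_cast min_le_right _ _) h
  have hh : Measurable (Function.uncurry fun (u : ℝ≥0) (z : Ω × ℝ) =>
      {w : ℝ≥0 × (Ω × ℝ) | ((min w.1 T : ℝ≥0) : ℝ≥0∞)
        < defaultTime X (fun _ => w.2.2) w.2.1}.indicator
      (fun w => ENNReal.ofReal (R (min w.1 T) w.2.1)⁻¹) (u, z)) :=
    ((hR.comp (measurable_fst.prodMk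
      (measurable_fst.comp measurable_snd))).inv.ennreal_ofReal).indicator hA
  have := measurable_setLIntegral_stieltjes (f := fun z : Ω × ℝ => f z.1) htT
    (fun u hu => (hf u hu).comp measurable_fst) hh
  convert! this using 1
  ext z
  refine setLIntegral_congr_fun measurableSet_Ioc fun u hu => ?_
  simp only [indicator, Set.mem_ofPred_eq, min_eq_left hu.2]

end Joint

end

/-! ### Valuation for a known barrier. -/

section

variable {Ω : Type*} {mΩ : MeasurableSpace Ω} {𝓕 : Filtration ℝ≥0 mΩ}
  {P : Measure Ω} [IsProbabilityMeasure P]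

/-! ### The conditional value of the claim for a known barrier -/

lemma integral_mul_stopped {p : ℝ≥0 → Ω → ℝ} (hp : Martingale p 𝓕 P) (hp0 : ∀ u ω, 0 ≤ p u ω)
    (hrc : ∀ ω u, ContinuousWithinAt (fun u => p u ω) (Ici u) u) {ρ : Ω → ℝ≥0}
    (hρ : IsStoppingTime 𝓕 (fun ω => (ρ ω : WithTop ℝ≥0))) {T : ℝ≥0} (hT : ∀ ω, ρ ω ≤ T)
    {ξ : Ω → ℝ} (hξ : Measurable[hρ.measurableSpace] ξ) (hint : Integrable (fun ω => p T ω * ξ ω) P) :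
    Integrable (fun ω => p (ρ ω) ω * ξ ω) P ∧
      ∫ ω, p (ρ ω) ω * ξ ω ∂P = ∫ ω, p T ω * ξ ω ∂P := by
  have hξ' : Measurable ξ := hξ.mono hρ.measurableSpace_le le_rfl
  have hpρ : Measurable fun ω => p (ρ ω) ω :=
    (measurable_uncurry_of_rightCont (fun u => ((hp.1 u).mono (𝓕.le u)).measurable) hrc).comp
      ((measurable_of_isStoppingTime hρ).prodMk measurable_id)
  have key : ∀ s : ℝ → ℝ, Measurable s → ∫⁻ ω, ENNReal.ofReal (p (ρ ω) ω * s (ξ ω)) ∂P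
      = ∫⁻ ω, ENNReal.ofReal (p T ω * s (ξ ω)) ∂P := fun s hs => by
    simp_rw [ENNReal.ofReal_mul (hp0 _ _)]
    exact lintegral_mul_stopped hp hp0 hrc hρ hT (ENNReal.measurable_ofReal.comp (hs.comp hξ))
  have hint' : Integrable (fun ω => p (ρ ω) ω * ξ ω) P := by
    refine ⟨(hpρ.mul hξ').aestronglyMeasurable, ?_⟩
    have h1 := hint.2
    rw [hasFiniteIntegral_iff_norm] at h1 ⊢
    simp only [norm_mul, Real.norm_eq_abs, abs_of_nonneg (hp0 _ _)] at h1 ⊢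
    rwa [key _ continuous_abs.measurable]
  refine ⟨hint', ?_⟩
  rw [integral_eq_lintegral_pos_part_sub_lintegral_neg_part hint',
    integral_eq_lintegral_pos_part_sub_lintegral_neg_part hint]
  simp only [← mul_neg]
  have h1 := key _ measurable_id
  have h2 := key _ measurable_neg
  simp only [id] at h1
  rw [h1, h2]

lemma isStoppingTime_min_toNNReal {τ : Ω → ℝ≥0∞} (hτ : ∀ u : ℝ≥0, MeasurableSet[𝓕 u] {ω | τ ω ≤ u})
    (T : ℝ≥0) :
    IsStoppingTime 𝓕 (fun ω => (((min (τ ω) (T : ℝ≥0∞)).toNNReal : ℝ≥0) : WithTop ℝ≥0)) := by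
  have h : IsStoppingTime 𝓕 (fun ω => (τ ω : WithTop ℝ≥0)) := fun u => hτ u
  have h2 := h.min_const T
  convert! h2 using 2 with ω
  exact ENNReal.coe_toNNReal (ne_top_of_le_ne_top ENNReal.coe_ne_top (min_le_right _ _))

/-- The discounted cash flows after `t` of a claim with default time `τ`. -/
def cashFlow (τ : Ω → ℝ≥0∞) (R : ℝ≥0 → Ω → ℝ) (C : Ω → ℝ) (G Z : ℝ≥0 → Ω → ℝ) (t T : ℝ≥0) (ω : Ω) : ℝ :=
  terminalPart τ R C T ω + dividendPart τ R G t T ω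
    + {ω' | (t : ℝ≥0∞) < τ ω'}.indicator (recoveryPart τ R Z T) ω

/-- Term by term. The terminal terms coincide pointwise, since `F T` is `p T` on survival. In the
dividend term the density is moved to maturity by the time change. The stochastic integral has mean
minus the recovery weighted by `p` at default; the sign cancels the minus in the payoff, and
optional stopping at `τ ∧ T`, where the recovery is already known, replaces that weight by `p T`. -/
theorem setIntegral_managerPayoff (hrc : 𝓕.IsRightContinuous) (hcompl : IsCompleteFiltration 𝓕 P)
    {p F : ℝ≥0 → Ω → ℝ} (hp : Martingale p 𝓕 P)
    (hp0 : ∀ u ω, 0 ≤ p u ω) (hpc : ∀ ω, IsCadlag fun u => p u ω)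
    {τ : Ω → ℝ≥0∞} (hτ : ∀ u : ℝ≥0, MeasurableSet[𝓕 u] {ω | τ ω ≤ u})
    (hF : ∀ u ω, F u ω = if (u : ℝ≥0∞) < τ ω then p u ω else 0)
    {R : ℝ≥0 → Ω → ℝ} (hR : IsStronglyPredictable 𝓕 R) (hRpos : ∀ s ω, 0 < R s ω)
    {t T : ℝ≥0} (htT : t ≤ T) {C : Ω → ℝ} {G : ℝ≥0 → Ω → ℝ} (hG : ∀ s, Measurable[𝓕 s] (G s))
    (hGcont : ∀ ω, Continuous fun s => G s ω)
    (hGvar : ∀ ω, LocallyBoundedVariationOn (fun s => G s ω) univ)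
    {Z : ℝ≥0 → Ω → ℝ} (hZ : IsStronglyPredictable 𝓕 Z)
    {I : ℝ≥0 → Ω → ℝ} (hI : IsStochIntegral 𝓕 P F (recoveryIntegrand R Z t T) I)
    (hD : IsClassD 𝓕 P T I)
    (hCint : Integrable (fun ω => p T ω * terminalPart τ R C T ω) P)
    (hGint : ∫⁻ ω, ENNReal.ofReal (p T ω) * dividendVariation τ R G t T ω ∂P ≠ ∞)
    (hZint : Integrable (fun ω => p T ω *
      {ω' | (t : ℝ≥0∞) < τ ω'}.indicator (recoveryPart τ R Z T) ω) P) :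
    Integrable (managerPayoff F R C G I t T) P ∧
    Integrable (fun ω => p T ω * cashFlow τ R C G Z t T ω) P ∧
    ∀ B, MeasurableSet[𝓕 t] B → ∫ ω in B, managerPayoff F R C G I t T ω ∂P
      = ∫ ω in B, p T ω * cashFlow τ R C G Z t T ω ∂P := by
  obtain ⟨hd1, hd2, hd3⟩ := setIntegral_dividend hp hp0 hpc hτ hF hR hRpos htT hG hGcont hGvar hGint
  set H := recoveryIntegrand R Z t T with hH
  set Y : Ω → ℝ := {ω' | (t : ℝ≥0∞) < τ ω'}.indicator (recoveryPart τ R Z T) with hY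
  have hτm := measurable_of_measurableSet_le hτ
  let ρ : Ω → ℝ≥0 := fun ω => (min (τ ω) (T : ℝ≥0∞)).toNNReal
  have hρ : IsStoppingTime 𝓕 (fun ω => (ρ ω : WithTop ℝ≥0)) := isStoppingTime_min_toNNReal hτ T
  have hρT : ∀ ω, ρ ω ≤ T := fun ω => by
    simpa using ENNReal.toNNReal_mono ENNReal.coe_ne_top (min_le_right (τ ω) (T : ℝ≥0∞))
  have hρτ : ∀ ω, τ ω ≤ T → ρ ω = (τ ω).toNNReal := fun ω h => by
    simp only [ρ, min_eq_left h]
  -- the recovery payment is known at default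
  have hYm : ∀ B, MeasurableSet[𝓕 t] B → Measurable[hρ.measurableSpace] (B.indicator Y) := by
    intro B hB
    have h1 : MeasurableSet[hρ.measurableSpace] {ω | τ ω ≤ (ρ ω : ℝ≥0∞)} := by
      have := (measurableSet_lt_stopped hτ hρ).compl
      convert! this using 1
      ext ω
      exact (not_lt (a := (ρ ω : ℝ≥0∞)) (b := τ ω)).symm
    have h2 : MeasurableSet[hρ.measurableSpace] (B ∩ {ω | t < ρ ω}) := by
      have hlt : ∀ u, MeasurableSet[𝓕 u] {ω | ρ ω ≤ u} := fun u => by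
        have := hρ u
        simpa only [WithTop.coe_le_coe] using this
      have h3 : MeasurableSet[𝓕 t] {ω | t < ρ ω} := by
        have := (hlt t).compl
        convert! this using 1
        ext ω; exact (not_le (a := ρ ω) (b := t)).symm
      refine ⟨le_iSup (fun u => (𝓕 u : MeasurableSpace Ω)) t _ (hB.inter h3), fun u => ?_⟩
      rcases le_or_gt t u with hu | hu
      · exact (𝓕.mono hu _ (hB.inter h3)).inter (hρ u)
      · convert! MeasurableSet.empty
        ext ω
        simp only [mem_inter_iff, Set.mem_ofPred_eq, WithTop.coe_le_coe, mem_empty_iff_false,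
          iff_false, not_and, not_le]
        exact fun h => hu.trans h.2
    have h4 := ((measurable_stopped hZ hρ).mul (measurable_stopped hR hρ).inv).indicator (h1.inter h2)
    convert! h4 using 1
    ext ω
    by_cases hB' : ω ∈ B
    swap
    · simp [hB']
    by_cases hT : τ ω ≤ T
    · have h5 : (ρ ω : ℝ≥0∞) = τ ω := by
        rw [hρτ ω hT, ENNReal.coe_toNNReal (ne_top_of_le_ne_top ENNReal.coe_ne_top hT)]
      have h6 : t < ρ ω ↔ (t : ℝ≥0∞) < τ ω := by rw [← h5, ENNReal.coe_lt_coe]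
      by_cases ht : (t : ℝ≥0∞) < τ ω
      · rw [indicator_of_mem (show ω ∈ {ω | τ ω ≤ (ρ ω : ℝ≥0∞)} ∩ (B ∩ {ω | t < ρ ω}) from
          ⟨h5.ge, hB', h6.2 ht⟩)]
        simp [hB', hY, recoveryPart, hT, ht, hρτ ω hT]
      · simp [hB', hY, ht, mt h6.1 ht]
    · have h5 : ¬ τ ω ≤ (ρ ω : ℝ≥0∞) := fun h => hT (h.trans (by exact_mod_cast hρT ω))
      simp [hB', hY, recoveryPart, hT, h5, indicator]
  -- The factor `1_{(t,T]}` of the integrand becomes the event `t < τ` in `Y`. On `{τ ≤ T}` the time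
  -- `ρ` is `τ`; off it both sides vanish.
  have hjump : ∀ ω, jumpAt τ (fun _ => T) p H ω = p (ρ ω) ω * Y ω := fun ω => by
    by_cases hT : τ ω ≤ T
    · have h5 : ((τ ω).toNNReal : ℝ≥0∞) = τ ω :=
        ENNReal.coe_toNNReal (ne_top_of_le_ne_top ENNReal.coe_ne_top hT)
      have h7 : (τ ω).toNNReal ≤ T := by
        simpa using ENNReal.toNNReal_mono ENNReal.coe_ne_top hT
      have h6 : t < (τ ω).toNNReal ↔ (t : ℝ≥0∞) < τ ω := by rw [← ENNReal.coe_lt_coe, h5]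
      by_cases ht : (t : ℝ≥0∞) < τ ω
      · simp [jumpAt, hT, hY, ht, recoveryPart, hH, recoveryIntegrand, h6.2 ht, hρτ ω hT, h7, mul_comm]
      · simp [jumpAt, hT, hY, ht, hH, recoveryIntegrand, mt h6.1 ht]
    · simp [jumpAt, hT, hY, recoveryPart, indicator]
  have hYall : ∀ B, MeasurableSet[𝓕 t] B → Integrable (fun ω => p (ρ ω) ω * B.indicator Y ω) P ∧
      ∫ ω, p (ρ ω) ω * B.indicator Y ω ∂P = ∫ ω, p T ω * B.indicator Y ω ∂P := fun B hB => by
    refine integral_mul_stopped hp hp0 (fun ω => (hpc ω).1) hρ hρT (hYm B hB) ?_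
    convert! hZint.indicator (𝓕.le t _ hB) using 1
    ext ω
    by_cases h : ω ∈ B <;> simp [h, hY]
  have hjint : Integrable (jumpAt τ (fun _ => T) p H) P := by
    have h1 := (hYall univ (@MeasurableSet.univ _ (𝓕 t))).1
    simp only [indicator_univ] at h1
    exact h1.congr (ae_of_all _ fun ω => (hjump ω).symm)
  obtain ⟨hI1, hI2⟩ := hI.setIntegral_eq hrc hcompl hp hp0 hpc hτ hF hD (t := t) (fun u hu ω => by
    simp [hH, recoveryIntegrand, not_lt.2 hu]) hjint
  have hC' : (fun ω => C ω * (R T ω)⁻¹ * F T ω) = fun ω => p T ω * terminalPart τ R C T ω := by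
    ext ω
    rw [hF]
    by_cases h : (T : ℝ≥0∞) < τ ω <;> simp [terminalPart, h, mul_comm]
  have hC1 : Integrable (fun ω => C ω * (R T ω)⁻¹ * F T ω) P := by rwa [hC']
  have hsum : (fun ω => p T ω * cashFlow τ R C G Z t T ω) = fun ω =>
      p T ω * terminalPart τ R C T ω + p T ω * dividendPart τ R G t T ω + p T ω * Y ω := by
    ext ω
    simp only [cashFlow, hY]
    ring
  refine ⟨(hC1.add hd1).sub hI1, ?_, fun B hB => ?_⟩
  · rw [hsum]
    exact (hCint.add hd2).add hZint
  · have hBm := 𝓕.le t _ hB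
    have a1 : Integrable (fun ω => C ω * (R T ω)⁻¹ * F T ω
        + lsIntegral (fun u => G u ω) t T fun u => F u ω * (R u ω)⁻¹) P := hC1.add hd1
    have a2 : Integrable (fun ω => p T ω * terminalPart τ R C T ω
        + p T ω * dividendPart τ R G t T ω) P := hCint.add hd2
    have hjB : ∫ ω in B, jumpAt τ (fun _ => T) p H ω ∂P = ∫ ω in B, p T ω * Y ω ∂P := by
      have h2 := (hYall B hB).2
      rw [← integral_indicator hBm, ← integral_indicator hBm]
      refine Eq.trans (integral_congr_ae (ae_of_all _ fun ω => ?_)) (h2.trans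
        (integral_congr_ae (ae_of_all _ fun ω => ?_)))
      · by_cases h : ω ∈ B <;> simp [h, hjump]
      · by_cases h : ω ∈ B <;> simp [h]
    rw [hsum]
    simp only [managerPayoff]
    rw [integral_sub a1.integrableOn hI1.integrableOn, integral_add hC1.integrableOn hd1.integrableOn,
      integral_add a2.integrableOn hZint.integrableOn, integral_add hCint.integrableOn
      hd2.integrableOn, hI2 B hB, hd3 B hB, hjB, hC', sub_neg_eq_add]

end

/-! ### A jointly measurable version of a family of conditional expectations. -/

section

variable {Ω : Type*} {m mΩ : MeasurableSpace Ω} {P : Measure Ω} [IsProbabilityMeasure P]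
  {μ : Measure ℝ} [IsProbabilityMeasure μ]

/-! ### Conditional expectations depending on a parameter -/

lemma ae_section_of_ae_prod {r : Ω × ℝ → Prop} (h : ∀ᵐ z ∂(P.prod μ), r z) :
    ∀ᵐ x ∂μ, ∀ᵐ ω ∂P, r (ω, x) := by
  rw [← Measure.prod_swap] at h
  exact Measure.ae_ae_of_ae_prod (ae_of_ae_map measurable_swap.aemeasurable h)

/-- For almost every `x`, the section at `x` of the conditional expectation of `f` given `m ⊗ B(ℝ)` is
the conditional expectation of the section of `f`. -/
def HasCondExpSections {Ω : Type*} (m : MeasurableSpace Ω) {mΩ : MeasurableSpace Ω} (P : Measure Ω)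
    (μ : Measure ℝ) (f : Ω × ℝ → ℝ) : Prop :=
  ∀ᵐ x ∂μ, (fun ω => ((P.prod μ)[f | m.prod inferInstance]) (ω, x)) =ᵐ[P] P[fun ω => f (ω, x) | m]

variable {f g : Ω × ℝ → ℝ}

lemma HasCondExpSections.congr (hf : HasCondExpSections m P μ f) (hfg : f =ᵐ[P.prod μ] g) :
    HasCondExpSections m P μ g := by
  filter_upwards [hf, ae_section_of_ae_prod hfg,
    ae_section_of_ae_prod (condExp_congr_ae (m := m.prod inferInstance) hfg)] with x h1 h2 h3
  filter_upwards [h1, condExp_congr_ae (m := m) h2, h3] with ω h4 h5 h6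
  rw [← h6, h4, h5]

lemma HasCondExpSections.add (hf : HasCondExpSections m P μ f) (hg : HasCondExpSections m P μ g)
    (hfi : Integrable f (P.prod μ)) (hgi : Integrable g (P.prod μ)) :
    HasCondExpSections m P μ (f + g) := by
  filter_upwards [hf, hg, ae_section_of_ae_prod (condExp_add hfi hgi (m.prod inferInstance)),
    hfi.prod_left_ae, hgi.prod_left_ae] with x h1 h2 h3 h4 h5
  filter_upwards [h1, h2, h3, condExp_add h4 h5 m] with ω h6 h7 h8 h9
  rw [h8, Pi.add_apply, h6, h7]
  exact h9.symm

lemma HasCondExpSections.smul (c : ℝ) (hf : HasCondExpSections m P μ f) :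
    HasCondExpSections m P μ (c • f) := by
  filter_upwards [hf, ae_section_of_ae_prod (condExp_smul (μ := P.prod μ) c f (m.prod inferInstance))]
    with x h1 h3
  filter_upwards [h1, h3, condExp_smul (μ := P) c (fun ω => f (ω, x)) m] with ω h6 h8 h9
  rw [h8, Pi.smul_apply, h6]
  exact h9.symm

lemma lintegral_enorm_condExp_sub_le {α : Type*} {mα : MeasurableSpace α} {ν : Measure α}
    {m' : MeasurableSpace α} {u v : α → ℝ} (hu : Integrable u ν) (hv : Integrable v ν) :
    ∫⁻ z, ‖(ν[u | m']) z - (ν[v | m']) z‖ₑ ∂ν ≤ ∫⁻ z, ‖u z - v z‖ₑ ∂ν := by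
  have h := eLpNorm_condExp_le_eLpNorm (μ := ν) (m := m') (u - v) le_rfl
  rw [eLpNorm_one_eq_lintegral_enorm, eLpNorm_one_eq_lintegral_enorm] at h
  refine (lintegral_congr_ae ?_).le.trans h
  filter_upwards [condExp_sub hu hv m'] with z hz
  rw [hz, Pi.sub_apply]

/-- Conditional expectation contracts `L¹` both on the product space and in each section. Fatou's
lemma in `x` turns convergence of the mean sectional error into a vanishing error for almost every
`x`, with no passage to a subsequence. -/
lemma HasCondExpSections.of_tendsto (hm : m ≤ mΩ) {f : ℕ → Ω × ℝ → ℝ}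
    (hf : ∀ n, HasCondExpSections m P μ (f n)) (hfi : ∀ n, Integrable (f n) (P.prod μ))
    (hgi : Integrable g (P.prod μ))
    (hlim : Tendsto (fun n => ∫⁻ z, ‖f n z - g z‖ₑ ∂(P.prod μ)) atTop (𝓝 0)) :
    HasCondExpSections m P μ g := by
  have hm' : m.prod inferInstance ≤ (inferInstance : MeasurableSpace (Ω × ℝ)) :=
    sup_le_sup (MeasurableSpace.comap_mono hm) le_rfl
  let E : (Ω × ℝ → ℝ) → Ω × ℝ → ℝ := fun u => (P.prod μ)[u | m.prod inferInstance]
  have hE : ∀ u, Measurable (E u) := fun u => (stronglyMeasurable_condExp.mono hm').measurable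
  let Φ : ℕ → ℝ → ℝ≥0∞ := fun n x =>
    ∫⁻ ω, ‖E (f n) (ω, x) - E g (ω, x)‖ₑ ∂P + ∫⁻ ω, ‖f n (ω, x) - g (ω, x)‖ₑ ∂P
  have hm1 : ∀ n, AEMeasurable (fun z => ‖E (f n) z - E g z‖ₑ) (P.prod μ) := fun n =>
    ((hE _).sub (hE _)).enorm.aemeasurable
  have hm2 : ∀ n, AEMeasurable (fun z => ‖f n z - g z‖ₑ) (P.prod μ) := fun n =>
    ((hfi n).1.sub hgi.1).enorm
  have hΦm : ∀ n, AEMeasurable (Φ n) μ := fun n =>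
    (hm1 n).lintegral_prod_left'.add (hm2 n).lintegral_prod_left'
  have hΦ : ∀ n, ∫⁻ x, Φ n x ∂μ ≤ 2 * ∫⁻ z, ‖f n z - g z‖ₑ ∂(P.prod μ) := fun n => by
    rw [lintegral_add_left' (hm1 n).lintegral_prod_left', ← lintegral_prod_symm _ (hm1 n),
      ← lintegral_prod_symm _ (hm2 n), two_mul]
    exact add_le_add_left (lintegral_enorm_condExp_sub_le (hfi n) hgi) _
  have h0 : Tendsto (fun n => ∫⁻ x, Φ n x ∂μ) atTop (𝓝 0) := by
    refine tendsto_of_tendsto_of_tendsto_of_le_of_le tendsto_const_nhds ?_ (fun _ => zero_le) hΦ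
    simpa using ENNReal.Tendsto.const_mul hlim (Or.inr (by simp))
  -- The sectional errors are only almost everywhere measurable in `x`, since the `f n` and `g` are;
  -- they are replaced by measurable modifications.
  have h1 : ∫⁻ x, liminf (fun n => (hΦm n).mk (Φ n) x) atTop ∂μ = 0 := by
    refine le_antisymm ((lintegral_liminf_le fun n => (hΦm n).measurable_mk).trans ?_) zero_le
    simp_rw [fun n => (lintegral_congr_ae (hΦm n).ae_eq_mk).symm]
    exact h0.liminf_eq.le
  rw [lintegral_eq_zero_iff (Measurable.liminf fun n => (hΦm n).measurable_mk)] at h1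
  filter_upwards [h1, ae_all_iff.2 fun n => (hΦm n).ae_eq_mk, ae_all_iff.2 hf, ae_all_iff.2 fun n => (hfi n).prod_left_ae, hgi.prod_left_ae]
    with x h2 h7 h3 h4 h5
  have h6 : ∫⁻ ω, ‖E g (ω, x) - (P[fun ω => g (ω, x) | m]) ω‖ₑ ∂P = 0 := by
    refine le_antisymm ?_ zero_le
    rw [← (show liminf (fun n => (hΦm n).mk (Φ n) x) atTop = 0 from h2)]
    simp_rw [← h7]
    refine le_liminf_of_le (by isBoundedDefault) (Eventually.of_forall fun n => ?_)
    calc ∫⁻ ω, ‖E g (ω, x) - (P[fun ω => g (ω, x) | m]) ω‖ₑ ∂P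
        ≤ ∫⁻ ω, (‖E (f n) (ω, x) - E g (ω, x)‖ₑ
          + ‖(P[fun ω => f n (ω, x) | m]) ω - (P[fun ω => g (ω, x) | m]) ω‖ₑ) ∂P := by
          refine lintegral_mono_ae ?_
          filter_upwards [h3 n] with ω hω
          rw [← hω, ← enorm_neg (E (f n) (ω, x) - E g (ω, x))]
          refine le_trans (le_of_eq ?_) (enorm_add_le _ _)
          congr 1
          simp only [E]
          ring
      _ ≤ Φ n x := by
          rw [lintegral_add_left]
          · exact add_le_add_right (lintegral_enorm_condExp_sub_le (h4 n) h5) _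
          · exact (((hE _).comp measurable_prodMk_right).sub
              ((hE _).comp measurable_prodMk_right)).enorm
  have h8 : AEMeasurable (fun ω => ‖E g (ω, x) - (P[fun ω => g (ω, x) | m]) ω‖ₑ) P :=
    (((hE g).comp measurable_prodMk_right).aestronglyMeasurable.sub integrable_condExp.1).enorm
  rw [lintegral_eq_zero_iff' h8] at h6
  filter_upwards [h6] with ω hω
  simpa [sub_eq_zero] using hω

/-- For a product indicator the answer is explicit: the conditional expectation of the scenario
factor times the barrier factor. It is verified by Fubini, since each section of a set in `m ⊗ B(ℝ)`
lies in `m`. -/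
lemma hasCondExpSections_rectangle (hm : m ≤ mΩ) {A : Set Ω} (hA : MeasurableSet A) {B : Set ℝ}
    (hB : MeasurableSet B) :
    HasCondExpSections m P μ ((A ×ˢ B).indicator fun _ => 1) := by
  have hm' : m.prod inferInstance ≤ (inferInstance : MeasurableSpace (Ω × ℝ)) :=
    sup_le_sup (MeasurableSpace.comap_mono hm) le_rfl
  let w₀ : Ω → ℝ := P[A.indicator fun _ => (1 : ℝ) | m]
  let w : Ω × ℝ → ℝ := fun z => w₀ z.1 * B.indicator (fun _ => 1) z.2
  have hAi : Integrable (A.indicator fun _ => (1 : ℝ)) P := (integrable_const 1).indicator hA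
  have hBi : Integrable (B.indicator fun _ => (1 : ℝ)) μ := (integrable_const 1).indicator hB
  have hwi : Integrable w (P.prod μ) := Integrable.mul_prod integrable_condExp hBi
  have hri : Integrable ((A ×ˢ B).indicator fun _ => (1 : ℝ)) (P.prod μ) :=
    (integrable_const 1).indicator (hA.prod hB)
  have hprod : ∀ ω x, (A ×ˢ B).indicator (fun _ => (1 : ℝ)) (ω, x)
      = A.indicator (fun _ => 1) ω * B.indicator (fun _ => 1) x := fun ω x => by
    by_cases h1 : ω ∈ A <;> by_cases h2 : x ∈ B <;> simp [h1, h2]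
  have hw : w =ᵐ[P.prod μ] (P.prod μ)[(A ×ˢ B).indicator fun _ => 1 | m.prod inferInstance] := by
    refine ae_eq_condExp_of_forall_setIntegral_eq hm' hri (fun _ _ _ => hwi.integrableOn)
      (fun S hS _ => ?_) ?_
    · have hS' := hm' S hS
      rw [← integral_indicator hS', ← integral_indicator hS', integral_prod_symm _
        (hwi.indicator hS'), integral_prod_symm _ (hri.indicator hS')]
      refine integral_congr_ae (ae_of_all _ fun x => ?_)
      have hSx : MeasurableSet[m] ((fun ω => (ω, x)) ⁻¹' S) := @measurable_prodMk_right Ω ℝ m _ x S hS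
      have e : ∀ k : Ω → ℝ, ∫ ω, S.indicator (fun z => k z.1 * B.indicator (fun _ => 1) z.2) (ω, x) ∂P
          = (∫ ω in (fun ω => (ω, x)) ⁻¹' S, k ω ∂P) * B.indicator (fun _ => 1) x := fun k => by
        rw [← integral_mul_const, ← integral_indicator (hm _ hSx)]
        rfl
      have e1 := e w₀
      have e2 := e (A.indicator fun _ => 1)
      simp only [← hprod] at e2
      exact e1.trans ((congrArg (· * _) (setIntegral_condExp hm hAi hSx)).trans e2.symm)
    · exact ((stronglyMeasurable_condExp.comp_measurable (@measurable_fst Ω ℝ m _)).mul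
        ((stronglyMeasurable_const.indicator hB).comp_measurable
          (@measurable_snd Ω ℝ m _))).aestronglyMeasurable
  filter_upwards [ae_section_of_ae_prod hw] with x hx
  have h2 : (fun ω => (A ×ˢ B).indicator (fun _ => (1 : ℝ)) (ω, x))
      = B.indicator (fun _ => (1 : ℝ)) x • A.indicator fun _ => (1 : ℝ) := by
    ext ω
    rw [hprod, Pi.smul_apply, smul_eq_mul, mul_comm]
  rw [h2]
  filter_upwards [hx, condExp_smul (μ := P) (B.indicator (fun _ => (1 : ℝ)) x)
    (A.indicator fun _ => (1 : ℝ)) m] with ω h3 h4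
  rw [← h3, h4, Pi.smul_apply, smul_eq_mul, mul_comm]

lemma hasCondExpSections_indicator (hm : m ≤ mΩ) {S : Set (Ω × ℝ)} (hS : MeasurableSet S) :
    HasCondExpSections m P μ (S.indicator fun _ => 1) := by
  have hi : ∀ {S : Set (Ω × ℝ)}, MeasurableSet S →
      Integrable (S.indicator fun _ => (1 : ℝ)) (P.prod μ) := fun hS =>
    (integrable_const 1).indicator hS
  induction S, hS using MeasurableSpace.induction_on_inter generateFrom_prod.symm isPiSystem_prod with
  | empty =>
    have := hasCondExpSections_rectangle (P := P) (μ := μ) hm MeasurableSet.empty MeasurableSet.univ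
    simpa using this
  | basic S hS =>
    obtain ⟨A, hA, B, hB, rfl⟩ := hS
    exact hasCondExpSections_rectangle hm hA hB
  | compl S hS ih =>
    have h1 := hasCondExpSections_rectangle (P := P) (μ := μ) hm MeasurableSet.univ MeasurableSet.univ
    convert! h1.add (ih.smul (-1)) (hi (MeasurableSet.univ.prod MeasurableSet.univ))
      ((hi hS).smul (-1)) using 1
    ext z
    by_cases h : z ∈ S <;> simp [h]
  | iUnion f hd hf ih =>
    have hpart : ∀ n, HasCondExpSections m P μ ((⋃ i < n, f i).indicator fun _ => 1) := by
      intro n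
      induction n with
      | zero =>
        have := hasCondExpSections_rectangle (P := P) (μ := μ) hm MeasurableSet.empty
          MeasurableSet.univ
        simpa using this
      | succ n ihn =>
        convert! ihn.add (ih n) (hi (MeasurableSet.biUnion (to_countable _) fun i _ => hf i))
          (hi (hf n)) using 1
        rw [show (⋃ i < n + 1, f i) = (⋃ i < n, f i) ∪ f n from by
          rw [Set.biUnion_lt_succ], indicator_union_of_disjoint]
        · rfl
        · rw [disjoint_iUnion₂_left]
          exact fun i hin => hd hin.ne
    have hUm : ∀ n, MeasurableSet (⋃ i < n, f i) := fun n =>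
      MeasurableSet.biUnion (to_countable _) fun i _ => hf i
    refine HasCondExpSections.of_tendsto hm hpart (fun n => hi (hUm n)) (hi (MeasurableSet.iUnion hf)) ?_
    have hlim := tendsto_lintegral_of_dominated_convergence (μ := P.prod μ) (fun _ => (2 : ℝ≥0∞))
      (F := fun n z => ‖(⋃ i < n, f i).indicator (fun _ => (1 : ℝ)) z
        - (⋃ i, f i).indicator (fun _ => 1) z‖ₑ) (f := fun _ => 0)
      (fun n => ((measurable_const.indicator (hUm n)).sub
        (measurable_const.indicator (MeasurableSet.iUnion hf))).enorm)
      (fun n => ae_of_all _ fun z => ?_) (by simp) (ae_of_all _ fun z => ?_)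
    · simpa using hlim
    · simp only [indicator]
      split_ifs <;> simp [← ofReal_norm]
    · refine tendsto_const_nhds.congr' ?_
      by_cases hz : z ∈ ⋃ i, f i
      · obtain ⟨j, hj⟩ := mem_iUnion.1 hz
        filter_upwards [eventually_gt_atTop j] with n hn
        rw [indicator_of_mem hz, indicator_of_mem (mem_iUnion₂.2 ⟨j, hn, hj⟩)]
        simp
      · refine Eventually.of_forall fun n => ?_
        have : z ∉ ⋃ i < n, f i := fun h => hz (by
          obtain ⟨i, -, hi⟩ := mem_iUnion₂.1 h
          exact mem_iUnion.2 ⟨i, hi⟩)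
        simp only [indicator_of_notMem hz, indicator_of_notMem this]
        simp

/-- Conditional expectations given `m` are chosen separately for each `x`, with no measurability in
`x`. One conditional expectation on the product space supplies a jointly measurable choice; this
produces the manager's value as a function of the barrier. -/
theorem hasCondExpSections (hm : m ≤ mΩ) (hf : Integrable f (P.prod μ)) :
    HasCondExpSections m P μ f := by
  refine Integrable.induction (HasCondExpSections m P μ) (fun c S hS _ => ?_)
    (fun f g _ hf hg h1 h2 => h1.add h2 hf hg) ?_ (fun f g hfg _ h => h.congr hfg) hf
  · convert! (hasCondExpSections_indicator (P := P) (μ := μ) hm hS).smul c using 1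
    ext z
    by_cases h : z ∈ S <;> simp [h]
  · refine IsSeqClosed.isClosed fun u v hu huv => ?_
    refine HasCondExpSections.of_tendsto hm hu (fun n => L1.integrable_coeFn (u n))
      (L1.integrable_coeFn v) ?_
    have h := (Lp.tendsto_Lp_iff_tendsto_eLpNorm' u v).1 huv
    simpa only [eLpNorm_one_eq_lintegral_enorm, Pi.sub_apply] using h

end

/-! ### The structure of the insider's information. -/

section

variable {Ω : Type*} {mΩ : MeasurableSpace Ω} {𝓕 : Filtration ℝ≥0 mΩ}
  {P : Measure Ω} [IsProbabilityMeasure P]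

/-! ### The insider's information -/

/-- The sets whose trace on `S` is the trace of a set of `m₁` form a σ-algebra. It contains `m₁`,
and also `m₂`, whose sets have empty or full trace on `S`. -/
lemma exists_trace_eq {m₁ m₂ : MeasurableSpace Ω} {S : Set Ω}
    (h : ∀ D, MeasurableSet[m₂] D → D ∩ S = ∅ ∨ S ⊆ D) {A : Set Ω} (hA : MeasurableSet[m₁ ⊔ m₂] A) :
    ∃ A', MeasurableSet[m₁] A' ∧ A ∩ S = A' ∩ S := by
  have hle : m₁ ⊔ m₂ ≤ (m₁.comap (Subtype.val : S → Ω)).map (Subtype.val : S → Ω) := by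
    refine sup_le (fun D hD => ⟨D, hD, rfl⟩) fun D hD => ?_
    rcases h D hD with h' | h'
    · refine ⟨∅, MeasurableSpace.measurableSet_empty _, ?_⟩
      ext ω
      simp only [preimage_empty, mem_empty_iff_false, mem_preimage, false_iff]
      exact fun hω => (h'.subset ⟨hω, ω.2⟩ : _ ∈ (∅ : Set Ω))
    · refine ⟨univ, @MeasurableSet.univ _ m₁, ?_⟩
      ext ω
      simp only [preimage_univ, mem_univ, mem_preimage, true_iff]
      exact h' ω.2
  obtain ⟨A', hA', h'⟩ := hle A hA
  refine ⟨A', hA', ?_⟩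
  have := Subtype.preimage_coe_eq_preimage_coe_iff.1 h'
  rw [inter_comm A, inter_comm A', this]

/-- Given two scenarios alive at `t`, choose `u` strictly between `t` and both default times. Then
`τ ∧ u` takes the value `u` in both, so no event of `σ(τ ∧ u)` separates them. -/
lemma sigmaD_trivial {τ : Ω → ℝ≥0∞} {t : ℝ≥0} {D : Set Ω} (hD : MeasurableSet[sigmaD τ t] D) :
    D ∩ {ω | (t : ℝ≥0∞) < τ ω} = ∅ ∨ {ω | (t : ℝ≥0∞) < τ ω} ⊆ D := by
  rw [or_iff_not_imp_left]
  intro hne ω hω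
  obtain ⟨ω₀, h0, h0'⟩ := nonempty_iff_ne_empty.2 hne
  obtain ⟨u, hu1, hu2⟩ := ENNReal.lt_iff_exists_nnreal_btwn.1 (lt_min h0' hω)
  simp only [MeasurableSpace.measurableSet_iInf] at hD
  obtain ⟨E, -, hE⟩ := hD u (ENNReal.coe_lt_coe.1 hu1)
  rw [← hE] at h0 ⊢
  simp only [mem_preimage] at h0 ⊢
  rw [min_eq_right (hu2.trans_le (min_le_left _ _)).le] at h0
  rwa [min_eq_right (hu2.trans_le (min_le_right _ _)).le]

lemma measurableSet_sigmaD (τ : Ω → ℝ≥0∞) (t : ℝ≥0) :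
    MeasurableSet[sigmaD τ t] {ω | (t : ℝ≥0∞) < τ ω} := by
  simp only [MeasurableSpace.measurableSet_iInf]
  intro u hu
  refine ⟨Ioi (t : ℝ≥0∞), measurableSet_Ioi, ?_⟩
  ext ω
  simp [hu]

lemma sigmaD_le {τ : Ω → ℝ≥0∞} (hτ : Measurable τ) (t : ℝ≥0) : sigmaD τ t ≤ mΩ :=
  (iInf₂_le (t + 1) (lt_add_one t)).trans (hτ.min measurable_const).comap_le

variable {L : Ω → ℝ} {ε : ℝ≥0 → Ω → ℝ}

lemma sigmaFI_le (hL : Measurable L) (hε : ∀ s, Measurable (ε s)) (t : ℝ≥0) : sigmaFI 𝓕 L ε t ≤ mΩ :=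
  sup_le (𝓕.le t) (iSup₂_le fun s _ => (hL.add (hε s)).comap_le)

/-- The σ-algebra of the increments `ε_s - ε_t`, `s ≤ t`. -/
@[reducible] def sigmaInc (ε : ℝ≥0 → Ω → ℝ) (t : ℝ≥0) : MeasurableSpace Ω :=
  ⨆ (s : ℝ≥0) (_ : s ≤ t), MeasurableSpace.comap (fun ω => ε s ω - ε t ω) inferInstance

/-- All past observations are recovered from the current one through `L_s = L_t + (ε_s - ε_t)`,
which isolates the increments as the part that carries no information on the claim. -/
lemma sigmaFI_le_sup (t : ℝ≥0) : sigmaFI 𝓕 L ε t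
    ≤ 𝓕 t ⊔ MeasurableSpace.comap (fun ω => L ω + ε t ω) inferInstance ⊔ sigmaInc ε t := by
  refine sup_le (le_sup_left.trans le_sup_left) (iSup₂_le fun s hs => ?_)
  have h1 : Measurable[𝓕 t ⊔ MeasurableSpace.comap (fun ω => L ω + ε t ω) inferInstance ⊔ sigmaInc ε t]
      fun ω => L ω + ε t ω :=
    (comap_measurable _).mono (le_sup_right.trans le_sup_left) le_rfl
  have h2 : Measurable[𝓕 t ⊔ MeasurableSpace.comap (fun ω => L ω + ε t ω) inferInstance ⊔ sigmaInc ε t]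
      fun ω => ε s ω - ε t ω :=
    (comap_measurable _).mono ((le_iSup₂ (f := fun (s : ℝ≥0) (_ : s ≤ t) =>
      MeasurableSpace.comap (fun ω => ε s ω - ε t ω) inferInstance) s hs).trans le_sup_right) le_rfl
  convert! (h1.add h2).comap_le using 2
  ext ω
  simp

/-- On the π-system of intersections `H ∩ K`, with `H` in `𝓗` and `K` generated by `ε t`, the
probability factorizes in two stages: `𝓗` is independent of the whole noise, and within the noise
the increments up to `t` are independent of `ε t`. -/
lemma indep_sigmaInc (hε : ∀ s, Measurable (ε s)) {𝓗 : MeasurableSpace Ω} (h𝓗 : 𝓗 ≤ mΩ)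
    (hεindep : Indep (⨆ s, MeasurableSpace.comap (ε s) inferInstance) 𝓗 P)
    (hεinc : HasBackwardIndepIncrements P ε) (t : ℝ≥0) :
    Indep (𝓗 ⊔ MeasurableSpace.comap (ε t) inferInstance) (sigmaInc ε t) P := by
  have hs : ∀ s, Measurable[⨆ s, MeasurableSpace.comap (ε s) inferInstance] (ε s) := fun s =>
    (comap_measurable _).mono (le_iSup (fun s => MeasurableSpace.comap (ε s) inferInstance) s) le_rfl
  have hincle : sigmaInc ε t ≤ ⨆ s, MeasurableSpace.comap (ε s) inferInstance :=
    iSup₂_le fun s _ => ((hs s).sub (hs t)).comap_le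
  have hεle : (⨆ s, MeasurableSpace.comap (ε s) inferInstance) ≤ mΩ := iSup_le fun s => (hε s).comap_le
  set C : Set (Set Ω) := {A | ∃ H K, MeasurableSet[𝓗] H ∧
    MeasurableSet[MeasurableSpace.comap (ε t) inferInstance] K ∧ A = H ∩ K} with hC
  have hgen : 𝓗 ⊔ MeasurableSpace.comap (ε t) inferInstance ≤ MeasurableSpace.generateFrom C := by
    refine sup_le (fun H hH => ?_) fun K hK => ?_
    · exact MeasurableSpace.measurableSet_generateFrom
        ⟨H, univ, hH, MeasurableSet.univ, (inter_univ H).symm⟩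
    · exact MeasurableSpace.measurableSet_generateFrom
        ⟨univ, K, MeasurableSet.univ, hK, (univ_inter K).symm⟩
  have hpi : IsPiSystem C := by
    rintro _ ⟨H, K, hH, hK, rfl⟩ _ ⟨H', K', hH', hK', rfl⟩ -
    exact ⟨H ∩ H', K ∩ K', hH.inter hH', hK.inter hK', inter_inter_inter_comm _ _ _ _⟩
  have hgenInc : sigmaInc ε t = MeasurableSpace.generateFrom {J | MeasurableSet[sigmaInc ε t] J} :=
    (@MeasurableSpace.generateFrom_measurableSet _ (sigmaInc ε t)).symm
  have hKm : ∀ K, MeasurableSet[MeasurableSpace.comap (ε t) inferInstance] K → MeasurableSet[mΩ] K :=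
    fun K hK => (hε t).comap_le K hK
  have key : Indep (MeasurableSpace.generateFrom C) (MeasurableSpace.generateFrom
      {J | MeasurableSet[sigmaInc ε t] J}) P := by
    refine IndepSets.indep' ?_ (fun J hJ => hεle _ (hincle _ hJ)) hpi
      (@MeasurableSpace.isPiSystem_measurableSet _ (sigmaInc ε t)) ?_
    · rintro _ ⟨H, K, hH, hK, rfl⟩
      exact (h𝓗 _ hH).inter (hKm _ hK)
    · rw [IndepSets_iff]
      rintro _ J ⟨H, K, hH, hK, rfl⟩ hJ
      have hK' : MeasurableSet[⨆ s, MeasurableSpace.comap (ε s) inferInstance] K :=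
        le_iSup (fun s => MeasurableSpace.comap (ε s) inferInstance) t K hK
      have e1 := (Indep_iff _ _ _).1 hεindep (K ∩ J) H (hK'.inter (hincle _ hJ)) hH
      have e2 := (Indep_iff _ _ _).1 hεindep K H hK' hH
      have e3 := (Indep_iff _ _ _).1 (hεinc t t le_rfl) J K hJ hK
      rw [show H ∩ K ∩ J = K ∩ J ∩ H by ext; simp; tauto, e1, inter_comm K J, e3, inter_comm H K, e2]
      ring
  rw [hgenInc]
  exact indep_of_indep_of_le_left key hgen

/-! ### Equality of integrals on a generating class -/

lemma setIntegral_eq_of_isPiSystem {f g : Ω → ℝ} (hf : Integrable f P) (hg : Integrable g P)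
    {C : Set (Set Ω)} (hCm : ∀ A ∈ C, MeasurableSet A) (hpi : IsPiSystem C) (huniv : univ ∈ C)
    (h : ∀ A ∈ C, ∫ ω in A, f ω ∂P = ∫ ω in A, g ω ∂P) {A : Set Ω}
    (hA : MeasurableSet[MeasurableSpace.generateFrom C] A) : ∫ ω in A, f ω ∂P = ∫ ω in A, g ω ∂P := by
  have hle : MeasurableSpace.generateFrom C ≤ mΩ := MeasurableSpace.generateFrom_le hCm
  have h1 := h univ huniv
  rw [setIntegral_univ, setIntegral_univ] at h1
  induction A, hA using MeasurableSpace.induction_on_inter rfl hpi with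
  | empty => simp
  | basic A hA => exact h A hA
  | compl A hA ih =>
    have e1 := integral_add_compl (hle _ hA) hf
    have e2 := integral_add_compl (hle _ hA) hg
    linarith
  | iUnion s hd hs ih =>
    rw [integral_iUnion (fun i => hle _ (hs i)) hd hf.integrableOn,
      integral_iUnion (fun i => hle _ (hs i)) hd hg.integrableOn]
    exact tsum_congr ih

lemma setIntegral_inter_of_indep {m₁ m₂ : MeasurableSpace Ω} (hm₁ : m₁ ≤ mΩ) (hm₂ : m₂ ≤ mΩ)
    (hind : Indep m₁ m₂ P) {f : Ω → ℝ} (hf : Measurable[m₁] f) {A J : Set Ω}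
    (hA : MeasurableSet[m₁] A) (hJ : MeasurableSet[m₂] J) :
    ∫ ω in A ∩ J, f ω ∂P = (∫ ω in A, f ω ∂P) * P.real J := by
  have h1 : IndepFun (A.indicator f) (J.indicator fun _ => (1 : ℝ)) P :=
    indep_of_indep_of_le_left (indep_of_indep_of_le_right hind
      (Measurable.comap_le (measurable_const.indicator hJ))) (Measurable.comap_le (hf.indicator hA))
  have h2 := h1.integral_fun_mul_eq_mul_integral
    ((hf.indicator hA).mono hm₁ le_rfl).aestronglyMeasurable
    (measurable_const.indicator (hm₂ _ hJ)).aestronglyMeasurable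
  rw [integral_indicator (hm₁ _ hA), integral_indicator_const _ (hm₂ _ hJ), smul_eq_mul, mul_one] at h2
  rw [← h2, ← integral_indicator ((hm₁ _ hA).inter (hm₂ _ hJ))]
  refine integral_congr_ae (ae_of_all _ fun ω => ?_)
  by_cases ha : ω ∈ A <;> by_cases hj : ω ∈ J <;> simp [ha, hj]

/-- Integrals of functions independent of the increments, over events of the information `F^I_t`. -/
lemma setIntegral_eq_of_sigmaFI (hε : ∀ s, Measurable (ε s))
    {𝓗 : MeasurableSpace Ω} (h𝓗 : 𝓗 ≤ mΩ) (h𝓕 : ∀ s, 𝓕 s ≤ 𝓗) (hL𝓗 : Measurable[𝓗] L)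
    (hεindep : Indep (⨆ s, MeasurableSpace.comap (ε s) inferInstance) 𝓗 P)
    (hεinc : HasBackwardIndepIncrements P ε) {t : ℝ≥0} {f g : Ω → ℝ}
    (hf : Integrable f P) (hg : Integrable g P)
    (hfm : Measurable[𝓗 ⊔ MeasurableSpace.comap (ε t) inferInstance] f)
    (hgm : Measurable[𝓗 ⊔ MeasurableSpace.comap (ε t) inferInstance] g)
    (h : ∀ F, MeasurableSet[𝓕 t] F → ∀ B : Set ℝ, MeasurableSet B →
      ∫ ω in F ∩ (fun ω => L ω + ε t ω) ⁻¹' B, f ω ∂P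
        = ∫ ω in F ∩ (fun ω => L ω + ε t ω) ⁻¹' B, g ω ∂P)
    {A : Set Ω} (hA : MeasurableSet[sigmaFI 𝓕 L ε t] A) :
    ∫ ω in A, f ω ∂P = ∫ ω in A, g ω ∂P := by
  have hle : 𝓗 ⊔ MeasurableSpace.comap (ε t) inferInstance ≤ mΩ := sup_le h𝓗 (hε t).comap_le
  have hincle : sigmaInc ε t ≤ mΩ := iSup₂_le fun s _ => ((hε s).sub (hε t)).comap_le
  have hLt : Measurable[𝓗 ⊔ MeasurableSpace.comap (ε t) inferInstance] fun ω => L ω + ε t ω :=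
    (hL𝓗.mono le_sup_left le_rfl).add ((comap_measurable _).mono le_sup_right le_rfl)
  have hind := indep_sigmaInc hε h𝓗 hεindep hεinc t
  let C : Set (Set Ω) := {A | ∃ F B J, MeasurableSet[𝓕 t] F ∧ MeasurableSet (B : Set ℝ) ∧
    MeasurableSet[sigmaInc ε t] J ∧ A = (F ∩ (fun ω => L ω + ε t ω) ⁻¹' B) ∩ J}
  have hgen : 𝓕 t ⊔ MeasurableSpace.comap (fun ω => L ω + ε t ω) inferInstance ⊔ sigmaInc ε t
      ≤ MeasurableSpace.generateFrom C := by
    refine sup_le (sup_le (fun F hF => ?_) ?_) fun J hJ => ?_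
    · exact MeasurableSpace.measurableSet_generateFrom ⟨F, univ, univ, hF, MeasurableSet.univ,
        MeasurableSet.univ, by simp⟩
    · rintro _ ⟨B, hB, rfl⟩
      exact MeasurableSpace.measurableSet_generateFrom ⟨univ, B, univ, MeasurableSet.univ, hB,
        MeasurableSet.univ, by simp⟩
    · exact MeasurableSpace.measurableSet_generateFrom ⟨univ, univ, J, MeasurableSet.univ,
        MeasurableSet.univ, hJ, by simp⟩
  have hFB : ∀ F, MeasurableSet[𝓕 t] F → ∀ B : Set ℝ, MeasurableSet B →
      MeasurableSet[𝓗 ⊔ MeasurableSpace.comap (ε t) inferInstance]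
        (F ∩ (fun ω => L ω + ε t ω) ⁻¹' B) := fun F hF B hB =>
    MeasurableSet.inter (le_sup_left (a := 𝓗) _ (h𝓕 t _ hF)) (hLt hB)
  refine setIntegral_eq_of_isPiSystem hf hg (C := C) ?_ ?_ ⟨univ, univ, univ, MeasurableSet.univ,
    MeasurableSet.univ, MeasurableSet.univ, by simp⟩ ?_ (hgen _ (sigmaFI_le_sup t A hA))
  · rintro _ ⟨F, B, J, hF, hB, hJ, rfl⟩
    exact MeasurableSet.inter (hle _ (hFB F hF B hB)) (hincle _ hJ)
  · rintro _ ⟨F, B, J, hF, hB, hJ, rfl⟩ _ ⟨F', B', J', hF', hB', hJ', rfl⟩ -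
    refine ⟨F ∩ F', B ∩ B', J ∩ J', hF.inter hF', hB.inter hB', hJ.inter hJ', ?_⟩
    ext ω
    simp only [mem_inter_iff, mem_preimage]
    tauto
  · rintro _ ⟨F, B, J, hF, hB, hJ, rfl⟩
    rw [setIntegral_inter_of_indep hle hincle hind hfm (hFB F hF B hB) hJ,
      setIntegral_inter_of_indep hle hincle hind hgm (hFB F hF B hB) hJ, h F hF B hB]

end

/-! ### The cash flows as a function of the scenario and the barrier. -/

section

variable {Ω : Type*} {mΩ : MeasurableSpace Ω} {𝓕 : Filtration ℝ≥0 mΩ}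
  {P : Measure Ω} [IsProbabilityMeasure P]

/-! ### The cash flows as a function of the scenario and the barrier -/

lemma prod_le (𝓕 : Filtration ℝ≥0 mΩ) (u : ℝ≥0) :
    (𝓕 u).prod (inferInstance : MeasurableSpace ℝ) ≤ mΩ.prod inferInstance :=
  sup_le_sup (MeasurableSpace.comap_mono (𝓕.le u)) le_rfl

lemma measurable_section {β : Type*} [MeasurableSpace β] {u : ℝ≥0} {f : Ω × ℝ → β}
    (hf : @Measurable (Ω × ℝ) β ((𝓕 u).prod inferInstance) _ f) (x : ℝ) :
    Measurable fun ω => f (ω, x) :=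
  (hf.mono (prod_le 𝓕 u) le_rfl).comp measurable_prodMk_right

lemma measurable_along_barrier {β : Type*} [MeasurableSpace β] {u : ℝ≥0} {f : Ω × ℝ → β}
    (hf : @Measurable (Ω × ℝ) β ((𝓕 u).prod inferInstance) _ f) {L : Ω → ℝ} (hL : Measurable L) :
    Measurable fun ω => f (ω, L ω) :=
  (hf.mono (prod_le 𝓕 u) le_rfl).comp (measurable_id.prodMk hL)

lemma dividendVariation_eq_aliveIntegral {τ : Ω → ℝ≥0∞} {R G : ℝ≥0 → Ω → ℝ} {t T : ℝ≥0}
    (hb : ∀ ω, BoundedVariationOn (fun u => G (min u T) ω) univ)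
    (hc : ∀ ω, Continuous fun u => G (min u T) ω) (ω : Ω) :
    dividendVariation τ R G t T ω = aliveIntegral τ R (fun ω => upVar (hb ω) (hc ω)) t T ω
      + aliveIntegral τ R (fun ω => downVar (hb ω) (hc ω)) t T ω :=
  lsVariationIntegral_eq (G := fun u => G u ω) (hb ω) (hc ω) _

lemma aliveIntegral_eq_zero {τ : Ω → ℝ≥0∞} {R : ℝ≥0 → Ω → ℝ} {f : Ω → StieltjesFunction ℝ≥0}
    {t T : ℝ≥0} {ω : Ω} (h : ¬ (t : ℝ≥0∞) < τ ω) : aliveIntegral τ R f t T ω = 0 := by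
  refine (setLIntegral_congr_fun (g := 0) measurableSet_Ioc fun u hu => ?_).trans (by simp)
  have : ¬ (u : ℝ≥0∞) < τ ω := fun h' => h (lt_of_le_of_lt (by exact_mod_cast hu.1.le) h')
  simp [this]

lemma dividendPart_eq_aliveIntegral {τ : Ω → ℝ≥0∞} {R G : ℝ≥0 → Ω → ℝ} {t T : ℝ≥0}
    (hR : Measurable (Function.uncurry R)) (hRpos : ∀ s ω, 0 < R s ω)
    (hb : ∀ ω, BoundedVariationOn (fun u => G (min u T) ω) univ)
    (hc : ∀ ω, Continuous fun u => G (min u T) ω) {ω : Ω}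
    (h : dividendVariation τ R G t T ω ≠ ∞) :
    dividendPart τ R G t T ω = (aliveIntegral τ R (fun ω => upVar (hb ω) (hc ω)) t T ω).toReal
      - (aliveIntegral τ R (fun ω => downVar (hb ω) (hc ω)) t T ω).toReal := by
  rw [dividendVariation_eq_aliveIntegral hb hc, ENNReal.add_ne_top] at h
  have hm : Measurable fun u : ℝ≥0 => {u' : ℝ≥0 | (u' : ℝ≥0∞) < τ ω}.indicator
      (fun u' => ENNReal.ofReal (R u' ω)⁻¹) u := by
    have h1 : Measurable fun u => R u ω := hR.comp (measurable_id.prodMk measurable_const)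
    exact h1.inv.ennreal_ofReal.indicator
      (measurableSet_lt measurable_id.coe_nnreal_ennreal measurable_const)
  have key := lsIntegral_toReal (G := fun u => G u ω) (hb ω) (hc ω) hm
    (fun u => by simp only [indicator]; split_ifs <;> simp) h.1 h.2
  rw [dividendPart]
  refine Eq.trans (congrArg _ ?_) key
  ext u
  by_cases hu : (u : ℝ≥0∞) < τ ω <;> simp [hu, (hRpos u ω).le]

lemma dividendPart_eq_zero {τ : Ω → ℝ≥0∞} {R G : ℝ≥0 → Ω → ℝ} {t T : ℝ≥0}
    (hR : Measurable (Function.uncurry R)) (hRpos : ∀ s ω, 0 < R s ω)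
    (hGcont : ∀ ω, Continuous fun s => G s ω)
    (hGvar : ∀ ω, LocallyBoundedVariationOn (fun s => G s ω) univ) {ω : Ω}
    (h : ¬ (t : ℝ≥0∞) < τ ω) : dividendPart τ R G t T ω = 0 := by
  have hb := fun ω => boundedVariationOn_stopped (hGvar ω) T
  have hc : ∀ ω, Continuous fun u => G (min u T) ω := fun ω =>
    (hGcont ω).comp (continuous_id.min continuous_const)
  rw [dividendPart_eq_aliveIntegral hR hRpos hb hc]
  · simp [aliveIntegral_eq_zero h]
  · simp [dividendVariation_eq_aliveIntegral hb hc, aliveIntegral_eq_zero h]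

variable {X : ℝ≥0 → Ω → ℝ} {R G Z : ℝ≥0 → Ω → ℝ} {C : Ω → ℝ} {t T : ℝ≥0}

/-- The pathwise dividend integral is replaced by the difference of the finite parts of two monotone
integrals, which is measurable in scenario and barrier without any finiteness assumption and agrees
with the dividends where their variation is finite. The bound by the three integrable quantities and
the vanishing after default hold everywhere, so neither depends on an exceptional set. -/
theorem exists_jointCashFlow (hX : ∀ ω, IsCadlag fun s => X s ω) (hXm : ∀ s, Measurable[𝓕 s] (X s))
    (hR : IsStronglyPredictable 𝓕 R) (hRpos : ∀ s ω, 0 < R s ω) (htT : t ≤ T)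
    (hC : Measurable[𝓕 T] C) (hG : ∀ s, Measurable[𝓕 s] (G s))
    (hGcont : ∀ ω, Continuous fun s => G s ω)
    (hGvar : ∀ ω, LocallyBoundedVariationOn (fun s => G s ω) univ)
    (hZ : IsStronglyPredictable 𝓕 Z) :
    (@Measurable (Ω × ℝ) ℝ≥0∞ ((𝓕 T).prod inferInstance) _
      fun z => dividendVariation (defaultTime X fun _ => z.2) R G t T z.1) ∧
    (@Measurable (Ω × ℝ) ℝ ((𝓕 T).prod inferInstance) _
      fun z => terminalPart (defaultTime X fun _ => z.2) R C T z.1) ∧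
    (@Measurable (Ω × ℝ) ℝ ((𝓕 T).prod inferInstance) _
      fun z => {ω | (t : ℝ≥0∞) < defaultTime X (fun _ => z.2) ω}.indicator
        (recoveryPart (defaultTime X fun _ => z.2) R Z T) z.1) ∧
    ∃ g : Ω × ℝ → ℝ, @Measurable (Ω × ℝ) ℝ ((𝓕 T).prod inferInstance) _ g ∧
      (∀ z, dividendVariation (defaultTime X fun _ => z.2) R G t T z.1 ≠ ∞ →
        g z = cashFlow (defaultTime X fun _ => z.2) R C G Z t T z.1) ∧
      (∀ z, ‖g z‖ₑ ≤ ‖terminalPart (defaultTime X fun _ => z.2) R C T z.1‖ₑ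
        + dividendVariation (defaultTime X fun _ => z.2) R G t T z.1
        + ‖recoveryPart (defaultTime X fun _ => z.2) R Z T z.1‖ₑ) ∧
      ∀ z, ¬ (t : ℝ≥0∞) < defaultTime X (fun _ => z.2) z.1 → g z = 0 := by
  have hb := fun ω => boundedVariationOn_stopped (hGvar ω) T
  have hc : ∀ ω, Continuous fun u => G (min u T) ω := fun ω =>
    (hGcont ω).comp (continuous_id.min continuous_const)
  have hUD := measurable_upVar_downVar (𝓕 := 𝓕) (g := fun u => G (min u T)) hb hc
    fun u => (hG _).mono (𝓕.mono (min_le_left u T)) le_rfl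
  have hXr : ∀ u ≤ T, Measurable[𝓕 T] (runInf X u) := fun u hu =>
    (measurable_runInf hX hXm u).mono (𝓕.mono hu) le_rfl
  have hRm := measurable_min_uncurry hR T
  have hZm := measurable_min_uncurry hZ T
  have hU := @measurable_aliveIntegral Ω (𝓕 T) X T hX hXr R hRm _
    (fun u hu => (hUD u).1.mono (𝓕.mono hu) le_rfl) t htT
  have hD := @measurable_aliveIntegral Ω (𝓕 T) X T hX hXr R hRm _
    (fun u hu => (hUD u).2.mono (𝓕.mono hu) le_rfl) t htT
  have hCt := @measurable_terminalPart Ω (𝓕 T) X T hX hXr R C hC hRm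
  have hZt : @Measurable (Ω × ℝ) ℝ ((𝓕 T).prod inferInstance) _
      fun z => {ω | (t : ℝ≥0∞) < defaultTime X (fun _ => z.2) ω}.indicator
        (recoveryPart (defaultTime X fun _ => z.2) R Z T) z.1 :=
    (@measurable_recoveryPart Ω (𝓕 T) X T hX hXr R Z hRm hZm).indicator
      (@measurableSet_alive Ω (𝓕 T) X hX t (hXr t htT))
  refine ⟨?_, hCt, hZt, fun z => terminalPart (defaultTime X fun _ => z.2) R C T z.1
    + ((aliveIntegral (defaultTime X fun _ => z.2) R (fun ω => upVar (hb ω) (hc ω)) t T z.1).toReal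
      - (aliveIntegral (defaultTime X fun _ => z.2) R (fun ω => downVar (hb ω) (hc ω)) t T z.1).toReal)
    + {ω | (t : ℝ≥0∞) < defaultTime X (fun _ => z.2) ω}.indicator
        (recoveryPart (defaultTime X fun _ => z.2) R Z T) z.1,
    (hCt.add (hU.ennreal_toReal.sub hD.ennreal_toReal)).add hZt, fun z hz => ?_, fun z => ?_,
    fun z hz => ?_⟩
  · simp_rw [dividendVariation_eq_aliveIntegral hb hc]
    exact hU.add hD
  · rw [cashFlow, dividendPart_eq_aliveIntegral (measurable_uncurry_of_predictable hR) hRpos hb hc hz]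
  · rw [dividendVariation_eq_aliveIntegral hb hc]
    refine (enorm_add_le _ _).trans (add_le_add ((enorm_add_le _ _).trans (add_le_add le_rfl
      ((enorm_sub_le).trans (add_le_add ?_ ?_)))) (enorm_indicator_le_enorm_self _ _))
    all_goals
      rw [Real.enorm_eq_ofReal ENNReal.toReal_nonneg]
      exact ENNReal.ofReal_toReal_le
  · have h1 : ¬ (T : ℝ≥0∞) < defaultTime X (fun _ => z.2) z.1 := fun h =>
      hz (lt_of_le_of_lt (by exact_mod_cast htT) h)
    simp [terminalPart, h1, hz, aliveIntegral_eq_zero hz]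

variable {L : Ω → ℝ} {p : ℝ≥0 → ℝ → Ω → ℝ}

/-- Integrability along the true barrier is integrability on the product space with weight `p u`;
Fubini passes it to almost every fixed barrier. -/
lemma IsCondDensity.ae_lintegral_lt_top (hp : IsCondDensity 𝓕 P L p) (hL : Measurable L) {u : ℝ≥0}
    {φ : Ω × ℝ → ℝ≥0∞} (hφ : @Measurable (Ω × ℝ) ℝ≥0∞ ((𝓕 u).prod inferInstance) _ φ)
    (hfin : ∫⁻ ω, φ (ω, L ω) ∂P < ∞) :
    ∀ᵐ x ∂(P.map L), ∫⁻ ω, ENNReal.ofReal (p u x ω) * φ (ω, x) ∂P < ∞ := by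
  have : IsProbabilityMeasure (P.map L) := Measure.isProbabilityMeasure_map hL.aemeasurable
  have hm : Measurable fun z : Ω × ℝ => ENNReal.ofReal (p u z.2 z.1) * φ z :=
    ((hp.measurable_ofReal u).mul hφ).mono (prod_le 𝓕 u) le_rfl
  rw [hp.lintegral_eq hL u hφ, lintegral_lintegral_swap hm.aemeasurable] at hfin
  exact ae_lt_top (hm.lintegral_prod_left') hfin.ne

lemma IsCondDensity.ae_integrable (hp : IsCondDensity 𝓕 P L p) (hL : Measurable L) {u : ℝ≥0}
    {h : Ω × ℝ → ℝ} (hh : @Measurable (Ω × ℝ) ℝ ((𝓕 u).prod inferInstance) _ h)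
    (hfin : ∫⁻ ω, ‖h (ω, L ω)‖ₑ ∂P < ∞) :
    ∀ᵐ x ∂(P.map L), Integrable (fun ω => p u x ω * h (ω, x)) P := by
  have hh' : @Measurable (Ω × ℝ) ℝ≥0∞ ((𝓕 u).prod inferInstance) _ fun z => ‖h z‖ₑ :=
    measurable_enorm.comp hh
  filter_upwards [hp.ae_lintegral_lt_top hL hh' hfin] with x hx
  have hm : Measurable fun ω => p u x ω * h (ω, x) :=
    measurable_section ((hp.measurable u).mul hh) x
  refine ⟨hm.aestronglyMeasurable, ?_⟩
  simp only [HasFiniteIntegral, enorm_mul, Real.enorm_eq_ofReal (hp.nonneg u _ _)]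
  exact hx

section Congr

variable {τ τ' : Ω → ℝ≥0∞} {ω : Ω}

lemma terminalPart_congr (h : τ ω = τ' ω) : terminalPart τ R C T ω = terminalPart τ' R C T ω := by
  simp only [terminalPart, indicator, Set.mem_ofPred_eq, h]

lemma dividendPart_congr (h : τ ω = τ' ω) : dividendPart τ R G t T ω = dividendPart τ' R G t T ω := by
  simp only [dividendPart, h]

lemma dividendVariation_congr (h : τ ω = τ' ω) :
    dividendVariation τ R G t T ω = dividendVariation τ' R G t T ω := by
  simp only [dividendVariation, h]

lemma recoveryPart_congr (h : τ ω = τ' ω) : recoveryPart τ R Z T ω = recoveryPart τ' R Z T ω := by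
  simp only [recoveryPart, indicator, Set.mem_ofPred_eq, h]

end Congr

/-- The cash flows weighted by the conditional density at maturity: their integrability, and the
expression of the manager's value through them. -/
theorem exists_weightedCashFlow (hrc : 𝓕.IsRightContinuous) (hcompl : IsCompleteFiltration 𝓕 P)
    (hX : ∀ ω, IsCadlag fun s => X s ω) (hXm : ∀ s, Measurable[𝓕 s] (X s)) (hL : Measurable L)
    (hp : IsCondDensity 𝓕 P L p)
    (hR : IsStronglyPredictable 𝓕 R) (hRpos : ∀ s ω, 0 < R s ω) (htT : t ≤ T)
    (hC : Measurable[𝓕 T] C) (hG : ∀ s, Measurable[𝓕 s] (G s))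
    (hGcont : ∀ ω, Continuous fun s => G s ω)
    (hGvar : ∀ ω, LocallyBoundedVariationOn (fun s => G s ω) univ)
    (hZ : IsStronglyPredictable 𝓕 Z)
    (hCint : Integrable (terminalPart (defaultTime X L) R C T) P)
    (hGint : ∫⁻ ω, dividendVariation (defaultTime X L) R G t T ω ∂P < ∞)
    (hZint : Integrable (recoveryPart (defaultTime X L) R Z T) P)
    {I : ℝ → ℝ≥0 → Ω → ℝ}
    (hI : ∀ᵐ x ∂(P.map L), IsStochIntegral 𝓕 P (FM X p x) (recoveryIntegrand R Z t T) (I x) ∧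
      IsClassD 𝓕 P T (I x)) :
    ∃ g : Ω × ℝ → ℝ, @Measurable (Ω × ℝ) ℝ ((𝓕 T).prod inferInstance) _ g ∧
      Integrable (fun ω => g (ω, L ω)) P ∧
      (∀ᵐ ω ∂P, g (ω, L ω) = {ω | (t : ℝ≥0∞) < defaultTime X L ω}.indicator (fun ω =>
        terminalPart (defaultTime X L) R C T ω + dividendPart (defaultTime X L) R G t T ω
          + recoveryPart (defaultTime X L) R Z T ω) ω) ∧
      (∀ z, ¬ z.2 < runInf X t z.1 → g z = 0) ∧
      ∀ᵐ x ∂(P.map L), Integrable (managerPayoff (FM X p x) R C G (I x) t T) P ∧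
        P[managerPayoff (FM X p x) R C G (I x) t T | 𝓕 t] =ᵐ[P] P[fun ω => p T x ω * g (ω, x) | 𝓕 t] := by
  obtain ⟨hdm, hcm, hrm, g, hg, hg1, hg2, hg3⟩ :=
    exists_jointCashFlow (C := C) hX hXm hR hRpos htT hC hG hGcont hGvar hZ
  have : IsProbabilityMeasure (P.map L) := Measure.isProbabilityMeasure_map hL.aemeasurable
  have hτL : ∀ ω, defaultTime X (fun _ => L ω) ω = defaultTime X L ω := fun ω => rfl
  have hcL : ∀ ω, terminalPart (defaultTime X fun _ => L ω) R C T ω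
      = terminalPart (defaultTime X L) R C T ω := fun ω => terminalPart_congr (hτL ω)
  have hdL' : ∀ ω, dividendVariation (defaultTime X fun _ => L ω) R G t T ω
      = dividendVariation (defaultTime X L) R G t T ω := fun ω => dividendVariation_congr (hτL ω)
  have hrL : ∀ ω, recoveryPart (defaultTime X fun _ => L ω) R Z T ω
      = recoveryPart (defaultTime X L) R Z T ω := fun ω => recoveryPart_congr (hτL ω)
  have hdL : Measurable fun ω => dividendVariation (defaultTime X L) R G t T ω := by
    have := measurable_along_barrier hdm hL
    simpa only [hdL'] using this
  have hcLm : Measurable fun ω => ‖terminalPart (defaultTime X L) R C T ω‖ₑ := by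
    have := (measurable_along_barrier hcm hL).enorm
    simpa only [hcL] using this
  have hgL : Measurable fun ω => g (ω, L ω) := measurable_along_barrier hg hL
  have hbound : ∫⁻ ω, ‖g (ω, L ω)‖ₑ ∂P < ∞ := by
    have h0 : ∀ ω, ‖g (ω, L ω)‖ₑ ≤ ‖terminalPart (defaultTime X L) R C T ω‖ₑ
        + dividendVariation (defaultTime X L) R G t T ω
        + ‖recoveryPart (defaultTime X L) R Z T ω‖ₑ := fun ω => by
      have := hg2 (ω, L ω)
      simpa only [hcL, hdL', hrL] using this
    refine lt_of_le_of_lt (lintegral_mono h0) ?_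
    have hcd : Measurable fun ω => ‖terminalPart (defaultTime X L) R C T ω‖ₑ
        + dividendVariation (defaultTime X L) R G t T ω := hcLm.add hdL
    rw [lintegral_add_left hcd, lintegral_add_left hcLm]
    exact ENNReal.add_lt_top.2 ⟨ENNReal.add_lt_top.2 ⟨hCint.2, hGint⟩, hZint.2⟩
  refine ⟨g, hg, ⟨hgL.aestronglyMeasurable, hbound⟩, ?_, fun z hz => hg3 z ?_, ?_⟩
  · filter_upwards [ae_lt_top hdL hGint.ne] with ω hω
    by_cases h : (t : ℝ≥0∞) < defaultTime X L ω
    · have h1 : g (ω, L ω) = cashFlow (defaultTime X fun _ => L ω) R C G Z t T ω :=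
        hg1 (ω, L ω) (by simpa only [hdL'] using hω.ne)
      have h' : (t : ℝ≥0∞) < defaultTime X (fun _ => L ω) ω := h
      have hd : dividendPart (defaultTime X fun _ => L ω) R G t T ω
        = dividendPart (defaultTime X L) R G t T ω := dividendPart_congr (hτL ω)
      rw [h1, cashFlow, hcL, hd]
      simp [h, h', hrL]
    · rw [hg3 (ω, L ω) h]
      simp [h]
  · rwa [lt_defaultTime_iff hX]
  · have key := fun φ hφ => hp.ae_lintegral_lt_top hL (u := T) (φ := φ) hφ
    have hreal := fun h hh => hp.ae_integrable hL (u := T) (h := h) hh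
    have hrfin : ∫⁻ ω, ‖{ω' | (t : ℝ≥0∞) < defaultTime X (fun _ => L ω) ω'}.indicator
        (recoveryPart (defaultTime X fun _ => L ω) R Z T) ω‖ₑ ∂P < ∞ := by
      refine lt_of_le_of_lt (lintegral_mono fun ω => enorm_indicator_le_enorm_self _ _) ?_
      simp only [hrL]
      exact hZint.2
    have hcfin : ∫⁻ ω, ‖terminalPart (defaultTime X fun _ => L ω) R C T ω‖ₑ ∂P < ∞ := by
      simp only [hcL]
      exact hCint.2
    have hdfin : ∫⁻ ω, dividendVariation (defaultTime X fun _ => L ω) R G t T ω ∂P < ∞ := by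
      simp only [hdL']
      exact hGint
    filter_upwards [hI, hreal _ hcm hcfin, key _ hdm hdfin, hreal _ hrm hrfin, hreal _ hg hbound]
      with x hIx h1 h2 h3 h4
    obtain ⟨m1, m2, m3⟩ := setIntegral_managerPayoff hrc hcompl (hp.martingale x) (hp.nonneg · x)
      (hp.cadlag x) (measurableSet_defaultTime_le hX hXm x) (FM_eq hX p x) hR hRpos htT hG hGcont
      hGvar hZ hIx.1 hIx.2 h1 h2.ne h3
    have hpT : Measurable fun ω => ENNReal.ofReal (p T x ω) := measurable_section (hp.measurable_ofReal T) x
    have hdx := measurable_section hdm x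
    -- The cash flow and its measurable version can differ only where the variation of the dividends
    -- is infinite. The finite weighted integral forces `p T x` to vanish there, almost surely.
    have hae : (fun ω => p T x ω * cashFlow (defaultTime X fun _ => x) R C G Z t T ω)
        =ᵐ[P] fun ω => p T x ω * g (ω, x) := by
      filter_upwards [ae_lt_top (hpT.mul hdx) h2.ne] with ω hω
      rcases (hp.nonneg T x ω).eq_or_lt with h0 | h0
      · simp [← h0]
      · rw [hg1 (ω, x)]
        exact fun h => hω.ne ((congrArg (ENNReal.ofReal (p T x ω) * ·) h).trans
          (ENNReal.mul_top (ENNReal.ofReal_pos.2 h0).ne'))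
    refine ⟨m1, ?_⟩
    refine ((ae_eq_condExp_of_forall_setIntegral_eq (𝓕.le t) h4
      (fun B _ _ => integrable_condExp.integrableOn) (fun B hB _ => ?_)
      stronglyMeasurable_condExp.aestronglyMeasurable))
    rw [setIntegral_condExp (𝓕.le t) m1 hB, m3 B hB]
    exact integral_congr_ae (ae_restrict_of_ae hae)

end

/-! ### Bayes' formula for a barrier observed with noise. -/

section

variable {Ω : Type*} {mΩ : MeasurableSpace Ω} {𝓕 : Filtration ℝ≥0 mΩ}
  {P : Measure Ω} [IsProbabilityMeasure P]

/-! ### Kernels of the noise -/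

/-- The joint law is first written with the observation integrated inside the barrier. Bayes'
formula needs the opposite order: the barrier integrated inside for a given observation. -/
lemma measurePreserving_prodRightComm {μ ν : Measure ℝ} [SFinite μ] [SFinite ν] :
    MeasurePreserving (fun w : (Ω × ℝ) × ℝ => ((w.1.1, w.2), w.1.2))
      ((P.prod μ).prod ν) ((P.prod ν).prod μ) :=
  ((measurePreserving_prodAssoc P ν μ).symm _).comp
    (((MeasurePreserving.id P).prod Measure.measurePreserving_swap).comp
      (measurePreserving_prodAssoc P μ ν))

lemma measurableEmbedding_prodRightComm :
    MeasurableEmbedding (fun w : (Ω × ℝ) × ℝ => ((w.1.1, w.2), w.1.2)) :=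
  (MeasurableEquiv.mk ⟨fun w : (Ω × ℝ) × ℝ => ((w.1.1, w.2), w.1.2),
    fun w => ((w.1.1, w.2), w.1.2), fun _ => rfl, fun _ => rfl⟩
    (by dsimp; fun_prop) (by dsimp [Equiv.symm]; fun_prop)).measurableEmbedding

section Noise

variable {q : ℝ → ℝ}

lemma lintegral_noise_eq_one {E : Ω → ℝ} (hE : Measurable E)
    (hqE : P.map E = volume.withDensity fun y => ENNReal.ofReal (q y)) (x : ℝ) :
    ∫⁻ z : ℝ, ENNReal.ofReal (q (z - x)) = 1 := by
  have : IsProbabilityMeasure (P.map E) := Measure.isProbabilityMeasure_map hE.aemeasurable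
  rw [lintegral_sub_right_eq_self (fun z => ENNReal.ofReal (q z)) x]
  have h := measure_univ (μ := P.map E)
  rwa [hqE, withDensity_apply _ MeasurableSet.univ, Measure.restrict_univ] at h

variable {μ : Measure ℝ} [IsProbabilityMeasure μ]

/-- The kernel `q (z - x)` has mass one in `z` for each `x`, so adjoining the observation does not
change the `L¹` norm. -/
lemma integrable_mul_noise (hq : Measurable q) (hq0 : ∀ y, 0 ≤ q y)
    (hq1 : ∀ x, ∫⁻ z : ℝ, ENNReal.ofReal (q (z - x)) = 1) {h : Ω × ℝ → ℝ} (hm : Measurable h)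
    (hh : Integrable h (P.prod μ)) :
    Integrable (fun w : (Ω × ℝ) × ℝ => h w.1 * q (w.2 - w.1.2)) ((P.prod μ).prod volume) := by
  have hqm : Measurable fun w : (Ω × ℝ) × ℝ => q (w.2 - w.1.2) := hq.comp (by fun_prop)
  have hm' : Measurable fun w : (Ω × ℝ) × ℝ => h w.1 * q (w.2 - w.1.2) :=
    (hm.comp measurable_fst).mul hqm
  refine ⟨hm'.aestronglyMeasurable, ?_⟩
  rw [HasFiniteIntegral, lintegral_prod _ hm'.enorm.aemeasurable]
  refine lt_of_eq_of_lt (lintegral_congr fun z => ?_) hh.2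
  have hqz : Measurable fun y => ENNReal.ofReal (q (y - z.2)) :=
    (hq.comp (measurable_id.sub_const _)).ennreal_ofReal
  simp only [enorm_mul, Real.enorm_eq_ofReal (hq0 _)]
  rw [lintegral_const_mul _ hqz, hq1, mul_one]

lemma integrable_mul_noise_swap (hq : Measurable q) (hq0 : ∀ y, 0 ≤ q y)
    (hq1 : ∀ x, ∫⁻ z : ℝ, ENNReal.ofReal (q (z - x)) = 1) {h : Ω × ℝ → ℝ} (hm : Measurable h)
    (hh : Integrable h (P.prod μ)) :
    Integrable (fun w : (Ω × ℝ) × ℝ => h (w.1.1, w.2) * q (w.1.2 - w.2)) ((P.prod volume).prod μ) :=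
  (measurePreserving_prodRightComm.integrable_comp_emb measurableEmbedding_prodRightComm).1
    (integrable_mul_noise hq hq0 hq1 hm hh)

end Noise

variable {L : Ω → ℝ} {p : ℝ≥0 → ℝ → Ω → ℝ}

lemma IsCondDensity.lintegral_noisy_prod (hp : IsCondDensity 𝓕 P L p) (hL : Measurable L)
    {E : Ω → ℝ} (hE : Measurable E)
    (hind : Indep (MeasurableSpace.comap E inferInstance)
      ((⨆ s, 𝓕 s) ⊔ MeasurableSpace.comap L inferInstance) P)
    {q : ℝ → ℝ} (hq : Measurable q)
    (hqE : P.map E = volume.withDensity fun y => ENNReal.ofReal (q y)) (u : ℝ≥0)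
    {φ : (Ω × ℝ) × ℝ → ℝ≥0∞}
    (hφ : @Measurable ((Ω × ℝ) × ℝ) ℝ≥0∞ (((𝓕 u).prod inferInstance).prod inferInstance) _ φ) :
    ∫⁻ ω, φ ((ω, L ω), L ω + E ω) ∂P = ∫⁻ w, ENNReal.ofReal (p u w.1.2 w.1.1) *
      (ENNReal.ofReal (q (w.2 - w.1.2)) * φ w) ∂((P.prod (P.map L)).prod volume) := by
  have : IsProbabilityMeasure (P.map L) := Measure.isProbabilityMeasure_map hL.aemeasurable
  have hle : ((𝓕 u).prod (inferInstance : MeasurableSpace ℝ)).prod (inferInstance : MeasurableSpace ℝ)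
      ≤ (mΩ.prod inferInstance).prod inferInstance :=
    sup_le_sup (MeasurableSpace.comap_mono (prod_le 𝓕 u)) le_rfl
  have hφm : Measurable φ := hφ.mono hle le_rfl
  have hpm : Measurable fun z : Ω × ℝ => ENNReal.ofReal (p u z.2 z.1) :=
    (hp.measurable_ofReal u).mono (prod_le 𝓕 u) le_rfl
  have hqm : Measurable fun w : (Ω × ℝ) × ℝ => ENNReal.ofReal (q (w.2 - w.1.2)) :=
    (hq.comp (by fun_prop)).ennreal_ofReal
  have h1 : Measurable fun w : (Ω × ℝ) × ℝ => ENNReal.ofReal (q (w.2 - w.1.2)) * φ w := hqm.mul hφm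
  have h2 : Measurable fun w : (Ω × ℝ) × ℝ => ENNReal.ofReal (p u w.1.2 w.1.1) *
      (ENNReal.ofReal (q (w.2 - w.1.2)) * φ w) := (hpm.comp measurable_fst).mul h1
  have h3 : Measurable fun z : Ω × ℝ => ENNReal.ofReal (p u z.2 z.1) *
      ∫⁻ y : ℝ, ENNReal.ofReal (q (y - z.2)) * φ (z, y) := hpm.mul h1.lintegral_prod_right'
  rw [hp.lintegral_noisy_eq hL hE hind hq hqE u hφ, lintegral_prod _ h2.aemeasurable]
  have h4 := lintegral_prod (μ := P) (ν := P.map L) _ h3.aemeasurable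
  refine h4.symm.trans (lintegral_congr fun z => ?_)
  exact (lintegral_const_mul _ (h1.comp measurable_prodMk_left)).symm

lemma IsCondDensity.integral_noisy_prod (hp : IsCondDensity 𝓕 P L p) (hL : Measurable L)
    {E : Ω → ℝ} (hE : Measurable E)
    (hind : Indep (MeasurableSpace.comap E inferInstance)
      ((⨆ s, 𝓕 s) ⊔ MeasurableSpace.comap L inferInstance) P)
    {q : ℝ → ℝ} (hq : Measurable q) (hq0 : ∀ y, 0 ≤ q y)
    (hqE : P.map E = volume.withDensity fun y => ENNReal.ofReal (q y)) (u : ℝ≥0)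
    {φ : (Ω × ℝ) × ℝ → ℝ}
    (hφ : @Measurable ((Ω × ℝ) × ℝ) ℝ (((𝓕 u).prod inferInstance).prod inferInstance) _ φ)
    (hint : Integrable (fun ω => φ ((ω, L ω), L ω + E ω)) P) :
    Integrable (fun w => p u w.1.2 w.1.1 * (q (w.2 - w.1.2) * φ w))
      ((P.prod (P.map L)).prod volume) ∧
    ∫ ω, φ ((ω, L ω), L ω + E ω) ∂P = ∫ w, p u w.1.2 w.1.1 * (q (w.2 - w.1.2) * φ w)
      ∂((P.prod (P.map L)).prod volume) := by
  have hle : ((𝓕 u).prod (inferInstance : MeasurableSpace ℝ)).prod (inferInstance : MeasurableSpace ℝ)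
      ≤ (mΩ.prod inferInstance).prod inferInstance :=
    sup_le_sup (MeasurableSpace.comap_mono (prod_le 𝓕 u)) le_rfl
  have hφm : Measurable φ := hφ.mono hle le_rfl
  have hpm : Measurable fun z : Ω × ℝ => p u z.2 z.1 := (hp.measurable u).mono (prod_le 𝓕 u) le_rfl
  have hm : Measurable fun w : (Ω × ℝ) × ℝ => p u w.1.2 w.1.1 * (q (w.2 - w.1.2) * φ w) :=
    (hpm.comp measurable_fst).mul ((hq.comp (by fun_prop)).mul hφm)
  have hI : Integrable (fun w => p u w.1.2 w.1.1 * (q (w.2 - w.1.2) * φ w))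
      ((P.prod (P.map L)).prod volume) := by
    refine ⟨hm.aestronglyMeasurable, ?_⟩
    have h := hp.lintegral_noisy_prod hL hE hind hq hqE u (φ := fun w => ‖φ w‖ₑ)
      (measurable_enorm.comp hφ)
    refine lt_of_eq_of_lt ?_ (lt_of_eq_of_lt h.symm hint.2)
    refine lintegral_congr fun w => ?_
    rw [enorm_mul, enorm_mul, Real.enorm_eq_ofReal (hp.nonneg u _ _), Real.enorm_eq_ofReal (hq0 _)]
  refine ⟨hI, ?_⟩
  have e : ∀ w : (Ω × ℝ) × ℝ, ∀ c : ℝ, ENNReal.ofReal (p u w.1.2 w.1.1 * (q (w.2 - w.1.2) * c))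
      = ENNReal.ofReal (p u w.1.2 w.1.1) * (ENNReal.ofReal (q (w.2 - w.1.2)) * ENNReal.ofReal c) :=
    fun w c => by rw [ENNReal.ofReal_mul (hp.nonneg u _ _), ENNReal.ofReal_mul (hq0 _)]
  rw [integral_eq_lintegral_pos_part_sub_lintegral_neg_part hint,
    integral_eq_lintegral_pos_part_sub_lintegral_neg_part hI,
    hp.lintegral_noisy_prod hL hE hind hq hqE u (φ := fun w => ENNReal.ofReal (φ w))
      (ENNReal.measurable_ofReal.comp hφ),
    hp.lintegral_noisy_prod hL hE hind hq hqE u (φ := fun w => ENNReal.ofReal (-φ w))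
      (ENNReal.measurable_ofReal.comp (measurable_neg.comp hφ))]
  simp only [← mul_neg, e]

end

section

variable {Ω : Type*} {mΩ : MeasurableSpace Ω} {𝓕 : Filtration ℝ≥0 mΩ}
  {P : Measure Ω} [IsProbabilityMeasure P]

/-! ### Conditional expectations of the weighted cash flows -/

lemma ae_prod_of_ae_section {μ : Measure ℝ} [IsProbabilityMeasure μ] {s : Set (Ω × ℝ)}
    (hs : MeasurableSet s) (h : ∀ᵐ x ∂μ, ∀ᵐ ω ∂P, (ω, x) ∈ s) : ∀ᵐ z ∂(P.prod μ), z ∈ s := by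
  rw [← Measure.prod_swap]
  refine (ae_map_iff measurable_swap.aemeasurable hs).2 ?_
  exact (Measure.ae_prod_iff_ae_ae (measurable_swap hs)).2 h

lemma integrable_of_condExp_sections {μ : Measure ℝ} [IsProbabilityMeasure μ]
    {t : ℝ≥0} {f v : Ω × ℝ → ℝ} (hf : Integrable f (P.prod μ)) (hvm : Measurable v)
    (hv : ∀ᵐ x ∂μ, (fun ω => v (ω, x)) =ᵐ[P] P[fun ω => f (ω, x) | 𝓕 t]) :
    Integrable v (P.prod μ) := by
  refine ⟨hvm.aestronglyMeasurable, ?_⟩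
  have hf2 := hf.2
  rw [HasFiniteIntegral, lintegral_prod_symm _ hf.1.enorm] at hf2
  rw [HasFiniteIntegral, lintegral_prod_symm _ hvm.enorm.aemeasurable]
  refine lt_of_le_of_lt (lintegral_mono_ae ?_) hf2
  filter_upwards [hv] with x hx
  have h1 := eLpNorm_condExp_le_eLpNorm (μ := P) (m := 𝓕 t) (fun ω => f (ω, x)) le_rfl
  rw [eLpNorm_one_eq_lintegral_enorm, eLpNorm_one_eq_lintegral_enorm] at h1
  refine (lintegral_congr_ae ?_).trans_le h1
  filter_upwards [hx] with ω hω
  rw [hω]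

variable {L : Ω → ℝ} {p : ℝ≥0 → ℝ → Ω → ℝ}

lemma IsCondDensity.integrable_prod (hp : IsCondDensity 𝓕 P L p) (hL : Measurable L) {u : ℝ≥0}
    {g : Ω × ℝ → ℝ} (hg : @Measurable (Ω × ℝ) ℝ ((𝓕 u).prod inferInstance) _ g)
    (hint : Integrable (fun ω => g (ω, L ω)) P) :
    Integrable (fun z : Ω × ℝ => p u z.2 z.1 * g z) (P.prod (P.map L)) := by
  have : IsProbabilityMeasure (P.map L) := Measure.isProbabilityMeasure_map hL.aemeasurable
  have hm : Measurable fun z : Ω × ℝ => p u z.2 z.1 * g z :=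
    ((hp.measurable u).mul hg).mono (prod_le 𝓕 u) le_rfl
  have h := hp.lintegral_eq hL u (φ := fun z => ‖g z‖ₑ) (measurable_enorm.comp hg)
  refine ⟨hm.aestronglyMeasurable, ?_⟩
  rw [HasFiniteIntegral, lintegral_prod _ hm.enorm.aemeasurable]
  refine lt_of_eq_of_lt ?_ (lt_of_eq_of_lt h.symm hint.2)
  simp only [enorm_mul, Real.enorm_eq_ofReal (hp.nonneg u _ _)]

/-- On `{p t = 0}`, an event known at `t`, the nonnegative variable `p T` has the same integral as
`p t`, namely zero. -/
lemma ae_eq_zero_of_martingale {p : ℝ≥0 → Ω → ℝ} (hp : Martingale p 𝓕 P) (hp0 : ∀ u ω, 0 ≤ p u ω)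
    {t T : ℝ≥0} (htT : t ≤ T) : ∀ᵐ ω ∂P, p t ω = 0 → p T ω = 0 := by
  have hB : MeasurableSet[𝓕 t] {ω | p t ω = 0} :=
    (hp.1 t).measurable (measurableSet_singleton 0)
  have h1 := hp.setIntegral_eq htT hB
  have h2 : ∫ ω in {ω | p t ω = 0}, p t ω ∂P = 0 :=
    (setIntegral_congr_fun (g := 0) (𝓕.le t _ hB) fun ω hω => hω).trans (by simp)
  rw [h2, eq_comm, integral_eq_zero_iff_of_nonneg (hp0 T) (hp.integrable T).integrableOn] at h1
  exact (ae_restrict_iff' (𝓕.le t _ hB)).1 h1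

variable {S : Set (Ω × ℝ)} {t T : ℝ≥0}

/-- Where the weight vanishes, either default has occurred by `t` and `g` is zero, or `p t` is zero
and stays so until `T`. The conditioned function is then zero on an event of `𝓕 t`, hence so is its
conditional expectation. This keeps the numerator of Bayes' ratio from charging points where the
denominator vanishes. -/
lemma IsCondDensity.ae_eq_zero (hp : IsCondDensity 𝓕 P L p) (hL : Measurable L) (htT : t ≤ T)
    (hS : MeasurableSet[(𝓕 t).prod inferInstance] S) {g v : Ω × ℝ → ℝ} (hgS : ∀ z ∉ S, g z = 0)
    (hvm : @Measurable (Ω × ℝ) ℝ ((𝓕 t).prod inferInstance) _ v)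
    (hv : ∀ᵐ x ∂(P.map L), (fun ω => v (ω, x)) =ᵐ[P] P[fun ω => p T x ω * g (ω, x) | 𝓕 t]) :
    ∀ᵐ z ∂(P.prod (P.map L)), S.indicator (fun z => p t z.2 z.1) z = 0 → v z = 0 := by
  have : IsProbabilityMeasure (P.map L) := Measure.isProbabilityMeasure_map hL.aemeasurable
  have ha : @Measurable (Ω × ℝ) ℝ ((𝓕 t).prod inferInstance) _ (S.indicator fun z => p t z.2 z.1) :=
    (hp.measurable t).indicator hS
  have hset : MeasurableSet {z : Ω × ℝ | S.indicator (fun z => p t z.2 z.1) z = 0 → v z = 0} := by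
    have h1 : MeasurableSet {z : Ω × ℝ | S.indicator (fun z => p t z.2 z.1) z = 0} :=
      (ha.mono (prod_le 𝓕 t) le_rfl) (measurableSet_singleton 0)
    have h2 : MeasurableSet {z : Ω × ℝ | v z = 0} :=
      (hvm.mono (prod_le 𝓕 t) le_rfl) (measurableSet_singleton 0)
    exact h1.imp h2
  refine ae_prod_of_ae_section hset ?_
  filter_upwards [hv] with x hx
  have hB : MeasurableSet[𝓕 t] {ω | S.indicator (fun z => p t z.2 z.1) (ω, x) = 0} :=
    (ha.comp (@measurable_prodMk_right Ω ℝ (𝓕 t) _ x)) (measurableSet_singleton 0)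
  have h0 : (fun ω => p T x ω * g (ω, x))
      =ᵐ[P.restrict {ω | S.indicator (fun z => p t z.2 z.1) (ω, x) = 0}] 0 := by
    refine (ae_restrict_iff' (𝓕.le t _ hB)).2 ?_
    filter_upwards [ae_eq_zero_of_martingale (hp.martingale x) (hp.nonneg · x) htT] with ω hω h
    by_cases hz : (ω, x) ∈ S
    · simp only [indicator_of_mem hz] at h
      simp [hω h]
    · simp [hgS _ hz]
  have h1 := (ae_restrict_iff' (𝓕.le t _ hB)).1 (condExp_ae_eq_restrict_zero hB h0)
  filter_upwards [hx, h1] with ω h2 h3 h4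
  exact h2.trans (h3 h4)

end

section

variable {Ω : Type*} {mΩ : MeasurableSpace Ω} {𝓕 : Filtration ℝ≥0 mΩ}
  {P : Measure Ω} [IsProbabilityMeasure P]

/-! ### Averages over the barrier given its noisy observation -/

/-- The integral `∫ h(ω,l) q(z-l) μ(dl)`. -/
def noisyMean (μ : Measure ℝ) (q : ℝ → ℝ) (h : Ω × ℝ → ℝ) (w : Ω × ℝ) : ℝ :=
  ∫ l, h (w.1, l) * q (w.2 - l) ∂μ

section

variable {μ : Measure ℝ} [IsProbabilityMeasure μ] {q : ℝ → ℝ}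

lemma stronglyMeasurable_mul_noise {m : MeasurableSpace Ω} (hq : Measurable q) {h : Ω × ℝ → ℝ}
    (hh : Measurable h) :
    StronglyMeasurable fun w : (Ω × ℝ) × ℝ => h (w.1.1, w.2) * q (w.1.2 - w.2) :=
  ((hh.comp (by fun_prop)).mul (hq.comp (by fun_prop))).stronglyMeasurable

lemma measurable_noisyMean {m : MeasurableSpace Ω} (hq : Measurable q) {h : Ω × ℝ → ℝ}
    (hh : Measurable h) : Measurable (noisyMean μ q h) :=
  (stronglyMeasurable_mul_noise hq hh).integral_prod_right'.measurable

lemma integrable_noisyMean (hq : Measurable q) (hq0 : ∀ y, 0 ≤ q y)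
    (hq1 : ∀ x, ∫⁻ z : ℝ, ENNReal.ofReal (q (z - x)) = 1) {h : Ω × ℝ → ℝ} (hm : Measurable h)
    (hh : Integrable h (P.prod μ)) : Integrable (noisyMean μ q h) (P.prod volume) :=
  (integrable_mul_noise_swap hq hq0 hq1 hm hh).integral_prod_left

/-- A test function of scenario and observation does not involve the barrier, so after reordering
the variables it comes out of the integral over the barrier. -/
lemma integral_mul_noisyMean {ψ h : Ω × ℝ → ℝ}
    (hint : Integrable (fun w : (Ω × ℝ) × ℝ => ψ (w.1.1, w.2) * (h w.1 * q (w.2 - w.1.2)))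
      ((P.prod μ).prod volume)) :
    ∫ w : (Ω × ℝ) × ℝ, ψ (w.1.1, w.2) * (h w.1 * q (w.2 - w.1.2)) ∂((P.prod μ).prod volume)
      = ∫ w, ψ w * noisyMean μ q h w ∂(P.prod volume) := by
  have hpres := measurePreserving_prodRightComm (P := P) (μ := volume) (ν := μ)
  have h1 := hpres.integral_comp measurableEmbedding_prodRightComm
    fun w : (Ω × ℝ) × ℝ => ψ (w.1.1, w.2) * (h w.1 * q (w.2 - w.1.2))
  have h2 := (hpres.integrable_comp_emb measurableEmbedding_prodRightComm).2 hint
  exact h1.symm.trans ((integral_prod _ h2).trans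
    (integral_congr_ae (ae_of_all _ fun w =>
      integral_const_mul (ψ w) fun l => h (w.1, l) * q (w.2 - l))))

/-- For a rectangle the integral factorizes for each barrier, and `h` enters only through its
integrals over `F`. Two functions whose sections have the same integrals over `𝓕 t` are therefore
interchangeable. -/
lemma integral_indicator_mul_noise (hq : Measurable q) (hq0 : ∀ y, 0 ≤ q y)
    (hq1 : ∀ x, ∫⁻ z : ℝ, ENNReal.ofReal (q (z - x)) = 1) {h : Ω × ℝ → ℝ} (hm : Measurable h)
    (hh : Integrable h (P.prod μ)) {F : Set Ω} (hF : MeasurableSet F) {B : Set ℝ}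
    (hB : MeasurableSet B) :
    Integrable (fun w : (Ω × ℝ) × ℝ => (F ×ˢ B).indicator (fun _ => (1 : ℝ)) (w.1.1, w.2)
      * (h w.1 * q (w.2 - w.1.2))) ((P.prod μ).prod volume) ∧
    ∫ w : (Ω × ℝ) × ℝ, (F ×ˢ B).indicator (fun _ => (1 : ℝ)) (w.1.1, w.2)
      * (h w.1 * q (w.2 - w.1.2)) ∂((P.prod μ).prod volume)
      = ∫ x, (∫ ω in F, h (ω, x) ∂P) * (∫ z : ℝ, B.indicator (fun _ => (1 : ℝ)) z * q (z - x)) ∂μ := by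
  have hint : Integrable (fun w : (Ω × ℝ) × ℝ => (F ×ˢ B).indicator (fun _ => (1 : ℝ)) (w.1.1, w.2)
      * (h w.1 * q (w.2 - w.1.2))) ((P.prod μ).prod volume) := by
    refine (integrable_mul_noise hq hq0 hq1 hm hh).bdd_mul (c := 1) ?_ (ae_of_all _ fun w => ?_)
    · exact ((measurable_const.indicator (hF.prod hB)).comp
        (g := (F ×ˢ B).indicator (fun _ => (1 : ℝ))) (by fun_prop)).aestronglyMeasurable
    · simp only [indicator]
      split_ifs <;> simp
  refine ⟨hint, ?_⟩
  have e : ∀ z : Ω × ℝ, ∫ y : ℝ, (F ×ˢ B).indicator (fun _ => (1 : ℝ)) (z.1, y) * (h z * q (y - z.2))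
      = F.indicator (fun ω => h (ω, z.2)) z.1
        * ∫ y : ℝ, B.indicator (fun _ => (1 : ℝ)) y * q (y - z.2) := fun z => by
    rw [← integral_const_mul]
    refine integral_congr_ae (ae_of_all _ fun y => ?_)
    by_cases h1 : z.1 ∈ F <;> by_cases h2 : y ∈ B <;> simp [h1, h2]
  have h3 := hint.integral_prod_left
  simp only [e] at h3
  rw [integral_prod _ hint]
  simp only [e]
  rw [integral_prod_symm _ h3]
  refine integral_congr_ae (ae_of_all _ fun x => ?_)
  simp only
  rw [integral_mul_const, integral_indicator hF]

end

variable {L : Ω → ℝ} {p : ℝ≥0 → ℝ → Ω → ℝ} {S : Set (Ω × ℝ)} {t T : ℝ≥0} {E : Ω → ℝ} {q : ℝ → ℝ}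

/-- The insider's integrals of the cash flows are integrals of averages over the barrier. -/
lemma IsCondDensity.setIntegral_cashFlow (hp : IsCondDensity 𝓕 P L p) (hL : Measurable L)
    (hE : Measurable E)
    (hind : Indep (MeasurableSpace.comap E inferInstance)
      ((⨆ s, 𝓕 s) ⊔ MeasurableSpace.comap L inferInstance) P)
    (hq : Measurable q) (hq0 : ∀ y, 0 ≤ q y)
    (hqE : P.map E = volume.withDensity fun y => ENNReal.ofReal (q y)) (htT : t ≤ T)
    {g v : Ω × ℝ → ℝ} (hg : @Measurable (Ω × ℝ) ℝ ((𝓕 T).prod inferInstance) _ g)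
    (hgint : Integrable (fun ω => g (ω, L ω)) P) (hvm : Measurable v)
    (hv : ∀ᵐ x ∂(P.map L), (fun ω => v (ω, x)) =ᵐ[P] P[fun ω => p T x ω * g (ω, x) | 𝓕 t])
    {F : Set Ω} (hF : MeasurableSet[𝓕 t] F) {B : Set ℝ} (hB : MeasurableSet B) :
    ∫ ω in F ∩ (fun ω => L ω + E ω) ⁻¹' B, g (ω, L ω) ∂P
      = ∫ w, (F ×ˢ B).indicator (fun _ => (1 : ℝ)) w * noisyMean (P.map L) q v w ∂(P.prod volume) := by
  have : IsProbabilityMeasure (P.map L) := Measure.isProbabilityMeasure_map hL.aemeasurable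
  have hq1 := lintegral_noise_eq_one hE hqE
  have hFm := 𝓕.le t _ hF
  have hfm : Measurable fun z : Ω × ℝ => p T z.2 z.1 * g z :=
    ((hp.measurable T).mul hg).mono (prod_le 𝓕 T) le_rfl
  have hf := hp.integrable_prod hL hg hgint
  have hvint := integrable_of_condExp_sections hf hvm hv
  obtain ⟨i1, i2⟩ := integral_indicator_mul_noise hq hq0 hq1 hfm hf hFm hB
  obtain ⟨j1, j2⟩ := integral_indicator_mul_noise hq hq0 hq1 hvm hvint hFm hB
  have hA : MeasurableSet (F ∩ (fun ω => L ω + E ω) ⁻¹' B) := hFm.inter ((hL.add hE) hB)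
  have hφ : @Measurable ((Ω × ℝ) × ℝ) ℝ (((𝓕 T).prod inferInstance).prod inferInstance) _
      fun w => (F ×ˢ B).indicator (fun _ => (1 : ℝ)) (w.1.1, w.2) * g w.1 := by
    have hFB : @MeasurableSet (Ω × ℝ) ((𝓕 T).prod inferInstance) (F ×ˢ B) :=
      @MeasurableSet.prod Ω ℝ (𝓕 T) _ _ _ (𝓕.mono htT _ hF) hB
    have h1 : @Measurable ((Ω × ℝ) × ℝ) (Ω × ℝ) (((𝓕 T).prod inferInstance).prod inferInstance)
        ((𝓕 T).prod inferInstance) fun w => (w.1.1, w.2) :=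
      ((@measurable_fst Ω ℝ (𝓕 T) _).comp measurable_fst).prodMk measurable_snd
    exact ((measurable_const.indicator hFB).comp h1).mul (hg.comp measurable_fst)
  have e1 : ∀ ω, (F ×ˢ B).indicator (fun _ => (1 : ℝ)) (ω, L ω + E ω) * g (ω, L ω)
      = (F ∩ (fun ω => L ω + E ω) ⁻¹' B).indicator (fun ω => g (ω, L ω)) ω := fun ω => by
    by_cases h1 : ω ∈ F <;> by_cases h2 : L ω + E ω ∈ B <;> simp [h1, h2]
  have hint : Integrable (fun ω => (F ×ˢ B).indicator (fun _ => (1 : ℝ)) (ω, L ω + E ω) * g (ω, L ω)) P := by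
    simp only [e1]
    exact hgint.indicator hA
  have h2 := (hp.integral_noisy_prod hL hE hind hq hq0 hqE T hφ hint).2
  rw [← integral_indicator hA, ← integral_mul_noisyMean j1, j2]
  simp only [e1] at h2
  -- The joint law is used with the density at maturity, since `g` is known only at `T`. As `F` is
  -- known at `t`, the integral over `F` may then be taken of the conditional expectation `v` in
  -- place of `p T * g`.
  refine h2.trans (Eq.trans ?_ (i2.trans (integral_congr_ae ?_)))
  · refine integral_congr_ae (ae_of_all _ fun w => ?_)
    simp only
    ring
  · have hfx : ∀ᵐ x ∂(P.map L), Integrable (fun ω => p T x ω * g (ω, x)) P := hf.prod_left_ae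
    filter_upwards [hv, hfx] with x hx hx'
    have h3 : ∫ ω in F, v (ω, x) ∂P = ∫ ω in F, p T x ω * g (ω, x) ∂P :=
      (integral_congr_ae (ae_restrict_of_ae hx)).trans (setIntegral_condExp (𝓕.le t) hx' hF)
    simp only [h3]

end

section

variable {Ω : Type*} {mΩ : MeasurableSpace Ω} {𝓕 : Filtration ℝ≥0 mΩ}
  {P : Measure Ω} [IsProbabilityMeasure P]

/-! ### The insider's Bayes formula -/

lemma ae_ae_of_ae_prod_noise {μ : Measure ℝ} [IsProbabilityMeasure μ] {r : Ω × ℝ → Prop}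
    (h : ∀ᵐ z ∂(P.prod μ), r z) : ∀ᵐ w ∂(P.prod (volume : Measure ℝ)), ∀ᵐ l ∂μ, r (w.1, l) := by
  have h1 := (Measure.quasiMeasurePreserving_fst (μ := P.prod μ) (ν := (volume : Measure ℝ))).ae h
  exact Measure.ae_ae_of_ae_prod ((measurePreserving_prodRightComm (P := P) (μ := volume)
    (ν := μ)).quasiMeasurePreserving.ae h1)

variable {L : Ω → ℝ} {p : ℝ≥0 → ℝ → Ω → ℝ} {S : Set (Ω × ℝ)} {t T : ℝ≥0} {E : Ω → ℝ} {q : ℝ → ℝ}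

lemma IsCondDensity.integrable_alive (hp : IsCondDensity 𝓕 P L p) (hL : Measurable L)
    (hS : MeasurableSet[(𝓕 t).prod inferInstance] S) :
    Integrable (S.indicator fun z => p t z.2 z.1) (P.prod (P.map L)) := by
  have hm : @Measurable (Ω × ℝ) ℝ ((𝓕 t).prod inferInstance) _ (S.indicator fun _ => 1) :=
    measurable_const.indicator hS
  have hint : Integrable (fun ω => S.indicator (fun _ => (1 : ℝ)) (ω, L ω)) P := by
    refine Integrable.of_bound (measurable_along_barrier hm hL).aestronglyMeasurable 1
      (ae_of_all _ fun ω => ?_)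
    simp only [indicator]
    split_ifs <;> simp
  convert! hp.integrable_prod hL hm hint using 1
  ext z
  by_cases hz : z ∈ S <;> simp [hz]

/-- On survival, the pair formed by the scenario and the noisy barrier has the average of `F^M_t` as
its density with respect to `P ⊗ dz`. This is the denominator of Bayes' formula. -/
lemma IsCondDensity.lintegral_alive (hp : IsCondDensity 𝓕 P L p) (hL : Measurable L)
    (hE : Measurable E)
    (hind : Indep (MeasurableSpace.comap E inferInstance)
      ((⨆ s, 𝓕 s) ⊔ MeasurableSpace.comap L inferInstance) P)
    (hq : Measurable q) (hq0 : ∀ y, 0 ≤ q y)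
    (hqE : P.map E = volume.withDensity fun y => ENNReal.ofReal (q y))
    (hS : MeasurableSet[(𝓕 t).prod inferInstance] S) {ψ : Ω × ℝ → ℝ≥0∞}
    (hψ : @Measurable (Ω × ℝ) ℝ≥0∞ ((𝓕 t).prod inferInstance) _ ψ) :
    ∫⁻ ω, S.indicator (fun _ => 1) (ω, L ω) * ψ (ω, L ω + E ω) ∂P
      = ∫⁻ w, ψ w * ENNReal.ofReal (noisyMean (P.map L) q (S.indicator fun z => p t z.2 z.1) w)
        ∂(P.prod volume) := by
  have : IsProbabilityMeasure (P.map L) := Measure.isProbabilityMeasure_map hL.aemeasurable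
  have hq1 := lintegral_noise_eq_one hE hqE
  have ham : @Measurable (Ω × ℝ) ℝ ((𝓕 t).prod inferInstance) _ (S.indicator fun z => p t z.2 z.1) :=
    (hp.measurable t).indicator hS
  have ha0 : ∀ z, 0 ≤ S.indicator (fun z => p t z.2 z.1) z :=
    indicator_nonneg fun z _ => hp.nonneg t _ _
  have haq := integrable_mul_noise_swap hq hq0 hq1 (ham.mono (prod_le 𝓕 t) le_rfl)
    (hp.integrable_alive hL hS)
  have h1 : @Measurable ((Ω × ℝ) × ℝ) (Ω × ℝ) (((𝓕 t).prod inferInstance).prod inferInstance)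
      ((𝓕 t).prod inferInstance) fun w => (w.1.1, w.2) :=
    ((@measurable_fst Ω ℝ (𝓕 t) _).comp measurable_fst).prodMk measurable_snd
  have hSm : @Measurable (Ω × ℝ) ℝ≥0∞ ((𝓕 t).prod inferInstance) _ (S.indicator fun _ => 1) :=
    measurable_const.indicator hS
  have hφ : @Measurable ((Ω × ℝ) × ℝ) ℝ≥0∞ (((𝓕 t).prod inferInstance).prod inferInstance) _
      fun w => S.indicator (fun _ => 1) w.1 * ψ (w.1.1, w.2) :=
    (hSm.comp measurable_fst).mul (hψ.comp h1)
  have h2 := hp.lintegral_noisy_prod hL hE hind hq hqE t hφ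
  have hpres := measurePreserving_prodRightComm (P := P) (μ := volume) (ν := P.map L)
  have hqm : Measurable fun w : (Ω × ℝ) × ℝ =>
      ENNReal.ofReal (S.indicator (fun z => p t z.2 z.1) (w.1.1, w.2) * q (w.1.2 - w.2)) :=
    (stronglyMeasurable_mul_noise hq (ham.mono (prod_le 𝓕 t) le_rfl)).measurable.ennreal_ofReal
  have hm : Measurable fun w : (Ω × ℝ) × ℝ => ψ w.1 *
      ENNReal.ofReal (S.indicator (fun z => p t z.2 z.1) (w.1.1, w.2) * q (w.1.2 - w.2)) :=
    ((hψ.mono (prod_le 𝓕 t) le_rfl).comp measurable_fst).mul hqm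
  rw [h2, ← hpres.lintegral_comp_emb measurableEmbedding_prodRightComm]
  have e : ∀ w : (Ω × ℝ) × ℝ, ENNReal.ofReal (p t w.2 w.1.1) * (ENNReal.ofReal (q (w.1.2 - w.2)) *
      (S.indicator (fun _ => 1) (w.1.1, w.2) * ψ (w.1.1, w.1.2))) = ψ w.1 *
      ENNReal.ofReal (S.indicator (fun z => p t z.2 z.1) (w.1.1, w.2) * q (w.1.2 - w.2)) := fun w => by
    rw [ENNReal.ofReal_mul (ha0 _)]
    by_cases hz : (w.1.1, w.2) ∈ S
    · simp only [indicator_of_mem hz]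
      ring
    · simp [hz]
  simp only [e]
  rw [lintegral_prod _ hm.aemeasurable]
  refine lintegral_congr_ae ?_
  filter_upwards [haq.prod_right_ae] with w hw
  have hqw : Measurable fun l =>
      ENNReal.ofReal (S.indicator (fun z => p t z.2 z.1) (w.1, l) * q (w.2 - l)) :=
    hqm.comp (measurable_prodMk_left (x := w))
  rw [lintegral_const_mul _ hqw, noisyMean,
    ofReal_integral_eq_lintegral_ofReal hw (ae_of_all _ fun l => mul_nonneg (ha0 _) (hq0 _))]

end

section

variable {Ω : Type*} {mΩ : MeasurableSpace Ω} {𝓕 : Filtration ℝ≥0 mΩ}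
  {P : Measure Ω} [IsProbabilityMeasure P]
variable {L : Ω → ℝ} {p : ℝ≥0 → ℝ → Ω → ℝ} {S : Set (Ω × ℝ)} {t T : ℝ≥0} {E : Ω → ℝ} {q : ℝ → ℝ}

/-- A vanishing average of nonnegative terms forces almost every term to vanish: for almost every
barrier either the noise kernel or the weight is zero. In the second case `v` is zero by hypothesis,
so the numerator vanishes as well. -/
lemma IsCondDensity.ae_noisyMean (hp : IsCondDensity 𝓕 P L p) (hL : Measurable L)
    (hq : Measurable q) (hq0 : ∀ y, 0 ≤ q y)
    (hq1 : ∀ x, ∫⁻ z : ℝ, ENNReal.ofReal (q (z - x)) = 1)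
    (hS : MeasurableSet[(𝓕 t).prod inferInstance] S) {v : Ω × ℝ → ℝ} (hvm : Measurable v)
    (hvint : Integrable v (P.prod (P.map L)))
    (hv0 : ∀ᵐ z ∂(P.prod (P.map L)), S.indicator (fun z => p t z.2 z.1) z = 0 → v z = 0) :
    ∀ᵐ w ∂(P.prod (volume : Measure ℝ)),
      Integrable (fun l => v (w.1, l) * q (w.2 - l)) (P.map L) ∧
      Integrable (fun l => S.indicator (fun z => p t z.2 z.1) (w.1, l) * q (w.2 - l)) (P.map L) ∧
      (0 < noisyMean (P.map L) q (S.indicator fun z => p t z.2 z.1) w ∨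
        noisyMean (P.map L) q (S.indicator fun z => p t z.2 z.1) w = 0 ∧
          noisyMean (P.map L) q v w = 0) := by
  have : IsProbabilityMeasure (P.map L) := Measure.isProbabilityMeasure_map hL.aemeasurable
  have ham : Measurable (S.indicator fun z => p t z.2 z.1) :=
    ((hp.measurable t).indicator hS).mono (prod_le 𝓕 t) le_rfl
  have ha0 : ∀ z, 0 ≤ S.indicator (fun z => p t z.2 z.1) z :=
    indicator_nonneg fun z _ => hp.nonneg t _ _
  filter_upwards [(integrable_mul_noise_swap hq hq0 hq1 ham (hp.integrable_alive hL hS)).prod_right_ae,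
    (integrable_mul_noise_swap hq hq0 hq1 hvm hvint).prod_right_ae, ae_ae_of_ae_prod_noise hv0]
    with w h1 h2 h3
  refine ⟨h2, h1, ?_⟩
  have h4 : ∀ l, 0 ≤ S.indicator (fun z => p t z.2 z.1) (w.1, l) * q (w.2 - l) := fun l =>
    mul_nonneg (ha0 _) (hq0 _)
  have h5 : 0 ≤ noisyMean (P.map L) q (S.indicator fun z => p t z.2 z.1) w := integral_nonneg h4
  rcases h5.eq_or_lt with h6 | h6
  · refine Or.inr ⟨h6.symm, ?_⟩
    have h7 := (integral_eq_zero_iff_of_nonneg h4 h1).1 h6.symm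
    refine integral_eq_zero_of_ae ?_
    filter_upwards [h7, h3] with l h8 h9
    rcases mul_eq_zero.1 h8 with h | h
    · simp [h9 h]
    · simp [h]
  · exact Or.inl h6

/-- Before default, the averages over the barrier exist and the average of the density is positive. -/
lemma ae_noisyMean_pos (hp : IsCondDensity 𝓕 P L p) (hL : Measurable L) (hE : Measurable E)
    (hind : Indep (MeasurableSpace.comap E inferInstance)
      ((⨆ s, 𝓕 s) ⊔ MeasurableSpace.comap L inferInstance) P)
    (hq : Measurable q) (hq0 : ∀ y, 0 ≤ q y)
    (hqE : P.map E = volume.withDensity fun y => ENNReal.ofReal (q y))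
    (hS : MeasurableSet[(𝓕 t).prod inferInstance] S) {v : Ω × ℝ → ℝ}
    (hvm : @Measurable (Ω × ℝ) ℝ ((𝓕 t).prod inferInstance) _ v)
    (hvint : Integrable v (P.prod (P.map L)))
    (hv0 : ∀ᵐ z ∂(P.prod (P.map L)), S.indicator (fun z => p t z.2 z.1) z = 0 → v z = 0) :
    ∀ᵐ ω ∂P, (ω, L ω) ∈ S →
      Integrable (fun l => v (ω, l) * q (L ω + E ω - l)) (P.map L) ∧
      Integrable (fun l => S.indicator (fun z => p t z.2 z.1) (ω, l) * q (L ω + E ω - l)) (P.map L) ∧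
      0 < noisyMean (P.map L) q (S.indicator fun z => p t z.2 z.1) (ω, L ω + E ω) := by
  have : IsProbabilityMeasure (P.map L) := Measure.isProbabilityMeasure_map hL.aemeasurable
  have ham : @Measurable (Ω × ℝ) ℝ ((𝓕 t).prod inferInstance) _ (S.indicator fun z => p t z.2 z.1) :=
    (hp.measurable t).indicator hS
  set K : Set (Ω × ℝ) := {w | Integrable (fun l => v (w.1, l) * q (w.2 - l)) (P.map L) ∧
      Integrable (fun l => S.indicator (fun z => p t z.2 z.1) (w.1, l) * q (w.2 - l)) (P.map L) ∧
      0 < noisyMean (P.map L) q (S.indicator fun z => p t z.2 z.1) w} with hK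
  have hKm : MeasurableSet[(𝓕 t).prod inferInstance] K := by
    refine MeasurableSet.inter ?_ (MeasurableSet.inter ?_ ?_)
    · exact _root_.measurableSet_integrable (mβ := (𝓕 t).prod inferInstance) (μ := P.map L)
        (@stronglyMeasurable_mul_noise Ω q (𝓕 t) hq v hvm)
    · exact _root_.measurableSet_integrable (mβ := (𝓕 t).prod inferInstance) (μ := P.map L)
        (@stronglyMeasurable_mul_noise Ω q (𝓕 t) hq _ ham)
    · exact (@measurable_noisyMean Ω (P.map L) _ q (𝓕 t) hq _ ham) measurableSet_Ioi
  have hψ : @Measurable (Ω × ℝ) ℝ≥0∞ ((𝓕 t).prod inferInstance) _ (Kᶜ.indicator fun _ => 1) :=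
    measurable_const.indicator hKm.compl
  have h1 := hp.lintegral_alive hL hE hind hq hq0 hqE hS hψ
  -- Outside `K` the average is almost everywhere zero, because the two integrability conditions
  -- fail only on a null set. By the density formula the bad event has probability zero on survival.
  have h2 : ∫⁻ w, Kᶜ.indicator (fun _ => 1) w
      * ENNReal.ofReal (noisyMean (P.map L) q (S.indicator fun z => p t z.2 z.1) w)
        ∂(P.prod volume) = 0 := by
    refine (lintegral_congr_ae (g := 0) ?_).trans (by simp)
    filter_upwards [hp.ae_noisyMean hL hq hq0 (lintegral_noise_eq_one hE hqE) hS
      (hvm.mono (prod_le 𝓕 t) le_rfl) hvint hv0] with w ⟨h3, h4, h5⟩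
    by_cases hw : w ∈ K
    · simp [hw]
    · have h6 : ¬ 0 < noisyMean (P.map L) q (S.indicator fun z => p t z.2 z.1) w :=
        fun h => hw ⟨h3, h4, h⟩
      rcases h5 with h5 | h5
      · exact absurd h5 h6
      · simp [h5.1]
  have hSm : @Measurable (Ω × ℝ) ℝ≥0∞ ((𝓕 t).prod inferInstance) _ (S.indicator fun _ => 1) :=
    measurable_const.indicator hS
  have h7 : Measurable fun ω => S.indicator (fun _ => (1 : ℝ≥0∞)) (ω, L ω)
      * Kᶜ.indicator (fun _ => 1) (ω, L ω + E ω) :=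
    (measurable_along_barrier hSm hL).mul (measurable_along_barrier hψ (hL.add hE))
  rw [h2, lintegral_eq_zero_iff h7] at h1
  filter_upwards [h1] with ω hω hωS
  by_contra hcon
  have : (ω, L ω + E ω) ∉ K := hcon
  simp [hωS, this] at hω

/-- The ratio of the averages has the integrals of the average of `v`. -/
lemma setIntegral_ratio (hp : IsCondDensity 𝓕 P L p) (hL : Measurable L) (hE : Measurable E)
    (hind : Indep (MeasurableSpace.comap E inferInstance)
      ((⨆ s, 𝓕 s) ⊔ MeasurableSpace.comap L inferInstance) P)
    (hq : Measurable q) (hq0 : ∀ y, 0 ≤ q y)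
    (hqE : P.map E = volume.withDensity fun y => ENNReal.ofReal (q y))
    (hS : MeasurableSet[(𝓕 t).prod inferInstance] S) {v : Ω × ℝ → ℝ}
    (hvm : @Measurable (Ω × ℝ) ℝ ((𝓕 t).prod inferInstance) _ v)
    (hvint : Integrable v (P.prod (P.map L)))
    (hv0 : ∀ᵐ z ∂(P.prod (P.map L)), S.indicator (fun z => p t z.2 z.1) z = 0 → v z = 0) :
    Integrable (fun ω => S.indicator (fun _ => (1 : ℝ)) (ω, L ω) * (noisyMean (P.map L) q v (ω, L ω + E ω)
      / noisyMean (P.map L) q (S.indicator fun z => p t z.2 z.1) (ω, L ω + E ω))) P ∧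
    ∀ F, MeasurableSet[𝓕 t] F → ∀ B : Set ℝ, MeasurableSet B →
      ∫ ω in F ∩ (fun ω => L ω + E ω) ⁻¹' B, S.indicator (fun _ => (1 : ℝ)) (ω, L ω) *
        (noisyMean (P.map L) q v (ω, L ω + E ω)
          / noisyMean (P.map L) q (S.indicator fun z => p t z.2 z.1) (ω, L ω + E ω)) ∂P
      = ∫ w, (F ×ˢ B).indicator (fun _ => (1 : ℝ)) w * noisyMean (P.map L) q v w ∂(P.prod volume) := by
  have : IsProbabilityMeasure (P.map L) := Measure.isProbabilityMeasure_map hL.aemeasurable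
  have hq1 := lintegral_noise_eq_one hE hqE
  have ham : @Measurable (Ω × ℝ) ℝ ((𝓕 t).prod inferInstance) _ (S.indicator fun z => p t z.2 z.1) :=
    (hp.measurable t).indicator hS
  set N := noisyMean (P.map L) q v with hN
  set D := noisyMean (P.map L) q (S.indicator fun z => p t z.2 z.1) with hD
  have hNm : @Measurable (Ω × ℝ) ℝ ((𝓕 t).prod inferInstance) _ N :=
    @measurable_noisyMean Ω (P.map L) _ q (𝓕 t) hq _ hvm
  have hDm : @Measurable (Ω × ℝ) ℝ ((𝓕 t).prod inferInstance) _ D :=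
    @measurable_noisyMean Ω (P.map L) _ q (𝓕 t) hq _ ham
  have hQm : @Measurable (Ω × ℝ) ℝ ((𝓕 t).prod inferInstance) _ fun w => N w / D w := hNm.div hDm
  have hSm : @Measurable (Ω × ℝ) ℝ ((𝓕 t).prod inferInstance) _ (S.indicator fun _ => 1) :=
    measurable_const.indicator hS
  have hae := hp.ae_noisyMean hL hq hq0 hq1 hS (hvm.mono (prod_le 𝓕 t) le_rfl) hvint hv0
  have hWm : Measurable fun ω => S.indicator (fun _ => (1 : ℝ)) (ω, L ω)
      * (N (ω, L ω + E ω) / D (ω, L ω + E ω)) :=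
    (measurable_along_barrier hSm hL).mul (measurable_along_barrier hQm (hL.add hE))
  have hWint : Integrable (fun ω => S.indicator (fun _ => (1 : ℝ)) (ω, L ω)
      * (N (ω, L ω + E ω) / D (ω, L ω + E ω))) P := by
    refine ⟨hWm.aestronglyMeasurable, ?_⟩
    have h1 := hp.lintegral_alive hL hE hind hq hq0 hqE hS (ψ := fun w => ‖N w / D w‖ₑ)
      (measurable_enorm.comp hQm)
    have h2 : ∫⁻ ω, ‖S.indicator (fun _ => (1 : ℝ)) (ω, L ω)
        * (N (ω, L ω + E ω) / D (ω, L ω + E ω))‖ₑ ∂P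
        = ∫⁻ ω, S.indicator (fun _ => 1) (ω, L ω) * ‖N (ω, L ω + E ω) / D (ω, L ω + E ω)‖ₑ ∂P := by
      refine lintegral_congr fun ω => ?_
      by_cases h : (ω, L ω) ∈ S <;> simp [h]
    rw [HasFiniteIntegral, h2, h1]
    refine lt_of_le_of_lt (lintegral_mono_ae ?_)
      (integrable_noisyMean hq hq0 hq1 (hvm.mono (prod_le 𝓕 t) le_rfl) hvint).2
    filter_upwards [hae] with w hw
    rcases hw.2.2 with h | h
    · rw [← Real.enorm_eq_ofReal h.le, ← enorm_mul, div_mul_cancel₀ _ h.ne']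
    · simp [h.1]
  refine ⟨hWint, fun F hF B hB => ?_⟩
  have hA : MeasurableSet (F ∩ (fun ω => L ω + E ω) ⁻¹' B) := (𝓕.le t _ hF).inter ((hL.add hE) hB)
  have h1 : @Measurable ((Ω × ℝ) × ℝ) (Ω × ℝ) (((𝓕 t).prod inferInstance).prod inferInstance)
      ((𝓕 t).prod inferInstance) fun w => (w.1.1, w.2) :=
    ((@measurable_fst Ω ℝ (𝓕 t) _).comp measurable_fst).prodMk measurable_snd
  have hψ : @Measurable (Ω × ℝ) ℝ ((𝓕 t).prod inferInstance) _
      fun w => (F ×ˢ B).indicator (fun _ => (1 : ℝ)) w * (N w / D w) :=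
    (measurable_const.indicator (@MeasurableSet.prod Ω ℝ (𝓕 t) _ _ _ hF hB)).mul hQm
  have hφ : @Measurable ((Ω × ℝ) × ℝ) ℝ (((𝓕 t).prod inferInstance).prod inferInstance) _
      fun w => S.indicator (fun _ => (1 : ℝ)) w.1 *
        ((F ×ˢ B).indicator (fun _ => (1 : ℝ)) (w.1.1, w.2) * (N (w.1.1, w.2) / D (w.1.1, w.2))) :=
    (hSm.comp measurable_fst).mul (hψ.comp h1)
  have e1 : ∀ ω, S.indicator (fun _ => (1 : ℝ)) (ω, L ω) *
        ((F ×ˢ B).indicator (fun _ => (1 : ℝ)) (ω, L ω + E ω) * (N (ω, L ω + E ω) / D (ω, L ω + E ω)))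
      = (F ∩ (fun ω => L ω + E ω) ⁻¹' B).indicator (fun ω => S.indicator (fun _ => (1 : ℝ)) (ω, L ω)
        * (N (ω, L ω + E ω) / D (ω, L ω + E ω))) ω := fun ω => by
    by_cases h1 : ω ∈ F <;> by_cases h2 : L ω + E ω ∈ B <;> simp [h1, h2]
  have hint : Integrable (fun ω => S.indicator (fun _ => (1 : ℝ)) (ω, L ω) *
      ((F ×ˢ B).indicator (fun _ => (1 : ℝ)) (ω, L ω + E ω)
        * (N (ω, L ω + E ω) / D (ω, L ω + E ω)))) P := by
    simp only [e1]
    exact hWint.indicator hA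
  obtain ⟨i1, i2⟩ := hp.integral_noisy_prod hL hE hind hq hq0 hqE t hφ hint
  have e2 : ∀ w : (Ω × ℝ) × ℝ, p t w.1.2 w.1.1 * (q (w.2 - w.1.2) *
      (S.indicator (fun _ => (1 : ℝ)) w.1 *
        ((F ×ˢ B).indicator (fun _ => (1 : ℝ)) (w.1.1, w.2) * (N (w.1.1, w.2) / D (w.1.1, w.2)))))
      = ((F ×ˢ B).indicator (fun _ => (1 : ℝ)) (w.1.1, w.2) * (N (w.1.1, w.2) / D (w.1.1, w.2)))
        * (S.indicator (fun z => p t z.2 z.1) w.1 * q (w.2 - w.1.2)) := fun w => by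
    by_cases h : w.1 ∈ S
    · simp only [indicator_of_mem h]
      ring
    · simp [h]
  simp only [e2] at i1 i2
  simp only [e1] at i2
  have h3 := integral_mul_noisyMean
    (ψ := fun w => (F ×ˢ B).indicator (fun _ => (1 : ℝ)) w * (N w / D w)) i1
  rw [← integral_indicator hA, i2, h3]
  refine integral_congr_ae ?_
  -- Where the denominator is positive it cancels; where it is zero the numerator is zero too, so
  -- the quotient times the denominator is the numerator in both cases.
  filter_upwards [hae] with w hw
  rcases hw.2.2 with h | h
  · rw [← hD, mul_assoc, div_mul_cancel₀ _ h.ne']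
  · rw [h.1, show N w = 0 from h.2]
    simp

end

/-! ### The insider's conditional expectation. -/

section

variable {Ω : Type*} {mΩ : MeasurableSpace Ω} {𝓕 : Filtration ℝ≥0 mΩ}
  {P : Measure Ω} [IsProbabilityMeasure P]
variable {L : Ω → ℝ} {p : ℝ≥0 → ℝ → Ω → ℝ} {t T : ℝ≥0} {q : ℝ → ℝ} {X ε : ℝ≥0 → Ω → ℝ}

lemma measurable_along {m₁ m₂ : MeasurableSpace Ω} (h : m₁ ≤ m₂) {f : Ω × ℝ → ℝ}
    (hf : @Measurable (Ω × ℝ) ℝ (m₁.prod inferInstance) _ f) {Y : Ω → ℝ} (hY : Measurable[m₂] Y) :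
    Measurable[m₂] fun ω => f (ω, Y ω) :=
  hf.comp (@Measurable.prodMk Ω m₂ Ω ℝ m₁ _ _ _ (measurable_id'' h) hY)

/-- The scenarios and barriers without default at time `t`. -/
def aliveSet (X : ℝ≥0 → Ω → ℝ) (t : ℝ≥0) : Set (Ω × ℝ) := {z | z.2 < runInf X t z.1}

lemma measurableSet_snd_lt {m : MeasurableSpace Ω} {f : Ω → ℝ} (hf : Measurable f) :
    MeasurableSet {z : Ω × ℝ | z.2 < f z.1} :=
  measurableSet_lt measurable_snd (hf.comp measurable_fst)

lemma measurableSet_aliveSet (hX : ∀ ω, IsCadlag fun s => X s ω) (hXm : ∀ s, Measurable[𝓕 s] (X s)) :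
    MeasurableSet[(𝓕 t).prod inferInstance] (aliveSet X t) :=
  @measurableSet_snd_lt Ω (𝓕 t) _ (measurable_runInf hX hXm t)

lemma measurable_defaultTime (hX : ∀ ω, IsCadlag fun s => X s ω) (hXm : ∀ s, Measurable[𝓕 s] (X s))
    (hL : Measurable L) : Measurable (defaultTime X L) := by
  refine measurable_of_Iic fun a => ?_
  induction a using ENNReal.recTopCoe with
  | top => simp
  | coe u =>
    have h1 : MeasurableSet {ω | runInf X u ω ≤ L ω} :=
      measurableSet_le ((measurable_runInf hX hXm u).mono (𝓕.le u) le_rfl) hL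
    convert! h1 using 1
    ext ω
    exact defaultTime_le_iff hX

lemma sigmaGI_le (hX : ∀ ω, IsCadlag fun s => X s ω) (hXm : ∀ s, Measurable[𝓕 s] (X s))
    (hL : Measurable L) (hε : ∀ s, Measurable (ε s)) : sigmaGI 𝓕 X L ε t ≤ mΩ :=
  sup_le (sigmaFI_le hL hε t) (sigmaD_le (measurable_defaultTime hX hXm hL) t)

/-- The conditional expectation of a payment vanishing after default, given the insider's
information. -/
theorem condExp_sigmaGI (hX : ∀ ω, IsCadlag fun s => X s ω) (hXm : ∀ s, Measurable[𝓕 s] (X s))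
    (hL : Measurable L) (hp : IsCondDensity 𝓕 P L p) (hε : ∀ s, Measurable (ε s))
    (hεindep : Indep (⨆ s, MeasurableSpace.comap (ε s) inferInstance)
      ((⨆ s, 𝓕 s) ⊔ MeasurableSpace.comap L inferInstance) P)
    (hεinc : HasBackwardIndepIncrements P ε) (htT : t ≤ T)
    (hq : Measurable q) (hq0 : ∀ y, 0 ≤ q y)
    (hqdens : P.map (ε t) = volume.withDensity fun y => ENNReal.ofReal (q y))
    {g v : Ω × ℝ → ℝ} (hg : @Measurable (Ω × ℝ) ℝ ((𝓕 T).prod inferInstance) _ g)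
    (hgint : Integrable (fun ω => g (ω, L ω)) P) (hgS : ∀ z ∉ aliveSet X t, g z = 0)
    (hvm : @Measurable (Ω × ℝ) ℝ ((𝓕 t).prod inferInstance) _ v)
    (hv : ∀ᵐ x ∂(P.map L), (fun ω => v (ω, x)) =ᵐ[P] P[fun ω => p T x ω * g (ω, x) | 𝓕 t]) :
    (∀ᵐ ω ∂P, (ω, L ω) ∈ aliveSet X t →
      Integrable (fun l => v (ω, l) * q (L ω + ε t ω - l)) (P.map L) ∧
      Integrable (fun l => (aliveSet X t).indicator (fun z => p t z.2 z.1) (ω, l)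
        * q (L ω + ε t ω - l)) (P.map L) ∧
      0 < noisyMean (P.map L) q ((aliveSet X t).indicator fun z => p t z.2 z.1) (ω, L ω + ε t ω)) ∧
    P[fun ω => g (ω, L ω) | sigmaGI 𝓕 X L ε t] =ᵐ[P] fun ω =>
      (aliveSet X t).indicator (fun _ => (1 : ℝ)) (ω, L ω) * (noisyMean (P.map L) q v (ω, L ω + ε t ω)
        / noisyMean (P.map L) q ((aliveSet X t).indicator fun z => p t z.2 z.1) (ω, L ω + ε t ω)) := by
  have : IsProbabilityMeasure (P.map L) := Measure.isProbabilityMeasure_map hL.aemeasurable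
  set S := aliveSet X t with hSdef
  have hS : MeasurableSet[(𝓕 t).prod inferInstance] S := measurableSet_aliveSet hX hXm
  have hind : Indep (MeasurableSpace.comap (ε t) inferInstance)
      ((⨆ s, 𝓕 s) ⊔ MeasurableSpace.comap L inferInstance) P :=
    indep_of_indep_of_le_left hεindep
      (le_iSup (fun s => MeasurableSpace.comap (ε s) inferInstance) t)
  have hvm' := hvm.mono (prod_le 𝓕 t) le_rfl
  have hvint := integrable_of_condExp_sections (hp.integrable_prod hL hg hgint) hvm' hv
  have hv0 := hp.ae_eq_zero hL htT hS hgS hvm hv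
  refine ⟨ae_noisyMean_pos hp hL (hε t) hind hq hq0 hqdens hS hvm hvint hv0, ?_⟩
  obtain ⟨hWint, hWset⟩ := setIntegral_ratio hp hL (hε t) hind hq hq0 hqdens hS hvm hvint hv0
  set N := noisyMean (P.map L) q v with hN
  set D := noisyMean (P.map L) q (S.indicator fun z => p t z.2 z.1) with hD
  have hSm : @Measurable (Ω × ℝ) ℝ ((𝓕 t).prod inferInstance) _ (S.indicator fun _ => 1) :=
    measurable_const.indicator hS
  have hQm : @Measurable (Ω × ℝ) ℝ ((𝓕 t).prod inferInstance) _ fun w => N w / D w :=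
    (@measurable_noisyMean Ω (P.map L) _ q (𝓕 t) hq _ hvm).div
      (@measurable_noisyMean Ω (P.map L) _ q (𝓕 t) hq _ ((hp.measurable t).indicator hS))
  have h𝓕 : ∀ s, 𝓕 s ≤ (⨆ s, 𝓕 s) ⊔ MeasurableSpace.comap L inferInstance := fun s =>
    (le_iSup (fun s => (𝓕 s : MeasurableSpace Ω)) s).trans le_sup_left
  have hL𝓗 : Measurable[(⨆ s, 𝓕 s) ⊔ MeasurableSpace.comap L inferInstance] L :=
    (comap_measurable L).mono le_sup_right le_rfl
  have h𝓗 : (⨆ s, 𝓕 s) ⊔ MeasurableSpace.comap L inferInstance ≤ mΩ :=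
    sup_le (iSup_le fun s => 𝓕.le s) hL.comap_le
  have hgm : Measurable[(⨆ s, 𝓕 s) ⊔ MeasurableSpace.comap L inferInstance
      ⊔ MeasurableSpace.comap (ε t) inferInstance] fun ω => g (ω, L ω) :=
    measurable_along ((h𝓕 T).trans le_sup_left) hg (hL𝓗.mono le_sup_left le_rfl)
  have hWm : Measurable[(⨆ s, 𝓕 s) ⊔ MeasurableSpace.comap L inferInstance
      ⊔ MeasurableSpace.comap (ε t) inferInstance] fun ω =>
        S.indicator (fun _ => (1 : ℝ)) (ω, L ω) * (N (ω, L ω + ε t ω) / D (ω, L ω + ε t ω)) := by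
    refine Measurable.mul
      (measurable_along ((h𝓕 t).trans le_sup_left) hSm (hL𝓗.mono le_sup_left le_rfl))
      (measurable_along ((h𝓕 t).trans le_sup_left) hQm (Measurable.add (hL𝓗.mono le_sup_left le_rfl)
        ((comap_measurable _).mono le_sup_right le_rfl)))
  have hτm := measurable_defaultTime hX hXm hL
  have hGle : sigmaGI 𝓕 X L ε t ≤ mΩ := sigmaGI_le hX hXm hL hε
  set S' : Set Ω := {ω | (t : ℝ≥0∞) < defaultTime X L ω} with hS'
  have hmem : ∀ ω, (ω, L ω) ∈ S ↔ ω ∈ S' := fun ω => (lt_defaultTime_iff hX).symm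
  have hS'D : MeasurableSet[sigmaD (defaultTime X L) t] S' := measurableSet_sigmaD _ t
  have hS'm : MeasurableSet S' := sigmaD_le hτm t _ hS'D
  have hWind : ∀ ω, S.indicator (fun _ => (1 : ℝ)) (ω, L ω) = S'.indicator (fun _ => 1) ω := fun ω => by
    by_cases h : ω ∈ S'
    · simp [h, (hmem ω).2 h]
    · simp [h, mt (hmem ω).1 h]
  have hLt : Measurable[sigmaFI 𝓕 L ε t] fun ω => L ω + ε t ω :=
    (comap_measurable _).mono ((le_iSup₂ (f := fun (s : ℝ≥0) (_ : s ≤ t) =>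
      MeasurableSpace.comap (fun ω => L ω + ε s ω) inferInstance) t le_rfl).trans le_sup_right) le_rfl
  have hWG : Measurable[sigmaGI 𝓕 X L ε t] fun ω =>
      S.indicator (fun _ => (1 : ℝ)) (ω, L ω) * (N (ω, L ω + ε t ω) / D (ω, L ω + ε t ω)) := by
    simp only [hWind]
    exact Measurable.mul (measurable_const.indicator (le_sup_right (a := sigmaFI 𝓕 L ε t) _ hS'D))
      ((measurable_along le_sup_left hQm hLt).mono le_sup_left le_rfl)
  refine (ae_eq_condExp_of_forall_setIntegral_eq hGle hgint (fun A _ _ => hWint.integrableOn)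
    (fun A hA _ => ?_) hWG.stronglyMeasurable.aestronglyMeasurable).symm
  -- Both integrands vanish after default, so only the trace of `A` on the survival event matters;
  -- there `A` may be exchanged for an event of `F^I_t`.
  obtain ⟨A', hA', hAA'⟩ := exists_trace_eq (fun D hD => sigmaD_trivial hD) hA
  have hAm := hGle _ hA
  have hA'm := sigmaFI_le hL hε t _ hA'
  have hred : ∀ f : Ω → ℝ, (∀ ω ∉ S', f ω = 0) → ∫ ω in A, f ω ∂P = ∫ ω in A', f ω ∂P := fun f hf => by
    rw [← integral_indicator hAm, ← integral_indicator hA'm]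
    refine integral_congr_ae (ae_of_all _ fun ω => ?_)
    by_cases h : ω ∈ S'
    · have h1 : ω ∈ A ↔ ω ∈ A' := by
        have : ω ∈ A ∩ S' ↔ ω ∈ A' ∩ S' := by rw [hAA']
        simpa [h] using this
      by_cases h2 : ω ∈ A
      · simp [h2, h1.1 h2]
      · simp [h2, mt h1.2 h2]
    · simp [indicator, hf ω h]
  rw [hred _ fun ω hω => by simp [hWind, hω], hred _ fun ω hω => hgS _ (mt (hmem ω).1 hω)]
  -- Both functions are determined by `F_∞`, `L` and `ε t`, hence independent of the earlier
  -- increments. It remains to compare them on events `F ∩ {L_t ∈ B}`, where each gives the integral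
  -- of the numerator over `F × B`.
  refine setIntegral_eq_of_sigmaFI hε h𝓗 h𝓕 hL𝓗 hεindep hεinc hWint hgint hWm hgm ?_ hA'
  intro F hF B hB
  rw [hWset F hF B hB,
    hp.setIntegral_cashFlow hL (hε t) hind hq hq0 hqdens htT hg hgint hvm' hv hF hB]

end

end CreditInfo

end

theorem mainTheorem1 {Ω : Type*} {mΩ : MeasurableSpace Ω} (P : Measure Ω) [IsProbabilityMeasure P]
    -- the default-free filtration, satisfying the usual conditions
    (𝓕 : Filtration ℝ≥0 mΩ) (hrc : 𝓕.IsRightContinuous)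
    (hcompl : CreditInfo.IsCompleteFiltration 𝓕 P)
    -- the fundamental process and the default barrier
    (X : ℝ≥0 → Ω → ℝ) (hX : ∀ s, Measurable[𝓕 s] (X s))
    (hXpath : ∀ ω, CreditInfo.IsCadlag (fun s => X s ω))
    (L : Ω → ℝ) (hL : Measurable L)
    -- Jacod's hypothesis and the conditional density
    (hJacod : CreditInfo.JacodHypothesis 𝓕 P L)
    (p : ℝ≥0 → ℝ → Ω → ℝ) (hp : CreditInfo.IsCondDensity 𝓕 P L p)
    -- the noise
    (ε : ℝ≥0 → Ω → ℝ) (hε : ∀ s, Measurable (ε s)) (hεpath : ∀ ω, Continuous (fun s => ε s ω))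
    (hεindep : Indep (⨆ s, MeasurableSpace.comap (ε s) inferInstance)
      ((⨆ s, 𝓕 s) ⊔ MeasurableSpace.comap L inferInstance) P)
    (hεinc : CreditInfo.HasBackwardIndepIncrements P ε)
    -- the valuation date, the maturity, and the density of the noise at the valuation date
    (t T : ℝ≥0) (htT : t ≤ T)
    (q : ℝ → ℝ) (hq : Measurable q) (hq0 : ∀ y, 0 ≤ q y)
    (hqdens : P.map (ε t) = volume.withDensity (fun y => ENNReal.ofReal (q y)))
    -- the discount factor process and the claim
    (R : ℝ≥0 → Ω → ℝ) (hR : IsStronglyPredictable 𝓕 R) (hRpos : ∀ s ω, 0 < R s ω)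
    (C : Ω → ℝ) (hC : Measurable[𝓕 T] C)
    (G : ℝ≥0 → Ω → ℝ) (hG : ∀ s, Measurable[𝓕 s] (G s)) (hG0 : ∀ ω, G 0 ω = 0)
    (hGcont : ∀ ω, Continuous (fun s => G s ω))
    (hGvar : ∀ ω, LocallyBoundedVariationOn (fun s => G s ω) univ)
    (Z : ℝ≥0 → Ω → ℝ) (hZ : IsStronglyPredictable 𝓕 Z)
    -- integrability of the discounted cash flows
    (hCint : Integrable (CreditInfo.terminalPart (CreditInfo.defaultTime X L) R C T) P)
    (hGint : ∫⁻ ω, CreditInfo.dividendVariation (CreditInfo.defaultTime X L) R G t T ω ∂P < ∞)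
    (hZint : Integrable (CreditInfo.recoveryPart (CreditInfo.defaultTime X L) R Z T) P)
    -- the stochastic integrals `∫ 1_{(t,T]} Z R⁻¹ dF^M(x)`
    (I : ℝ → ℝ≥0 → Ω → ℝ)
    (hI : ∀ᵐ x ∂(P.map L),
      CreditInfo.IsStochIntegral 𝓕 P (CreditInfo.FM X p x)
        (CreditInfo.recoveryIntegrand R Z t T) (I x) ∧
      CreditInfo.IsClassD 𝓕 P T (I x)) :
    (∃ V : ℝ → Ω → ℝ, CreditInfo.IsManagerValue 𝓕 P X L p R C G I t T V) ∧
    ∀ V : ℝ → Ω → ℝ, CreditInfo.IsManagerValue 𝓕 P X L p R C G I t T V →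
      ∀ᵐ ω ∂P,
        ((t : ℝ≥0∞) < CreditInfo.defaultTime X L ω →
          Integrable (fun l => V l ω * q (L ω + ε t ω - l)) (P.map L) ∧
          Integrable (fun l => CreditInfo.FM X p l t ω * q (L ω + ε t ω - l)) (P.map L) ∧
          0 < ∫ l, CreditInfo.FM X p l t ω * q (L ω + ε t ω - l) ∂(P.map L)) ∧
        CreditInfo.valueProcess P (CreditInfo.sigmaGI 𝓕 X L ε t) (CreditInfo.defaultTime X L)
            R C G Z t T ω =
          {ω' | (t : ℝ≥0∞) < CreditInfo.defaultTime X L ω'}.indicator (fun ω' =>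
            (∫ l, V l ω' * q (L ω' + ε t ω' - l) ∂(P.map L)) /
              ∫ l, CreditInfo.FM X p l t ω' * q (L ω' + ε t ω' - l) ∂(P.map L)) ω := by
  have : IsProbabilityMeasure (P.map L) := Measure.isProbabilityMeasure_map hL.aemeasurable
  obtain ⟨g, hg, hgint, hgL, hg0, hpay⟩ := CreditInfo.exists_weightedCashFlow hrc hcompl hXpath hX hL hp
    hR hRpos htT hC hG hGcont hGvar hZ hCint hGint hZint hI
  have hRt : Measurable[𝓕 t] (R t) := (hR.stronglyAdapted t).measurable
  constructor
  -- Existence: the section at `x` of one conditional expectation on the product space, multiplied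
  -- by `R t`.
  · have hsec := CreditInfo.hasCondExpSections (m := 𝓕 t) (𝓕.le t) (hp.integrable_prod hL hg hgint)
    refine ⟨fun x ω => R t ω * ((P.prod (P.map L))[fun z => p T z.2 z.1 * g z
      | (𝓕 t).prod inferInstance]) (ω, x), ?_, ?_, ?_⟩
    · exact (hRt.comp (@measurable_fst Ω ℝ (𝓕 t) _)).mul stronglyMeasurable_condExp.measurable
    · filter_upwards [hpay] with x hx using hx.1
    · filter_upwards [hpay, hsec] with x hx hx'
      filter_upwards [hx.2, hx'] with ω h1 h2
      rw [h1]
      exact congrArg (R t ω * ·) h2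
  intro V hV
  set v : Ω × ℝ → ℝ := fun z => (R t z.1)⁻¹ * V z.2 z.1 with hvdef
  have hVv : ∀ l ω, V l ω = R t ω * v (ω, l) := fun l ω => by
    simp only [hvdef]
    rw [mul_inv_cancel_left₀ (hRpos t ω).ne']
  -- For uniqueness only the three defining properties of `V` are used: dividing by `R t > 0` gives
  -- a jointly measurable version of the conditional expectations of the weighted cash flows, and
  -- any such version can enter Bayes' formula.
  have hvm : @Measurable (Ω × ℝ) ℝ ((𝓕 t).prod inferInstance) _ v :=
    (hRt.comp (@measurable_fst Ω ℝ (𝓕 t) _)).inv.mul hV.measurable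
  have hv : ∀ᵐ x ∂(P.map L),
      (fun ω => v (ω, x)) =ᵐ[P] P[fun ω => p T x ω * g (ω, x) | 𝓕 t] := by
    filter_upwards [hV.eq_condExp, hpay] with x h1 h2
    filter_upwards [h1, h2.2] with ω h3 h4
    simp only [hvdef]
    rw [h3, h4, inv_mul_cancel_left₀ (hRpos t ω).ne']
  obtain ⟨h1, h2⟩ := CreditInfo.condExp_sigmaGI hXpath hX hL hp hε hεindep hεinc htT hq hq0 hqdens
    hg hgint hg0 hvm hv
  have hFM : ∀ l ω, (CreditInfo.aliveSet X t).indicator (fun z => p t z.2 z.1) (ω, l)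
      = CreditInfo.FM X p l t ω := fun l ω => by
    by_cases h : l < CreditInfo.runInf X t ω <;> simp [CreditInfo.aliveSet, CreditInfo.FM, h]
  set τ := CreditInfo.defaultTime X L with hτ
  set Y : Ω → ℝ := fun ω => CreditInfo.terminalPart τ R C T ω + CreditInfo.dividendPart τ R G t T ω
    + CreditInfo.recoveryPart τ R Z T ω with hY
  set A : Set Ω := {ω | (t : ℝ≥0∞) < τ ω} with hA
  have hAD : MeasurableSet[CreditInfo.sigmaGI 𝓕 X L ε t] A :=
    le_sup_right (a := CreditInfo.sigmaFI 𝓕 L ε t) _ (CreditInfo.measurableSet_sigmaD τ t)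
  have hAm : MeasurableSet A := CreditInfo.sigmaGI_le hXpath hX hL hε _ hAD
  have hYint : Integrable Y P := by
    -- On survival the total payment is `g (·, L)`. After default by `t`, terminal payment and
    -- dividends vanish and only a recovery already due is left, which is integrable by hypothesis.
    refine (hgint.add (hZint.indicator hAm.compl)).congr ?_
    filter_upwards [hgL] with ω hω
    rw [Pi.add_apply, hω]
    by_cases h : (t : ℝ≥0∞) < τ ω
    · simp [A, h, hY]
    · have hT : ¬ (T : ℝ≥0∞) < τ ω := fun h' => h (lt_of_le_of_lt (by exact_mod_cast htT) h')
      simp [A, h, hY, CreditInfo.terminalPart, hT, CreditInfo.dividendPart_eq_zero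
        (CreditInfo.measurable_uncurry_of_predictable hR) hRpos hGcont hGvar h]
  -- The payment cut down to survival is `g (·, L)` almost surely. Since survival belongs to the
  -- insider's information, the indicator can be moved outside the conditional expectation, which
  -- reduces the value on `A` to the ratio found for `g`.
  have h3 : P[A.indicator Y | CreditInfo.sigmaGI 𝓕 X L ε t]
      =ᵐ[P] P[fun ω => g (ω, L ω) | CreditInfo.sigmaGI 𝓕 X L ε t] :=
    condExp_congr_ae (by filter_upwards [hgL] with ω hω using hω.symm)
  have hmem : ∀ ω, (ω, L ω) ∈ CreditInfo.aliveSet X t ↔ ω ∈ A := fun ω =>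
    (CreditInfo.lt_defaultTime_iff hXpath).symm
  have hmean : ∀ ω, R t ω * CreditInfo.noisyMean (P.map L) q v (ω, L ω + ε t ω)
      = ∫ l, V l ω * q (L ω + ε t ω - l) ∂(P.map L) := fun ω => by
    simp only [CreditInfo.noisyMean, hVv, mul_assoc, integral_const_mul]
  have hden : ∀ ω, CreditInfo.noisyMean (P.map L) q
      ((CreditInfo.aliveSet X t).indicator fun z => p t z.2 z.1) (ω, L ω + ε t ω)
      = ∫ l, CreditInfo.FM X p l t ω * q (L ω + ε t ω - l) ∂(P.map L) := fun ω => by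
    simp only [CreditInfo.noisyMean, hFM]
  filter_upwards [h1, h2, h3, condExp_indicator hYint hAD] with ω k1 k2 k3 k4
  refine ⟨fun h => ?_, ?_⟩
  · obtain ⟨i1, i2, i3⟩ := k1 ((hmem ω).2 h)
    refine ⟨?_, ?_, hden ω ▸ i3⟩
    · simp only [hVv, mul_assoc]
      exact i1.const_mul _
    · simpa only [hFM] using i2
  · by_cases h : ω ∈ A
    · have k5 : (P[Y | CreditInfo.sigmaGI 𝓕 X L ε t]) ω
          = CreditInfo.noisyMean (P.map L) q v (ω, L ω + ε t ω) / CreditInfo.noisyMean (P.map L) q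
            ((CreditInfo.aliveSet X t).indicator fun z => p t z.2 z.1) (ω, L ω + ε t ω) := by
        rw [← indicator_of_mem h (P[Y | CreditInfo.sigmaGI 𝓕 X L ε t]), ← k4, k3, k2,
          indicator_of_mem ((hmem ω).2 h), one_mul]
      rw [CreditInfo.valueProcess, indicator_of_mem h, indicator_of_mem h, ← hmean, ← hden,
        mul_div_assoc, ← k5]
    · rw [CreditInfo.valueProcess, indicator_of_notMem h, indicator_of_notMem h]
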